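/- **Theorem.** Consider differential-difference equations $$u_t=\varphi\,u_x+f\,\triangle_y^+g+p\,\triangle_y^-q,\qquad w_x=\triangle_y^+u, \tag{1}$$ where $T_yh(x,y)=h(x,y+\epsilon)$, $\triangle_y^+=\frac{T_y-1}{\epsilon}$, $\triangle_y^-=\frac{1-T_y^{-1}}{\epsilon}$, and where $\varphi,f,g,p,q$ are holomorphic functions of $(u,w)$ on a connected open set $U\subset\mathbb C^2$. Put $\psi=fg_u+pq_u$ and $\eta=fg_w+pq_w$, so that the dispersionless limit $\epsilon\to0$ of (1) is $u_t=\varphi u_x+\psi u_y+\eta w_y$, $w_x=u_y$. Call (1) *non-degenerate* if $\eta\not\equiv0$ and the four relations $\eta_w=0$, $\psi_w+\eta_u=0$, $\varphi_w+\psi_u=0$, $\varphi_u=0$ do not all hold identically on $U$. The one-phase solutions of the dispersionless limit are $u=R$, $w=w(R)$ with $R_y=\mu R_x$, $R_t=\lambda R_x$, where $w(R)$ is an arbitrary holomorphic function on an open set $D\subset\mathbb C$ with $(R,w(R))\in U$ for $R\in D$, and $\mu=w'(R)$, $\lambda=\varphi+\psi\mu+\eta\mu^2$. Such a family is *inherited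 modulo $\epsilon^{N+1}$* if there are $$w=w(R)+\sum_{k=1}^N\epsilon^kW_k,\qquad R_y=\mu R_x+\sum_{k=1}^N\epsilon^kA_k,\qquad R_t=\lambda R_x+\sum_{k=1}^N\epsilon^kB_k,$$ where $W_k$, $A_k$, $B_k$ are homogeneous differential polynomials in the $x$-derivatives of $R$ of degrees $k$, $k+1$, $k+1$, with coefficients that are holomorphic functions of $R\in D$, such that with $u=R$ both equations (1), with $T_y^{\pm1}=e^{\pm\epsilon\partial_y}$ expanded by Taylor's formula, and the compatibility condition $R_{yt}=R_{ty}$ hold modulo $\epsilon^{N+1}$, identically in $R\in D$ and $R_x,R_{xx},\dots$. Call (1) *integrable modulo $\epsilon^{N+1}$* if this is so for all $D$ and $w(R)$ in general position, that is, such that $\varphi_u+(\varphi_w+\psi_u)\mu+(\psi_w+\eta_u)\mu^2+\eta_w\mu^3$, evaluated at $w=w(R)$, $u=R$, $\mu=w'(R)$, does not vanish on $D$. The following equations constitute a complete list of non-degenerate integrable equations of the form (1): $$u_t=u\,\triangle_y^-w,\qquad u_t=(\alpha u+\beta)\,\triangle_y^-e^w,\qquad u_t=e^w\sqrt u\,\triangle_y^+\sqrt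 u+\sqrt u\,\triangle_y^-\!\left(e^w\sqrt u\right),$$ where $\alpha,\beta\in\mathbb C$ are constants, not both zero, and $\sqrt u$ is a holomorphic branch of the root. Precisely: 1. If (1) is non-degenerate and integrable modulo $\epsilon^3$, then a substitution $u\to au+b$, $w\to aw+d$ with constants $a\neq0$, $b$, $d$, combined with a Galilean transformation $x\to x+ct$, brings it to one of these three equations (on the whole transformed domain). 2. On every connected non-empty open set $U$ (for the third equation: on which $\sqrt u$ has a holomorphic branch) each of the three equations is non-degenerate and integrable modulo $\epsilon^4$. -/

import Mathlib

open scoped Topology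

noncomputable section

/-- The coefficient functions `φ, f, g, p, q` of an equation
`u_t = φ u_x + f Δ_y⁺ g + p Δ_y⁻ q`, `w_x = Δ_y⁺ u`; each is a function of the pair `(u, w)`. -/
structure TodaEquation where
  phi : ℂ × ℂ → ℂ
  f : ℂ × ℂ → ℂ
  g : ℂ × ℂ → ℂ
  p : ℂ × ℂ → ℂ
  q : ℂ × ℂ → ℂ

/-- The partial derivative with respect to `u`. -/
def partialU (F : ℂ × ℂ → ℂ) (P : ℂ × ℂ) : ℂ := fderiv ℂ F P (1, 0)

/-- The partial derivative with respect to `w`. -/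
def partialW (F : ℂ × ℂ → ℂ) (P : ℂ × ℂ) : ℂ := fderiv ℂ F P (0, 1)

/-! ### Differential functions of one field `R(x)` -/

/-- A jet `(R, R_x, R_xx, …)`; the entry with index `k` is the `k`-th `x`-derivative of `R`. -/
abbrev RJet := ℕ → ℂ

/-- The homogeneous differential polynomial of degree `n` in the `x`-derivatives of `R`
(where the `k`-th derivative has degree `k`) with coefficients `c` that are functions of `R`:
its monomials `R_{n₁} R_{n₂} ⋯` are indexed by the partitions `n = n₁ + n₂ + ⋯`. -/
def diffPoly (n : ℕ) (c : n.Partition → ℂ → ℂ) (j : RJet) : ℂ :=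
  ∑ π : n.Partition, c π (j 0) * (π.parts.map j).prod

/-- The total `x`-derivative `∑ₖ R_{k+1} ∂/∂R_k`. -/
def totalDx (F : RJet → ℂ) (j : RJet) : ℂ :=
  lineDeriv ℂ F j (fun k => j (k + 1))

/-- The derivative of a differential function along the evolution `R_s = A(R, R_x, …)`, that is
`∑ₖ (D_x^k A) ∂F/∂R_k`. -/
def evolDeriv (A F : RJet → ℂ) (j : RJet) : ℂ :=
  lineDeriv ℂ F j (fun k => (totalDx^[k] A) j)

/-- The Taylor expansion of the discrete derivative `Δ_y⁺ G = (T_y G - G) / ε`, where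
`T_y = exp (ε ∂_y)`, along the evolution `R_y = A`, up to and including the terms with the factor
`ε ^ N`. As `Δ_y⁻ = (1 - T_y⁻¹) / ε` arises from `Δ_y⁺` on replacing `ε` by `-ε` in the step of the
shift, `taylorDelta N (-ε) A G` is the expansion of `Δ_y⁻ G`. -/
def taylorDelta (N : ℕ) (ε : ℂ) (A G : RJet → ℂ) (j : RJet) : ℂ :=
  ∑ k ∈ Finset.range (N + 1), ε ^ k / ((k + 1).factorial : ℂ) * ((evolDeriv A)^[k + 1] G) j

namespace TodaEquation

/-- All coefficient functions are holomorphic on `U`. -/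
def HolomorphicOn (E : TodaEquation) (U : Set (ℂ × ℂ)) : Prop :=
  AnalyticOnNhd ℂ E.phi U ∧ AnalyticOnNhd ℂ E.f U ∧ AnalyticOnNhd ℂ E.g U ∧
    AnalyticOnNhd ℂ E.p U ∧ AnalyticOnNhd ℂ E.q U

/-- The right-hand side `φ u_x + f Δ_y⁺ g + p Δ_y⁻ q` at a point where `(u, w)` has the value `P`,
`T_y (u, w)` the value `Pplus`, `T_y⁻¹ (u, w)` the value `Pminus`, and `u_x` the value `ux`. -/
def rhs (E : TodaEquation) (ε : ℂ) (P Pplus Pminus : ℂ × ℂ) (ux : ℂ) : ℂ :=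
  E.phi P * ux + E.f P * ((E.g Pplus - E.g P) / ε) + E.p P * ((E.q P - E.q Pminus) / ε)

/-! ### The dispersionless limit `u_t = φ u_x + ψ u_y + η w_y`, `w_x = u_y` -/

def psi (E : TodaEquation) (P : ℂ × ℂ) : ℂ := E.f P * partialU E.g P + E.p P * partialU E.q P

def eta (E : TodaEquation) (P : ℂ × ℂ) : ℂ := E.f P * partialW E.g P + E.p P * partialW E.q P

/-- The dispersionless limit is totally linearly degenerate. -/
def TotallyLinearlyDegenerate (E : TodaEquation) (U : Set (ℂ × ℂ)) : Prop :=
  ∀ P ∈ U, partialW E.eta P = 0 ∧ partialW E.psi P + partialU E.eta P = 0 ∧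
    partialW E.phi P + partialU E.psi P = 0 ∧ partialU E.phi P = 0

/-- The dispersionless limit is non-degenerate: `η` is not identically zero, and the system is not
totally linearly degenerate. -/
def Nondegenerate (E : TodaEquation) (U : Set (ℂ × ℂ)) : Prop :=
  (∃ P ∈ U, E.eta P ≠ 0) ∧ ¬ E.TotallyLinearlyDegenerate U

/-- The characteristic speed `λ = φ + ψ μ + η μ²`: the one-phase solutions `u = R`, `w = w(R)` of
the dispersionless limit satisfy `R_y = μ R_x`, `R_t = λ R_x` with `μ = w'(R)`. -/
def speed (E : TodaEquation) (μ : ℂ) (P : ℂ × ℂ) : ℂ := E.phi P + E.psi P * μ + E.eta P * μ ^ 2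

/-- The rate of change `λ_u + μ λ_w = φ_u + (φ_w + ψ_u) μ + (ψ_w + η_u) μ² + η_w μ³` of the
characteristic speed along a one-phase solution, at fixed `μ`. It vanishes for all `μ` exactly for
totally linearly degenerate systems. -/
def nonlinearity (E : TodaEquation) (μ : ℂ) (P : ℂ × ℂ) : ℂ :=
  fderiv ℂ (E.speed μ) P (1, μ)

/-- A family of one-phase solutions `u = R`, `w = w(R)` of the dispersionless limit, with `R` in the
open set `D`: a holomorphic function `w` on `D` whose graph lies in the domain `U` of the
coefficients. -/
def IsOnePhase (U : Set (ℂ × ℂ)) (D : Set ℂ) (w : ℂ → ℂ) : Prop :=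
  IsOpen D ∧ AnalyticOnNhd ℂ w D ∧ ∀ R ∈ D, (R, w R) ∈ U

/-- The one-phase solutions given by `w` are inherited by the full equation modulo `ε ^ (N + 1)`:
there are deformations
`w = w(R) + ∑_{k = 1}^N ε^k W_k`, `R_y = μ R_x + ∑_{k = 1}^N ε^k A_k`,
`R_t = λ R_x + ∑_{k = 1}^N ε^k B_k`,
where `W_k`, `A_k`, `B_k` are homogeneous differential polynomials in the `x`-derivatives of `R` of
degrees `k`, `k + 1`, `k + 1`, whose coefficients are holomorphic functions of `R`,
such that `u = R` and `w` satisfy `w_x = Δ_y⁺ u`, `u_t = φ u_x + f Δ_y⁺ g + p Δ_y⁻ q`, and the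
compatibility condition `R_yt = R_ty`, all modulo `ε ^ (N + 1)`, identically in
`R, R_x, R_xx, …`. -/
def InheritsOnePhase (E : TodaEquation) (N : ℕ) (D : Set ℂ) (w : ℂ → ℂ) : Prop :=
  ∃ (ω : (k : ℕ) → k.Partition → ℂ → ℂ) (α β : (k : ℕ) → (k + 1).Partition → ℂ → ℂ),
    (∀ k π, AnalyticOnNhd ℂ (ω k π) D) ∧ (∀ k π, AnalyticOnNhd ℂ (α k π) D) ∧
    (∀ k π, AnalyticOnNhd ℂ (β k π) D) ∧
    let W : ℂ → RJet → ℂ := fun ε j =>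
      w (j 0) + ∑ k ∈ Finset.Icc 1 N, ε ^ k * diffPoly k (ω k) j
    let A : ℂ → RJet → ℂ := fun ε j =>
      deriv w (j 0) * j 1 + ∑ k ∈ Finset.Icc 1 N, ε ^ k * diffPoly (k + 1) (α k) j
    let B : ℂ → RJet → ℂ := fun ε j =>
      E.speed (deriv w (j 0)) (j 0, w (j 0)) * j 1 +
        ∑ k ∈ Finset.Icc 1 N, ε ^ k * diffPoly (k + 1) (β k) j
    let sub : (ℂ × ℂ → ℂ) → ℂ → RJet → ℂ := fun F ε j => F (j 0, W ε j)
    ∀ j : RJet, j 0 ∈ D →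
      (fun ε : ℂ => totalDx (W ε) j - taylorDelta N ε (A ε) (fun i => i 0) j)
        =O[𝓝 0] (fun ε : ℂ => ε ^ (N + 1)) ∧
      (fun ε : ℂ => B ε j - (sub E.phi ε j * j 1 +
          sub E.f ε j * taylorDelta N ε (A ε) (sub E.g ε) j +
          sub E.p ε j * taylorDelta N (-ε) (A ε) (sub E.q ε) j))
        =O[𝓝 0] (fun ε : ℂ => ε ^ (N + 1)) ∧
      (fun ε : ℂ => evolDeriv (B ε) (A ε) j - evolDeriv (A ε) (B ε) j)
        =O[𝓝 0] (fun ε : ℂ => ε ^ (N + 1))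

/-- Integrability modulo `ε ^ (N + 1)`: for arbitrary `μ(R) = w'(R)` (in general position, that is
as long as the nonlinearity `λ_u + μ λ_w`, by whose powers the coefficients of the deformation
are divided, does not vanish) the one-phase solutions of the dispersionless limit are inherited by
the full equation modulo `ε ^ (N + 1)`. -/
def IntegrableModulo (E : TodaEquation) (U : Set (ℂ × ℂ)) (N : ℕ) : Prop :=
  ∀ (D : Set ℂ) (w : ℂ → ℂ), IsOnePhase U D w →
    (∀ R ∈ D, E.nonlinearity (deriv w R) (R, w R) ≠ 0) → E.InheritsOnePhase N D w

/-! ### The three equations -/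

/-- `u_t = u Δ_y⁻ w`. -/
def toda : TodaEquation where
  phi := fun _ => 0
  f := fun _ => 0
  g := fun _ => 0
  p := fun P => P.1
  q := fun P => P.2

/-- `u_t = (α u + β) Δ_y⁻ e^w`. -/
def volterra (α β : ℂ) : TodaEquation where
  phi := fun _ => 0
  f := fun _ => 0
  g := fun _ => 0
  p := fun P => α * P.1 + β
  q := fun P => Complex.exp P.2

/-- `u_t = e^w √u Δ_y⁺ √u + √u Δ_y⁻ (e^w √u)`, where `s` is the chosen branch of `√u`. -/
def sqrtToda (s : ℂ × ℂ → ℂ) : TodaEquation where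
  phi := fun _ => 0
  f := fun P => Complex.exp P.2 * s P
  g := s
  p := s
  q := fun P => Complex.exp P.2 * s P

/-- `E` is, on the domain `V`, one of the equations of the list. -/
def IsListed (E : TodaEquation) (V : Set (ℂ × ℂ)) : Prop :=
  E = toda ∨
  (∃ α β : ℂ, (α ≠ 0 ∨ β ≠ 0) ∧ E = volterra α β) ∨
  (∃ s : ℂ × ℂ → ℂ, AnalyticOnNhd ℂ s V ∧ (∀ P ∈ V, s P ^ 2 = P.1) ∧ E = sqrtToda s)

/-- The substitution `u = a u' + b`, `w = a w' + d` (which preserves `w_x = Δ_y⁺ u`), combined with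
the Galilean transformation `x' = x + c t`, brings the equation `E` to the form `E'` for `(u', w')`
in `V`. -/
def TransformsTo (E E' : TodaEquation) (V : Set (ℂ × ℂ)) (a b c d : ℂ) : Prop :=
  let m : ℂ × ℂ → ℂ × ℂ := fun P => (a * P.1 + b, a * P.2 + d)
  ∀ ε : ℂ, ε ≠ 0 → ∀ P ∈ V, ∀ Pplus ∈ V, ∀ Pminus ∈ V, ∀ ux : ℂ,
    E.rhs ε (m P) (m Pplus) (m Pminus) (a * ux) = a * (E'.rhs ε P Pplus Pminus ux + c * ux)

end TodaEquation

end

/-! The definition of inheritance is analytic: errors O(ε^(N+1)) at each jet, with derivatives along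
directions that themselves depend on ε. All functions involved are analytic along every analytic
family of jets (`IsAnalyticFamily`), and Schwarz and Cauchy estimates show that directional
differentiation preserves the order of vanishing in ε (`isBigO_deriv_diagonal`). Hence every
expression has Taylor coefficients in a differential algebra `JetAlg`, on which D_x and the flows
are derivations (`HasExpansion`), and inheritance is equivalent to finitely many identities between
differential polynomials (`inheritsOnePhase_iff`), which can be compared monomial by monomial.

Sufficiency. Put w = T^{1/2} v with T = T_y. Then w_x = Δ⁺u reads v_x = (T^{1/2} - T^{-1/2})u/ε, and
the right-hand sides become even in ε too: p(u) (T^{1/2} - T^{-1/2}) q(v)/ε for the first two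
equations, √u (T^{1/2}e^v · T√u - T^{-1/2}e^v · T^{-1}√u)/ε for the third. So one may take v = w(R)
+ ε²V and only even corrections to R_y and R_t; the odd orders then hold by parity
(`inheritsOnePhase_of_symmetric`). At order ε² the corrections to two commuting flows are built from
the same two functions z, y of R, once with the derivatives of μ and once with those of λ
(`inheritsOnePhase_of_ratios`). The coefficients of R_xxx and R_x R_xx in u_t fix z and y, after
division by the nonlinearity, and the coefficient of R_x³ turns out to be an identity
(`inheritsOnePhase_of_exponential`, `inheritsOnePhase_sqrtToda`).

Necessity. Through a generic point there are curves of arbitrary generic slope μ and arbitrary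
constant curvature c = w'' ≠ 0, so solvability yields polynomial identities in c and μ. Order ε
gives f g_w = 0, f g_u = p q_u, p_w = 0 and a formula for φ_w, and makes the first-order corrections
to the flows vanish (`IntegrableModulo.firstOrderConditions`). Order ε² gives differential relations
between φ, p, q and γ = g_uu / g_u (`SecondOrderSetting.relations_at`). If q_u ≡ 0, then φ is
constant, p is affine in u and q_ww = κ q_w: the Toda case for κ = 0, the Volterra case for κ ≠ 0.
Otherwise q_ww = κ q_w with κ ≠ 0, p² is affine in u, g is affine in p, q is affine in p e^{κw}, and
f is proportional to p e^{κw}; scaling and shifting give the third equation. The relations are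
derived on small open sets and extended to U by the identity theorem. -/

open Filter Asymptotics TopologicalSpace

noncomputable section

open Filter Asymptotics

/-! ### Analytic families of differential functions -/

/-- A function of a parameter `ε` and a jet is an analytic family over `D` if it is analytic along
every finite-parameter analytic family of parameters and jets, near parameter value `0` and jets
with base point in `D`. -/
def IsAnalyticFamily (D : Set ℂ) (H : ℂ → RJet → ℂ) : Prop :=
  ∀ (E : Type) [NormedAddCommGroup E] [NormedSpace ℂ E] (e : E → ℂ) (γ : E → RJet) (s : E),
    AnalyticAt ℂ e s → (∀ k, AnalyticAt ℂ (fun x => γ x k) s) → e s = 0 → γ s 0 ∈ D →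
    AnalyticAt ℂ (fun x => H (e x) (γ x)) s

theorem analyticAt_deriv_snd {E : Type} [NormedAddCommGroup E] [NormedSpace ℂ E]
    {K : E × ℂ → ℂ} {s : E} (hK : AnalyticAt ℂ K (s, 0)) :
    AnalyticAt ℂ (fun x => deriv (fun t => K (x, t)) 0) s := by
  have h1 : AnalyticAt ℂ (fun x : E => fderiv ℂ K (x, 0) (0, 1)) s := by
    have hf : AnalyticAt ℂ (fun x : E => fderiv ℂ K (x, (0 : ℂ))) s :=
      AnalyticAt.fun_comp (f := fun x : E => (x, (0 : ℂ))) hK.fderiv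
        (analyticAt_id.prod analyticAt_const)
    exact (ContinuousLinearMap.apply ℂ ℂ ((0 : E), (1 : ℂ))).analyticAt _ |>.comp hf
  refine h1.congr ?_
  have h2 : ∀ᶠ x in 𝓝 s, AnalyticAt ℂ K (x, 0) := by
    have hc : ContinuousAt (fun x : E => (x, (0 : ℂ))) s := by fun_prop
    exact hc.eventually hK.eventually_analyticAt
  filter_upwards [h2] with x hx
  have hd : HasDerivAt (fun t : ℂ => ((x, t) : E × ℂ)) (0, 1) 0 :=
    (hasDerivAt_const 0 x).prodMk (hasDerivAt_id 0)
  exact ((hx.differentiableAt.hasFDerivAt).comp_hasDerivAt (0 : ℂ) hd).deriv.symm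

namespace IsAnalyticFamily

variable {D : Set ℂ} {H K : ℂ → RJet → ℂ}

theorem const (c : ℂ) : IsAnalyticFamily D (fun _ _ => c) :=
  fun _ _ _ _ _ _ _ _ _ _ => analyticAt_const

theorem param : IsAnalyticFamily D (fun ε _ => ε) := fun _ _ _ _ _ _ he _ _ _ => he

theorem coord (k : ℕ) : IsAnalyticFamily D (fun _ j => j k) :=
  fun _ _ _ _ _ _ _ hγ _ _ => hγ k

theorem add (hH : IsAnalyticFamily D H) (hK : IsAnalyticFamily D K) :
    IsAnalyticFamily D (fun ε j => H ε j + K ε j) :=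
  fun E _ _ e γ s h1 h2 h3 h4 => (hH E e γ s h1 h2 h3 h4).add (hK E e γ s h1 h2 h3 h4)

theorem sub (hH : IsAnalyticFamily D H) (hK : IsAnalyticFamily D K) :
    IsAnalyticFamily D (fun ε j => H ε j - K ε j) :=
  fun E _ _ e γ s h1 h2 h3 h4 => (hH E e γ s h1 h2 h3 h4).sub (hK E e γ s h1 h2 h3 h4)

theorem mul (hH : IsAnalyticFamily D H) (hK : IsAnalyticFamily D K) :
    IsAnalyticFamily D (fun ε j => H ε j * K ε j) :=
  fun E _ _ e γ s h1 h2 h3 h4 => (hH E e γ s h1 h2 h3 h4).mul (hK E e γ s h1 h2 h3 h4)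

theorem pow (hH : IsAnalyticFamily D H) (n : ℕ) : IsAnalyticFamily D (fun ε j => H ε j ^ n) :=
  fun E _ _ e γ s h1 h2 h3 h4 => (hH E e γ s h1 h2 h3 h4).pow n

theorem sum {ι : Type*} (S : Finset ι) {H : ι → ℂ → RJet → ℂ}
    (hH : ∀ i ∈ S, IsAnalyticFamily D (H i)) :
    IsAnalyticFamily D (fun ε j => ∑ i ∈ S, H i ε j) :=
  fun E _ _ e γ s h1 h2 h3 h4 =>
    Finset.analyticAt_fun_sum S fun i hi => hH i hi E e γ s h1 h2 h3 h4

theorem comp_curve {F : ℂ × ℂ → ℂ} {U : Set (ℂ × ℂ)} (hF : AnalyticOnNhd ℂ F U)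
    (hH : IsAnalyticFamily D H) (hU : ∀ j : RJet, j 0 ∈ D → (j 0, H 0 j) ∈ U) :
    IsAnalyticFamily D (fun ε j => F (j 0, H ε j)) := by
  intro E _ _ e γ s h1 h2 h3 h4
  have h5 : AnalyticAt ℂ (fun x => (γ x 0, H (e x) (γ x))) s :=
    (h2 0).prod (hH E e γ s h1 h2 h3 h4)
  refine AnalyticAt.fun_comp (f := fun x => (γ x 0, H (e x) (γ x))) (hF _ ?_) h5
  simpa [h3] using hU _ h4

theorem of_base {c : ℂ → ℂ} (hc : AnalyticOnNhd ℂ c D) : IsAnalyticFamily D (fun _ j => c (j 0)) :=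
  fun _ _ _ _ _ _ _ h2 _ h4 => AnalyticAt.fun_comp (hc _ h4) (h2 0)

/-- A directional derivative is a partial derivative in one extra scalar parameter. The definition
of an analytic family allows every parameter space, in particular `E × ℂ`, so the class is closed
under differentiation without any topology on jets. -/
theorem lineDeriv (hH : IsAnalyticFamily D H) {v : ℂ → RJet → RJet}
    (hv : ∀ k, IsAnalyticFamily D (fun ε j => v ε j k)) :
    IsAnalyticFamily D (fun ε j => lineDeriv ℂ (H ε) j (v ε j)) := by
  intro E _ _ e γ s h1 h2 h3 h4
  refine analyticAt_deriv_snd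
    (K := fun q : E × ℂ => H (e q.1) (γ q.1 + q.2 • v (e q.1) (γ q.1))) ?_
  have hfst : AnalyticAt ℂ (Prod.fst : E × ℂ → E) (s, 0) := analyticAt_fst
  refine hH (E × ℂ) (fun q => e q.1) (fun q => γ q.1 + q.2 • v (e q.1) (γ q.1)) (s, 0)
    (h1.fun_comp hfst) (fun k => ?_) h3 (by simpa using h4)
  simp only [Pi.add_apply, Pi.smul_apply, smul_eq_mul]
  exact ((h2 k).fun_comp hfst).add (analyticAt_snd.mul ((hv k E e γ s h1 h2 h3 h4).fun_comp hfst))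

end IsAnalyticFamily

/-! ### Order of vanishing in the parameter -/

/-- The Schwarz lemma applied n times, to successive quotients by z. The gain over the hypothesis is
that the constant depends only on the sup bound `M` and on `r`, so pointwise orders of vanishing
become uniform in further parameters. -/
theorem norm_le_of_isBigO_pow {r : ℝ} (hr : 0 < r) (n : ℕ) :
    ∀ (h : ℂ → ℂ) (M : ℝ), DifferentiableOn ℂ h (Metric.ball 0 r) →
      (∀ z ∈ Metric.ball (0 : ℂ) r, ‖h z‖ ≤ M) → h =O[𝓝 0] (fun z => z ^ n) →
      ∀ z ∈ Metric.ball (0 : ℂ) r, ‖h z‖ ≤ M * (‖z‖ / r) ^ n := by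
  induction n with
  | zero => intro h M _ hM _ z hz; simpa using hM z hz
  | succ n ih =>
    intro h M hd hM hO z hz
    have h0 : h 0 = 0 := by
      have := hO.eq_zero_imp.self_of_nhds
      exact this (by simp)
    have hball : Metric.ball (0 : ℂ) r ∈ 𝓝 (0 : ℂ) := Metric.ball_mem_nhds 0 hr
    have hds : DifferentiableOn ℂ (dslope h 0) (Metric.ball 0 r) :=
      (Complex.differentiableOn_dslope hball).2 hd
    have hb : ∀ z ∈ Metric.ball (0 : ℂ) r, ‖dslope h 0 z‖ ≤ M / r := fun z hz =>
      Complex.norm_dslope_le_div_of_mapsTo_ball hd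
        (fun y hy => by simpa [h0] using hM y hy) hz
    have hmul : ∀ z, h z = z * dslope h 0 z := fun z => by
      have := sub_smul_dslope h 0 z
      simpa [h0] using this.symm
    -- Division by z costs one power off the origin; the bound at the origin follows by continuity.
    have hO' : dslope h 0 =O[𝓝 0] (fun z => z ^ n) := by
      obtain ⟨C, hC⟩ := hO.bound
      have hcont : ContinuousAt (dslope h 0) 0 := (hds.differentiableAt hball).continuousAt
      have hne : ∀ᶠ z in 𝓝[≠] (0 : ℂ), ‖dslope h 0 z‖ ≤ C * ‖z ^ n‖ := by
        filter_upwards [nhdsWithin_le_nhds hC, self_mem_nhdsWithin] with z hz hz0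
        have hpos : 0 < ‖z‖ := norm_pos_iff.2 hz0
        rw [hmul z, norm_mul, pow_succ, norm_mul] at hz
        nlinarith
      have h00 : ‖dslope h 0 0‖ ≤ C * ‖(0 : ℂ) ^ n‖ := by
        have t1 : Tendsto (fun z => ‖dslope h 0 z‖) (𝓝[≠] (0 : ℂ)) (𝓝 ‖dslope h 0 0‖) :=
          (hcont.norm.tendsto).mono_left nhdsWithin_le_nhds
        have t2 : Tendsto (fun z : ℂ => C * ‖z ^ n‖) (𝓝[≠] (0 : ℂ)) (𝓝 (C * ‖(0 : ℂ) ^ n‖)) := by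
          have : Continuous (fun z : ℂ => C * ‖z ^ n‖) := by fun_prop
          exact (this.tendsto 0).mono_left nhdsWithin_le_nhds
        exact le_of_tendsto_of_tendsto t1 t2 hne
      refine IsBigO.of_bound C ?_
      rw [eventually_nhdsWithin_iff] at hne
      filter_upwards [hne] with z hz
      rcases eq_or_ne z 0 with rfl | h
      · exact h00
      · exact hz h
    have := ih (dslope h 0) (M / r) hds hb hO' z hz
    rw [hmul z, norm_mul]
    calc ‖z‖ * ‖dslope h 0 z‖ ≤ ‖z‖ * (M / r * (‖z‖ / r) ^ n) := by gcongr
      _ = M * (‖z‖ / r) ^ (n + 1) := by rw [pow_succ]; ring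

/-- Three separate variables are needed because the direction of differentiation depends on ε as
well. The Schwarz bound is uniform in the last two variables, so the second may be set equal to ε,
and Cauchy's estimate on a circle of fixed radius bounds the t-derivative. -/
theorem isBigO_deriv_diagonal {n : ℕ} {K : ℂ × ℂ × ℂ → ℂ} (hK : AnalyticAt ℂ K 0)
    (hO : ∀ᶠ q in 𝓝 (0 : ℂ × ℂ), (fun e => K (e, q.1, q.2)) =O[𝓝 0] (fun e => e ^ n)) :
    (fun ε => deriv (fun t => K (ε, ε, t)) 0) =O[𝓝 0] (fun ε => ε ^ n) := by
  obtain ⟨M, hM⟩ : ∃ M : ℝ, ∀ᶠ p in 𝓝 (0 : ℂ × ℂ × ℂ), ‖K p‖ ≤ M :=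
    ⟨‖K 0‖ + 1, (hK.continuousAt.norm.eventually_lt continuousAt_const (by simp)).mono
      fun p hp => hp.le⟩
  obtain ⟨r, hr, hrb⟩ := Metric.eventually_nhds_iff_ball.1 (hM.and hK.eventually_analyticAt)
  obtain ⟨r', hr', hrb'⟩ := Metric.eventually_nhds_iff_ball.1 hO
  have mem3 : ∀ a b c : ℂ, ‖a‖ < r → ‖b‖ < r → ‖c‖ < r →
      ((a, b, c) : ℂ × ℂ × ℂ) ∈ Metric.ball 0 r := by
    intro a b c ha hb hc
    simp [Prod.norm_def, ha, hb, hc]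
  set ρ := min r r' / 2 with hρ
  have hρ0 : 0 < ρ := by positivity
  have hρr : ρ < r := by
    have := min_le_left r r'; have : 0 < min r r' := by positivity
    linarith
  have hρr' : ρ < r' := by
    have := min_le_right r r'; have : 0 < min r r' := by positivity
    linarith
  have hbound : ∀ ε b t : ℂ, ‖ε‖ < r → ‖b‖ ≤ ρ → ‖t‖ ≤ ρ → ‖K (ε, b, t)‖ ≤ M * (‖ε‖ / r) ^ n := by
    intro ε b t hε hb ht
    refine norm_le_of_isBigO_pow hr n (fun e => K (e, b, t)) M ?_ ?_ ?_ ε (by simpa using hε)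
    · intro e he
      have he' : ‖e‖ < r := by simpa using he
      have h1 := (hrb _ (mem3 e b t he' (by linarith) (by linarith))).2.differentiableAt
      have h2 : DifferentiableAt ℂ (fun e : ℂ => ((e, b, t) : ℂ × ℂ × ℂ)) e := by fun_prop
      exact (h1.comp e h2).differentiableWithinAt
    · intro e he
      exact (hrb _ (mem3 e b t (by simpa using he) (by linarith) (by linarith))).1
    · refine hrb' (b, t) ?_
      simp only [Metric.mem_ball, dist_zero_right, Prod.norm_def, sup_lt_iff]
      exact ⟨by linarith, by linarith⟩
  refine IsBigO.of_bound (M / ρ / r ^ n) ?_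
  filter_upwards [Metric.ball_mem_nhds (0 : ℂ) hρ0] with ε hε
  have hε' : ‖ε‖ < ρ := by simpa using hε
  have hd : DiffContOnCl ℂ (fun t => K (ε, ε, t)) (Metric.ball 0 ρ) := by
    have : DifferentiableOn ℂ (fun t => K (ε, ε, t)) (Metric.ball 0 r) := by
      intro t ht
      have h1 := (hrb _ (mem3 ε ε t (by linarith) (by linarith) (by simpa using ht))).2.differentiableAt
      have h2 : DifferentiableAt ℂ (fun t : ℂ => ((ε, ε, t) : ℂ × ℂ × ℂ)) t := by fun_prop
      exact (h1.comp t h2).differentiableWithinAt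
    exact (this.mono (Metric.closedBall_subset_ball hρr)).diffContOnCl_ball subset_rfl
  have := Complex.norm_deriv_le_of_forall_mem_sphere_norm_le hρ0 hd
    (C := M * (‖ε‖ / r) ^ n) (fun t ht => hbound ε ε t (by linarith) hε'.le (by
      have : ‖t‖ = ρ := by simpa using ht
      exact this.le))
  refine this.trans (le_of_eq ?_)
  rw [norm_pow, div_pow]
  ring

/-! ### Directional derivatives of analytic families and division by powers of ε -/

section LineDerivative

variable {D : Opens ℂ} {H : ℂ → RJet → ℂ}

theorem IsAnalyticFamily.congr {K : ℂ → RJet → ℂ} (hH : IsAnalyticFamily D H)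
    (h : ∀ ε, ∀ j : RJet, j 0 ∈ D → H ε j = K ε j) : IsAnalyticFamily D K := by
  intro E _ _ e γ s h1 h2 h3 h4
  refine (hH E e γ s h1 h2 h3 h4).congr ?_
  have : ∀ᶠ x in 𝓝 s, γ x 0 ∈ D := (h2 0).continuousAt.eventually (D.isOpen.mem_nhds h4)
  filter_upwards [this] with x hx using h _ _ hx

theorem IsAnalyticFamily.analyticAt_param (hH : IsAnalyticFamily D H) {j : RJet} (hj : j 0 ∈ D) :
    AnalyticAt ℂ (fun ε => H ε j) 0 :=
  hH ℂ (fun ε => ε) (fun _ => j) 0 analyticAt_id (fun _ => analyticAt_const) rfl hj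

theorem IsAnalyticFamily.eventually_lineDifferentiableAt (hH : IsAnalyticFamily D H)
    {v : ℂ → RJet} (hv : ∀ k, AnalyticAt ℂ (fun ε => v ε k) 0) {j : RJet} (hj : j 0 ∈ D) :
    ∀ᶠ ε in 𝓝 (0 : ℂ), LineDifferentiableAt ℂ (H ε) j (v ε) := by
  have h := hH (ℂ × ℂ) (fun q => q.1) (fun q => j + q.2 • v q.1) 0 analyticAt_fst (fun k => by
    simp only [Pi.add_apply, Pi.smul_apply, smul_eq_mul]
    exact analyticAt_const.add (analyticAt_snd.mul
      ((hv k).fun_comp (f := Prod.fst) (x := (0 : ℂ × ℂ)) analyticAt_fst))) rfl (by simpa using hj)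
  have hc : ContinuousAt (fun x : ℂ => (x, (0 : ℂ))) 0 := by fun_prop
  filter_upwards [hc.eventually h.eventually_analyticAt] with ε hε
  have h2 : DifferentiableAt ℂ (fun t : ℂ => ((ε, t) : ℂ × ℂ)) 0 := by fun_prop
  exact hε.differentiableAt.comp (0 : ℂ) h2

theorem IsAnalyticFamily.lineDifferentiableAt {F : RJet → ℂ} (hF : IsAnalyticFamily D fun _ => F)
    {j : RJet} (hj : j 0 ∈ D) (v : RJet) : LineDifferentiableAt ℂ F j v :=
  (hF.eventually_lineDifferentiableAt (v := fun _ => v) (fun _ => analyticAt_const) hj).self_of_nhds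

/-- Directional derivatives need not be additive in general. Here the restriction of `F` to the
plane spanned by the two directions is analytic, hence has a linear differential. -/
theorem IsAnalyticFamily.lineDeriv_add_dir {F : RJet → ℂ} (hF : IsAnalyticFamily D fun _ => F)
    {j : RJet} (hj : j 0 ∈ D) (v w : RJet) :
    _root_.lineDeriv ℂ F j (v + w) = _root_.lineDeriv ℂ F j v + _root_.lineDeriv ℂ F j w := by
  have h := hF (ℂ × ℂ) (fun _ => 0) (fun q => j + (q.1 • v + q.2 • w)) 0 analyticAt_const
    (fun k => by
      simp only [Pi.add_apply, Pi.smul_apply, smul_eq_mul]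
      exact analyticAt_const.add ((analyticAt_fst.mul analyticAt_const).add
        (analyticAt_snd.mul analyticAt_const))) rfl (by simpa using hj)
  have hd := h.differentiableAt.hasFDerivAt
  set L := fderiv ℂ (fun q : ℂ × ℂ => F (j + (q.1 • v + q.2 • w))) 0
  have key : ∀ a b : ℂ, _root_.lineDeriv ℂ F j (a • v + b • w) = L (a, b) := by
    intro a b
    have h1 : HasDerivAt (fun t : ℂ => ((t * a, t * b) : ℂ × ℂ)) (a, b) 0 := by
      have ha : HasDerivAt (fun t : ℂ => t * a) a 0 := by
        simpa using (hasDerivAt_id (0 : ℂ)).mul_const a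
      have hb : HasDerivAt (fun t : ℂ => t * b) b 0 := by
        simpa using (hasDerivAt_id (0 : ℂ)).mul_const b
      exact ha.prodMk hb
    have h0 : ((0 * a, 0 * b) : ℂ × ℂ) = 0 := by ext <;> simp
    rw [← h0] at hd
    have h2 := (hd.comp_hasDerivAt (0 : ℂ) h1).deriv
    rw [← h2, _root_.lineDeriv]
    congr 1
    funext t
    simp [smul_smul, smul_add]
  have e1 := key 1 1
  have e2 := key 1 0
  have e3 := key 0 1
  simp only [one_smul, zero_smul, add_zero, zero_add] at e1 e2 e3
  rw [e1, e2, e3, ← map_add]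
  simp

theorem IsAnalyticFamily.lineDeriv_sum_dir {F : RJet → ℂ} (hF : IsAnalyticFamily D fun _ => F)
    {j : RJet} (hj : j 0 ∈ D) {ι : Type*} (S : Finset ι) (v : ι → RJet) :
    _root_.lineDeriv ℂ F j (∑ i ∈ S, v i) = ∑ i ∈ S, _root_.lineDeriv ℂ F j (v i) := by
  classical
  induction S using Finset.induction_on with
  | empty => simp [lineDeriv_zero]
  | insert a S ha ih => rw [Finset.sum_insert ha, Finset.sum_insert ha,
      hF.lineDeriv_add_dir hj, ih]

theorem IsAnalyticFamily.isBigO_lineDeriv (hH : IsAnalyticFamily D H) {n : ℕ}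
    (hO : ∀ j : RJet, j 0 ∈ D → (fun ε => H ε j) =O[𝓝 0] (fun ε => ε ^ n))
    {v : ℂ → RJet} (hv : ∀ k, AnalyticAt ℂ (fun ε => v ε k) 0) {j : RJet} (hj : j 0 ∈ D) :
    (fun ε => _root_.lineDeriv ℂ (H ε) j (v ε)) =O[𝓝 0] (fun ε => ε ^ n) := by
  refine isBigO_deriv_diagonal (K := fun p => H p.1 (j + p.2.2 • v p.2.1)) ?_ ?_
  · refine hH (ℂ × ℂ × ℂ) (fun p => p.1) (fun p => j + p.2.2 • v p.2.1) 0 analyticAt_fst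
      (fun k => ?_) rfl (by simpa using hj)
    simp only [Pi.add_apply, Pi.smul_apply, smul_eq_mul]
    have h1 : AnalyticAt ℂ (fun p : ℂ × ℂ × ℂ => p.2.1) 0 :=
      (ContinuousLinearMap.fst ℂ ℂ ℂ ∘L ContinuousLinearMap.snd ℂ ℂ (ℂ × ℂ)).analyticAt 0
    have h2 : AnalyticAt ℂ (fun p : ℂ × ℂ × ℂ => p.2.2) 0 :=
      (ContinuousLinearMap.snd ℂ ℂ ℂ ∘L ContinuousLinearMap.snd ℂ ℂ (ℂ × ℂ)).analyticAt 0
    exact analyticAt_const.add (h2.mul ((hv k).fun_comp (x := (0 : ℂ × ℂ × ℂ)) h1))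
  · have hc : ContinuousAt (fun q : ℂ × ℂ => (j + q.2 • v q.1) 0) 0 := by
      simp only [Pi.add_apply, Pi.smul_apply, smul_eq_mul]
      have := (hv 0).fun_comp (f := Prod.fst) (x := (0 : ℂ × ℂ)) analyticAt_fst
      exact continuousAt_const.add (continuousAt_snd.mul this.continuousAt)
    filter_upwards [hc.eventually (D.isOpen.mem_nhds (by simpa using hj))] with q hq
    exact hO _ hq

theorem exists_eq_pow_mul {n : ℕ} {a : ℂ → ℂ} (ha : AnalyticAt ℂ a 0)
    (hO : a =O[𝓝 0] (fun ε => ε ^ n)) :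
    ∃ b : ℂ → ℂ, AnalyticAt ℂ b 0 ∧ ∀ ε, a ε = ε ^ n * b ε := by
  rcases n.eq_zero_or_pos with rfl | hn
  · exact ⟨a, ha, by simp⟩
  have hord : (n : ℕ∞) ≤ analyticOrderAt a 0 := by
    by_contra! hlt
    obtain ⟨m, hm⟩ : ∃ m : ℕ, analyticOrderAt a 0 = m := by
      have := ne_top_of_lt hlt
      exact ⟨_, (ENat.natCast_toNat this).symm⟩
    rw [hm] at hlt
    have hmn : m < n := by exact_mod_cast hlt
    obtain ⟨g, hg, hg0, hag⟩ := (ha.analyticOrderAt_eq_natCast).1 hm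
    simp only [sub_zero, smul_eq_mul] at hag
    have h1 : (fun ε : ℂ => ε ^ m * g ε) =O[𝓝[≠] 0] (fun ε => ε ^ n) :=
      (hO.congr' hag EventuallyEq.rfl).mono nhdsWithin_le_nhds
    obtain ⟨C, hC⟩ := h1.bound
    obtain ⟨d, rfl⟩ := Nat.exists_eq_add_of_lt hmn
    have h2 : ∀ᶠ ε in 𝓝[≠] (0 : ℂ), ‖g ε‖ ≤ C * ‖ε‖ ^ (d + 1) := by
      filter_upwards [hC, self_mem_nhdsWithin] with ε h hε
      have hpos : 0 < ‖ε‖ ^ m := pow_pos (norm_pos_iff.2 hε) m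
      rw [norm_mul, norm_pow, norm_pow, add_assoc, pow_add] at h
      refine le_of_mul_le_mul_left ?_ hpos
      linarith
    have t1 : Tendsto (fun z => ‖g z‖) (𝓝[≠] (0 : ℂ)) (𝓝 ‖g 0‖) :=
      (hg.continuousAt.norm.tendsto).mono_left nhdsWithin_le_nhds
    have t2 : Tendsto (fun z : ℂ => C * ‖z‖ ^ (d + 1)) (𝓝[≠] (0 : ℂ))
        (𝓝 (C * ‖(0 : ℂ)‖ ^ (d + 1))) := by
      have : Continuous (fun z : ℂ => C * ‖z‖ ^ (d + 1)) := by fun_prop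
      exact (this.tendsto 0).mono_left nhdsWithin_le_nhds
    have h3 := le_of_tendsto_of_tendsto t1 t2 h2
    rw [norm_zero, zero_pow (by omega), mul_zero, norm_le_zero_iff] at h3
    exact hg0 h3
  obtain ⟨g, hg, hag⟩ := (natCast_le_analyticOrderAt ha).1 hord
  simp only [sub_zero, smul_eq_mul] at hag
  -- Away from 0 the quotient itself is used, so that the factorization holds for every ε and not
  -- only near 0.
  refine ⟨fun ε => if ε = 0 then g 0 else a ε / ε ^ n, hg.congr ?_, fun ε => ?_⟩
  · filter_upwards [hag] with ε h
    rcases eq_or_ne ε 0 with rfl | hε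
    · simp
    · simp [hε, h]
  · rcases eq_or_ne ε 0 with rfl | hε
    · have := hO.eq_zero_imp.self_of_nhds (by simp [hn.ne'])
      simp [this, hn.ne']
    · have : ε ^ n ≠ 0 := pow_ne_zero _ hε
      simp only [hε, if_false]
      field_simp

/-- The direction is divided by ε^n coordinate by coordinate and the factor is pulled out by
homogeneity; the quotient is an analytic family of directions, so no uniformity over the infinitely
many coordinates is required. -/
theorem IsAnalyticFamily.isBigO_lineDeriv_dir {F : RJet → ℂ} (hF : IsAnalyticFamily D fun _ => F)
    {n : ℕ} {a : ℂ → RJet} (ha : ∀ k, AnalyticAt ℂ (fun ε => a ε k) 0)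
    (hO : ∀ k, (fun ε => a ε k) =O[𝓝 0] (fun ε => ε ^ n)) {j : RJet} (hj : j 0 ∈ D) :
    (fun ε => _root_.lineDeriv ℂ F j (a ε)) =O[𝓝 0] (fun ε => ε ^ n) := by
  choose b hb hab using fun k => exists_eq_pow_mul (ha k) (hO k)
  have h1 : ∀ ε, a ε = ε ^ n • (fun k => b k ε) := fun ε => by
    funext k; simpa using hab k ε
  have h2 : AnalyticAt ℂ (fun ε => _root_.lineDeriv ℂ F j (fun k => b k ε)) 0 := by
    refine analyticAt_deriv_snd (K := fun q : ℂ × ℂ => F (j + q.2 • fun k => b k q.1)) ?_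
    refine hF (ℂ × ℂ) (fun _ => 0) (fun q => j + q.2 • fun k => b k q.1) (0, 0) analyticAt_const
      (fun k => ?_) rfl (by simpa using hj)
    simp only [Pi.add_apply, Pi.smul_apply, smul_eq_mul]
    exact analyticAt_const.add (analyticAt_snd.mul
      ((hb k).fun_comp (f := Prod.fst) (x := ((0, 0) : ℂ × ℂ)) analyticAt_fst))
  have h3 := (isBigO_refl (fun ε : ℂ => ε ^ n) (𝓝 0)).mul (h2.continuousAt.norm.isBoundedUnder_le.isBigO_one ℂ)
  simp only [mul_one] at h3
  refine h3.congr_left fun ε => ?_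
  rw [h1 ε, lineDeriv_smul, smul_eq_mul]

end LineDerivative

/-! ### The differential algebra of analytic functions of jets -/

/-- Jets with base point in `D`. -/
abbrev JetPt (D : Opens ℂ) : Type := {j : RJet // j 0 ∈ D}

open Classical in
/-- Extension by zero of a function of jets over `D`. -/
def extendJet {D : Opens ℂ} (F : JetPt D → ℂ) (j : RJet) : ℂ :=
  if h : j 0 ∈ D then F ⟨j, h⟩ else 0

theorem extendJet_of_mem {D : Opens ℂ} (F : JetPt D → ℂ) {j : RJet} (h : j 0 ∈ D) :
    extendJet F j = F ⟨j, h⟩ := by simp [extendJet, h]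

@[simp] theorem extendJet_coe {D : Opens ℂ} (F : JetPt D → ℂ) (j : JetPt D) :
    extendJet F j = F j := extendJet_of_mem F j.2

/-- The subalgebra of analytic differential functions over `D`. -/
def jetSubalgebra (D : Opens ℂ) : Subalgebra ℂ (JetPt D → ℂ) where
  carrier := {F | IsAnalyticFamily D (fun _ => extendJet F)}
  mul_mem' {F G} hF hG := by
    rw [Set.mem_ofPred] at *
    exact (hF.mul hG).congr fun _ j h => by simp [extendJet_of_mem _ h]
  add_mem' {F G} hF hG := by
    rw [Set.mem_ofPred] at *
    exact (hF.add hG).congr fun _ j h => by simp [extendJet_of_mem _ h]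
  algebraMap_mem' r := by
    rw [Set.mem_ofPred]
    exact (IsAnalyticFamily.const r).congr fun _ j h => by simp [extendJet_of_mem _ h]

theorem mem_jetSubalgebra {D : Opens ℂ} {F : JetPt D → ℂ} :
    F ∈ jetSubalgebra D ↔ IsAnalyticFamily D (fun _ => extendJet F) := Iff.rfl

/-- The algebra of analytic differential functions over `D`. -/
def JetAlg (D : Opens ℂ) : Type := jetSubalgebra D

instance (D : Opens ℂ) : CommRing (JetAlg D) := inferInstanceAs (CommRing (jetSubalgebra D))
instance (D : Opens ℂ) : Algebra ℂ (JetAlg D) := inferInstanceAs (Algebra ℂ (jetSubalgebra D))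

namespace JetAlg

variable {D : Opens ℂ}

instance : CoeFun (JetAlg D) (fun _ => JetPt D → ℂ) := ⟨fun F => Subtype.val F⟩

theorem family (F : JetAlg D) : IsAnalyticFamily D (fun _ => extendJet F) :=
  mem_jetSubalgebra.1 F.2

@[simp] theorem add_apply (F G : JetAlg D) (j : JetPt D) : (F + G : JetAlg D) j = F j + G j := rfl
@[simp] theorem sub_apply (F G : JetAlg D) (j : JetPt D) : (F - G : JetAlg D) j = F j - G j := rfl
@[simp] theorem neg_apply (F : JetAlg D) (j : JetPt D) : (-F : JetAlg D) j = -F j := rfl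
@[simp] theorem mul_apply (F G : JetAlg D) (j : JetPt D) : (F * G : JetAlg D) j = F j * G j := rfl
@[simp] theorem smul_apply (c : ℂ) (F : JetAlg D) (j : JetPt D) :
    (c • F : JetAlg D) j = c * F j := rfl
@[simp] theorem zero_apply (j : JetPt D) : (0 : JetAlg D) j = 0 := rfl
@[simp] theorem one_apply (j : JetPt D) : (1 : JetAlg D) j = 1 := rfl
@[simp] theorem pow_apply (F : JetAlg D) (n : ℕ) (j : JetPt D) : (F ^ n : JetAlg D) j = F j ^ n := rfl
@[simp] theorem natCast_apply (n : ℕ) (j : JetPt D) : (n : JetAlg D) j = n := rfl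
@[simp] theorem ofNat_apply (n : ℕ) [n.AtLeastTwo] (j : JetPt D) :
    (ofNat(n) : JetAlg D) j = ofNat(n) := rfl
@[simp] theorem algebraMap_apply (c : ℂ) (j : JetPt D) : (algebraMap ℂ (JetAlg D) c) j = c := rfl
@[simp] theorem sum_apply {ι : Type*} (S : Finset ι) (F : ι → JetAlg D) (j : JetPt D) :
    (∑ i ∈ S, F i : JetAlg D) j = ∑ i ∈ S, F i j := by
  classical
  induction S using Finset.induction_on with
  | empty => simp
  | insert a S ha ih => rw [Finset.sum_insert ha, Finset.sum_insert ha, add_apply, ih]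

theorem ext' {F G : JetAlg D} (h : ∀ j, F j = G j) : F = G := Subtype.ext (funext h)

/-- The restriction to jets over `D` of an analytic differential function. -/
def mk' (F : RJet → ℂ) (hF : IsAnalyticFamily D (fun _ => F)) : JetAlg D :=
  ⟨fun j => F j, mem_jetSubalgebra.2 <|
    hF.congr fun _ j h => by rw [extendJet_of_mem _ h]⟩

@[simp] theorem mk'_apply (F : RJet → ℂ) (hF : IsAnalyticFamily D (fun _ => F)) (j : JetPt D) :
    mk' F hF j = F j := rfl

/-- The jet coordinate `R_k`. -/
def X (k : ℕ) : JetAlg D := mk' (fun j => j k) (IsAnalyticFamily.coord k)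

@[simp] theorem X_apply (k : ℕ) (j : JetPt D) : (X k : JetAlg D) j = j.1 k := rfl

/-- A function of the base point. -/
def base (c : ℂ → ℂ) (hc : AnalyticOnNhd ℂ c D) : JetAlg D :=
  mk' (fun j => c (j 0)) (IsAnalyticFamily.of_base hc)

@[simp] theorem base_apply (c : ℂ → ℂ) (hc : AnalyticOnNhd ℂ c D) (j : JetPt D) :
    base c hc j = c (j.1 0) := rfl

theorem lineDeriv_congr {F G : RJet → ℂ} (h : ∀ j : RJet, j 0 ∈ D → F j = G j) {j : RJet}
    (hj : j 0 ∈ D) (v : RJet) : lineDeriv ℂ F j v = lineDeriv ℂ G j v := by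
  refine EventuallyEq.deriv_eq ?_
  have hc : ContinuousAt (fun t : ℂ => (j + t • v) 0) 0 := by
    simp only [Pi.add_apply, Pi.smul_apply, smul_eq_mul]; fun_prop
  filter_upwards [hc.eventually (D.isOpen.mem_nhds (by simpa using hj))] with t ht using h _ ht

/-- The derivation of the algebra of differential functions along a vector field. -/
def dir (v : ℕ → JetAlg D) : Derivation ℂ (JetAlg D) (JetAlg D) where
  toFun F := mk' (fun j => lineDeriv ℂ (extendJet F) j (fun k => extendJet (v k) j))
    (F.family.lineDeriv (v := fun _ j k => extendJet (v k) j) fun k => (v k).family)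
  map_add' F G := ext' fun j => by
    simp only [mk'_apply, add_apply]
    rw [lineDeriv_congr (G := extendJet F + extendJet G) (fun j hj => by
      simp [extendJet_of_mem _ hj]) j.2]
    exact deriv_add (F.family.lineDifferentiableAt j.2 _) (G.family.lineDifferentiableAt j.2 _)
  map_smul' c F := ext' fun j => by
    simp only [mk'_apply, RingHom.id_apply, smul_apply]
    rw [lineDeriv_congr (G := fun j => c * extendJet F j) (fun j hj => by
      simp [extendJet_of_mem _ hj]) j.2]
    exact deriv_const_mul _ (F.family.lineDifferentiableAt j.2 _)
  map_one_eq_zero' := ext' fun j => by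
    change lineDeriv ℂ (extendJet _) j.1 _ = 0
    rw [lineDeriv_congr (G := fun _ => 1) (fun j hj => by simp [extendJet_of_mem _ hj]) j.2]
    exact deriv_const _ _
  leibniz' F G := ext' fun j => by
    change lineDeriv ℂ (extendJet _) j.1 _ = _
    rw [lineDeriv_congr (G := fun j => extendJet F j * extendJet G j) (fun j hj => by
      simp [extendJet_of_mem _ hj]) j.2]
    refine (deriv_mul (F.family.lineDifferentiableAt j.2 _)
      (G.family.lineDifferentiableAt j.2 _)).trans ?_
    simp [lineDeriv]
    ring

theorem dir_apply (v : ℕ → JetAlg D) (F : JetAlg D) (j : JetPt D) :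
    dir v F j = lineDeriv ℂ (extendJet F) j (fun k => v k j) := by
  change lineDeriv ℂ (extendJet F) j.1 _ = _
  simp

theorem dir_X (v : ℕ → JetAlg D) (k : ℕ) : dir v (X k) = v k := ext' fun j => by
  rw [dir_apply, lineDeriv_congr (G := fun j => j k) (fun j hj => by
    simp [extendJet_of_mem _ hj]) j.2]
  have : HasDerivAt (fun t : ℂ => (j.1 + t • fun k => v k j) k) (v k j) 0 := by
    simpa using ((hasDerivAt_id (0 : ℂ)).mul_const (v k j)).const_add (j.1 k)
  exact this.deriv

theorem dir_base (v : ℕ → JetAlg D) {c : ℂ → ℂ} (hc : AnalyticOnNhd ℂ c D) :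
    dir v (base c hc) = base (deriv c) hc.deriv * v 0 := ext' fun j => by
  rw [dir_apply, lineDeriv_congr (G := fun j => c (j 0)) (fun j hj => by
    simp [extendJet_of_mem _ hj]) j.2]
  have h1 : HasDerivAt (fun t : ℂ => (j.1 + t • fun k => v k j) 0) (v 0 j) 0 := by
    simpa using ((hasDerivAt_id (0 : ℂ)).mul_const (v 0 j)).const_add (j.1 0)
  have h2 : HasDerivAt c (deriv c (j.1 0)) ((j.1 + (0 : ℂ) • fun k => v k j) 0) := by
    simpa using (hc _ j.2).differentiableAt.hasDerivAt
  exact (h2.comp (0 : ℂ) h1).deriv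

/-- The total derivative. -/
def Dx : Derivation ℂ (JetAlg D) (JetAlg D) := dir fun k => X (k + 1)

/-- The derivative along the evolution `R_s = A`. -/
def evol (A : JetAlg D) : Derivation ℂ (JetAlg D) (JetAlg D) := dir fun k => Dx^[k] A

@[simp] theorem Dx_X (k : ℕ) : Dx (X k : JetAlg D) = X (k + 1) := dir_X _ k

theorem evol_X (A : JetAlg D) (k : ℕ) : evol A (X k) = Dx^[k] A := dir_X _ k

end JetAlg

/-! ### Taylor expansions in ε with coefficients in the differential algebra -/

/-- Cauchy product with respect to an operation. -/
def conv {M : Type*} [AddCommMonoid M] (op : M → M → M) (a b : ℕ → M) (n : ℕ) : M :=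
  ∑ p ∈ Finset.HasAntidiagonal.antidiagonal n, op (a p.1) (b p.2)

theorem isBigO_pow_pow {m n : ℕ} (h : n ≤ m) :
    (fun ε : ℂ => ε ^ m) =O[𝓝 0] (fun ε => ε ^ n) := by
  obtain ⟨d, rfl⟩ := Nat.exists_eq_add_of_le h
  have h1 : (fun ε : ℂ => ε ^ d) =O[𝓝 0] (fun _ => (1 : ℂ)) :=
    (continuous_pow d).continuousAt.norm.isBoundedUnder_le.isBigO_one ℂ
  simpa [pow_add] using (isBigO_refl (fun ε : ℂ => ε ^ n) (𝓝 0)).mul h1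

/-- The difference consists of the terms with i + k > N, each of which carries a factor ε^(N+1). -/
theorem isBigO_conv (N : ℕ) (c : ℕ → ℕ → ℂ) :
    (fun ε : ℂ => ∑ i ∈ Finset.range (N + 1), ∑ k ∈ Finset.range (N + 1), ε ^ (i + k) * c i k -
      ∑ n ∈ Finset.range (N + 1), ε ^ n * ∑ p ∈ Finset.HasAntidiagonal.antidiagonal n, c p.1 p.2)
      =O[𝓝 0] (fun ε => ε ^ (N + 1)) := by
  have key : ∀ ε : ℂ,
      ∑ i ∈ Finset.range (N + 1), ∑ k ∈ Finset.range (N + 1), ε ^ (i + k) * c i k -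
      ∑ n ∈ Finset.range (N + 1), ε ^ n * ∑ p ∈ Finset.HasAntidiagonal.antidiagonal n, c p.1 p.2 =
      ∑ p ∈ (Finset.range (N + 1) ×ˢ Finset.range (N + 1)).filter (fun p => ¬ p.1 + p.2 < N + 1),
        ε ^ (p.1 + p.2) * c p.1 p.2 := by
    intro ε
    rw [← Finset.sum_product', ← Finset.sum_filter_add_sum_filter_not _ (fun p => p.1 + p.2 < N + 1)]
    suffices h : ∑ p ∈ (Finset.range (N + 1) ×ˢ Finset.range (N + 1)).filter
        (fun p => p.1 + p.2 < N + 1), ε ^ (p.1 + p.2) * c p.1 p.2 =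
        ∑ n ∈ Finset.range (N + 1), ε ^ n * ∑ p ∈ Finset.HasAntidiagonal.antidiagonal n, c p.1 p.2 by
      rw [h]; ring
    simp_rw [Finset.mul_sum]
    rw [Finset.sum_sigma']
    refine Finset.sum_bij' (fun p _ => ⟨p.1 + p.2, p⟩) (fun q _ => q.2) ?_ ?_ ?_ ?_ ?_
    · intro p hp
      simp only [Finset.mem_filter, Finset.mem_product, Finset.mem_range] at hp
      simp [hp.2]
    · rintro ⟨n, p⟩ hp
      simp only [Finset.mem_sigma, Finset.mem_range, Finset.HasAntidiagonal.mem_antidiagonal] at hp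
      simp only [Finset.mem_filter, Finset.mem_product, Finset.mem_range]
      omega
    · intro p _; rfl
    · rintro ⟨n, p⟩ hp
      simp only [Finset.mem_sigma, Finset.mem_range, Finset.HasAntidiagonal.mem_antidiagonal] at hp
      obtain ⟨_, rfl⟩ := hp
      rfl
    · intro p _; rfl
  simp_rw [key]
  refine IsBigO.fun_sum fun p hp => ?_
  simp only [Finset.mem_filter, not_lt] at hp
  simpa [mul_comm] using (isBigO_pow_pow hp.2).const_mul_left (c p.1 p.2)

/-- The analytic family `H` has the Taylor coefficients `h 0, …, h N` in the parameter. -/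
structure HasExpansion {D : Opens ℂ} (N : ℕ) (H : ℂ → RJet → ℂ) (h : ℕ → JetAlg D) : Prop where
  family : IsAnalyticFamily D H
  bound : ∀ j : JetPt D, (fun ε : ℂ => H ε j - ∑ k ∈ Finset.range (N + 1), ε ^ k * h k j)
    =O[𝓝 0] (fun ε => ε ^ (N + 1))

theorem isBigO_sum_pow_iff {N : ℕ} {c : ℕ → ℂ} :
    (fun ε : ℂ => ∑ k ∈ Finset.range (N + 1), ε ^ k * c k) =O[𝓝 0] (fun ε => ε ^ (N + 1)) ↔
      ∀ k ≤ N, c k = 0 := by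
  constructor
  · intro h
    have ha : AnalyticAt ℂ (fun ε : ℂ => ∑ k ∈ Finset.range (N + 1), ε ^ k * c k) 0 := by fun_prop
    obtain ⟨b, hb, hab⟩ := exists_eq_pow_mul ha h
    by_contra! hne
    classical
    have hm := Nat.find_spec hne
    set m := Nat.find hne with hmdef
    have hlt : ∀ k < m, c k = 0 := fun k hk => by
      have := Nat.find_min hne hk
      push Not at this
      exact this (by omega)
    -- After division by ε^m the lowest non-zero coefficient equals ε times a function continuous at
    -- 0, hence tends to 0.
    have key : ∀ ε : ℂ, ε ≠ 0 → c m =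
        ε * (ε ^ (N - m) * b ε - ∑ k ∈ Finset.Ioc m N, ε ^ (k - m - 1) * c k) := by
      intro ε hε
      have h1 := hab ε
      have hsplit : ∑ k ∈ Finset.range (N + 1), ε ^ k * c k =
          ε ^ m * (c m + ε * ∑ k ∈ Finset.Ioc m N, ε ^ (k - m - 1) * c k) := by
        have h2 : ∑ k ∈ Finset.range (N + 1), ε ^ k * c k = ∑ k ∈ Finset.Icc m N, ε ^ k * c k := by
          symm
          refine Finset.sum_subset (fun k hk => ?_) (fun k hk hk' => ?_)
          · simp only [Finset.mem_Icc, Finset.mem_range] at *; omega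
          · simp only [Finset.mem_Icc, Finset.mem_range] at *
            rw [hlt k (by omega), mul_zero]
        rw [h2, ← Finset.Ioc_insert_left hm.1, Finset.sum_insert (by simp), mul_add,
          Finset.mul_sum, Finset.mul_sum]
        congr 1
        refine Finset.sum_congr rfl fun k hk => ?_
        simp only [Finset.mem_Ioc] at hk
        obtain ⟨d, rfl⟩ := Nat.exists_eq_add_of_lt hk.1
        have : m + d + 1 - m - 1 = d := by omega
        rw [this]; ring
      rw [hsplit] at h1
      obtain ⟨d, hd⟩ := Nat.exists_eq_add_of_le hm.1
      have h3 : N - m = d := by omega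
      have h4 : ε ^ m * (c m + ε * ∑ k ∈ Finset.Ioc m N, ε ^ (k - m - 1) * c k) =
          ε ^ m * (ε * (ε ^ (N - m) * b ε)) := by rw [h1, h3, hd]; ring
      have h5 := mul_left_cancel₀ (pow_ne_zero m hε) h4
      linear_combination h5
    have t1 : Tendsto (fun ε : ℂ => ε * (ε ^ (N - m) * b ε -
        ∑ k ∈ Finset.Ioc m N, ε ^ (k - m - 1) * c k)) (𝓝[≠] 0) (𝓝 0) := by
      have hc : ContinuousAt (fun ε : ℂ => ε * (ε ^ (N - m) * b ε -
        ∑ k ∈ Finset.Ioc m N, ε ^ (k - m - 1) * c k)) 0 := by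
        have := hb.continuousAt
        fun_prop
      have := hc.tendsto
      simp only [zero_mul] at this
      exact this.mono_left nhdsWithin_le_nhds
    have t2 : Tendsto (fun _ : ℂ => c m) (𝓝[≠] (0 : ℂ)) (𝓝 0) :=
      t1.congr' (by filter_upwards [self_mem_nhdsWithin] with ε hε using (key ε hε).symm)
    exact hm.2 (tendsto_nhds_unique tendsto_const_nhds t2)
  · intro h
    rw [show (fun ε : ℂ => ∑ k ∈ Finset.range (N + 1), ε ^ k * c k) = fun _ => 0 from
      funext fun ε => Finset.sum_eq_zero fun k hk => by
        rw [h k (by simpa [Nat.lt_succ_iff] using hk), mul_zero]]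
    exact isBigO_zero _ _

namespace HasExpansion

variable {D : Opens ℂ} {N : ℕ} {H K : ℂ → RJet → ℂ} {h k : ℕ → JetAlg D}

/-- Uniqueness of Taylor coefficients at each jet. This is the passage from asymptotic statements to
identities in `JetAlg D`. -/
theorem isBigO_iff (hH : HasExpansion N H h) :
    (∀ j : JetPt D, (fun ε => H ε j) =O[𝓝 0] (fun ε : ℂ => ε ^ (N + 1))) ↔ ∀ i ≤ N, h i = 0 := by
  have h1 : ∀ j : JetPt D, (fun ε => H ε j) =O[𝓝 0] (fun ε : ℂ => ε ^ (N + 1)) ↔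
      ∀ i ≤ N, h i j = 0 := fun j => by
    rw [← isBigO_sum_pow_iff]
    exact (hH.bound j).congr_of_sub
  simp only [h1]
  exact ⟨fun h2 i hi => JetAlg.ext' fun j => h2 j i hi, fun h2 j i hi => by simp [h2 i hi]⟩

theorem congr {H' : ℂ → RJet → ℂ} {h' : ℕ → JetAlg D} (hH : HasExpansion N H h)
    (h1 : ∀ ε, ∀ j : RJet, j 0 ∈ D → H ε j = H' ε j) (h2 : ∀ i ≤ N, h i = h' i) :
    HasExpansion N H' h' where
  family := hH.family.congr h1
  bound j := by
    refine (hH.bound j).congr_left fun ε => ?_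
    rw [h1 _ _ j.2]
    congr 1
    exact Finset.sum_congr rfl fun i hi => by
      rw [h2 i (by simpa [Nat.lt_succ_iff] using hi)]

theorem of_sum (h : ℕ → JetAlg D)
    (hH : ∀ ε, ∀ j : JetPt D, H ε j = ∑ k ∈ Finset.range (N + 1), ε ^ k * h k j) :
    HasExpansion N H h where
  family := (IsAnalyticFamily.sum (Finset.range (N + 1)) fun k _ =>
    (IsAnalyticFamily.param.pow k).mul (h k).family).congr fun ε j hj => by
      rw [hH ε ⟨j, hj⟩]
      exact Finset.sum_congr rfl fun k _ => by rw [extendJet_of_mem _ hj]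
  bound j := by simpa [hH] using isBigO_zero _ _

theorem const (F : JetAlg D) (hH : ∀ ε, ∀ j : JetPt D, H ε j = F j) :
    HasExpansion N H (fun i => if i = 0 then F else 0) :=
  of_sum _ fun ε j => by
    rw [Finset.sum_eq_single 0 (fun i _ hi => by simp [hi]) (by simp)]; simp [hH]

theorem monomial (m : ℕ) (hm : m ≤ N) (c : ℂ) (hH : ∀ ε, ∀ j : JetPt D, H ε j = ε ^ m * c) :
    HasExpansion N H (fun i => if i = m then algebraMap ℂ (JetAlg D) c else 0) :=
  of_sum _ fun ε j => by
    rw [Finset.sum_eq_single m (fun i _ hi => by simp [hi])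
      (fun h => absurd (Finset.mem_range.2 (by omega)) h)]
    simp [hH]

theorem add (hH : HasExpansion N H h) (hK : HasExpansion N K k) :
    HasExpansion N (fun ε j => H ε j + K ε j) (fun i => h i + k i) where
  family := hH.family.add hK.family
  bound j := by
    refine ((hH.bound j).add (hK.bound j)).congr_left fun ε => ?_
    simp only [JetAlg.add_apply, mul_add, Finset.sum_add_distrib]
    ring

theorem sub (hH : HasExpansion N H h) (hK : HasExpansion N K k) :
    HasExpansion N (fun ε j => H ε j - K ε j) (fun i => h i - k i) where
  family := hH.family.sub hK.family
  bound j := by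
    refine ((hH.bound j).sub (hK.bound j)).congr_left fun ε => ?_
    simp only [JetAlg.sub_apply, mul_sub, Finset.sum_sub_distrib]
    ring

theorem isBigO_one (hH : HasExpansion N H h) (j : JetPt D) :
    (fun ε => H ε j) =O[𝓝 0] (fun _ : ℂ => (1 : ℂ)) :=
  (hH.family.analyticAt_param j.2).continuousAt.norm.isBoundedUnder_le.isBigO_one ℂ

theorem mul (hH : HasExpansion N H h) (hK : HasExpansion N K k) :
    HasExpansion N (fun ε j => H ε j * K ε j) (conv (· * ·) h k) where
  family := hH.family.mul hK.family
  bound j := by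
    have h1 := (hH.bound j).mul (hK.isBigO_one j)
    have hP : (fun ε : ℂ => ∑ i ∈ Finset.range (N + 1), ε ^ i * h i j)
        =O[𝓝 0] (fun _ : ℂ => (1 : ℂ)) := by
      have hc : Continuous (fun ε : ℂ => ∑ i ∈ Finset.range (N + 1), ε ^ i * h i j) := by fun_prop
      exact hc.continuousAt.norm.isBoundedUnder_le.isBigO_one ℂ
    have h2 := hP.mul (hK.bound j)
    simp only [mul_one, one_mul] at h1 h2
    refine ((h1.add h2).add (isBigO_conv N fun i l => h i j * k l j)).congr_left fun ε => ?_
    have e1 : ∑ i ∈ Finset.range (N + 1), ∑ l ∈ Finset.range (N + 1), ε ^ (i + l) * (h i j * k l j)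
        = (∑ i ∈ Finset.range (N + 1), ε ^ i * h i j) *
          ∑ i ∈ Finset.range (N + 1), ε ^ i * k i j := by
      rw [Finset.sum_mul_sum]
      exact Finset.sum_congr rfl fun i _ => Finset.sum_congr rfl fun l _ => by ring
    rw [e1]
    simp only [conv, JetAlg.sum_apply, JetAlg.mul_apply]
    ring

/-- The function is replaced by its truncation `P` and then the direction by its truncation `Q`; the
two errors are controlled by `isBigO_lineDeriv` and `isBigO_lineDeriv_dir`. What remains is bilinear
in the coefficients, a truncated Cauchy product. -/
theorem lineDeriv (hH : HasExpansion N H h) {v : ℂ → RJet → RJet} {a : ℕ → ℕ → JetAlg D}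
    (hv : ∀ i, HasExpansion N (fun ε j => v ε j i) (fun n => a n i)) :
    HasExpansion N (fun ε j => lineDeriv ℂ (H ε) j (v ε j))
      (fun n => ∑ p ∈ Finset.HasAntidiagonal.antidiagonal n, JetAlg.dir (a p.1) (h p.2)) where
  family := hH.family.lineDeriv fun i => (hv i).family
  bound j := by
    set P : ℂ → RJet → ℂ := fun ε j => ∑ i ∈ Finset.range (N + 1), ε ^ i * extendJet (h i) j
    set Q : ℂ → RJet := fun ε => ∑ n ∈ Finset.range (N + 1), ε ^ n • fun i => a n i j with hQ
    have hPfam : IsAnalyticFamily D P := IsAnalyticFamily.sum _ fun i _ =>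
      (IsAnalyticFamily.param.pow i).mul (h i).family
    have hvan : ∀ i, AnalyticAt ℂ (fun ε => v ε j i) 0 := fun i =>
      (hv i).family.analyticAt_param j.2
    have hQan : ∀ i, AnalyticAt ℂ (fun ε => Q ε i) 0 := fun i => by
      simp only [hQ, Finset.sum_apply, Pi.smul_apply, smul_eq_mul]
      fun_prop
    have t1 := (hH.family.sub hPfam).isBigO_lineDeriv (n := N + 1) (fun j' hj' => by
      have := hH.bound ⟨j', hj'⟩
      simpa only [P, extendJet_of_mem _ hj'] using this) hvan j.2
    have t2 : ∀ i, (fun ε => _root_.lineDeriv ℂ (extendJet (h i)) j (v ε j - Q ε))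
        =O[𝓝 0] (fun ε : ℂ => ε ^ (N + 1)) := fun i => by
      refine (h i).family.isBigO_lineDeriv_dir (fun l => (hvan l).sub (hQan l)) (fun l => ?_) j.2
      refine ((hv l).bound j).congr_left fun ε => ?_
      simp [hQ]
    have t3 : (fun ε : ℂ => ∑ i ∈ Finset.range (N + 1), ε ^ i *
        _root_.lineDeriv ℂ (extendJet (h i)) j (v ε j - Q ε)) =O[𝓝 0]
        (fun ε : ℂ => ε ^ (N + 1)) := by
      refine IsBigO.fun_sum fun i _ => ?_
      have hc : (fun ε : ℂ => ε ^ i) =O[𝓝 0] (fun _ : ℂ => (1 : ℂ)) :=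
        (continuous_pow i).continuousAt.norm.isBoundedUnder_le.isBigO_one ℂ
      simpa using hc.mul (t2 i)
    refine ((t1.add t3).add (isBigO_conv N fun n i => JetAlg.dir (a n) (h i) j)).congr' ?_
      EventuallyEq.rfl
    filter_upwards [hH.family.eventually_lineDifferentiableAt hvan j.2] with ε hε
    have hPd : ∀ w : RJet, HasDerivAt (fun t : ℂ => P ε (j.1 + t • w))
        (∑ i ∈ Finset.range (N + 1), ε ^ i * _root_.lineDeriv ℂ (extendJet (h i)) j w) 0 :=
      fun w => HasDerivAt.fun_sum fun i _ =>
        (((h i).family.lineDifferentiableAt j.2 w).hasDerivAt).const_mul _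
    have e1 : _root_.lineDeriv ℂ (fun j => H ε j - P ε j) j.1 (v ε j) =
        _root_.lineDeriv ℂ (H ε) j.1 (v ε j) -
        ∑ i ∈ Finset.range (N + 1), ε ^ i * _root_.lineDeriv ℂ (extendJet (h i)) j (v ε j) :=
      (hε.hasDerivAt.sub (hPd (v ε j))).deriv
    have e2 : ∀ i, _root_.lineDeriv ℂ (extendJet (h i)) j (v ε j) =
        _root_.lineDeriv ℂ (extendJet (h i)) j (v ε j - Q ε) +
        ∑ n ∈ Finset.range (N + 1), ε ^ n * JetAlg.dir (a n) (h i) j := fun i => by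
      have h3 : ∑ n ∈ Finset.range (N + 1), ε ^ n * JetAlg.dir (a n) (h i) j =
          _root_.lineDeriv ℂ (extendJet (h i)) j (Q ε) := by
        rw [hQ, (h i).family.lineDeriv_sum_dir j.2]
        exact Finset.sum_congr rfl fun n _ => by
          rw [lineDeriv_smul, smul_eq_mul, JetAlg.dir_apply]
      rw [h3, ← (h i).family.lineDeriv_add_dir j.2, sub_add_cancel]
    have e3 : ∑ n ∈ Finset.range (N + 1), ∑ i ∈ Finset.range (N + 1),
        ε ^ (n + i) * JetAlg.dir (a n) (h i) j =
        ∑ i ∈ Finset.range (N + 1), ε ^ i * ∑ n ∈ Finset.range (N + 1),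
          ε ^ n * JetAlg.dir (a n) (h i) j := by
      rw [Finset.sum_comm]
      refine Finset.sum_congr rfl fun i _ => ?_
      rw [Finset.mul_sum]
      exact Finset.sum_congr rfl fun n _ => by ring
    rw [e1, e3]
    simp only [JetAlg.sum_apply]
    have e4 : ∑ i ∈ Finset.range (N + 1), ε ^ i *
        _root_.lineDeriv ℂ (extendJet (h i)) j (v ε j) =
        ∑ i ∈ Finset.range (N + 1), ε ^ i *
          _root_.lineDeriv ℂ (extendJet (h i)) j (v ε j - Q ε) +
        ∑ i ∈ Finset.range (N + 1), ε ^ i * ∑ n ∈ Finset.range (N + 1),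
          ε ^ n * JetAlg.dir (a n) (h i) j := by
      rw [← Finset.sum_add_distrib]
      exact Finset.sum_congr rfl fun i _ => by rw [← mul_add, ← e2 i]
    rw [e4]
    ring

theorem totalDx (hH : HasExpansion N H h) :
    HasExpansion N (fun ε => totalDx (H ε)) (fun n => JetAlg.Dx (h n)) := by
  refine (hH.lineDeriv (v := fun _ j i => j (i + 1))
    (a := fun n i => if n = 0 then JetAlg.X (i + 1) else 0)
    fun i => const (JetAlg.X (i + 1)) fun _ _ => rfl).congr (fun _ _ _ => rfl) fun n _ => ?_
  rw [Finset.sum_eq_single (0, n)]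
  · rfl
  · rintro ⟨p, q⟩ hp hne
    rw [Finset.HasAntidiagonal.mem_antidiagonal] at hp
    have : p ≠ 0 := by rintro rfl; simp_all
    simp only [this, if_false]
    refine JetAlg.ext' fun j => ?_
    rw [JetAlg.dir_apply]
    exact lineDeriv_zero
  · simp

theorem totalDx_iterate (hH : HasExpansion N H h) (i : ℕ) :
    HasExpansion N (fun ε => _root_.totalDx^[i] (H ε)) (fun n => JetAlg.Dx^[i] (h n)) := by
  induction i with
  | zero => exact hH
  | succ i ih => simpa only [Function.iterate_succ_apply'] using ih.totalDx

theorem evolDeriv {A : ℂ → RJet → ℂ} {a : ℕ → JetAlg D} (hA : HasExpansion N A a)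
    (hH : HasExpansion N H h) :
    HasExpansion N (fun ε => evolDeriv (A ε) (H ε)) (conv (fun a => JetAlg.evol a) a h) :=
  hH.lineDeriv (v := fun ε j i => (_root_.totalDx^[i] (A ε)) j)
    (a := fun n i => JetAlg.Dx^[i] (a n)) fun i => hA.totalDx_iterate i

theorem evolDeriv_iterate {A : ℂ → RJet → ℂ} {a : ℕ → JetAlg D} (hA : HasExpansion N A a)
    (hH : HasExpansion N H h) (i : ℕ) :
    HasExpansion N (fun ε => (_root_.evolDeriv (A ε))^[i] (H ε))
      ((conv (fun a => JetAlg.evol a) a)^[i] h) := by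
  induction i with
  | zero => exact hH
  | succ i ih => simpa only [Function.iterate_succ_apply'] using hA.evolDeriv ih

end HasExpansion

/-! ### Partial derivatives, one-phase curves, and composition with w = w(R) + ε W₁ + ⋯ -/

theorem AnalyticOnNhd.partialU {F : ℂ × ℂ → ℂ} {U : Set (ℂ × ℂ)} (hF : AnalyticOnNhd ℂ F U) :
    AnalyticOnNhd ℂ (partialU F) U := fun P hP =>
  ((ContinuousLinearMap.apply ℂ ℂ ((1, 0) : ℂ × ℂ)).analyticAt _).comp (hF.fderiv P hP)

theorem AnalyticOnNhd.partialW {F : ℂ × ℂ → ℂ} {U : Set (ℂ × ℂ)} (hF : AnalyticOnNhd ℂ F U) :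
    AnalyticOnNhd ℂ (partialW F) U := fun P hP =>
  ((ContinuousLinearMap.apply ℂ ℂ ((0, 1) : ℂ × ℂ)).analyticAt _).comp (hF.fderiv P hP)

theorem fderiv_apply_eq_partial (F : ℂ × ℂ → ℂ) (P : ℂ × ℂ) (a b : ℂ) :
    fderiv ℂ F P (a, b) = a * partialU F P + b * partialW F P := by
  have : ((a, b) : ℂ × ℂ) = a • (1, 0) + b • (0, 1) := by simp
  rw [this, map_add, map_smul, map_smul]; rfl

theorem hasDerivAt_comp_curve {F : ℂ × ℂ → ℂ} {x : ℂ} {a b : ℂ → ℂ} {a' b' : ℂ}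
    (hF : DifferentiableAt ℂ F (a x, b x)) (ha : HasDerivAt a a' x) (hb : HasDerivAt b b' x) :
    HasDerivAt (fun R => F (a R, b R)) (a' * partialU F (a x, b x) + b' * partialW F (a x, b x)) x := by
  have := hF.hasFDerivAt.comp_hasDerivAt x (ha.prodMk hb)
  rwa [fderiv_apply_eq_partial] at this

theorem AnalyticOnNhd.partialW_iterate {F : ℂ × ℂ → ℂ} {U : Set (ℂ × ℂ)}
    (hF : AnalyticOnNhd ℂ F U) (i : ℕ) : AnalyticOnNhd ℂ (_root_.partialW^[i] F) U := by
  induction i with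
  | zero => exact hF
  | succ i ih => simpa only [Function.iterate_succ_apply'] using ih.partialW

theorem deriv_snd_eq_partialW {F : ℂ × ℂ → ℂ} {u v : ℂ} (hF : AnalyticAt ℂ F (u, v)) :
    deriv (fun v => F (u, v)) v = partialW F (u, v) := by
  have := hasDerivAt_comp_curve (a := fun _ => u) (b := fun v => v) hF.differentiableAt
    (hasDerivAt_const v u) (hasDerivAt_id v)
  simpa using this.deriv

theorem iteratedDeriv_snd_eq (i : ℕ) : ∀ {F : ℂ × ℂ → ℂ} {u v : ℂ}, AnalyticAt ℂ F (u, v) →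
    iteratedDeriv i (fun v => F (u, v)) v = (partialW^[i] F) (u, v) := by
  induction i with
  | zero => intros; simp
  | succ i ih =>
    intro F u v hF
    rw [iteratedDeriv_succ', Function.iterate_succ_apply]
    have h1 : ∀ᶠ x in 𝓝 v, deriv (fun v => F (u, v)) x = partialW F (u, x) := by
      have hc : ContinuousAt (fun x : ℂ => ((u, x) : ℂ × ℂ)) v := by fun_prop
      filter_upwards [hc.eventually hF.eventually_analyticAt] with x hx
      exact deriv_snd_eq_partialW hx
    have h2 : AnalyticAt ℂ (partialW F) (u, v) :=
      ((ContinuousLinearMap.apply ℂ ℂ ((0, 1) : ℂ × ℂ)).analyticAt _).comp hF.fderiv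
    rw [EventuallyEq.iteratedDeriv_eq i h1, ih h2]

theorem taylor_snd {F : ℂ × ℂ → ℂ} {u v : ℂ} (hF : AnalyticAt ℂ F (u, v)) (n : ℕ) :
    (fun y => F (u, v + y) - ∑ i ∈ Finset.range n,
      ((partialW^[i] F) (u, v) / (i.factorial : ℂ)) * y ^ i) =O[𝓝 0] (fun y => y ^ n) := by
  have h0 : AnalyticAt ℂ (fun x : ℂ => ((u, x) : ℂ × ℂ)) v := analyticAt_const.prod analyticAt_id
  have h1 : AnalyticAt ℂ (fun v => F (u, v)) v :=
    AnalyticAt.fun_comp (f := fun x : ℂ => ((u, x) : ℂ × ℂ)) hF h0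
  have h2 := h1.hasFPowerSeriesAt.isBigO_sub_partialSum_pow n
  simp only [← norm_pow] at h2
  refine h2.of_norm_right.congr_left fun y => ?_
  simp [FormalMultilinearSeries.partialSum, FormalMultilinearSeries.ofScalars,
    iteratedDeriv_snd_eq _ hF, mul_comm]

theorem partialW_partialU {F : ℂ × ℂ → ℂ} {P : ℂ × ℂ} (hF : AnalyticAt ℂ F P) :
    partialW (partialU F) P = partialU (partialW F) P := by
  have hs : IsSymmSndFDerivAt ℂ F P := (hF.contDiffAt (n := 2)).isSymmSndFDerivAt (by simp)
  have hd : DifferentiableAt ℂ (fderiv ℂ F) P := hF.fderiv.differentiableAt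
  have key : ∀ v w : ℂ × ℂ, fderiv ℂ (fun Q => fderiv ℂ F Q v) P w =
      fderiv ℂ (fderiv ℂ F) P w v := fun v w => by
    rw [fderiv_clm_apply hd (differentiableAt_const v)]
    simp
  change fderiv ℂ (fun Q => fderiv ℂ F Q (1, 0)) P (0, 1) =
    fderiv ℂ (fun Q => fderiv ℂ F Q (0, 1)) P (1, 0)
  rw [key, key]
  exact hs _ _

/-- A one-phase curve `w = w(R)` over `D` inside `U`. -/
structure PhaseCurve (U : Set (ℂ × ℂ)) (D : Opens ℂ) where
  w : ℂ → ℂ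
  analytic : AnalyticOnNhd ℂ w D
  mem : ∀ R ∈ D, (R, w R) ∈ U

namespace PhaseCurve

open JetAlg

variable {U : Set (ℂ × ℂ)} {D : Opens ℂ} (C : PhaseCurve U D)

theorem analytic_comp {F : ℂ × ℂ → ℂ} (hF : AnalyticOnNhd ℂ F U) :
    AnalyticOnNhd ℂ (fun R => F (R, C.w R)) D := fun R hR =>
  AnalyticAt.fun_comp (f := fun R => (R, C.w R)) (hF _ (C.mem R hR))
    (analyticAt_id.prod (C.analytic R hR))

/-- The restriction of a function of `(u, w)` to the curve. -/
def lift {F : ℂ × ℂ → ℂ} (hF : AnalyticOnNhd ℂ F U) : JetAlg D :=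
  base (fun R => F (R, C.w R)) (C.analytic_comp hF)

@[simp] theorem lift_apply {F : ℂ × ℂ → ℂ} (hF : AnalyticOnNhd ℂ F U) (j : JetPt D) :
    C.lift hF j = F (j.1 0, C.w (j.1 0)) := rfl

/-- The function `w(R)`. -/
def W : JetAlg D := base C.w C.analytic

/-- The slope `μ = w'(R)`. -/
def mu : JetAlg D := base (deriv C.w) C.analytic.deriv

@[simp] theorem W_apply (j : JetPt D) : C.W j = C.w (j.1 0) := rfl
@[simp] theorem mu_apply (j : JetPt D) : C.mu j = deriv C.w (j.1 0) := rfl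

theorem deriv_comp {F : ℂ × ℂ → ℂ} (hF : AnalyticOnNhd ℂ F U) {R : ℂ} (hR : R ∈ D) :
    deriv (fun R => F (R, C.w R)) R =
      partialU F (R, C.w R) + deriv C.w R * partialW F (R, C.w R) := by
  have := hasDerivAt_comp_curve (a := fun R => R) (b := C.w) (hF _ (C.mem R hR)).differentiableAt
    (hasDerivAt_id R) (C.analytic R hR).differentiableAt.hasDerivAt
  simpa using this.deriv

theorem dir_lift (v : ℕ → JetAlg D) {F : ℂ × ℂ → ℂ} (hF : AnalyticOnNhd ℂ F U) :
    dir v (C.lift hF) = (C.lift hF.partialU + C.mu * C.lift hF.partialW) * v 0 := by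
  rw [lift, dir_base]
  refine JetAlg.ext' fun j => ?_
  simp [C.deriv_comp hF j.2]

end PhaseCurve

theorem HasExpansion.pow_aux {D : Opens ℂ} {N : ℕ} {H : ℂ → RJet → ℂ} {h : ℕ → JetAlg D}
    (hH : HasExpansion N H h) (i : ℕ) :
    HasExpansion N (fun ε j => H ε j ^ i)
      ((conv (· * ·) h)^[i] (fun n => if n = 0 then 1 else 0)) := by
  induction i with
  | zero => exact HasExpansion.const 1 fun _ _ => by simp
  | succ i ih =>
    rw [Function.iterate_succ_apply']
    exact (hH.mul ih).congr (fun _ _ _ => by rw [pow_succ']) fun _ _ => rfl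

theorem HasExpansion.finset_sum {D : Opens ℂ} {N : ℕ} {ι : Type*} (S : Finset ι)
    {H : ι → ℂ → RJet → ℂ} {h : ι → ℕ → JetAlg D} (hH : ∀ i ∈ S, HasExpansion N (H i) (h i)) :
    HasExpansion N (fun ε j => ∑ i ∈ S, H i ε j) (fun n => ∑ i ∈ S, h i n) := by
  classical
  induction S using Finset.induction_on with
  | empty => exact HasExpansion.of_sum _ fun _ _ => by simp
  | insert a S ha ih =>
    simp only [Finset.sum_insert ha]
    exact (hH a (by simp)).add (ih fun i hi => hH i (by simp [hi]))

/-- Taylor coefficients of a composition with `w = w₀ + ε W₁ + ε² W₂ + ⋯`; here `h n` is the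
coefficient `W_n`, `n ≥ 1`. -/
def compCoeff {U : Set (ℂ × ℂ)} {D : Opens ℂ} (C : PhaseCurve U D) {F : ℂ × ℂ → ℂ}
    (hF : AnalyticOnNhd ℂ F U) (N : ℕ) (h : ℕ → JetAlg D) (n : ℕ) : JetAlg D :=
  ∑ i ∈ Finset.range (N + 1), C.lift (hF.partialW_iterate i) *
    (algebraMap ℂ (JetAlg D) (i.factorial : ℂ)⁻¹ *
    (conv (· * ·) (fun n => if n = 0 then 0 else h n))^[i] (fun n => if n = 0 then 1 else 0) n)

/-- Taylor's formula for `F` in the second variable at w(R), truncated after the N-th power. The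
increment of w is O(ε), so the remainder is O(ε^(N+1)); the powers of the increment are expanded by
iterated Cauchy products. -/
theorem HasExpansion.comp_curve {U : Set (ℂ × ℂ)} {D : Opens ℂ} {N : ℕ} (C : PhaseCurve U D)
    {F : ℂ × ℂ → ℂ} (hF : AnalyticOnNhd ℂ F U) {H : ℂ → RJet → ℂ} {h : ℕ → JetAlg D}
    (hH : HasExpansion N H h) (h0 : h 0 = C.W)
    (hz : ∀ j : JetPt D, H 0 j = C.w (j.1 0)) :
    HasExpansion N (fun ε j => F (j 0, H ε j)) (compCoeff C hF N h) := by
  have hfam : IsAnalyticFamily D (fun ε j => F (j 0, H ε j)) :=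
    hH.family.comp_curve hF fun j hj => by rw [hz ⟨j, hj⟩]; exact C.mem _ hj
  have hδ : HasExpansion N (fun ε j => H ε j - C.w (j 0)) (fun n => if n = 0 then 0 else h n) :=
    (hH.sub (HasExpansion.const (H := fun _ j => C.w (j 0)) C.W fun _ _ => rfl)).congr
      (fun _ _ _ => rfl) fun i _ => by
        rcases eq_or_ne i 0 with rfl | hi
        · simp [h0]
        · simp [hi]
  have hterm : ∀ i, HasExpansion N (fun ε j => (partialW^[i] F) (j 0, C.w (j 0)) *
      ((i.factorial : ℂ)⁻¹ * (H ε j - C.w (j 0)) ^ i)) (fun n => C.lift (hF.partialW_iterate i) *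
    (algebraMap ℂ (JetAlg D) (i.factorial : ℂ)⁻¹ *
    (conv (· * ·) (fun n => if n = 0 then 0 else h n))^[i]
      (fun n => if n = 0 then 1 else 0) n)) := fun i => by
    have h1 := HasExpansion.const (N := N) (H := fun _ j => (partialW^[i] F) (j 0, C.w (j 0)) *
      (i.factorial : ℂ)⁻¹) (C.lift (hF.partialW_iterate i) *
        algebraMap ℂ (JetAlg D) (i.factorial : ℂ)⁻¹) fun _ _ => by simp
    refine (h1.mul (hδ.pow_aux i)).congr (fun _ _ _ => by ring) fun n _ => ?_
    rw [conv, Finset.sum_eq_single (0, n)]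
    · simp [mul_assoc]
    · rintro ⟨p, q⟩ hp hne
      rw [Finset.HasAntidiagonal.mem_antidiagonal] at hp
      have : p ≠ 0 := by rintro rfl; simp_all
      simp [this]
    · simp
  refine ⟨hfam, fun j => ?_⟩
  have hS := (HasExpansion.finset_sum (Finset.range (N + 1)) fun i _ => hterm i).bound j
  have hO : (fun ε => H ε j - C.w (j.1 0)) =O[𝓝 0] (fun ε : ℂ => ε) := by
    have h1 := (hδ.family.analyticAt_param j.2).differentiableAt.isBigO_sub
    simpa [hz j] using h1
  have hT : Tendsto (fun ε => H ε j - C.w (j.1 0)) (𝓝 0) (𝓝 0) :=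
    hO.trans_tendsto tendsto_id
  have h2 := ((taylor_snd (hF _ (C.mem _ j.2)) (N + 1)).comp_tendsto hT).trans
    (hO.pow (N + 1))
  refine (h2.add hS).congr_left fun ε => ?_
  simp only [Function.comp_apply, add_sub_cancel, compCoeff]
  have : ∀ i, (partialW^[i] F) (j.1 0, C.w (j.1 0)) / (i.factorial : ℂ) *
      (H ε j - C.w (j.1 0)) ^ i = (partialW^[i] F) (j.1 0, C.w (j.1 0)) *
      ((i.factorial : ℂ)⁻¹ * (H ε j - C.w (j.1 0)) ^ i) := fun i => by
    rw [div_eq_mul_inv]; ring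
  simp only [this]
  ring

/-! ### Explicit coefficients of low order -/

section Coefficients

variable {M : Type*} [AddCommMonoid M] (op : M → M → M) (a b : ℕ → M)

theorem conv_zero : conv op a b 0 = op (a 0) (b 0) := by simp [conv]
theorem conv_one : conv op a b 1 = op (a 0) (b 1) + op (a 1) (b 0) := by
  simp [conv, Finset.Nat.antidiagonal_succ]
theorem conv_two : conv op a b 2 = op (a 0) (b 2) + op (a 1) (b 1) + op (a 2) (b 0) := by
  simp [conv, Finset.Nat.antidiagonal_succ, add_assoc]
theorem conv_three : conv op a b 3 =
    op (a 0) (b 3) + op (a 1) (b 2) + op (a 2) (b 1) + op (a 3) (b 0) := by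
  simp [conv, Finset.Nat.antidiagonal_succ, add_assoc]

end Coefficients

section CompCoeff

variable {U : Set (ℂ × ℂ)} {D : Opens ℂ} (C : PhaseCurve U D) {F : ℂ × ℂ → ℂ}
  (hF : AnalyticOnNhd ℂ F U) (h : ℕ → JetAlg D)

/-- Both truncations occur: `N = 2` for the necessary conditions, `N = 3` for the listed equations.
-/
theorem compCoeff_zero {N : ℕ} (hN : N = 2 ∨ N = 3) : compCoeff C hF N h 0 = C.lift hF := by
  rcases hN with rfl | rfl <;>
  simp [compCoeff, Finset.sum_range_succ, conv_zero]

theorem compCoeff_one {N : ℕ} (hN : N = 2 ∨ N = 3) :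
    compCoeff C hF N h 1 = C.lift hF.partialW * h 1 := by
  rcases hN with rfl | rfl <;>
  simp [compCoeff, Finset.sum_range_succ, conv_zero, conv_one]

theorem compCoeff_two {N : ℕ} (hN : N = 2 ∨ N = 3) :
    compCoeff C hF N h 2 = C.lift hF.partialW * h 2 +
      algebraMap ℂ _ (1 / 2) * (C.lift hF.partialW.partialW * h 1 ^ 2) := by
  rcases hN with rfl | rfl <;>
  · simp [compCoeff, Finset.sum_range_succ, conv_zero, conv_one, conv_two]
    ring

theorem compCoeff_three :
    compCoeff C hF 3 h 3 = C.lift hF.partialW * h 3 +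
      C.lift hF.partialW.partialW * (h 1 * h 2) +
      algebraMap ℂ _ (1 / 6) * (C.lift hF.partialW.partialW.partialW * h 1 ^ 3) := by
  simp [compCoeff, Finset.sum_range_succ, conv_zero, conv_one, conv_two, conv_three, Nat.factorial]
  rw [show ((6 : ℂ)⁻¹) = 1 / 6 by norm_num, show ((2 : ℂ)⁻¹) = 1 / 2 by norm_num]
  have : algebraMap ℂ (JetAlg D) (1 / 2) * 2 = 1 := by
    rw [← map_ofNat (algebraMap ℂ (JetAlg D)) 2, ← map_mul]; norm_num
  linear_combination (C.lift hF.partialW.partialW * (h 1 * h 2)) * this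

end CompCoeff

/-! ### Inheritance as a list of identities between coefficients -/

/-- A differential polynomial with analytic coefficients. -/
def JetAlg.dpoly {D : Opens ℂ} (n : ℕ) (c : n.Partition → ℂ → ℂ)
    (hc : ∀ π, AnalyticOnNhd ℂ (c π) D) : JetAlg D :=
  ∑ π, JetAlg.base (c π) (hc π) * (π.parts.map JetAlg.X).prod

theorem JetAlg.multiset_prod_apply {D : Opens ℂ} (s : Multiset ℕ) (j : JetPt D) :
    ((s.map JetAlg.X).prod : JetAlg D) j = (s.map j.1).prod := by
  induction s using Multiset.induction_on with
  | empty => simp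
  | cons a s ih => simp [ih]

@[simp] theorem JetAlg.dpoly_apply {D : Opens ℂ} (n : ℕ) (c : n.Partition → ℂ → ℂ)
    (hc : ∀ π, AnalyticOnNhd ℂ (c π) D) (j : JetPt D) :
    JetAlg.dpoly n c hc j = diffPoly n c j := by
  simp [JetAlg.dpoly, diffPoly, JetAlg.multiset_prod_apply]

/-- Coefficients of the expansion of the discrete derivative with step `s ε`. -/
def deltaCoeff {D : Opens ℂ} (N : ℕ) (s : ℂ) (a g : ℕ → JetAlg D) (n : ℕ) : JetAlg D :=
  ∑ k ∈ Finset.range (N + 1), conv (· * ·)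
    (fun i => if i = k then algebraMap ℂ (JetAlg D) (s ^ k / ((k + 1).factorial : ℂ)) else 0)
    ((conv (fun a => JetAlg.evol a) a)^[k + 1] g) n

theorem HasExpansion.taylorDelta {D : Opens ℂ} {N : ℕ} {A G : ℂ → RJet → ℂ} {a g : ℕ → JetAlg D}
    (s : ℂ) (hA : HasExpansion N A a) (hG : HasExpansion N G g) :
    HasExpansion N (fun ε => taylorDelta N (s * ε) (A ε) (G ε)) (deltaCoeff N s a g) := by
  refine (HasExpansion.finset_sum (Finset.range (N + 1)) fun k hk =>
    (HasExpansion.monomial (H := fun ε _ => ε ^ k * (s ^ k / ((k + 1).factorial : ℂ))) k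
      (by simpa [Nat.lt_succ_iff] using hk) _ fun _ _ => rfl).mul
      (hA.evolDeriv_iterate hG (k + 1))).congr (fun ε j _ => ?_) fun _ _ => rfl
  simp only [_root_.taylorDelta]
  refine Finset.sum_congr rfl fun k _ => ?_
  rw [mul_pow]; ring

theorem sum_range_succ_eq_add_Icc (N : ℕ) (f : ℕ → ℂ) :
    ∑ k ∈ Finset.range (N + 1), f k = f 0 + ∑ k ∈ Finset.Icc 1 N, f k := by
  have : Finset.range (N + 1) = insert 0 (Finset.Icc 1 N) := by
    ext k; simp only [Finset.mem_range, Finset.mem_insert, Finset.mem_Icc]; omega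
  rw [this, Finset.sum_insert (by simp)]

namespace TodaEquation

variable {E : TodaEquation} {U : Set (ℂ × ℂ)} {D : Opens ℂ}

/-- The characteristic speed along a one-phase curve. -/
def lam (hE : E.HolomorphicOn U) (C : PhaseCurve U D) : JetAlg D :=
  C.lift hE.1 + (C.lift hE.2.1 * C.lift hE.2.2.1.partialU +
    C.lift hE.2.2.2.1 * C.lift hE.2.2.2.2.partialU) * C.mu +
  (C.lift hE.2.1 * C.lift hE.2.2.1.partialW +
    C.lift hE.2.2.2.1 * C.lift hE.2.2.2.2.partialW) * C.mu ^ 2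

theorem lam_apply (hE : E.HolomorphicOn U) (C : PhaseCurve U D) (j : JetPt D) :
    E.lam hE C j = E.speed (deriv C.w (j.1 0)) (j.1 0, C.w (j.1 0)) := by
  simp [lam, speed, psi, eta]

/-- The coefficients in the parameter of the right-hand side of the equation. -/
def rhsCoeff (hE : E.HolomorphicOn U) (C : PhaseCurve U D) (N : ℕ) (W A : ℕ → JetAlg D) (n : ℕ) :
    JetAlg D :=
  compCoeff C hE.1 N W n * JetAlg.X 1 +
  conv (· * ·) (compCoeff C hE.2.1 N W) (deltaCoeff N 1 A (compCoeff C hE.2.2.1 N W)) n +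
  conv (· * ·) (compCoeff C hE.2.2.2.1 N W) (deltaCoeff N (-1) A (compCoeff C hE.2.2.2.2 N W)) n

/-- The equations for the coefficients of a deformed one-phase solution. -/
structure FormalReduction (hE : E.HolomorphicOn U) (C : PhaseCurve U D) (N : ℕ)
    (W A B : ℕ → JetAlg D) : Prop where
  wx : ∀ n ≤ N, JetAlg.Dx (W n) =
    deltaCoeff N 1 A (fun i => if i = 0 then JetAlg.X 0 else 0) n
  ut : ∀ n ≤ N, B n = rhsCoeff hE C N W A n
  compat : ∀ n ≤ N, conv (fun a => JetAlg.evol a) B A n = conv (fun a => JetAlg.evol a) A B n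

/-- Each of the three error functions is assembled from operations for which expansions are
available, so `isBigO_iff` applies to each of them. -/
theorem formalReduction_iff (hE : E.HolomorphicOn U) (C : PhaseCurve U D) (N : ℕ)
    (ω : (k : ℕ) → k.Partition → ℂ → ℂ) (α β : (k : ℕ) → (k + 1).Partition → ℂ → ℂ)
    (hω : ∀ k π, AnalyticOnNhd ℂ (ω k π) D) (hα : ∀ k π, AnalyticOnNhd ℂ (α k π) D)
    (hβ : ∀ k π, AnalyticOnNhd ℂ (β k π) D) :
    E.FormalReduction hE C N
        (fun n => if n = 0 then C.W else JetAlg.dpoly n (ω n) (hω n))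
        (fun n => if n = 0 then C.mu * JetAlg.X 1 else JetAlg.dpoly (n + 1) (α n) (hα n))
        (fun n => if n = 0 then E.lam hE C * JetAlg.X 1 else
          JetAlg.dpoly (n + 1) (β n) (hβ n)) ↔
    let W : ℂ → RJet → ℂ := fun ε j =>
      C.w (j 0) + ∑ k ∈ Finset.Icc 1 N, ε ^ k * diffPoly k (ω k) j
    let A : ℂ → RJet → ℂ := fun ε j =>
      deriv C.w (j 0) * j 1 + ∑ k ∈ Finset.Icc 1 N, ε ^ k * diffPoly (k + 1) (α k) j
    let B : ℂ → RJet → ℂ := fun ε j =>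
      E.speed (deriv C.w (j 0)) (j 0, C.w (j 0)) * j 1 +
        ∑ k ∈ Finset.Icc 1 N, ε ^ k * diffPoly (k + 1) (β k) j
    let sub : (ℂ × ℂ → ℂ) → ℂ → RJet → ℂ := fun F ε j => F (j 0, W ε j)
    ∀ j : RJet, j 0 ∈ D →
      (fun ε : ℂ => totalDx (W ε) j - taylorDelta N ε (A ε) (fun i => i 0) j)
        =O[𝓝 0] (fun ε : ℂ => ε ^ (N + 1)) ∧
      (fun ε : ℂ => B ε j - (sub E.phi ε j * j 1 +
          sub E.f ε j * taylorDelta N ε (A ε) (sub E.g ε) j +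
          sub E.p ε j * taylorDelta N (-ε) (A ε) (sub E.q ε) j))
        =O[𝓝 0] (fun ε : ℂ => ε ^ (N + 1)) ∧
      (fun ε : ℂ => evolDeriv (B ε) (A ε) j - evolDeriv (A ε) (B ε) j)
        =O[𝓝 0] (fun ε : ℂ => ε ^ (N + 1)) := by
  let W : ℂ → RJet → ℂ := fun ε j =>
    C.w (j 0) + ∑ k ∈ Finset.Icc 1 N, ε ^ k * diffPoly k (ω k) j
  let A : ℂ → RJet → ℂ := fun ε j =>
    deriv C.w (j 0) * j 1 + ∑ k ∈ Finset.Icc 1 N, ε ^ k * diffPoly (k + 1) (α k) j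
  let B : ℂ → RJet → ℂ := fun ε j =>
    E.speed (deriv C.w (j 0)) (j 0, C.w (j 0)) * j 1 +
      ∑ k ∈ Finset.Icc 1 N, ε ^ k * diffPoly (k + 1) (β k) j
  let sub : (ℂ × ℂ → ℂ) → ℂ → RJet → ℂ := fun F ε j => F (j 0, W ε j)
  set Wc : ℕ → JetAlg D := fun n => if n = 0 then C.W else JetAlg.dpoly n (ω n) (hω n) with hWc
  set Ac : ℕ → JetAlg D := fun n => if n = 0 then C.mu * JetAlg.X 1 else
    JetAlg.dpoly (n + 1) (α n) (hα n) with hAc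
  set Bc : ℕ → JetAlg D := fun n => if n = 0 then E.lam hE C * JetAlg.X 1 else
    JetAlg.dpoly (n + 1) (β n) (hβ n) with hBc
  have sum_eq : ∀ (x : ℂ) (y : ℕ → ℂ) (z : ℕ → ℂ), z 0 = x → (∀ n, n ≠ 0 → z n = y n) → ∀ ε : ℂ,
      x + ∑ k ∈ Finset.Icc 1 N, ε ^ k * y k = ∑ k ∈ Finset.range (N + 1), ε ^ k * z k := by
    intro x y z hx hy ε
    rw [sum_range_succ_eq_add_Icc, pow_zero, one_mul, hx]
    congr 1
    refine Finset.sum_congr rfl fun k hk => ?_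
    rw [hy k (by simp only [Finset.mem_Icc] at hk; omega)]
  have hW : HasExpansion N W Wc := HasExpansion.of_sum _ fun ε j =>
    sum_eq _ (fun k => diffPoly k (ω k) j) (fun k => Wc k j) (by simp [hWc])
      (fun n hn => by simp [hWc, hn]) ε
  have hA : HasExpansion N A Ac := HasExpansion.of_sum _ fun ε j =>
    sum_eq _ (fun k => diffPoly (k + 1) (α k) j) (fun k => Ac k j) (by simp [hAc])
      (fun n hn => by simp [hAc, hn]) ε
  have hB : HasExpansion N B Bc := HasExpansion.of_sum _ fun ε j =>
    sum_eq _ (fun k => diffPoly (k + 1) (β k) j) (fun k => Bc k j)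
      (by simp [hBc, lam_apply])
      (fun n hn => by simp [hBc, hn]) ε
  have hW0 : ∀ j : JetPt D, W 0 j = C.w (j.1 0) := fun j => by
    simp only [W, add_eq_left]
    refine Finset.sum_eq_zero fun k hk => ?_
    rw [zero_pow (by simp only [Finset.mem_Icc] at hk; omega), zero_mul]
  have hsub : ∀ {F : ℂ × ℂ → ℂ} (hF : AnalyticOnNhd ℂ F U),
      HasExpansion N (sub F) (compCoeff C hF N Wc) := fun hF =>
    hW.comp_curve C hF (by simp [hWc]) hW0
  have hX : HasExpansion N (fun _ j => j 0) (fun i => if i = 0 then (JetAlg.X 0 : JetAlg D) else 0) :=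
    HasExpansion.const _ fun _ _ => rfl
  have e1 := hW.totalDx.sub (hA.taylorDelta 1 hX)
  have hX1 : HasExpansion N (fun _ j => j 1) (fun i => if i = 0 then (JetAlg.X 1 : JetAlg D) else 0) :=
    HasExpansion.const _ fun _ _ => rfl
  have e2 := hB.sub ((((hsub hE.1).mul hX1).add ((hsub hE.2.1).mul
    (hA.taylorDelta 1 (hsub hE.2.2.1)))).add ((hsub hE.2.2.2.1).mul
    (hA.taylorDelta (-1) (hsub hE.2.2.2.2))))
  have e3 := (hB.evolDeriv hA).sub (hA.evolDeriv hB)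
  have i1 := e1.isBigO_iff
  have i2 := e2.isBigO_iff
  have i3 := e3.isBigO_iff
  -- The factor u_x = R_x is independent of ε, so only one term of the Cauchy product survives.
  have hphi : ∀ n, conv (· * ·) (compCoeff C hE.1 N Wc)
      (fun i => if i = 0 then (JetAlg.X 1 : JetAlg D) else 0) n =
      compCoeff C hE.1 N Wc n * JetAlg.X 1 := fun n => by
    rw [conv, Finset.sum_eq_single (n, 0)]
    · simp
    · rintro ⟨p, q⟩ hp hne
      rw [Finset.HasAntidiagonal.mem_antidiagonal] at hp
      have : q ≠ 0 := by rintro rfl; simp_all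
      simp [this]
    · simp
  simp only [one_mul, neg_mul, sub_eq_zero, hphi] at i1 i2 i3
  constructor
  · rintro ⟨h1, h2, h3⟩
    intro _ _ _ _ j hj
    exact ⟨i1.2 h1 ⟨j, hj⟩, i2.2 h2 ⟨j, hj⟩, i3.2 h3 ⟨j, hj⟩⟩
  · intro h
    exact ⟨i1.1 fun j => (h j j.2).1, i2.1 fun j => (h j j.2).2.1, i3.1 fun j => (h j j.2).2.2⟩

theorem inheritsOnePhase_iff (hE : E.HolomorphicOn U) (C : PhaseCurve U D) (N : ℕ) :
    E.InheritsOnePhase N D C.w ↔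
    ∃ (ω : (k : ℕ) → k.Partition → ℂ → ℂ) (α β : (k : ℕ) → (k + 1).Partition → ℂ → ℂ)
      (hω : ∀ k π, AnalyticOnNhd ℂ (ω k π) D) (hα : ∀ k π, AnalyticOnNhd ℂ (α k π) D)
      (hβ : ∀ k π, AnalyticOnNhd ℂ (β k π) D),
      E.FormalReduction hE C N
        (fun n => if n = 0 then C.W else JetAlg.dpoly n (ω n) (hω n))
        (fun n => if n = 0 then C.mu * JetAlg.X 1 else JetAlg.dpoly (n + 1) (α n) (hα n))
        (fun n => if n = 0 then E.lam hE C * JetAlg.X 1 else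
          JetAlg.dpoly (n + 1) (β n) (hβ n)) := by
  rw [InheritsOnePhase]
  refine exists_congr fun ω => exists_congr fun α => exists_congr fun β => ?_
  constructor
  · rintro ⟨hω, hα, hβ, h⟩
    exact ⟨hω, hα, hβ, (formalReduction_iff hE C N ω α β hω hα hβ).2 h⟩
  · rintro ⟨hω, hα, hβ, h⟩
    exact ⟨hω, hα, hβ, (formalReduction_iff hE C N ω α β hω hα hβ).1 h⟩

end TodaEquation

/-! ### Partitions of 1, 2 and 3: the monomials of differential polynomials of degree at most 3 -/

section Partitions

/-- The partition with a given multiset of parts. -/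
def partitionOf (n : ℕ) (s : Multiset ℕ) (h0 : ∀ i ∈ s, 0 < i) (hs : s.sum = n) : n.Partition :=
  ⟨s, fun {i} hi => h0 i hi, hs⟩

def partition2 : Nat.Partition 2 := partitionOf 2 {2} (by decide) rfl
def partition11 : Nat.Partition 2 := partitionOf 2 {1, 1} (by decide) rfl
def partition3 : Nat.Partition 3 := partitionOf 3 {3} (by decide) rfl
def partition21 : Nat.Partition 3 := partitionOf 3 {2, 1} (by decide) rfl
def partition111 : Nat.Partition 3 := partitionOf 3 {1, 1, 1} (by decide) rfl

theorem multiset_cases_of_sum {s : Multiset ℕ} (hs : s ≠ 0) (h0 : ∀ i ∈ s, 0 < i) :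
    ∃ a t, s = a ::ₘ t ∧ 0 < a ∧ (∀ i ∈ t, 0 < i ∧ i ≤ a) := by
  obtain ⟨a, ha, hmax⟩ := s.toFinset.exists_max_image id (by
    obtain ⟨x, hx⟩ := Multiset.exists_mem_of_ne_zero hs
    exact ⟨x, by simpa using hx⟩)
  simp only [Multiset.mem_toFinset, id] at ha hmax
  obtain ⟨t, rfl⟩ := Multiset.exists_cons_of_mem ha
  exact ⟨a, t, rfl, h0 a ha, fun i hi => ⟨h0 i (by simp [hi]), hmax i (by simp [hi])⟩⟩

theorem parts_one {s : Multiset ℕ} (h0 : ∀ i ∈ s, 0 < i) (hs : s.sum = 1) : s = {1} := by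
  obtain ⟨a, t, rfl, ha, ht⟩ := multiset_cases_of_sum (by rintro rfl; simp at hs) h0
  rw [Multiset.sum_cons] at hs
  have h1 : a = 1 := by omega
  rcases eq_or_ne t 0 with rfl | hne
  · simp [h1]
  · obtain ⟨b, t', rfl, hb, _⟩ := multiset_cases_of_sum hne fun i hi => (ht i hi).1
    rw [Multiset.sum_cons] at hs; omega

theorem parts_two {s : Multiset ℕ} (h0 : ∀ i ∈ s, 0 < i) (hs : s.sum = 2) :
    s = {2} ∨ s = {1, 1} := by
  obtain ⟨a, t, rfl, ha, ht⟩ := multiset_cases_of_sum (by rintro rfl; simp at hs) h0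
  rw [Multiset.sum_cons] at hs
  rcases eq_or_ne t 0 with rfl | hne
  · left; simp at hs; simp [hs]
  · obtain ⟨b, t', rfl, hb, _⟩ := multiset_cases_of_sum hne fun i hi => (ht i hi).1
    have h2 := ht b (by simp)
    have : a = 1 := by rw [Multiset.sum_cons] at hs; omega
    subst this
    right
    rw [parts_one (fun i hi => (ht i hi).1) (by omega)]; rfl

theorem parts_three {s : Multiset ℕ} (h0 : ∀ i ∈ s, 0 < i) (hs : s.sum = 3) :
    s = {3} ∨ s = {2, 1} ∨ s = {1, 1, 1} := by
  obtain ⟨a, t, rfl, ha, ht⟩ := multiset_cases_of_sum (by rintro rfl; simp at hs) h0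
  rw [Multiset.sum_cons] at hs
  rcases eq_or_ne t 0 with rfl | hne
  · left; simp at hs; simp [hs]
  · obtain ⟨b, t', rfl, hb, _⟩ := multiset_cases_of_sum hne fun i hi => (ht i hi).1
    have h2 := ht b (by simp)
    have h3 : a = 1 ∨ a = 2 := by rw [Multiset.sum_cons] at hs; omega
    rcases h3 with rfl | rfl
    · rcases parts_two (fun i hi => (ht i hi).1) (show _ = 2 by omega) with h | h
      · rw [h] at ht; have := ht 2 (by simp); omega
      · right; right; rw [h]; rfl
    · right; left
      rw [parts_one (fun i hi => (ht i hi).1) (by omega)]; rfl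

theorem sum_partition_one {M : Type*} [AddCommMonoid M] (F : Nat.Partition 1 → M) :
    ∑ π, F π = F (Nat.Partition.indiscrete 1) := by
  rw [Fintype.sum_unique]; congr 1

theorem sum_partition_two {M : Type*} [AddCommMonoid M] (F : Nat.Partition 2 → M) :
    ∑ π, F π = F partition2 + F partition11 := by
  classical
  have hne : partition2 ≠ partition11 := fun h => by
    have := congrArg (fun π => Multiset.card π.parts) h
    simp [partition2, partition11, partitionOf] at this
  rw [← Finset.sum_pair hne]
  refine (Finset.sum_subset (Finset.subset_univ _) fun π _ hπ => ?_).symm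
  exfalso; apply hπ
  simp only [Finset.mem_insert, Finset.mem_singleton]
  rcases parts_two (fun i hi => π.parts_pos hi) π.parts_sum with h | h
  · left; exact Nat.Partition.ext h
  · right; exact Nat.Partition.ext h

theorem sum_partition_three {M : Type*} [AddCommMonoid M] (F : Nat.Partition 3 → M) :
    ∑ π, F π = F partition3 + F partition21 + F partition111 := by
  classical
  have h12 : partition3 ≠ partition21 := fun h => by
    have := congrArg (fun π => Multiset.card π.parts) h
    simp [partition3, partition21, partitionOf] at this
  have h13 : partition3 ≠ partition111 := fun h => by
    have := congrArg (fun π => Multiset.card π.parts) h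
    simp [partition3, partition111, partitionOf] at this
  have h23 : partition21 ≠ partition111 := fun h => by
    have := congrArg (fun π => Multiset.card π.parts) h
    simp [partition21, partition111, partitionOf] at this
  have : ∑ π ∈ {partition3, partition21, partition111}, F π =
      F partition3 + F partition21 + F partition111 := by
    rw [Finset.sum_insert (by simp [h12, h13]), Finset.sum_pair h23, add_assoc]
  rw [← this]
  refine (Finset.sum_subset (Finset.subset_univ _) fun π _ hπ => ?_).symm
  exfalso; apply hπ
  simp only [Finset.mem_insert, Finset.mem_singleton]
  rcases parts_three (fun i hi => π.parts_pos hi) π.parts_sum with h | h | h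
  · left; exact Nat.Partition.ext h
  · right; left; exact Nat.Partition.ext h
  · right; right; exact Nat.Partition.ext h

end Partitions

/-! ### Comparing differential polynomials of low degree, and commutators of flows -/

namespace JetAlg

variable {D : Opens ℂ}

theorem dpoly_one (c : Nat.Partition 1 → ℂ → ℂ) (hc : ∀ π, AnalyticOnNhd ℂ (c π) D) :
    dpoly 1 c hc = base _ (hc (Nat.Partition.indiscrete 1)) * X 1 := by
  rw [dpoly, sum_partition_one]
  simp

theorem dpoly_two (c : Nat.Partition 2 → ℂ → ℂ) (hc : ∀ π, AnalyticOnNhd ℂ (c π) D) :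
    dpoly 2 c hc = base _ (hc partition2) * X 2 + base _ (hc partition11) * X 1 ^ 2 := by
  rw [dpoly, sum_partition_two]
  simp [partition2, partition11, partitionOf, pow_two]

theorem dpoly_three (c : Nat.Partition 3 → ℂ → ℂ) (hc : ∀ π, AnalyticOnNhd ℂ (c π) D) :
    dpoly 3 c hc = base _ (hc partition3) * X 3 + base _ (hc partition21) * (X 1 * X 2) +
      base _ (hc partition111) * X 1 ^ 3 := by
  rw [dpoly, sum_partition_three]
  simp [partition3, partition21, partition111, partitionOf, pow_succ, mul_comm]

@[simp] theorem evol_zero (F : JetAlg D) : evol (0 : JetAlg D) F = 0 := ext' fun j => by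
  rw [evol, dir_apply]
  have : (fun k => (Dx^[k] (0 : JetAlg D)) j) = 0 := by
    funext k
    rw [show Dx^[k] (0 : JetAlg D) = 0 from Function.iterate_fixed (map_zero _) k]; rfl
  rw [this]
  exact lineDeriv_zero

/-- `c` depends on the base point only. -/
def IsBase (c : JetAlg D) : Prop := ∀ j j' : JetPt D, j.1 0 = j'.1 0 → c j = c j'

/-- `c'` is the derivative of `c`, in the sense that every vector field acts on `c` as on a function
of the base point with derivative `c'`. -/
def HasD (c c' : JetAlg D) : Prop := ∀ v : ℕ → JetAlg D, dir v c = c' * v 0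

theorem HasD.evol {c c' : JetAlg D} (h : HasD c c') (A : JetAlg D) : evol A c = c' * A := h _
theorem HasD.Dx {c c' : JetAlg D} (h : HasD c c') : Dx c = c' * X 1 := h _

theorem hasD_base {c : ℂ → ℂ} (hc : AnalyticOnNhd ℂ c D) :
    HasD (base c hc) (base (deriv c) hc.deriv) := fun v => dir_base v hc

theorem hasD_lift {U : Set (ℂ × ℂ)} (C : PhaseCurve U D) {F : ℂ × ℂ → ℂ}
    (hF : AnalyticOnNhd ℂ F U) :
    HasD (C.lift hF) (C.lift hF.partialU + C.mu * C.lift hF.partialW) := fun v => C.dir_lift v hF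

theorem HasD.add {a a' b b' : JetAlg D} (ha : HasD a a') (hb : HasD b b') :
    HasD (a + b) (a' + b') := fun v => by rw [map_add, ha, hb]; ring

theorem HasD.sub {a a' b b' : JetAlg D} (ha : HasD a a') (hb : HasD b b') :
    HasD (a - b) (a' - b') := fun v => by rw [map_sub, ha, hb]; ring

theorem HasD.mul {a a' b b' : JetAlg D} (ha : HasD a a') (hb : HasD b b') :
    HasD (a * b) (a' * b + a * b') := fun v => by
  rw [Derivation.leibniz, ha, hb, smul_eq_mul, smul_eq_mul]; ring

theorem HasD.pow {a a' : JetAlg D} (ha : HasD a a') (n : ℕ) :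
    HasD (a ^ n) (n * a ^ (n - 1) * a') := fun v => by
  rw [Derivation.leibniz_pow, ha, nsmul_eq_mul, smul_eq_mul]; ring

theorem hasD_algebraMap (c : ℂ) : HasD (algebraMap ℂ (JetAlg D) c) 0 := fun v => by simp

theorem HasD.congr {a a' b b' : JetAlg D} (h : HasD a a') (h1 : a = b) (h2 : a' = b') :
    HasD b b' := by subst h1 h2; exact h

/-- The jet with base point `R` and `x`-derivatives `r₁, r₂, r₃, 0, …`. -/
def pt {R : ℂ} (hR : R ∈ D) (r₁ r₂ r₃ : ℂ) : JetPt D :=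
  ⟨fun k => match k with | 0 => R | 1 => r₁ | 2 => r₂ | 3 => r₃ | _ => 0, hR⟩

@[simp] theorem pt_zero {R : ℂ} (hR : R ∈ D) (r₁ r₂ r₃ : ℂ) : (pt hR r₁ r₂ r₃).1 0 = R := rfl
@[simp] theorem pt_one {R : ℂ} (hR : R ∈ D) (r₁ r₂ r₃ : ℂ) : (pt hR r₁ r₂ r₃).1 1 = r₁ := rfl
@[simp] theorem pt_two {R : ℂ} (hR : R ∈ D) (r₁ r₂ r₃ : ℂ) : (pt hR r₁ r₂ r₃).1 2 = r₂ := rfl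
@[simp] theorem pt_three {R : ℂ} (hR : R ∈ D) (r₁ r₂ r₃ : ℂ) : (pt hR r₁ r₂ r₃).1 3 = r₃ := rfl

/-- The coefficients see only the base point, so the derivatives of R may be chosen freely:
evaluation at special jets separates the monomials. -/
theorem eq_zero_of_deg_two {c₁ c₂ : JetAlg D} (h₁ : IsBase c₁) (h₂ : IsBase c₂)
    (h : c₁ * X 2 + c₂ * X 1 ^ 2 = 0) : c₁ = 0 ∧ c₂ = 0 := by
  have key : ∀ (j : JetPt D) (r₁ r₂ r₃ : ℂ), c₁ j * r₂ + c₂ j * r₁ ^ 2 = 0 := fun j r₁ r₂ r₃ => by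
    have := congrArg (fun F : JetAlg D => F (pt j.2 r₁ r₂ r₃)) h
    simpa [h₁ (pt j.2 r₁ r₂ r₃) j rfl, h₂ (pt j.2 r₁ r₂ r₃) j rfl] using this
  exact ⟨ext' fun j => by simpa using key j 0 1 0, ext' fun j => by simpa using key j 1 0 0⟩

theorem eq_zero_of_deg_three {c₁ c₂ c₃ : JetAlg D} (h₁ : IsBase c₁) (h₂ : IsBase c₂)
    (h₃ : IsBase c₃) (h : c₁ * X 3 + c₂ * (X 1 * X 2) + c₃ * X 1 ^ 3 = 0) :
    c₁ = 0 ∧ c₂ = 0 ∧ c₃ = 0 := by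
  have key : ∀ (j : JetPt D) (r₁ r₂ r₃ : ℂ),
      c₁ j * r₃ + c₂ j * (r₁ * r₂) + c₃ j * r₁ ^ 3 = 0 := fun j r₁ r₂ r₃ => by
    have := congrArg (fun F : JetAlg D => F (pt j.2 r₁ r₂ r₃)) h
    simpa [h₁ (pt j.2 r₁ r₂ r₃) j rfl, h₂ (pt j.2 r₁ r₂ r₃) j rfl,
      h₃ (pt j.2 r₁ r₂ r₃) j rfl] using this
  have k3 : ∀ j, c₃ j = 0 := fun j => by simpa using key j 1 0 0
  exact ⟨ext' fun j => by simpa using key j 0 0 1,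
    ext' fun j => by simpa [k3 j] using key j 1 1 0, ext' k3⟩

/-- The monomials R_x R_xxx and R_xx² enter with equal coefficients because this is the shape of the
commutator in `compat_second`. -/
theorem eq_zero_of_deg_four {c₁ c₂ c₃ : JetAlg D} (h₁ : IsBase c₁) (h₂ : IsBase c₂)
    (h₃ : IsBase c₃)
    (h : c₁ * (X 1 * X 3 + X 2 ^ 2) + c₂ * (X 1 ^ 2 * X 2) + c₃ * X 1 ^ 4 = 0) :
    c₁ = 0 ∧ c₂ = 0 ∧ c₃ = 0 := by
  have key : ∀ (j : JetPt D) (r₁ r₂ r₃ : ℂ),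
      c₁ j * (r₁ * r₃ + r₂ ^ 2) + c₂ j * (r₁ ^ 2 * r₂) + c₃ j * r₁ ^ 4 = 0 := fun j r₁ r₂ r₃ => by
    have := congrArg (fun F : JetAlg D => F (pt j.2 r₁ r₂ r₃)) h
    simpa [h₁ (pt j.2 r₁ r₂ r₃) j rfl, h₂ (pt j.2 r₁ r₂ r₃) j rfl,
      h₃ (pt j.2 r₁ r₂ r₃) j rfl] using this
  have k3 : ∀ j, c₃ j = 0 := fun j => by simpa using key j 1 0 0
  have k1 : ∀ j, c₁ j = 0 := fun j => by simpa using key j 0 1 0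
  exact ⟨ext' k1, ext' fun j => by simpa [k3 j, k1 j] using key j 1 1 0, ext' k3⟩

/-- Commutativity of flows `R_y = m R_x + ε (a₁ R_xx + a₂ R_x²)`, `R_t = l R_x + ⋯` at first order. -/
theorem compat_first {m m₁ m₂ l l₁ l₂ a₁ a₁' a₂ a₂' b₁ b₁' b₂ b₂' : JetAlg D}
    (hm : HasD m m₁) (hm₁ : HasD m₁ m₂) (hl : HasD l l₁) (hl₁ : HasD l₁ l₂)
    (ha₁ : HasD a₁ a₁') (ha₂ : HasD a₂ a₂') (hb₁ : HasD b₁ b₁') (hb₂ : HasD b₂ b₂') :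
    evol (m * X 1) (b₁ * X 2 + b₂ * X 1 ^ 2) + evol (a₁ * X 2 + a₂ * X 1 ^ 2) (l * X 1) -
      (evol (l * X 1) (a₁ * X 2 + a₂ * X 1 ^ 2) + evol (b₁ * X 2 + b₂ * X 1 ^ 2) (m * X 1)) =
    X 1 * ((2 * (b₁ * m₁ - a₁ * l₁)) * X 2 + (b₁ * m₂ + b₂ * m₁ - a₁ * l₂ - a₂ * l₁) * X 1 ^ 2) := by
  simp only [map_add, Derivation.leibniz, Derivation.leibniz_pow, smul_eq_mul, nsmul_eq_mul,
    evol_X, Function.iterate_succ_apply', Function.iterate_zero, id, Dx_X, hm.evol, hl.evol,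
    ha₁.evol, ha₂.evol, hb₁.evol, hb₂.evol, hm.Dx, hm₁.Dx, hl.Dx, hl₁.Dx, ha₁.Dx, ha₂.Dx, hb₁.Dx,
    hb₂.Dx, Nat.cast_ofNat]
  ring

/-- Commutativity of flows `R_y = m R_x + ε² (a₁ R_xxx + a₂ R_x R_xx + a₃ R_x³)`, `R_t = l R_x + ⋯`
at second order. -/
theorem compat_second {m m₁ m₂ m₃ l l₁ l₂ l₃ a₁ a₁' a₂ a₂' a₃ a₃' b₁ b₁' b₂ b₂' b₃ b₃' : JetAlg D}
    (hm : HasD m m₁) (hm₁ : HasD m₁ m₂) (hm₂ : HasD m₂ m₃)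
    (hl : HasD l l₁) (hl₁ : HasD l₁ l₂) (hl₂ : HasD l₂ l₃)
    (ha₁ : HasD a₁ a₁') (ha₂ : HasD a₂ a₂') (ha₃ : HasD a₃ a₃')
    (hb₁ : HasD b₁ b₁') (hb₂ : HasD b₂ b₂') (hb₃ : HasD b₃ b₃') :
    evol (m * X 1) (b₁ * X 3 + b₂ * (X 1 * X 2) + b₃ * X 1 ^ 3) +
      evol (a₁ * X 3 + a₂ * (X 1 * X 2) + a₃ * X 1 ^ 3) (l * X 1) -
      (evol (l * X 1) (a₁ * X 3 + a₂ * (X 1 * X 2) + a₃ * X 1 ^ 3) +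
      evol (b₁ * X 3 + b₂ * (X 1 * X 2) + b₃ * X 1 ^ 3) (m * X 1)) =
    (3 * (b₁ * m₁ - a₁ * l₁)) * (X 1 * X 3 + X 2 ^ 2) +
    (3 * (2 * b₁ * m₂ + b₂ * m₁ - 2 * a₁ * l₂ - a₂ * l₁)) * (X 1 ^ 2 * X 2) +
    (b₁ * m₃ + b₂ * m₂ + 2 * b₃ * m₁ - a₁ * l₃ - a₂ * l₂ - 2 * a₃ * l₁) * X 1 ^ 4 := by
  simp only [map_add, Derivation.leibniz, Derivation.leibniz_pow, smul_eq_mul, nsmul_eq_mul,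
    evol_X, Function.iterate_succ_apply', Function.iterate_zero, id, Dx_X, hm.evol, hl.evol,
    ha₁.evol, ha₂.evol, ha₃.evol, hb₁.evol, hb₂.evol, hb₃.evol, hm.Dx, hm₁.Dx, hm₂.Dx, hl.Dx,
    hl₁.Dx, hl₂.Dx, ha₁.Dx, ha₂.Dx, ha₃.Dx, hb₁.Dx, hb₂.Dx, hb₃.Dx, Nat.cast_ofNat]
  ring

end JetAlg

/-! ### Expansion of the discrete derivative -/

section DeltaCoeff

variable {D : Opens ℂ} {N : ℕ} (s : ℂ) (a g : ℕ → JetAlg D)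

open JetAlg

theorem deltaCoeff_eq {n : ℕ} (hn : n ≤ N) : deltaCoeff N s a g n =
    ∑ k ∈ Finset.range (n + 1), algebraMap ℂ (JetAlg D) (s ^ k / ((k + 1).factorial : ℂ)) *
      (conv (fun a => evol a) a)^[k + 1] g (n - k) := by
  rw [deltaCoeff]
  symm
  refine Finset.sum_subset_zero_on_sdiff (Finset.range_subset_range.2 (by omega)) ?_ ?_
  · intro k hk
    simp only [Finset.mem_sdiff, Finset.mem_range] at hk
    refine Finset.sum_eq_zero ?_
    rintro ⟨p, q⟩ hp
    rw [Finset.HasAntidiagonal.mem_antidiagonal] at hp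
    have : p ≠ k := by simp only at hp; omega
    simp [this]
  · intro k hk
    simp only [Finset.mem_range] at hk
    rw [conv, Finset.sum_eq_single (k, n - k)]
    · simp
    · rintro ⟨p, q⟩ hp hne
      rw [Finset.HasAntidiagonal.mem_antidiagonal] at hp
      have : p ≠ k := by rintro rfl; apply hne; simp only at hp; simp; omega
      simp [this]
    · intro h
      rw [Finset.HasAntidiagonal.mem_antidiagonal] at h
      exact absurd (by simp; omega) h

theorem deltaCoeff_zero : deltaCoeff N s a g 0 = evol (a 0) (g 0) := by
  rw [deltaCoeff_eq _ _ _ (Nat.zero_le _)]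
  simp [conv_zero]

theorem deltaCoeff_one (hN : 1 ≤ N) : deltaCoeff N s a g 1 =
    evol (a 0) (g 1) + evol (a 1) (g 0) +
      algebraMap ℂ _ (s / 2) * evol (a 0) (evol (a 0) (g 0)) := by
  rw [deltaCoeff_eq _ _ _ hN]
  simp [Finset.sum_range_succ, conv_zero, conv_one]

theorem deltaCoeff_two (hN : 2 ≤ N) : deltaCoeff N s a g 2 =
    evol (a 0) (g 2) + evol (a 1) (g 1) + evol (a 2) (g 0) +
    algebraMap ℂ _ (s / 2) * (evol (a 0) (evol (a 0) (g 1) + evol (a 1) (g 0)) +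
      evol (a 1) (evol (a 0) (g 0))) +
    algebraMap ℂ _ (s ^ 2 / 6) * evol (a 0) (evol (a 0) (evol (a 0) (g 0))) := by
  rw [deltaCoeff_eq _ _ _ hN]
  simp [Finset.sum_range_succ, conv_zero, conv_one, conv_two, Nat.factorial]
  rw [show ((1 : ℂ) + 1) = 2 by norm_num, show (((2 : ℂ) + 1) * 2) = 6 by norm_num]

/-- Third order is needed only for deformations without odd corrections to R_y. -/
theorem deltaCoeff_three (hN : 3 ≤ N) (h1 : a 1 = 0) (h3 : a 3 = 0) : deltaCoeff N s a g 3 =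
    evol (a 0) (g 3) + evol (a 2) (g 1) +
    algebraMap ℂ _ (s / 2) * (evol (a 0) (evol (a 0) (g 2) + evol (a 2) (g 0)) +
      evol (a 2) (evol (a 0) (g 0))) +
    algebraMap ℂ _ (s ^ 2 / 6) * evol (a 0) (evol (a 0) (evol (a 0) (g 1))) +
    algebraMap ℂ _ (s ^ 3 / 24) *
      evol (a 0) (evol (a 0) (evol (a 0) (evol (a 0) (g 0)))) := by
  rw [deltaCoeff_eq _ _ _ hN]
  simp [Finset.sum_range_succ, conv_zero, conv_one, conv_two, conv_three, Nat.factorial, h1, h3]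
  rw [show ((1 : ℂ) + 1) = 2 by norm_num, show (((2 : ℂ) + 1) * 2) = 6 by norm_num,
    show (((3 : ℂ) + 1) * 6) = 24 by norm_num]

end DeltaCoeff

/-! ### Functions of the base point, existence of differential polynomials, and commutation of flows
with D_x -/

namespace JetAlg

variable {D : Opens ℂ}

/-- The function is recovered on the jets (R, 0, 0, …), an analytic one-parameter family, which
gives its holomorphy in R. -/
theorem IsBase.exists_base {c : JetAlg D} (hc : IsBase c) :
    ∃ (f : ℂ → ℂ) (hf : AnalyticOnNhd ℂ f D), base f hf = c := by
  refine ⟨fun R => extendJet c (fun k => if k = 0 then R else 0), fun R hR => ?_, ?_⟩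
  · refine c.family ℂ (fun _ => 0) (fun R k => if k = 0 then R else 0) R analyticAt_const
      (fun k => ?_) rfl (by simpa using hR)
    split_ifs
    · exact analyticAt_id
    · exact analyticAt_const
  · refine ext' fun j => ?_
    change extendJet c (fun k => if k = 0 then j.1 0 else 0) = c j
    rw [extendJet_of_mem _ (by simpa using j.2)]
    exact hc _ _ (by simp)

theorem isBase_base {c : ℂ → ℂ} (hc : AnalyticOnNhd ℂ c D) : IsBase (base c hc) :=
  fun j j' h => by simp [h]

theorem isBase_lift {U : Set (ℂ × ℂ)} (C : PhaseCurve U D) {F : ℂ × ℂ → ℂ}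
    (hF : AnalyticOnNhd ℂ F U) : IsBase (C.lift hF) := fun j j' h => by simp [h]

theorem isBase_algebraMap (c : ℂ) : IsBase (algebraMap ℂ (JetAlg D) c) := fun _ _ _ => by simp

theorem isBase_zero : IsBase (0 : JetAlg D) := fun _ _ _ => by simp

theorem isBase_ofNat (n : ℕ) [n.AtLeastTwo] : IsBase (OfNat.ofNat n : JetAlg D) :=
  fun _ _ _ => (ofNat_apply _ _).trans (ofNat_apply _ _).symm

theorem isBase_X_zero : IsBase (X 0 : JetAlg D) := fun _ _ h => by simpa using h

theorem IsBase.add {a b : JetAlg D} (ha : IsBase a) (hb : IsBase b) : IsBase (a + b) :=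
  fun j j' h => by simp [ha j j' h, hb j j' h]

theorem IsBase.sub {a b : JetAlg D} (ha : IsBase a) (hb : IsBase b) : IsBase (a - b) :=
  fun j j' h => by simp [ha j j' h, hb j j' h]

theorem IsBase.mul {a b : JetAlg D} (ha : IsBase a) (hb : IsBase b) : IsBase (a * b) :=
  fun j j' h => by simp [ha j j' h, hb j j' h]

theorem IsBase.pow {a : JetAlg D} (ha : IsBase a) (n : ℕ) : IsBase (a ^ n) :=
  fun j j' h => by simp [ha j j' h]

theorem exists_dpoly_one {c : JetAlg D} (h : IsBase c) :
    ∃ (f : Nat.Partition 1 → ℂ → ℂ) (hf : ∀ π, AnalyticOnNhd ℂ (f π) D),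
      dpoly 1 f hf = c * X 1 := by
  obtain ⟨g, hg, rfl⟩ := h.exists_base
  exact ⟨fun _ => g, fun _ => hg, dpoly_one _ _⟩

theorem exists_dpoly_two {c₁ c₂ : JetAlg D} (h₁ : IsBase c₁) (h₂ : IsBase c₂) :
    ∃ (f : Nat.Partition 2 → ℂ → ℂ) (hf : ∀ π, AnalyticOnNhd ℂ (f π) D),
      dpoly 2 f hf = c₁ * X 2 + c₂ * X 1 ^ 2 := by
  obtain ⟨g₁, hg₁, rfl⟩ := h₁.exists_base
  obtain ⟨g₂, hg₂, rfl⟩ := h₂.exists_base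
  have hne : partition11.parts ≠ partition2.parts := fun h => by
    simpa [partition2, partition11, partitionOf] using congrArg Multiset.card h
  let f : Nat.Partition 2 → ℂ → ℂ := fun π => if π.parts = partition2.parts then g₁ else g₂
  have hf : ∀ π, AnalyticOnNhd ℂ (f π) D := fun π => by
    simp only [f]; split_ifs <;> assumption
  refine ⟨f, hf, ?_⟩
  rw [dpoly_two]
  refine ext' fun j => ?_
  simp [f, hne]

theorem exists_dpoly_three {c₁ c₂ c₃ : JetAlg D} (h₁ : IsBase c₁) (h₂ : IsBase c₂)
    (h₃ : IsBase c₃) :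
    ∃ (f : Nat.Partition 3 → ℂ → ℂ) (hf : ∀ π, AnalyticOnNhd ℂ (f π) D),
      dpoly 3 f hf = c₁ * X 3 + c₂ * (X 1 * X 2) + c₃ * X 1 ^ 3 := by
  obtain ⟨g₁, hg₁, rfl⟩ := h₁.exists_base
  obtain ⟨g₂, hg₂, rfl⟩ := h₂.exists_base
  obtain ⟨g₃, hg₃, rfl⟩ := h₃.exists_base
  have h12 : partition21.parts ≠ partition3.parts := fun h => by
    simpa [partition3, partition21, partitionOf] using congrArg Multiset.card h
  have h13 : partition111.parts ≠ partition3.parts := fun h => by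
    simpa [partition3, partition111, partitionOf] using congrArg Multiset.card h
  have h23 : partition111.parts ≠ partition21.parts := fun h => by
    simpa [partition21, partition111, partitionOf] using congrArg Multiset.card h
  let f : Nat.Partition 3 → ℂ → ℂ := fun π =>
    if π.parts = partition3.parts then g₁ else if π.parts = partition21.parts then g₂ else g₃
  have hf : ∀ π, AnalyticOnNhd ℂ (f π) D := fun π => by
    simp only [f]; split_ifs <;> assumption
  refine ⟨f, hf, ?_⟩
  rw [dpoly_three]
  refine ext' fun j => ?_
  simp [f, h12, h13, h23]

theorem exists_dpoly_zero (n : ℕ) :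
    ∃ (f : n.Partition → ℂ → ℂ) (hf : ∀ π, AnalyticOnNhd ℂ (f π) D),
      dpoly n f hf = (0 : JetAlg D) :=
  ⟨fun _ _ => 0, fun _ => analyticOnNhd_const, ext' fun j => by simp [diffPoly]⟩

theorem hasD_X_zero : HasD (X 0 : JetAlg D) 1 := fun v => by rw [dir_X, one_mul]

/-- The flow of `A` and the total derivative commute on `F`. -/
def FlowComm (A F : JetAlg D) : Prop := Dx (evol A F) = evol A (Dx F)

theorem flowComm_X (A : JetAlg D) (k : ℕ) : FlowComm A (X k) := by
  rw [FlowComm, evol_X, Dx_X, evol_X, Function.iterate_succ_apply']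

theorem HasD.flowComm {c c' c'' : JetAlg D} (h : HasD c c') (h' : HasD c' c'') (A : JetAlg D) :
    FlowComm A c := by
  rw [FlowComm, h.evol, h.Dx, Derivation.leibniz, Derivation.leibniz, h'.evol, h'.Dx, evol_X]
  simp only [smul_eq_mul, Function.iterate_one]
  ring

theorem FlowComm.add {A F G : JetAlg D} (hF : FlowComm A F) (hG : FlowComm A G) :
    FlowComm A (F + G) := by
  rw [FlowComm, map_add, map_add, hF, hG, map_add, map_add]

theorem FlowComm.mul {A F G : JetAlg D} (hF : FlowComm A F) (hG : FlowComm A G) :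
    FlowComm A (F * G) := by
  rw [FlowComm] at *
  simp only [Derivation.leibniz, smul_eq_mul, map_add, hF, hG]
  ring

theorem HasD.of_mul_eq_one {c c' i : JetAlg D} (hc : HasD c c') (h : c * i = 1) :
    HasD i (-(i ^ 2 * c')) := fun v => by
  have h1 : dir v (c * i) = 0 := by rw [h]; exact Derivation.map_one_eq_zero _
  rw [Derivation.leibniz, hc, smul_eq_mul, smul_eq_mul] at h1
  linear_combination i * h1 - (dir v i) * h

end JetAlg

/-! ### Deformations that are even in ε after the half-shift w = T_y^{1/2} v -/

namespace TodaEquation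

open JetAlg

variable {E : TodaEquation} {U : Set (ℂ × ℂ)} {D : Opens ℂ}

/-- The second-order correction to `R_y` determined by the correction `V` of the symmetrized
field `T_y^{-1/2} w`. -/
def symA (C : PhaseCurve U D) (V : JetAlg D) : JetAlg D :=
  Dx V - algebraMap ℂ _ (1 / 24) * evol (C.mu * X 1) (evol (C.mu * X 1) (C.mu * X 1))

/-- The coefficients of `T_y^{1/2} (w(R) + ε² V)`. -/
def symW (C : PhaseCurve U D) (V : JetAlg D) : ℕ → JetAlg D
  | 0 => C.W
  | 1 => algebraMap ℂ _ (1 / 2) * evol (C.mu * X 1) C.W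
  | 2 => V + algebraMap ℂ _ (1 / 8) * evol (C.mu * X 1) (evol (C.mu * X 1) C.W)
  | 3 => algebraMap ℂ _ (1 / 2) * (evol (C.mu * X 1) V + evol (symA C V) C.W) +
      algebraMap ℂ _ (1 / 48) *
        evol (C.mu * X 1) (evol (C.mu * X 1) (evol (C.mu * X 1) C.W))
  | _ => 0

/-- The coefficients of an evolution without odd corrections. -/
def evenCoeff (A₀ A₂ : JetAlg D) : ℕ → JetAlg D
  | 0 => A₀
  | 2 => A₂
  | _ => 0

/-- With v = T_y^{-1/2} w the relation w_x = Δ_y⁺ u is v_x = 2 sinh(ε∂_y/2) u / ε = u_y + ε² u_yyy /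
24 + ⋯, which holds for v = w(R) + ε²V by the choice of `symA`. What is left is the equation for
u_t, whose odd orders must vanish, and commutation of the flows at order ε². -/
theorem inheritsOnePhase_of_symmetric (hE : E.HolomorphicOn U) (C : PhaseCurve U D)
    {v₁ v₁' v₁'' v₂ v₂' v₂'' m₁ m₂ m₃ a₁ a₂ a₃ b₁ b₂ b₃ : JetAlg D}
    (hv₁ : HasD v₁ v₁') (hv₁' : HasD v₁' v₁'') (hv₂ : HasD v₂ v₂') (hv₂' : HasD v₂' v₂'') (hm : HasD C.mu m₁) (hm₁ : HasD m₁ m₂)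
    (hm₂ : HasD m₂ m₃)
    (iv₁ : IsBase v₁) (iv₁' : IsBase v₁') (iv₂ : IsBase v₂) (iv₂' : IsBase v₂')
    (im₁ : IsBase m₁) (im₂ : IsBase m₂)
    (hA : symA C (v₁ * X 2 + v₂ * X 1 ^ 2) = a₁ * X 3 + a₂ * (X 1 * X 2) + a₃ * X 1 ^ 3)
    (ia₁ : IsBase a₁) (ia₂ : IsBase a₂) (ia₃ : IsBase a₃)
    (ib₁ : IsBase b₁) (ib₂ : IsBase b₂) (ib₃ : IsBase b₃)
    (ut₁ : rhsCoeff hE C 3 (symW C (v₁ * X 2 + v₂ * X 1 ^ 2))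
      (evenCoeff (C.mu * X 1) (symA C (v₁ * X 2 + v₂ * X 1 ^ 2))) 1 = 0)
    (ut₂ : rhsCoeff hE C 3 (symW C (v₁ * X 2 + v₂ * X 1 ^ 2))
      (evenCoeff (C.mu * X 1) (symA C (v₁ * X 2 + v₂ * X 1 ^ 2))) 2 =
        b₁ * X 3 + b₂ * (X 1 * X 2) + b₃ * X 1 ^ 3)
    (ut₃ : rhsCoeff hE C 3 (symW C (v₁ * X 2 + v₂ * X 1 ^ 2))
      (evenCoeff (C.mu * X 1) (symA C (v₁ * X 2 + v₂ * X 1 ^ 2))) 3 = 0)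
    (hc : evol (C.mu * X 1) (b₁ * X 3 + b₂ * (X 1 * X 2) + b₃ * X 1 ^ 3) +
      evol (a₁ * X 3 + a₂ * (X 1 * X 2) + a₃ * X 1 ^ 3) (E.lam hE C * X 1) -
      (evol (E.lam hE C * X 1) (a₁ * X 3 + a₂ * (X 1 * X 2) + a₃ * X 1 ^ 3) +
      evol (b₁ * X 3 + b₂ * (X 1 * X 2) + b₃ * X 1 ^ 3) (C.mu * X 1)) = 0) :
    E.InheritsOnePhase 3 D C.w := by
  have imu : IsBase C.mu := isBase_base _
  have hW : HasD C.W C.mu := hasD_base _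
  obtain ⟨l₁, hl⟩ : ∃ l₁, HasD (E.lam hE C) l₁ := by
    have h := hE
    exact ⟨_, ((hasD_lift C hE.1).add ((((hasD_lift C hE.2.1).mul
      (hasD_lift C hE.2.2.1.partialU)).add ((hasD_lift C hE.2.2.2.1).mul
      (hasD_lift C hE.2.2.2.2.partialU))).mul hm)).add ((((hasD_lift C hE.2.1).mul
      (hasD_lift C hE.2.2.1.partialW)).add ((hasD_lift C hE.2.2.2.1).mul
      (hasD_lift C hE.2.2.2.2.partialW))).mul (hm.pow 2))⟩
  set V := v₁ * X 2 + v₂ * X 1 ^ 2 with hV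
  set A₂ := symA C V with hA₂
  rw [inheritsOnePhase_iff hE C]
  -- The half-shifted coefficients have to be exhibited as differential polynomials of degree k with
  -- coefficients depending on R only.
  have exW : ∀ k, ∃ (f : k.Partition → ℂ → ℂ) (hf : ∀ π, AnalyticOnNhd ℂ (f π) D),
      (if k = 0 then C.W else dpoly k f hf) = symW C V k := by
    intro k
    match k with
    | 0 => exact ⟨fun _ _ => 0, fun _ => analyticOnNhd_const, rfl⟩
    | 1 =>
      obtain ⟨f, hf, h⟩ := exists_dpoly_one ((isBase_algebraMap (D := D) (1 / 2)).mul (imu.pow 2))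
      refine ⟨f, hf, ?_⟩
      rw [if_neg (by norm_num), h, symW, hW.evol]
      ring
    | 2 =>
      obtain ⟨f, hf, h⟩ := exists_dpoly_two
        (iv₁.add ((isBase_algebraMap (D := D) (1 / 8)).mul (imu.pow 3)))
        (iv₂.add ((isBase_algebraMap (D := D) (3 / 8)).mul ((imu.pow 2).mul im₁)))
      refine ⟨f, hf, ?_⟩
      rw [if_neg (by norm_num), h, symW]
      simp only [hV, Derivation.leibniz, smul_eq_mul, hW.evol, hm.evol, evol_X,
        Function.iterate_succ_apply', Function.iterate_zero, id, Dx_X, hm.Dx]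
      refine ext' fun j => ?_
      simp
      ring
    | 3 =>
      obtain ⟨f, hf, h⟩ := exists_dpoly_three
        (((isBase_algebraMap (D := D) (1 / 2)).mul ((imu.mul iv₁).add (imu.mul ia₁))).add
          ((isBase_algebraMap (D := D) (1 / 48)).mul (imu.pow 4)))
        (((isBase_algebraMap (D := D) (1 / 2)).mul
          ((((isBase_ofNat 3).mul (im₁.mul iv₁)).add ((imu.mul iv₁').add
            ((isBase_ofNat 2).mul (imu.mul iv₂)))).add (imu.mul ia₂))).add
          ((isBase_algebraMap (D := D) (1 / 4)).mul ((imu.pow 3).mul im₁)))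
        (((isBase_algebraMap (D := D) (1 / 2)).mul
          (((im₂.mul iv₁).add (((isBase_ofNat 2).mul (im₁.mul iv₂)).add
            (imu.mul iv₂'))).add (imu.mul ia₃))).add
          ((isBase_algebraMap (D := D) (1 / 48)).mul
            (((isBase_ofNat 12).mul ((imu.pow 2).mul (im₁.pow 2))).add
            ((isBase_ofNat 4).mul ((imu.pow 3).mul im₂)))))
      refine ⟨f, hf, ?_⟩
      rw [if_neg (by norm_num), h, symW, ← hA₂, hA]
      simp only [hV, map_add, Derivation.leibniz, Derivation.leibniz_pow, smul_eq_mul,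
        nsmul_eq_mul, hW.evol, hm.evol, hm₁.evol, hv₁.evol, hv₂.evol, evol_X,
        Function.iterate_succ_apply', Function.iterate_zero, id, Dx_X, hm.Dx, hm₁.Dx]
      refine ext' fun j => ?_
      simp
      ring
    | k + 4 =>
      obtain ⟨f, hf, h⟩ := exists_dpoly_zero (D := D) (k + 4)
      exact ⟨f, hf, by rw [if_neg (by omega), h]; rfl⟩
  have exA : ∀ (A₀ : JetAlg D) {c₁ c₂ c₃ : JetAlg D}, IsBase c₁ → IsBase c₂ → IsBase c₃ → ∀ k,
      ∃ (f : (k + 1).Partition → ℂ → ℂ) (hf : ∀ π, AnalyticOnNhd ℂ (f π) D),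
      (if k = 0 then A₀ else dpoly (k + 1) f hf) =
        evenCoeff A₀ (c₁ * X 3 + c₂ * (X 1 * X 2) + c₃ * X 1 ^ 3) k := by
    intro A₀ c₁ c₂ c₃ h₁ h₂ h₃ k
    match k with
    | 0 => exact ⟨fun _ _ => 0, fun _ => analyticOnNhd_const, rfl⟩
    | 2 => exact exists_dpoly_three h₁ h₂ h₃
    | 1 => exact exists_dpoly_zero 2
    | k + 3 =>
      obtain ⟨f, hf, h⟩ := exists_dpoly_zero (D := D) (k + 3 + 1)
      exact ⟨f, hf, by rw [if_neg (by omega), h]; rfl⟩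
  choose ω hω eω using exW
  choose α hα eα using exA (C.mu * X 1) ia₁ ia₂ ia₃
  choose β hβ eβ using exA (E.lam hE C * X 1) ib₁ ib₂ ib₃
  refine ⟨ω, α, β, hω, hα, hβ, ?_⟩
  rw [funext eω, funext eα, funext eβ, ← hA]
  have c0 : ∀ a b : JetAlg D, evenCoeff a b 0 = a := fun _ _ => rfl
  have c1 : ∀ a b : JetAlg D, evenCoeff a b 1 = 0 := fun _ _ => rfl
  have c2 : ∀ a b : JetAlg D, evenCoeff a b 2 = b := fun _ _ => rfl
  have c3 : ∀ a b : JetAlg D, evenCoeff a b 3 = 0 := fun _ _ => rfl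
  have hX0 : ∀ A : JetAlg D, evol A (X 0) = A := fun A => by simp [evol_X]
  refine ⟨fun n hn => ?_, fun n hn => ?_, fun n hn => ?_⟩
  · interval_cases n
    · rw [deltaCoeff_zero, c0, symW, hW.Dx]
      simp [evol_X]
    · rw [deltaCoeff_one _ _ _ (by norm_num), c0, c1, symW]
      simp only [if_true, one_ne_zero, if_false, map_zero, hX0,
        Derivation.map_algebraMap, Derivation.leibniz, smul_eq_mul, hW.evol, hm.evol, evol_X,
        Function.iterate_succ_apply', Function.iterate_zero, id, Dx_X, hm.Dx]
      refine ext' fun j => ?_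
      simp
      ring
    · rw [deltaCoeff_two _ _ _ (by norm_num), c0, c1, c2, symW, hA₂, symA]
      simp only [if_true, one_ne_zero, OfNat.ofNat_ne_zero, if_false, map_zero, hX0, hV, map_add, Derivation.leibniz, Derivation.leibniz_pow, smul_eq_mul,
        nsmul_eq_mul, hW.evol, hm.evol, hm₁.evol, evol_X,
        Function.iterate_succ_apply', Function.iterate_zero, id, Dx_X, hm.Dx, hm₁.Dx, hv₁.Dx,
        hv₂.Dx, Derivation.map_algebraMap]
      refine ext' fun j => ?_
      simp
      ring
    -- At order ε³ one moves D_x through the flows and inserts D_x V = A₂ + ∂_y²(μR_x)/24; the terms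
    -- ∂_y³(μR_x) then match because 1/48 + 1/48 = 1/24.
    · have hcommV : Dx (evol (C.mu * X 1) V) = evol (C.mu * X 1) (Dx V) := by
        rw [hV, pow_two]
        exact ((hv₁.flowComm hv₁' _).mul (flowComm_X _ _)).add
          ((hv₂.flowComm hv₂' _).mul ((flowComm_X _ _).mul (flowComm_X _ _)))
      have hcommW : ∀ A : JetAlg D, Dx (evol A C.W) = evol A (Dx C.W) := by
        intro A
        simp only [hW.evol, hW.Dx, Derivation.leibniz, hm.Dx, hm.evol, smul_eq_mul, evol_X,
          Function.iterate_succ_apply', Function.iterate_zero, id]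
        ring
      have hcomm3 : Dx (evol (C.mu * X 1) (evol (C.mu * X 1) (evol (C.mu * X 1) C.W))) =
          evol (C.mu * X 1) (evol (C.mu * X 1) (evol (C.mu * X 1) (C.mu * X 1))) := by
        simp only [map_add, Derivation.leibniz, smul_eq_mul, hW.evol, hm.evol, hm₁.evol, evol_X,
          Function.iterate_succ_apply', Function.iterate_zero, id, Dx_X, hm.Dx, hm₁.Dx, hm₂.Dx,
          hm₂.evol]
        ring
      rw [deltaCoeff_three _ _ _ (by norm_num) rfl rfl, c0, c2, symW, map_add,
        ← Algebra.smul_def, ← Algebra.smul_def, Derivation.map_smul, Derivation.map_smul, map_add,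
        hcommV, hcommW, hcomm3]
      have hDV : Dx V = A₂ + algebraMap ℂ _ (1 / 24) *
          evol (C.mu * X 1) (evol (C.mu * X 1) (C.mu * X 1)) := by rw [hA₂, symA]; ring
      rw [hDV, hW.Dx]
      simp only [if_true, one_ne_zero, OfNat.ofNat_ne_zero, if_false, map_zero, hX0,
        map_add, ← Algebra.smul_def, Derivation.map_smul, smul_zero]
      refine ext' fun j => ?_
      simp
      ring
  · interval_cases n
    · rw [c0, rhsCoeff, conv_zero, conv_zero, deltaCoeff_zero, deltaCoeff_zero]
      simp only [compCoeff_zero C _ _ (Or.inr rfl), c0, (hasD_lift C _).evol, lam]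
      ring
    · rw [c1, ut₁]
    · rw [c2, ut₂]
    · rw [c3, ut₃]
  · interval_cases n
    · simp only [conv_zero, c0, Derivation.leibniz, smul_eq_mul, hm.evol, hl.evol, evol_X,
        Function.iterate_succ_apply', Function.iterate_zero, id, Dx_X, hm.Dx, hl.Dx]
      ring
    · simp [conv_one, c0, c1]
    · simp only [conv_two, c0, c1, c2, map_zero, add_zero]
      rw [hA]
      linear_combination -hc
    · simp [conv_three, c0, c1, c2, c3]

end TodaEquation

/-! ### Derivatives and inverses of functions of the base point -/

namespace JetAlg

variable {D : Opens ℂ}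

theorem IsBase.exists_hasD {c : JetAlg D} (hc : IsBase c) : ∃ c', HasD c c' ∧ IsBase c' := by
  obtain ⟨f, hf, rfl⟩ := hc.exists_base
  exact ⟨_, hasD_base hf, isBase_base _⟩

theorem HasD.unique {c c' c'' : JetAlg D} (h : HasD c c') (h' : HasD c c'') : c' = c'' := by
  have := (h fun _ => 1).symm.trans (h' fun _ => 1)
  simpa using this

theorem HasD.isBase {c c' : JetAlg D} (h : HasD c c') (hc : IsBase c) : IsBase c' := by
  obtain ⟨c'', h', hb⟩ := hc.exists_hasD
  rwa [h.unique h']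

theorem IsBase.exists_inv {c : JetAlg D} (hc : IsBase c) (h0 : ∀ j, c j ≠ 0) :
    ∃ i, IsBase i ∧ c * i = 1 := by
  obtain ⟨f, hf, rfl⟩ := hc.exists_base
  have hne : ∀ R ∈ D, f R ≠ 0 := fun R hR => by simpa using h0 (pt hR 0 0 0)
  have hi : AnalyticOnNhd ℂ (fun R => (f R)⁻¹) D := fun R hR => (hf R hR).inv (hne R hR)
  refine ⟨base _ hi, isBase_base _, ext' fun j => ?_⟩
  simp [mul_inv_cancel₀ (hne _ j.2)]

end JetAlg

/-! ### Solving the commutation condition at order ε² -/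

namespace TodaEquation

open JetAlg

variable {E : TodaEquation} {U : Set (ℂ × ℂ)} {D : Opens ℂ}

/-- The correction to the symmetrized field in terms of the ratios `z = a₁ / μ'`,
`y = (a₂ - 2 μ'' z) / μ'` of the corrections to the flows. -/
def symV (C : PhaseCurve U D) (m₁ m₂ z z' y : JetAlg D) : JetAlg D :=
  (m₁ * z + algebraMap ℂ _ (1 / 24) * C.mu ^ 3) * X 2 +
    (algebraMap ℂ _ (1 / 2) * (m₁ * (y - z') + m₂ * z) +
      algebraMap ℂ _ (1 / 8) * (C.mu ^ 2 * m₁)) * X 1 ^ 2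

/-- The commutator in `compat_second` is antisymmetric in the two flows, so it vanishes when both
corrections arise by one rule with the same z and y: coefficients m₁z, m₁y + 2m₂z and (m₂y + m₃z +
m₁(y' - z''))/2, and likewise with l in place of m. The third is (a₂' - a₁'')/2, which makes the
correction a total x-derivative, as `symA` requires. -/
theorem inheritsOnePhase_of_ratios (hE : E.HolomorphicOn U) (C : PhaseCurve U D)
    {m₁ m₂ m₃ l₁ l₂ l₃ z z' z'' y y' : JetAlg D}
    (hm : HasD C.mu m₁) (hm₁ : HasD m₁ m₂) (hm₂ : HasD m₂ m₃)
    (hl : HasD (E.lam hE C) l₁) (hl₁ : HasD l₁ l₂) (hl₂ : HasD l₂ l₃)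
    (hz : HasD z z') (hz' : HasD z' z'') (hy : HasD y y') (iz : IsBase z) (iy : IsBase y)
    (ut₁ : rhsCoeff hE C 3 (symW C (symV C m₁ m₂ z z' y))
      (evenCoeff (C.mu * X 1) (symA C (symV C m₁ m₂ z z' y))) 1 = 0)
    (ut₂ : rhsCoeff hE C 3 (symW C (symV C m₁ m₂ z z' y))
      (evenCoeff (C.mu * X 1) (symA C (symV C m₁ m₂ z z' y))) 2 =
        (l₁ * z) * X 3 + (l₁ * y + 2 * l₂ * z) * (X 1 * X 2) +
        (algebraMap ℂ _ (1 / 2) * (l₁ * (y' - z'') + l₂ * y + l₃ * z)) * X 1 ^ 3)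
    (ut₃ : rhsCoeff hE C 3 (symW C (symV C m₁ m₂ z z' y))
      (evenCoeff (C.mu * X 1) (symA C (symV C m₁ m₂ z z' y))) 3 = 0) :
    E.InheritsOnePhase 3 D C.w := by
  have imu : IsBase C.mu := isBase_base _
  have im₁ := hm.isBase imu
  have im₂ := hm₁.isBase im₁
  have im₃ := hm₂.isBase im₂
  have il : IsBase (E.lam hE C) := fun j j' h => by simp only [lam_apply, h]
  have il₁ := hl.isBase il
  have il₂ := hl₁.isBase il₁
  have il₃ := hl₂.isBase il₂
  have iz' := hz.isBase iz
  have iz'' := hz'.isBase iz'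
  have iy' := hy.isBase iy
  obtain ⟨z₃, hz'', -⟩ := iz''.exists_hasD
  obtain ⟨y'', hy', -⟩ := iy'.exists_hasD
  obtain ⟨m₄, hm₃, -⟩ := im₃.exists_hasD
  obtain ⟨l₄, hl₃, -⟩ := il₃.exists_hasD
  have hcst := fun c => hasD_algebraMap (D := D) c
  have icst := fun c => isBase_algebraMap (D := D) c
  have hv₁ := (hm₁.mul hz).add ((hcst (1 / 24)).mul (hm.pow 3))
  have iv₁ := (im₁.mul iz).add ((icst (1 / 24)).mul (imu.pow 3))
  have hv₂ := ((hcst (1 / 2)).mul ((hm₁.mul (hy.sub hz')).add (hm₂.mul hz))).add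
    ((hcst (1 / 8)).mul ((hm.pow 2).mul hm₁))
  have iv₂ := ((icst (1 / 2)).mul ((im₁.mul (iy.sub iz')).add (im₂.mul iz))).add
    ((icst (1 / 8)).mul ((imu.pow 2).mul im₁))
  obtain ⟨v₁'', hv₁', -⟩ := (hv₁.isBase iv₁).exists_hasD
  obtain ⟨v₂'', hv₂', -⟩ := (hv₂.isBase iv₂).exists_hasD
  have itwo : IsBase (2 : JetAlg D) := fun _ _ _ => by simp
  have ha₁ := hm₁.mul hz
  have ha₂ := (hm₁.mul hy).add ((hcst 2).mul (hm₂.mul hz))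
  have ha₃ := (hcst (1 / 2)).mul (((hm₂.mul hy).add (hm₃.mul hz)).add
    (hm₁.mul (hy'.sub hz'')))
  have hb₁ := hl₁.mul hz
  have hb₂ := (hl₁.mul hy).add (((hcst 2).mul hl₂).mul hz)
  have hb₃ := (hcst (1 / 2)).mul (((hl₁.mul (hy'.sub hz'')).add (hl₂.mul hy)).add (hl₃.mul hz))
  have htwo : (algebraMap ℂ (JetAlg D) 2) = 2 := map_ofNat _ 2
  rw [htwo] at ha₂ hb₂
  refine inheritsOnePhase_of_symmetric (a₁ := m₁ * z) (a₂ := m₁ * y + 2 * (m₂ * z))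
    (a₃ := algebraMap ℂ _ (1 / 2) * (m₂ * y + m₃ * z + m₁ * (y' - z''))) hE C
    hv₁ hv₁' hv₂ hv₂' hm hm₁ hm₂ iv₁ (hv₁.isBase iv₁) iv₂ (hv₂.isBase iv₂) im₁ im₂ ?_
    (im₁.mul iz) ((im₁.mul iy).add (itwo.mul (im₂.mul iz)))
    ((icst _).mul (((im₂.mul iy).add (im₃.mul iz)).add (im₁.mul (iy'.sub iz''))))
    (il₁.mul iz) ((il₁.mul iy).add ((itwo.mul il₂).mul iz))
    ((icst _).mul (((il₁.mul (iy'.sub iz'')).add (il₂.mul iy)).add (il₃.mul iz)))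
    ut₁ ut₂ ut₃ ?_
  · rw [symA]
    simp only [map_add, map_sub, Derivation.leibniz, Derivation.leibniz_pow, smul_eq_mul,
      nsmul_eq_mul, hm.evol, hm₁.evol, evol_X, Derivation.map_algebraMap,
      Function.iterate_succ_apply', Function.iterate_zero, id, Dx_X, hm.Dx, hm₁.Dx, hm₂.Dx,
      hz.Dx, hz'.Dx, hy.Dx]
    refine ext' fun j => ?_
    simp
    ring
  · rw [compat_second hm hm₁ hm₂ hl hl₁ hl₂ ha₁ ha₂ ha₃ hb₁ hb₂ hb₃]
    refine ext' fun j => ?_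
    simp
    ring

end TodaEquation

/-! ### Calculus of the partial derivatives in u and w -/

section PartialDerivatives

variable {F G : ℂ × ℂ → ℂ} {P : ℂ × ℂ}

theorem partialU_add (hF : AnalyticAt ℂ F P) (hG : AnalyticAt ℂ G P) :
    partialU (fun Q => F Q + G Q) P = partialU F P + partialU G P := by
  rw [partialU, fderiv_fun_add hF.differentiableAt hG.differentiableAt]; rfl

theorem partialW_add (hF : AnalyticAt ℂ F P) (hG : AnalyticAt ℂ G P) :
    partialW (fun Q => F Q + G Q) P = partialW F P + partialW G P := by
  rw [partialW, fderiv_fun_add hF.differentiableAt hG.differentiableAt]; rfl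

theorem partialU_mul (hF : AnalyticAt ℂ F P) (hG : AnalyticAt ℂ G P) :
    partialU (fun Q => F Q * G Q) P = partialU F P * G P + F P * partialU G P := by
  rw [partialU, fderiv_fun_mul hF.differentiableAt hG.differentiableAt]
  simp [partialU]; ring

theorem partialW_mul (hF : AnalyticAt ℂ F P) (hG : AnalyticAt ℂ G P) :
    partialW (fun Q => F Q * G Q) P = partialW F P * G P + F P * partialW G P := by
  rw [partialW, fderiv_fun_mul hF.differentiableAt hG.differentiableAt]
  simp [partialW]; ring

@[simp] theorem partialU_const (c : ℂ) : partialU (fun _ => c) P = 0 := by simp [partialU]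
@[simp] theorem partialW_const (c : ℂ) : partialW (fun _ => c) P = 0 := by simp [partialW]

theorem partialU_congr (h : F =ᶠ[𝓝 P] G) : partialU F P = partialU G P := by
  rw [partialU, h.fderiv_eq]; rfl

theorem partialW_congr (h : F =ᶠ[𝓝 P] G) : partialW F P = partialW G P := by
  rw [partialW, h.fderiv_eq]; rfl

theorem partialU_comp_fst {s : ℂ → ℂ} {s' : ℂ} (hs : HasDerivAt s s' P.1) :
    partialU (fun Q => s Q.1) P = s' := by
  have : HasFDerivAt (fun Q : ℂ × ℂ => s Q.1) _ P :=
    (hs.hasFDerivAt).comp P (hasFDerivAt_fst (𝕜 := ℂ) (E := ℂ) (F := ℂ) (p := P))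
  rw [partialU, this.fderiv]; simp

theorem partialW_comp_fst {s : ℂ → ℂ} {s' : ℂ} (hs : HasDerivAt s s' P.1) :
    partialW (fun Q => s Q.1) P = 0 := by
  have : HasFDerivAt (fun Q : ℂ × ℂ => s Q.1) _ P :=
    (hs.hasFDerivAt).comp P (hasFDerivAt_fst (𝕜 := ℂ) (E := ℂ) (F := ℂ) (p := P))
  rw [partialW, this.fderiv]; simp

theorem partialU_comp_snd {s : ℂ → ℂ} {s' : ℂ} (hs : HasDerivAt s s' P.2) :
    partialU (fun Q => s Q.2) P = 0 := by
  have : HasFDerivAt (fun Q : ℂ × ℂ => s Q.2) _ P :=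
    (hs.hasFDerivAt).comp P (hasFDerivAt_snd (𝕜 := ℂ) (E := ℂ) (F := ℂ) (p := P))
  rw [partialU, this.fderiv]; simp

theorem partialW_comp_snd {s : ℂ → ℂ} {s' : ℂ} (hs : HasDerivAt s s' P.2) :
    partialW (fun Q => s Q.2) P = s' := by
  have : HasFDerivAt (fun Q : ℂ × ℂ => s Q.2) _ P :=
    (hs.hasFDerivAt).comp P (hasFDerivAt_snd (𝕜 := ℂ) (E := ℂ) (F := ℂ) (p := P))
  rw [partialW, this.fderiv]; simp

end PartialDerivatives

/-! ### The nonlinearity, and the one-phase solutions of the Toda and Volterra equations -/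

namespace TodaEquation

open JetAlg

variable {E : TodaEquation} {U : Set (ℂ × ℂ)} {D : Opens ℂ}

theorem analyticOnNhd_psi (hE : E.HolomorphicOn U) : AnalyticOnNhd ℂ E.psi U :=
  (hE.2.1.mul hE.2.2.1.partialU).add (hE.2.2.2.1.mul hE.2.2.2.2.partialU)

theorem analyticOnNhd_eta (hE : E.HolomorphicOn U) : AnalyticOnNhd ℂ E.eta U :=
  (hE.2.1.mul hE.2.2.1.partialW).add (hE.2.2.2.1.mul hE.2.2.2.2.partialW)

theorem nonlinearity_eq (hE : E.HolomorphicOn U) (μ : ℂ) {P : ℂ × ℂ} (hP : P ∈ U) :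
    E.nonlinearity μ P = partialU E.phi P + (partialW E.phi P + partialU E.psi P) * μ +
      (partialW E.psi P + partialU E.eta P) * μ ^ 2 + partialW E.eta P * μ ^ 3 := by
  have h1 := hE.1 P hP
  have h2 := analyticOnNhd_psi hE P hP
  have h3 := analyticOnNhd_eta hE P hP
  have hs : E.speed μ = fun Q => (E.phi Q + E.psi Q * μ) + E.eta Q * μ ^ 2 := rfl
  rw [nonlinearity, fderiv_apply_eq_partial, hs,
    partialU_add (h1.fun_add (h2.fun_mul analyticAt_const)) (h3.fun_mul analyticAt_const),
    partialW_add (h1.fun_add (h2.fun_mul analyticAt_const)) (h3.fun_mul analyticAt_const),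
    partialU_add h1 (h2.fun_mul analyticAt_const), partialW_add h1 (h2.fun_mul analyticAt_const),
    partialU_mul h2 analyticAt_const, partialW_mul h2 analyticAt_const,
    partialU_mul h3 analyticAt_const, partialW_mul h3 analyticAt_const]
  simp only [partialU_const, partialW_const]
  ring

theorem partialU_psi (hE : E.HolomorphicOn U) {P : ℂ × ℂ} (hP : P ∈ U) :
    partialU E.psi P = partialU E.f P * partialU E.g P + E.f P * partialU (partialU E.g) P +
      (partialU E.p P * partialU E.q P + E.p P * partialU (partialU E.q) P) := by
  have : E.psi = fun Q => E.f Q * partialU E.g Q + E.p Q * partialU E.q Q := rfl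
  rw [this, partialU_add ((hE.2.1 P hP).fun_mul (hE.2.2.1.partialU P hP))
    ((hE.2.2.2.1 P hP).fun_mul (hE.2.2.2.2.partialU P hP)), partialU_mul (hE.2.1 P hP)
    (hE.2.2.1.partialU P hP), partialU_mul (hE.2.2.2.1 P hP) (hE.2.2.2.2.partialU P hP)]

theorem partialW_psi (hE : E.HolomorphicOn U) {P : ℂ × ℂ} (hP : P ∈ U) :
    partialW E.psi P = partialW E.f P * partialU E.g P + E.f P * partialW (partialU E.g) P +
      (partialW E.p P * partialU E.q P + E.p P * partialW (partialU E.q) P) := by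
  have : E.psi = fun Q => E.f Q * partialU E.g Q + E.p Q * partialU E.q Q := rfl
  rw [this, partialW_add ((hE.2.1 P hP).fun_mul (hE.2.2.1.partialU P hP))
    ((hE.2.2.2.1 P hP).fun_mul (hE.2.2.2.2.partialU P hP)), partialW_mul (hE.2.1 P hP)
    (hE.2.2.1.partialU P hP), partialW_mul (hE.2.2.2.1 P hP) (hE.2.2.2.2.partialU P hP)]

theorem partialU_eta (hE : E.HolomorphicOn U) {P : ℂ × ℂ} (hP : P ∈ U) :
    partialU E.eta P = partialU E.f P * partialW E.g P + E.f P * partialU (partialW E.g) P +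
      (partialU E.p P * partialW E.q P + E.p P * partialU (partialW E.q) P) := by
  have : E.eta = fun Q => E.f Q * partialW E.g Q + E.p Q * partialW E.q Q := rfl
  rw [this, partialU_add ((hE.2.1 P hP).fun_mul (hE.2.2.1.partialW P hP))
    ((hE.2.2.2.1 P hP).fun_mul (hE.2.2.2.2.partialW P hP)), partialU_mul (hE.2.1 P hP)
    (hE.2.2.1.partialW P hP), partialU_mul (hE.2.2.2.1 P hP) (hE.2.2.2.2.partialW P hP)]

theorem partialW_eta (hE : E.HolomorphicOn U) {P : ℂ × ℂ} (hP : P ∈ U) :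
    partialW E.eta P = partialW E.f P * partialW E.g P + E.f P * partialW (partialW E.g) P +
      (partialW E.p P * partialW E.q P + E.p P * partialW (partialW E.q) P) := by
  have : E.eta = fun Q => E.f Q * partialW E.g Q + E.p Q * partialW E.q Q := rfl
  rw [this, partialW_add ((hE.2.1 P hP).fun_mul (hE.2.2.1.partialW P hP))
    ((hE.2.2.2.1 P hP).fun_mul (hE.2.2.2.2.partialW P hP)), partialW_mul (hE.2.1 P hP)
    (hE.2.2.1.partialW P hP), partialW_mul (hE.2.2.2.1 P hP) (hE.2.2.2.2.partialW P hP)]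

theorem lift_eq_zero {F : ℂ × ℂ → ℂ} (C : PhaseCurve U D) (hF : AnalyticOnNhd ℂ F U)
    (h : ∀ P ∈ U, F P = 0) : C.lift hF = 0 :=
  JetAlg.ext' fun j => h _ (C.mem _ j.2)

set_option maxHeartbeats 2000000 in
/-- A lattice equation `u_t = p(u) Δ_y⁻ q(w)` with `p'' = 0` and `q'' = κ q'` inherits all its
one-phase solutions in general position. -/
theorem inheritsOnePhase_of_exponential (hE : E.HolomorphicOn U) (C : PhaseCurve U D) (α κ : ℂ)
    (hphi : E.phi = fun _ => 0) (hf : E.f = fun _ => 0) (hpU : partialU E.p = fun _ => α)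
    (hpW : partialW E.p = fun _ => 0) (hqU : partialU E.q = fun _ => 0)
    (hqW : partialW (partialW E.q) = fun P => κ * partialW E.q P)
    (hn : ∀ R ∈ D, E.nonlinearity (deriv C.w R) (R, C.w R) ≠ 0) :
    E.InheritsOnePhase 3 D C.w := by
  have hphiW : partialW E.phi = fun _ => 0 := by funext P; rw [hphi, partialW_const]
  have hfW : partialW E.f = fun _ => 0 := by funext P; rw [hf, partialW_const]
  have hfWW : partialW (partialW E.f) = fun _ => 0 := by funext P; rw [hfW, partialW_const]
  have hpWW : partialW (partialW E.p) = fun _ => 0 := by funext P; rw [hpW, partialW_const]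
  have hphiWW : partialW (partialW E.phi) = fun _ => 0 := by funext P; rw [hphiW, partialW_const]
  set P := C.lift hE.2.2.2.1 with hPdef
  set h := C.lift hE.2.2.2.2.partialW with hhdef
  obtain ⟨m₁, hm, im₁⟩ := (isBase_base (D := D) C.analytic.deriv).exists_hasD
  obtain ⟨m₂, hm₁, im₂⟩ := im₁.exists_hasD
  obtain ⟨m₃, hm₂, -⟩ := im₂.exists_hasD
  change HasD C.mu m₁ at hm
  have imu : IsBase C.mu := isBase_base _
  have hcst := fun c => hasD_algebraMap (D := D) c
  have icst := fun c => isBase_algebraMap (D := D) c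
  have hW : HasD C.W C.mu := hasD_base _
  have hP : HasD P (algebraMap ℂ _ α) := (hasD_lift C hE.2.2.2.1).congr rfl <|
    JetAlg.ext' fun j => by simp [hpU, hpW]
  have hh : HasD h (algebraMap ℂ _ κ * C.mu * h) := (hasD_lift C hE.2.2.2.2.partialW).congr rfl <|
    JetAlg.ext' fun j => by simp [hqW, h, ← partialW_partialU (hE.2.2.2.2 _ (C.mem _ j.2)), hqU]; ring
  have iP : IsBase P := isBase_lift C _
  have hlam : P * h * C.mu ^ 2 = E.lam hE C := JetAlg.ext' fun j => by
    simp [lam, hphi, hf, hqU, P, h]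
  have hl := ((hP.mul hh).mul (hm.pow 2)).congr hlam rfl
  have hl₁ := ((((hcst α).mul hh).add (hP.mul (((hcst κ).mul hm).mul hh))).mul (hm.pow 2)).add
    ((hP.mul hh).mul (((hcst 2).mul (hm.pow 1)).mul hm₁))
  -- The nonlinearity equals μ² q_w (α + κ p μ); only its last factor occurs in denominators.
  have hn' : ∀ j : JetPt D, α + κ * (P j * C.mu j) ≠ 0 := fun j h0 => hn _ j.2 <| by
    have hj := C.mem _ j.2
    rw [nonlinearity_eq hE _ hj, partialU_psi hE hj, partialW_psi hE hj, partialU_eta hE hj,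
      partialW_eta hE hj, hphi, ← partialW_partialU (hE.2.2.2.2 _ hj)]
    simp only [hf, hpU, hpW, hqU, hqW, partialU_const, partialW_const]
    simp only [P, PhaseCurve.lift_apply, PhaseCurve.mu_apply] at h0
    linear_combination deriv C.w (j.1 0) ^ 2 * partialW E.q (j.1 0, C.w (j.1 0)) * h0
  have hc := (hcst α).add ((hcst κ).mul (hP.mul hm))
  have ic := (icst α).add ((icst κ).mul (iP.mul imu))
  obtain ⟨I, iI, hcI⟩ := ic.exists_inv (by simpa using hn')
  have hI := hc.of_mul_eq_one hcI
  have hQ : HasD (C.lift hE.2.2.2.2) (h * C.mu) := (hasD_lift C hE.2.2.2.2).congr rfl <|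
    JetAlg.ext' fun j => by simp [hqU, h]; ring
  have hWW : C.lift hE.2.2.2.2.partialW.partialW = algebraMap ℂ _ κ * h :=
    JetAlg.ext' fun j => by simp [hqW, h]
  have hWWW : C.lift hE.2.2.2.2.partialW.partialW.partialW = algebraMap ℂ _ (κ ^ 2) * h :=
    JetAlg.ext' fun j => by
      simp only [PhaseCurve.lift_apply, hqW, algebraMap_apply, mul_apply, h]
      rw [partialW_mul analyticAt_const (hE.2.2.2.2.partialW _ (C.mem _ j.2)), hqW]
      simp only [partialW_const]
      ring
  have hrhs : ∀ W A : ℕ → JetAlg D, ∀ n ≤ 3, rhsCoeff hE C 3 W A n =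
      P * deltaCoeff 3 (-1) A (compCoeff C hE.2.2.2.2 3 W) n := fun W A n hn => by
    have l₁ : C.lift hE.1 = 0 := lift_eq_zero C _ fun _ _ => by rw [hphi]
    have l₂ : C.lift hE.1.partialW = 0 := lift_eq_zero C _ fun _ _ => by rw [hphiW]
    have l₃ : C.lift hE.1.partialW.partialW = 0 := lift_eq_zero C _ fun _ _ => by rw [hphiWW]
    have l₄ : C.lift hE.1.partialW.partialW.partialW = 0 :=
      lift_eq_zero C _ fun _ _ => by rw [hphiWW, partialW_const]
    have l₅ : C.lift hE.2.1 = 0 := lift_eq_zero C _ fun _ _ => by rw [hf]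
    have l₆ : C.lift hE.2.1.partialW = 0 := lift_eq_zero C _ fun _ _ => by rw [hfW]
    have l₇ : C.lift hE.2.1.partialW.partialW = 0 := lift_eq_zero C _ fun _ _ => by rw [hfWW]
    have l₈ : C.lift hE.2.1.partialW.partialW.partialW = 0 :=
      lift_eq_zero C _ fun _ _ => by rw [hfWW, partialW_const]
    have l₉ : C.lift hE.2.2.2.1.partialW = 0 := lift_eq_zero C _ fun _ _ => by rw [hpW]
    have l₁₀ : C.lift hE.2.2.2.1.partialW.partialW = 0 := lift_eq_zero C _ fun _ _ => by rw [hpWW]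
    have l₁₁ : C.lift hE.2.2.2.1.partialW.partialW.partialW = 0 :=
      lift_eq_zero C _ fun _ _ => by rw [hpWW, partialW_const]
    rw [rhsCoeff]
    interval_cases n <;>
    simp only [conv_zero, conv_one, conv_two, conv_three, compCoeff_zero C _ _ (Or.inr rfl),
      compCoeff_one C _ _ (Or.inr rfl), compCoeff_two C _ _ (Or.inr rfl), compCoeff_three, l₁, l₂,
      l₃, l₄, l₅, l₆, l₇, l₈, l₉, l₁₀, l₁₁, ← hPdef, zero_mul, mul_zero, add_zero, zero_add]
  have hQe : ∀ A, evol A (C.lift hE.2.2.2.2) = h * evol A C.W := fun A => by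
    rw [hQ.evol, hW.evol, mul_assoc]
  have hhe : ∀ A, evol A h = algebraMap ℂ _ κ * (h * evol A C.W) := fun A => by
    rw [hh.evol, hW.evol]; ring
  have e0 : ∀ a b : JetAlg D, evenCoeff a b 0 = a := fun _ _ => rfl
  have e1 : ∀ a b : JetAlg D, evenCoeff a b 1 = 0 := fun _ _ => rfl
  have e2 : ∀ a b : JetAlg D, evenCoeff a b 2 = b := fun _ _ => rfl
  have hz := (hcst (1 / 12)).mul ((hm.pow 2).mul (hP.mul hI))
  have iz := (icst (1 / 12)).mul ((imu.pow 2).mul (iP.mul iI))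
  have hY := (((hm.mul hm₁).mul ((hcst (4 * α)).add ((hcst (3 * κ)).mul (hP.mul hm)))).sub
      ((hcst (2 * α * κ)).mul (hm.pow 3))).sub (hP.mul (hm₁.pow 2))
  have iY := (((imu.mul im₁).mul ((icst (4 * α)).add ((icst (3 * κ)).mul (iP.mul imu)))).sub
      ((icst (2 * α * κ)).mul (imu.pow 3))).sub (iP.mul (im₁.pow 2))
  have iy := (icst (1 / 12)).mul ((iP.mul (iI.pow 2)).mul iY)
  -- The coefficients of R_xxx and R_x R_xx at order ε² force z = μ² p / (12c) and y = p Y / (12c²),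
  -- where c = α + κpμ and I = 1/c.
  obtain ⟨z, hzdef⟩ : ∃ z, z = algebraMap ℂ _ (1 / 12) * (C.mu ^ 2 * (P * I)) := ⟨_, rfl⟩
  obtain ⟨Y, hYdef⟩ : ∃ Y, Y = (C.mu * m₁) * (algebraMap ℂ (JetAlg D) (4 * α) +
    algebraMap ℂ _ (3 * κ) * (P * C.mu)) - algebraMap ℂ _ (2 * α * κ) * C.mu ^ 3 - P * m₁ ^ 2 :=
    ⟨_, rfl⟩
  obtain ⟨y, hydef⟩ : ∃ y, y = algebraMap ℂ _ (1 / 12) * ((P * I ^ 2) * Y) := ⟨_, rfl⟩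
  rw [← hYdef] at hY iY iy
  rw [← hydef] at iy
  rw [← hzdef] at iz
  obtain ⟨z', hz', iz'⟩ := iz.exists_hasD
  obtain ⟨z'', hz'', -⟩ := iz'.exists_hasD
  obtain ⟨y', hy', -⟩ := iy.exists_hasD
  obtain ⟨c, hcdef⟩ : ∃ c, c = algebraMap ℂ (JetAlg D) α + algebraMap ℂ _ κ * (P * C.mu) :=
    ⟨_, rfl⟩
  have hc₁ : HasD c (algebraMap ℂ _ κ * (algebraMap ℂ _ α * C.mu + P * m₁)) :=
    hc.congr hcdef.symm (by ring)
  have hc₂ := (hcst κ).mul (((hcst α).mul hm).add (hP.mul hm₁))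
  have hA : HasD (algebraMap ℂ _ (1 / 12) * (C.mu ^ 2 * P)) (algebraMap ℂ _ (1 / 12) *
      (2 * (C.mu * m₁) * P + algebraMap ℂ _ α * C.mu ^ 2)) :=
    ((hcst _).mul ((hm.pow 2).mul hP)).congr rfl <| JetAlg.ext' fun j => by simp; ring
  have htwo : (algebraMap ℂ (JetAlg D) 2) = 2 := map_ofNat _ 2
  have hA₂ := (hcst (1 / 12)).mul ((((hcst 2).mul (hm.mul hm₁)).mul hP).add
    ((hcst α).mul (hm.pow 2)))
  rw [htwo] at hA₂
  rw [← hcdef] at hcI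
  -- Differentiating this denominator-free relation, and the one for c² y, gives linear equations
  -- for z', z'' and y'.
  have rz : c * z = algebraMap ℂ _ (1 / 12) * (C.mu ^ 2 * P) := by
    linear_combination (algebraMap ℂ (JetAlg D) (1 / 12) * C.mu ^ 2 * P) * hcI + c * hzdef
  have rz' := ((hc₁.mul hz').congr rz rfl).unique hA
  have rz'' := (((hc₂.mul hz').add (hc₁.mul hz'')).congr rz' rfl).unique hA₂
  have ry : c ^ 2 * y = algebraMap ℂ _ (1 / 12) * (P * Y) := by
    linear_combination (algebraMap ℂ (JetAlg D) (1 / 12) * P * Y * (c * I + 1)) * hcI +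
      c ^ 2 * hydef
  have ry' := (((hc₁.pow 2).mul hy').congr ry rfl).unique ((hcst (1 / 12)).mul (hP.mul hY))
  have hl' : HasD (E.lam hE C) (h * (algebraMap ℂ _ α * C.mu ^ 2 +
      algebraMap ℂ _ κ * (P * C.mu ^ 3) + algebraMap ℂ _ 2 * (P * (C.mu * m₁)))) :=
    hl.congr rfl <| JetAlg.ext' fun j => by simp; ring
  have hl₁ : HasD _ (h * (algebraMap ℂ _ 4 * (algebraMap ℂ _ α * (C.mu * m₁)) +
      algebraMap ℂ _ (2 * α * κ) * C.mu ^ 3 + algebraMap ℂ _ (5 * κ) * (P * (C.mu ^ 2 * m₁)) +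
      algebraMap ℂ _ (κ ^ 2) * (P * C.mu ^ 4) +
      algebraMap ℂ _ 2 * (P * m₁ ^ 2) + algebraMap ℂ _ 2 * (P * (C.mu * m₂)))) :=
    (hh.mul ((((hcst α).mul (hm.pow 2)).add ((hcst κ).mul (hP.mul (hm.pow 3)))).add
      ((hcst 2).mul (hP.mul (hm.mul hm₁))))).congr rfl <| JetAlg.ext' fun j => by simp; ring
  have hl₂ := hh.mul (((((((hcst 4).mul ((hcst α).mul (hm.mul hm₁))).add
      ((hcst (2 * α * κ)).mul (hm.pow 3))).add
      ((hcst (5 * κ)).mul (hP.mul ((hm.pow 2).mul hm₁)))).add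
      ((hcst (κ ^ 2)).mul (hP.mul (hm.pow 4)))).add
      ((hcst 2).mul (hP.mul (hm₁.pow 2)))).add
      ((hcst 2).mul (hP.mul (hm.mul hm₂))))
  refine inheritsOnePhase_of_ratios hE C hm hm₁ hm₂ hl' hl₁ hl₂ hz' hz'' hy' iz iy ?_ ?_ ?_
  -- Orders ε and ε³ vanish for any V, since p (T_y^{1/2} - T_y^{-1/2}) q(v) / ε is even in ε.
  · rw [hrhs _ _ _ (by norm_num), deltaCoeff_one _ _ _ (by norm_num)]
    simp only [compCoeff_zero C _ _ (Or.inr rfl), compCoeff_one C _ _ (Or.inr rfl), ← hhdef, symW,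
      e0, e1, evol_zero, Derivation.leibniz, Derivation.map_algebraMap, smul_eq_mul, hQe, hhe]
    refine JetAlg.ext' fun j => ?_
    simp [-mul_eq_zero]
    ring
  · rw [hrhs _ _ _ (by norm_num), deltaCoeff_two _ _ _ (by norm_num)]
    simp only [compCoeff_zero C _ _ (Or.inr rfl), compCoeff_one C _ _ (Or.inr rfl),
      compCoeff_two C _ _ (Or.inr rfl), ← hhdef, symW, hWW,
      e0, e1, e2, evol_zero, symA, symV]
    simp only [Derivation.leibniz, Derivation.leibniz_pow, Derivation.map_algebraMap, smul_eq_mul,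
      map_add, map_sub, nsmul_eq_mul,
      hQ.evol, hh.evol, hW.evol, hm.evol, hm₁.evol, hm₂.evol, evol_X, hz'.evol, hz''.evol,
      hy'.evol, hz'.Dx, hz''.Dx, hy'.Dx, Function.iterate_succ_apply', Function.iterate_zero, id,
      Dx_X, hm.Dx, hm₁.Dx, hm₂.Dx]
    refine JetAlg.ext' fun j => ?_
    have pz := congrArg (fun F : JetAlg D => F j) rz
    have pz' := congrArg (fun F : JetAlg D => F j) rz'
    have pz'' := congrArg (fun F : JetAlg D => F j) rz''
    have py := congrArg (fun F : JetAlg D => F j) ry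
    have py' := congrArg (fun F : JetAlg D => F j) ry'
    have pc := congrArg (fun F : JetAlg D => F j) hcdef
    have pY := congrArg (fun F : JetAlg D => F j) hYdef
    have pn := hn' j
    simp [-PhaseCurve.mu_apply] at pz pz' pz'' py py' pc pY ⊢
    rw [show α + κ * (P j * C.mu j) = c j from pc.symm] at pn
    -- Eliminating α in favour of the non-zero c turns the claim into a rational identity with
    -- denominators powers of c.
    have eα : α = c j - κ * (P j * C.mu j) := by linear_combination -pc
    have ez : z j = C.mu j ^ 2 * P j / (12 * c j) := by
      field_simp; linear_combination 12 * pz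
    have ez' : z' j = (12⁻¹ * (2 * (C.mu j * m₁ j) * P j + α * C.mu j ^ 2) -
        κ * (α * C.mu j + P j * m₁ j) * z j) / c j := by
      field_simp; linear_combination 12 * pz'
    have ez'' : z'' j = (12⁻¹ * (2 * (m₁ j * m₁ j + C.mu j * m₂ j) * P j +
        4 * (C.mu j * m₁ j) * α) - κ * (α * m₁ j + (α * m₁ j + P j * m₂ j)) * z j -
        2 * (κ * (α * C.mu j + P j * m₁ j) * z' j)) / c j := by
      field_simp; linear_combination 12 * pz''
    have ey : y j = 12⁻¹ * (P j * Y j) / c j ^ 2 := by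
      field_simp; linear_combination 12 * py
    have ey' := eq_div_of_mul_eq (pow_ne_zero 2 pn)
      ((mul_comm _ _).trans (eq_sub_of_add_eq' py'))
    rw [ey', ey, ez'', ez', ez, pY]
    simp only [eα]
    field_simp
    ring
  · rw [hrhs _ _ _ (by norm_num), deltaCoeff_three _ _ _ (by norm_num) rfl rfl]
    simp only [compCoeff_zero C _ _ (Or.inr rfl), compCoeff_one C _ _ (Or.inr rfl),
      compCoeff_two C _ _ (Or.inr rfl), compCoeff_three, ← hhdef, symW, hWW, hWWW,
      e0, e2]
    simp only [evol_zero, Derivation.leibniz, Derivation.map_algebraMap, map_add,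
      smul_eq_mul, hQe, hhe, Derivation.leibniz_pow, nsmul_eq_mul, Derivation.map_natCast]
    refine JetAlg.ext' fun j => ?_
    simp [-mul_eq_zero]
    ring

end TodaEquation

/-! ### The one-phase solutions of the square-root equation -/

namespace TodaEquation

open JetAlg

variable {E : TodaEquation} {U : Set (ℂ × ℂ)} {D : Opens ℂ}

section SquareRoot

variable {s : ℂ × ℂ → ℂ}

theorem partialU_sqrt (hU : IsOpen U) (hs : AnalyticOnNhd ℂ s U) (hsq : ∀ P ∈ U, s P ^ 2 = P.1)
    {P : ℂ × ℂ} (hP : P ∈ U) : 2 * s P * partialU s P = 1 := by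
  have h1 : partialU (fun Q => s Q * s Q) P = partialU (fun Q => Q.1) P :=
    partialU_congr (by filter_upwards [hU.mem_nhds hP] with Q hQ; rw [← hsq Q hQ, pow_two])
  rw [partialU_mul (hs P hP) (hs P hP), partialU_comp_fst (s := fun x => x) (hasDerivAt_id _)] at h1
  linear_combination h1

/-- Differentiating s² = u gives 2 s s_u = 1: a holomorphic branch cannot exist at u = 0. -/
theorem sqrt_ne_zero (hU : IsOpen U) (hs : AnalyticOnNhd ℂ s U) (hsq : ∀ P ∈ U, s P ^ 2 = P.1)
    {P : ℂ × ℂ} (hP : P ∈ U) : s P ≠ 0 := fun h0 => by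
  simpa [h0] using partialU_sqrt hU hs hsq hP

theorem partialW_sqrt (hU : IsOpen U) (hs : AnalyticOnNhd ℂ s U) (hsq : ∀ P ∈ U, s P ^ 2 = P.1)
    {P : ℂ × ℂ} (hP : P ∈ U) : partialW s P = 0 := by
  have h1 : partialW (fun Q => s Q * s Q) P = partialW (fun Q => Q.1) P :=
    partialW_congr (by filter_upwards [hU.mem_nhds hP] with Q hQ; rw [← hsq Q hQ, pow_two])
  rw [partialW_mul (hs P hP) (hs P hP), partialW_comp_fst (s := fun x => x) (hasDerivAt_id _)] at h1
  have h2 : s P * partialW s P = 0 := by linear_combination h1 / 2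
  exact (mul_eq_zero.1 h2).resolve_left (sqrt_ne_zero hU hs hsq hP)

theorem analyticOnNhd_exp_snd : AnalyticOnNhd ℂ (fun P : ℂ × ℂ => Complex.exp P.2) U :=
  fun P _ => analyticAt_snd.cexp

theorem analyticAt_exp_snd (P : ℂ × ℂ) : AnalyticAt ℂ (fun P : ℂ × ℂ => Complex.exp P.2) P :=
  analyticOnNhd_exp_snd P (Set.mem_univ P)

theorem analyticOnNhd_exp_mul {s : ℂ × ℂ → ℂ} (hs : AnalyticOnNhd ℂ s U) :
    AnalyticOnNhd ℂ (fun P => Complex.exp P.2 * s P) U :=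
  fun P hP => (analyticAt_exp_snd P).fun_mul (hs P hP)

theorem partialW_exp_snd (P : ℂ × ℂ) :
    partialW (fun P => Complex.exp P.2) P = Complex.exp P.2 :=
  partialW_comp_snd (Complex.hasDerivAt_exp _)

theorem partialU_exp_snd (P : ℂ × ℂ) : partialU (fun P => Complex.exp P.2) P = 0 :=
  partialU_comp_snd (Complex.hasDerivAt_exp _)

theorem holomorphicOn_sqrtToda (hs : AnalyticOnNhd ℂ s U) : (sqrtToda s).HolomorphicOn U :=
  ⟨analyticOnNhd_const, analyticOnNhd_exp_mul hs, hs, hs, analyticOnNhd_exp_mul hs⟩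

theorem partialW_exp_mul_sqrt (hU : IsOpen U) (hs : AnalyticOnNhd ℂ s U)
    (hsq : ∀ P ∈ U, s P ^ 2 = P.1) {P : ℂ × ℂ} (hP : P ∈ U) :
    partialW (fun P => Complex.exp P.2 * s P) P = Complex.exp P.2 * s P := by
  rw [partialW_mul (analyticAt_exp_snd P) (hs P hP), partialW_exp_snd,
    partialW_sqrt hU hs hsq hP, mul_zero, add_zero]

theorem partialU_exp_mul_sqrt (hs : AnalyticOnNhd ℂ s U) {P : ℂ × ℂ} (hP : P ∈ U) :
    partialU (fun P => Complex.exp P.2 * s P) P = Complex.exp P.2 * partialU s P := by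
  rw [partialU_mul (analyticAt_exp_snd P) (hs P hP), partialU_exp_snd,
    zero_mul, zero_add]

theorem psi_sqrtToda (hU : IsOpen U) (hs : AnalyticOnNhd ℂ s U)
    (hsq : ∀ P ∈ U, s P ^ 2 = P.1) {P : ℂ × ℂ} (hP : P ∈ U) :
    (sqrtToda s).psi P = Complex.exp P.2 := by
  simp only [psi, sqrtToda, partialU_exp_mul_sqrt hs hP]
  linear_combination Complex.exp P.2 * partialU_sqrt hU hs hsq hP

theorem eta_sqrtToda (hU : IsOpen U) (hs : AnalyticOnNhd ℂ s U)
    (hsq : ∀ P ∈ U, s P ^ 2 = P.1) {P : ℂ × ℂ} (hP : P ∈ U) :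
    (sqrtToda s).eta P = P.1 * Complex.exp P.2 := by
  simp only [eta, sqrtToda, partialW_exp_mul_sqrt hU hs hsq hP, partialW_sqrt hU hs hsq hP]
  linear_combination Complex.exp P.2 * hsq P hP

theorem partialW_eta_sqrtToda (hU : IsOpen U) (hs : AnalyticOnNhd ℂ s U)
    (hsq : ∀ P ∈ U, s P ^ 2 = P.1) {P : ℂ × ℂ} (hP : P ∈ U) :
    partialW (sqrtToda s).eta P = P.1 * Complex.exp P.2 := by
  rw [partialW_congr (G := fun Q => Q.1 * Complex.exp Q.2) (by
    filter_upwards [hU.mem_nhds hP] with Q hQ using eta_sqrtToda hU hs hsq hQ),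
    partialW_mul analyticAt_fst (analyticAt_exp_snd P), partialW_exp_snd,
    partialW_comp_fst (s := fun x => x) (hasDerivAt_id _), zero_mul, zero_add]

theorem nonlinearity_sqrtToda (hU : IsOpen U) (hs : AnalyticOnNhd ℂ s U)
    (hsq : ∀ P ∈ U, s P ^ 2 = P.1) (μ : ℂ) {P : ℂ × ℂ} (hP : P ∈ U) :
    (sqrtToda s).nonlinearity μ P = Complex.exp P.2 * μ ^ 2 * (2 + P.1 * μ) := by
  have hpsi : (sqrtToda s).psi =ᶠ[𝓝 P] fun Q => Complex.exp Q.2 := by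
    filter_upwards [hU.mem_nhds hP] with Q hQ using psi_sqrtToda hU hs hsq hQ
  have heta : (sqrtToda s).eta =ᶠ[𝓝 P] fun Q => Q.1 * Complex.exp Q.2 := by
    filter_upwards [hU.mem_nhds hP] with Q hQ using eta_sqrtToda hU hs hsq hQ
  rw [nonlinearity_eq (holomorphicOn_sqrtToda hs) μ hP, partialU_congr hpsi, partialW_congr hpsi,
    partialU_congr heta, partialW_eta_sqrtToda hU hs hsq hP, partialU_exp_snd, partialW_exp_snd,
    partialU_mul analyticAt_fst (analyticAt_exp_snd P), partialU_exp_snd,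
    partialU_comp_fst (s := fun x => x) (hasDerivAt_id _)]
  simp only [sqrtToda, partialU_const, partialW_const]
  ring

set_option maxHeartbeats 2000000 in
-- With w = T^{1/2} v the two differences telescope to √u (T^{1/2}e^v · T√u - T^{-1/2}e^v ·
-- T^{-1}√u)/ε, which is even in ε, so orders ε and ε³ hold for any V. Order ε² fixes z and y as in
-- the exponential case.
theorem inheritsOnePhase_sqrtToda (hU : IsOpen U) (hs : AnalyticOnNhd ℂ s U)
    (hsq : ∀ P ∈ U, s P ^ 2 = P.1) (C : PhaseCurve U D)
    (hn : ∀ R ∈ D, (sqrtToda s).nonlinearity (deriv C.w R) (R, C.w R) ≠ 0) :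
    (sqrtToda s).InheritsOnePhase 3 D C.w := by
  have hE := holomorphicOn_sqrtToda hs
  have hes := analyticOnNhd_exp_mul hs
  obtain ⟨m₁, hm, im₁⟩ := (isBase_base (D := D) C.analytic.deriv).exists_hasD
  obtain ⟨m₂, hm₁, im₂⟩ := im₁.exists_hasD
  obtain ⟨m₃, hm₂, -⟩ := im₂.exists_hasD
  change HasD C.mu m₁ at hm
  have imu : IsBase C.mu := isBase_base _
  have hcst := fun c => hasD_algebraMap (D := D) c
  have icst := fun c => isBase_algebraMap (D := D) c
  have hW : HasD C.W C.mu := hasD_base _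
  have hu : HasD (X 0 : JetAlg D) 1 := hasD_X_zero
  have iu : IsBase (X 0 : JetAlg D) := isBase_X_zero
  obtain ⟨S, hSdef⟩ : ∃ S, S = C.lift hs := ⟨_, rfl⟩
  obtain ⟨J, hJdef⟩ : ∃ J, J = C.lift (analyticOnNhd_exp_snd (U := U)) := ⟨_, rfl⟩
  have iS : IsBase S := hSdef ▸ isBase_lift C _
  obtain ⟨T, iT, hST⟩ := iS.exists_inv fun j => by
    rw [hSdef]; exact sqrt_ne_zero hU hs hsq (C.mem _ j.2)
  have hSS : S ^ 2 = X 0 := JetAlg.ext' fun j => by simp [hSdef, hsq _ (C.mem _ j.2)]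
  have hSU : C.lift hs.partialU = algebraMap ℂ _ (1 / 2) * T := JetAlg.ext' fun j => by
    have h1 := congrArg (fun F : JetAlg D => F j) hST
    have h2 := partialU_sqrt hU hs hsq (C.mem _ j.2)
    simp [hSdef] at h1 ⊢
    linear_combination T j / 2 * h2 - partialU s (j.1 0, C.w (j.1 0)) * h1
  have hS : HasD S (algebraMap ℂ _ (1 / 2) * T) := (hasD_lift C hs).congr hSdef.symm <|
    JetAlg.ext' fun j => by
      rw [hSU]; simp [partialW_sqrt hU hs hsq (C.mem _ j.2)]
  have hT := hS.of_mul_eq_one hST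
  have hJ : HasD J (C.mu * J) := (hasD_lift C analyticOnNhd_exp_snd).congr hJdef.symm <|
    JetAlg.ext' fun j => by simp [hJdef, partialU_exp_snd, partialW_exp_snd]
  have hQ : C.lift hes = J * S := JetAlg.ext' fun j => by simp [hJdef, hSdef]
  have hQW : C.lift hes.partialW = J * S := JetAlg.ext' fun j => by
    simp [hJdef, hSdef, partialW_exp_mul_sqrt hU hs hsq (C.mem _ j.2)]
  have hpp : ∀ P ∈ U, partialW (partialW fun P => Complex.exp P.2 * s P) P =
      Complex.exp P.2 * s P := fun P hP => by
    rw [partialW_congr (G := fun P => Complex.exp P.2 * s P) (by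
      filter_upwards [hU.mem_nhds hP] with Q hQ using partialW_exp_mul_sqrt hU hs hsq hQ),
      partialW_exp_mul_sqrt hU hs hsq hP]
  have hQWW : C.lift hes.partialW.partialW = J * S := JetAlg.ext' fun j => by
    simp [hJdef, hSdef, hpp _ (C.mem _ j.2)]
  have hQWWW : C.lift hes.partialW.partialW.partialW = J * S := JetAlg.ext' fun j => by
    simp only [PhaseCurve.lift_apply, mul_apply, hJdef, hSdef]
    rw [partialW_congr (G := fun P => Complex.exp P.2 * s P) (by
      filter_upwards [hU.mem_nhds (C.mem _ j.2)] with Q hQ using hpp Q hQ),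
      partialW_exp_mul_sqrt hU hs hsq (C.mem _ j.2)]
  have hSW : C.lift hs.partialW = 0 :=
    lift_eq_zero C _ fun P hP => partialW_sqrt hU hs hsq hP
  have hpp0 : ∀ P ∈ U, partialW (partialW s) P = 0 := fun P hP => by
    rw [partialW_congr (G := fun _ => 0) (by
      filter_upwards [hU.mem_nhds hP] with Q hQ using partialW_sqrt hU hs hsq hQ), partialW_const]
  have hSWW : C.lift hs.partialW.partialW = 0 := lift_eq_zero C _ hpp0
  have hSWWW : C.lift hs.partialW.partialW.partialW = 0 := lift_eq_zero C _ fun P hP => by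
    rw [partialW_congr (G := fun _ => 0) (by
      filter_upwards [hU.mem_nhds hP] with Q hQ using hpp0 Q hQ), partialW_const]
  have hlam : J * (C.mu + X 0 * C.mu ^ 2) = (sqrtToda s).lam hE C := JetAlg.ext' fun j => by
    rw [lam_apply, speed, psi_sqrtToda hU hs hsq (C.mem _ j.2),
      eta_sqrtToda hU hs hsq (C.mem _ j.2)]
    simp [hJdef, sqrtToda]
    ring
  have hn' : ∀ j : JetPt D, C.mu j * (2 + j.1 0 * C.mu j) ≠ 0 := fun j h0 => hn _ j.2 <| by
    rw [nonlinearity_sqrtToda hU hs hsq _ (C.mem _ j.2)]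
    simp only [PhaseCurve.mu_apply] at h0
    linear_combination Complex.exp (C.w (j.1 0)) * deriv C.w (j.1 0) * h0
  have hrhs : ∀ W A : ℕ → JetAlg D, ∀ n, rhsCoeff hE C 3 W A n =
      compCoeff C hE.1 3 W n * X 1 +
      conv (· * ·) (compCoeff C hes 3 W) (deltaCoeff 3 1 A (compCoeff C hs 3 W)) n +
      conv (· * ·) (compCoeff C hs 3 W) (deltaCoeff 3 (-1) A (compCoeff C hes 3 W)) n :=
    fun _ _ _ => rfl
  have l₁ : C.lift hE.1 = 0 := lift_eq_zero C _ fun _ _ => rfl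
  have l₂ : C.lift hE.1.partialW = 0 := lift_eq_zero C _ fun P _ => partialW_const 0
  have hz0 : partialW (sqrtToda s).phi = fun _ => 0 := by
    funext P; exact partialW_const 0
  have l₃ : C.lift hE.1.partialW.partialW = 0 := lift_eq_zero C _ fun P _ => by
    rw [hz0, partialW_const]
  have hz1 : partialW (partialW (sqrtToda s).phi) = fun _ => 0 := by
    funext P; rw [hz0, partialW_const]
  have l₄ : C.lift hE.1.partialW.partialW.partialW = 0 := lift_eq_zero C _ fun P _ => by
    rw [hz1, partialW_const]
  have hJe : ∀ A, evol A J = J * evol A C.W := fun A => by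
    rw [hJ.evol, hW.evol]; ring
  have e0 : ∀ a b : JetAlg D, evenCoeff a b 0 = a := fun _ _ => rfl
  have e1 : ∀ a b : JetAlg D, evenCoeff a b 1 = 0 := fun _ _ => rfl
  have e2 : ∀ a b : JetAlg D, evenCoeff a b 2 = b := fun _ _ => rfl
  have hV := hT.pow 2
  have iV := iT.pow 2
  have hY := (((hm.mul hm₁).mul ((hcst 5).add ((hcst 3).mul (hu.mul hm)))).sub (hm.pow 3)).sub
    ((hu.mul (hm₁.pow 2)).add ((hcst 3).mul ((hm.pow 2).mul hV)))
  have iY := (((imu.mul im₁).mul ((icst 5).add ((icst 3).mul (iu.mul imu)))).sub (imu.pow 3)).sub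
    ((iu.mul (im₁.pow 2)).add ((icst 3).mul ((imu.pow 2).mul iV)))
  -- The nonlinearity is e^w μ² (2 + uμ). In the coefficient of R_xxx the factor 2 + uμ cancels,
  -- leaving z = μ/12; the coefficient of R_x R_xx gives y = Y/(12c) with c = μ(2 + uμ). Here `T ^
  -- 2` is 1/u.
  obtain ⟨Y, hYdef⟩ : ∃ Y, Y = C.mu * m₁ * (algebraMap ℂ (JetAlg D) 5 +
    algebraMap ℂ _ 3 * (X 0 * C.mu)) - C.mu ^ 3 - (X 0 * m₁ ^ 2 +
      algebraMap ℂ _ 3 * (C.mu ^ 2 * T ^ 2)) := ⟨_, rfl⟩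
  rw [← hYdef] at hY iY
  have hc := hm.mul ((hcst 2).add (hu.mul hm))
  have ic := imu.mul ((icst 2).add (iu.mul imu))
  obtain ⟨c, hcdef⟩ : ∃ c, c = C.mu * (algebraMap ℂ (JetAlg D) 2 + X 0 * C.mu) := ⟨_, rfl⟩
  rw [← hcdef] at hc ic
  obtain ⟨I, iI, hcI⟩ := ic.exists_inv (by rw [hcdef]; simpa using hn')
  have iy := (icst (1 / 12)).mul (iI.mul iY)
  obtain ⟨y, hydef⟩ : ∃ y, y = algebraMap ℂ _ (1 / 12) * (I * Y) := ⟨_, rfl⟩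
  rw [← hydef] at iy
  obtain ⟨y', hy', -⟩ := iy.exists_hasD
  have hz' : HasD (algebraMap ℂ _ (1 / 12) * C.mu) (algebraMap ℂ _ (1 / 12) * m₁) :=
    ((hcst _).mul hm).congr rfl (by ring)
  have hz'' : HasD (algebraMap ℂ _ (1 / 12) * m₁) (algebraMap ℂ _ (1 / 12) * m₂) :=
    ((hcst _).mul hm₁).congr rfl (by ring)
  have ry : c * y = algebraMap ℂ _ (1 / 12) * Y := by
    linear_combination (algebraMap ℂ (JetAlg D) (1 / 12) * Y) * hcI + c * hydef
  have ry' := ((hc.mul hy').congr ry rfl).unique ((hcst (1 / 12)).mul hY)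
  have hl := (hJ.mul (hm.add (hu.mul (hm.pow 2)))).congr hlam rfl
  have hl' : HasD ((sqrtToda s).lam hE C) (J * (algebraMap ℂ _ 2 * C.mu ^ 2 + X 0 * C.mu ^ 3 +
      m₁ + algebraMap ℂ _ 2 * (X 0 * (C.mu * m₁)))) :=
    hl.congr rfl <| JetAlg.ext' fun j => by simp; ring
  have hl₁ : HasD _ (J * (algebraMap ℂ _ 3 * C.mu ^ 3 + X 0 * C.mu ^ 4 +
      algebraMap ℂ _ 7 * (C.mu * m₁) + algebraMap ℂ _ 5 * (X 0 * (C.mu ^ 2 * m₁)) + m₂ +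
      algebraMap ℂ _ 2 * (X 0 * (m₁ ^ 2 + C.mu * m₂)))) :=
    (hJ.mul (((((hcst 2).mul (hm.pow 2)).add (hu.mul (hm.pow 3))).add hm₁).add
      ((hcst 2).mul (hu.mul (hm.mul hm₁))))).congr rfl <| JetAlg.ext' fun j => by simp; ring
  have hl₂ := hJ.mul ((((((hcst 3).mul (hm.pow 3)).add (hu.mul (hm.pow 4))).add
    ((hcst 7).mul (hm.mul hm₁))).add ((hcst 5).mul (hu.mul ((hm.pow 2).mul hm₁)))).add hm₂ |>.add
    ((hcst 2).mul (hu.mul ((hm₁.pow 2).add (hm.mul hm₂)))))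
  refine inheritsOnePhase_of_ratios hE C hm hm₁ hm₂ hl' hl₁ hl₂ hz' hz'' hy'
    ((icst _).mul imu) iy ?_ ?_ ?_
  · rw [hrhs, conv_one, conv_one]
    simp only [deltaCoeff_zero, deltaCoeff_one _ _ _ (show 1 ≤ 3 by norm_num),
      compCoeff_zero C _ _ (Or.inr rfl), compCoeff_one C _ _ (Or.inr rfl), symW, hQ, hQW,
      ← hSdef, hSW, l₁, l₂, zero_mul, map_zero,
      e0, e1, evol_zero, Derivation.leibniz, Derivation.map_algebraMap, smul_eq_mul, hJe]
    refine JetAlg.ext' fun j => ?_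
    simp [-mul_eq_zero, hJe]
    ring
  · rw [hrhs, conv_two, conv_two]
    simp only [deltaCoeff_zero, deltaCoeff_one _ _ _ (show 1 ≤ 3 by norm_num),
      deltaCoeff_two _ _ _ (show 2 ≤ 3 by norm_num),
      compCoeff_zero C _ _ (Or.inr rfl), compCoeff_one C _ _ (Or.inr rfl),
      compCoeff_two C _ _ (Or.inr rfl), symW, hQ, hQW, hQWW,
      ← hSdef, hSW, hSWW, l₁, l₂, l₃, zero_mul, mul_zero, map_zero, add_zero,
      e0, e1, e2, evol_zero, symA, symV]
    simp only [Derivation.leibniz, Derivation.leibniz_pow, Derivation.map_algebraMap, smul_eq_mul,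
      map_add, map_sub, nsmul_eq_mul, map_neg, Derivation.map_natCast,
      hS.evol, hT.evol, hJ.evol, hW.evol, hm.evol, hm₁.evol, hm₂.evol, evol_X,
      hy'.evol, hy'.Dx, Function.iterate_succ_apply', Function.iterate_zero, id,
      Dx_X, hm.Dx, hm₁.Dx, hm₂.Dx]
    refine JetAlg.ext' fun j => ?_
    have py := congrArg (fun F : JetAlg D => F j) ry
    have py' := congrArg (fun F : JetAlg D => F j) ry'
    have pc := congrArg (fun F : JetAlg D => F j) hcdef
    have pY := congrArg (fun F : JetAlg D => F j) hYdef
    have pT := congrArg (fun F : JetAlg D => F j) hST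
    have pS := congrArg (fun F : JetAlg D => F j) hSS
    have pn := hn' j
    simp [-PhaseCurve.mu_apply, -mul_eq_zero] at py py' pc pY pT pS pn ⊢
    have pcn : c j ≠ 0 := pc ▸ pn
    have hS0 : S j ≠ 0 := left_ne_zero_of_mul (pT.trans_ne one_ne_zero)
    have hm0 : C.mu j ≠ 0 := left_ne_zero_of_mul pn
    have hu0 : 2 + S j ^ 2 * C.mu j ≠ 0 := pS ▸ right_ne_zero_of_mul pn
    have eT : T j = (S j)⁻¹ := eq_inv_of_mul_eq_one_right pT
    have ey : y j = 12⁻¹ * Y j / c j := eq_div_of_mul_eq pcn ((mul_comm _ _).trans py)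
    have ey' := eq_div_of_mul_eq pcn ((mul_comm _ _).trans (eq_sub_of_add_eq' py'))
    rw [ey', ey, pY, pc, eT, ← pS]
    field_simp
    ring
  · rw [hrhs, conv_three, conv_three]
    simp only [deltaCoeff_zero, deltaCoeff_one _ _ _ (show 1 ≤ 3 by norm_num),
      deltaCoeff_two _ _ _ (show 2 ≤ 3 by norm_num),
      deltaCoeff_three _ _ _ (show 3 ≤ 3 by norm_num) (show evenCoeff _ _ 1 = 0 from rfl)
        (show evenCoeff _ _ 3 = 0 from rfl),
      compCoeff_zero C _ _ (Or.inr rfl), compCoeff_one C _ _ (Or.inr rfl),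
      compCoeff_two C _ _ (Or.inr rfl), compCoeff_three, symW, hQ, hQW, hQWW, hQWWW,
      ← hSdef, hSW, hSWW, hSWWW, l₁, l₂, l₃, l₄, zero_mul, mul_zero, map_zero, add_zero,
      e0, e1, e2]
    simp only [evol_zero, Derivation.leibniz, Derivation.map_algebraMap, map_add, zero_add,
      add_zero, map_zero, smul_eq_mul, hJe, Derivation.leibniz_pow, nsmul_eq_mul,
      Derivation.map_natCast]
    refine JetAlg.ext' fun j => ?_
    simp [-mul_eq_zero]
    ring

end SquareRoot

end TodaEquation

/-! ### Non-degeneracy and integrability of the listed equations -/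

namespace TodaEquation

variable {E : TodaEquation} {U : Set (ℂ × ℂ)}

theorem integrableModulo_of_forall_curve {N : ℕ}
    (h : ∀ {D : Opens ℂ} (C : PhaseCurve U D),
      (∀ R ∈ D, E.nonlinearity (deriv C.w R) (R, C.w R) ≠ 0) → E.InheritsOnePhase N D C.w) :
    E.IntegrableModulo U N := fun D w hw hn =>
  h (D := ⟨D, hw.1⟩) ⟨w, hw.2.1, hw.2.2⟩ hn

theorem exists_mem_affine_ne_zero (hU : IsOpen U) (hne : U.Nonempty) {α β : ℂ}
    (h : α ≠ 0 ∨ β ≠ 0) : ∃ P ∈ U, α * P.1 + β ≠ 0 := by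
  obtain ⟨P, hP⟩ := hne
  by_cases h0 : α * P.1 + β = 0
  · have hα : α ≠ 0 := by
      rintro rfl
      rcases h with h | h
      · exact h rfl
      · exact h (by simpa using h0)
    have hc : ContinuousAt (fun t : ℂ => ((P.1 + t, P.2) : ℂ × ℂ)) 0 := by fun_prop
    have h1 : ∀ᶠ t in 𝓝 (0 : ℂ), ((P.1 + t, P.2) : ℂ × ℂ) ∈ U :=
      hc.eventually (hU.mem_nhds (by simpa using hP))
    obtain ⟨t, ht, ht0⟩ := ((h1.filter_mono nhdsWithin_le_nhds).and
      (self_mem_nhdsWithin (a := (0 : ℂ)) (s := {0}ᶜ))).exists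
    refine ⟨_, ht, fun h2 => ?_⟩
    have : α * t = 0 := by linear_combination h2 - h0
    exact (mul_ne_zero hα ht0) this
  · exact ⟨P, hP, h0⟩

theorem holomorphicOn_toda : toda.HolomorphicOn U :=
  ⟨analyticOnNhd_const, analyticOnNhd_const, analyticOnNhd_const, analyticOnNhd_fst,
    analyticOnNhd_snd⟩

theorem holomorphicOn_volterra (α β : ℂ) : (volterra α β).HolomorphicOn U :=
  ⟨analyticOnNhd_const, analyticOnNhd_const, analyticOnNhd_const,
    (analyticOnNhd_const.mul analyticOnNhd_fst).add analyticOnNhd_const, analyticOnNhd_exp_snd⟩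

theorem hasDerivAt_affine (α β x : ℂ) : HasDerivAt (fun x => α * x + β) α x := by
  simpa using ((hasDerivAt_id x).const_mul α).add_const β

theorem partialU_affine (α β : ℂ) : partialU (fun P => α * P.1 + β) = fun _ => α := by
  funext P; exact partialU_comp_fst (s := fun x => α * x + β) (hasDerivAt_affine α β _)

theorem partialW_affine (α β : ℂ) : partialW (fun P => α * P.1 + β) = fun _ => 0 := by
  funext P; exact partialW_comp_fst (s := fun x => α * x + β) (hasDerivAt_affine α β _)

theorem partialU_fst : partialU (fun P => P.1) = fun _ => 1 := by
  funext P; exact partialU_comp_fst (s := fun x => x) (hasDerivAt_id _)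

theorem partialW_fst : partialW (fun P => P.1) = fun _ => 0 := by
  funext P; exact partialW_comp_fst (s := fun x => x) (hasDerivAt_id _)

theorem partialU_snd : partialU (fun P => P.2) = fun _ => 0 := by
  funext P; exact partialU_comp_snd (s := fun x => x) (hasDerivAt_id _)

theorem partialW_snd : partialW (fun P => P.2) = fun _ => 1 := by
  funext P; exact partialW_comp_snd (s := fun x => x) (hasDerivAt_id _)

theorem eta_toda : toda.eta = fun P => P.1 := by
  funext P; simp [eta, toda, partialW_snd]

theorem psi_toda : toda.psi = fun _ => 0 := by
  funext P; simp [psi, toda, partialU_snd]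

theorem eta_volterra (α β : ℂ) :
    (volterra α β).eta = fun P => (α * P.1 + β) * Complex.exp P.2 := by
  funext P; simp [eta, volterra, partialW_exp_snd]

theorem nondegenerate_toda (hU : IsOpen U) (hne : U.Nonempty) : toda.Nondegenerate U := by
  refine ⟨?_, fun h => ?_⟩
  · obtain ⟨P, hP, h⟩ := exists_mem_affine_ne_zero hU hne (α := 1) (β := 0) (by simp)
    exact ⟨P, hP, by rw [eta_toda]; simpa using h⟩
  · obtain ⟨P, hP⟩ := hne
    simpa [psi_toda, eta_toda, partialU_fst] using (h P hP).2.1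

theorem nondegenerate_volterra (hU : IsOpen U) (hne : U.Nonempty) {α β : ℂ}
    (h : α ≠ 0 ∨ β ≠ 0) : (volterra α β).Nondegenerate U := by
  obtain ⟨P, hP, h0⟩ := exists_mem_affine_ne_zero hU hne h
  have h1 : (α * P.1 + β) * Complex.exp P.2 ≠ 0 := mul_ne_zero h0 (Complex.exp_ne_zero _)
  refine ⟨⟨P, hP, by rwa [eta_volterra]⟩, fun hd => h1 ?_⟩
  have h2 := (hd P hP).1
  rwa [eta_volterra, partialW_mul ((analyticAt_const.fun_mul analyticAt_fst).fun_add analyticAt_const)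
    (analyticAt_exp_snd P), partialW_affine, partialW_exp_snd, zero_mul, zero_add] at h2

theorem nondegenerate_sqrtToda {s : ℂ × ℂ → ℂ} (hU : IsOpen U) (hne : U.Nonempty)
    (hs : AnalyticOnNhd ℂ s U) (hsq : ∀ P ∈ U, s P ^ 2 = P.1) :
    (sqrtToda s).Nondegenerate U := by
  obtain ⟨P, hP⟩ := hne
  have h1 : P.1 * Complex.exp P.2 ≠ 0 := mul_ne_zero
    (by rw [← hsq P hP]; exact pow_ne_zero 2 (sqrt_ne_zero hU hs hsq hP)) (Complex.exp_ne_zero _)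
  refine ⟨⟨P, hP, by rwa [eta_sqrtToda hU hs hsq hP]⟩, fun hd => h1 ?_⟩
  rw [← partialW_eta_sqrtToda hU hs hsq hP]
  exact (hd P hP).1

theorem integrableModulo_toda : toda.IntegrableModulo U 3 :=
  integrableModulo_of_forall_curve fun C hn =>
    inheritsOnePhase_of_exponential holomorphicOn_toda C 1 0 rfl rfl partialU_fst partialW_fst
      partialU_snd (by funext P; simp [toda, partialW_snd]) hn

theorem integrableModulo_volterra (α β : ℂ) : (volterra α β).IntegrableModulo U 3 :=
  integrableModulo_of_forall_curve fun C hn =>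
    inheritsOnePhase_of_exponential (holomorphicOn_volterra α β) C α 1 rfl rfl
      (partialU_affine α β) (partialW_affine α β) (by funext P; exact partialU_exp_snd P)
      (by
        have h : partialW (fun P => Complex.exp P.2) = fun P => Complex.exp P.2 :=
          funext partialW_exp_snd
        simp only [volterra, h, one_mul]) hn

theorem integrableModulo_sqrtToda {s : ℂ × ℂ → ℂ} (hU : IsOpen U) (hs : AnalyticOnNhd ℂ s U)
    (hsq : ∀ P ∈ U, s P ^ 2 = P.1) : (sqrtToda s).IntegrableModulo U 3 :=
  integrableModulo_of_forall_curve fun C hn => inheritsOnePhase_sqrtToda hU hs hsq C hn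

/-- The listed equations are non-degenerate and integrable modulo `ε ^ 4`. -/
theorem IsListed.integrable (h : E.IsListed U) (hU : IsOpen U) (hne : U.Nonempty) :
    E.HolomorphicOn U ∧ E.Nondegenerate U ∧ E.IntegrableModulo U 3 := by
  rcases h with rfl | ⟨α, β, hαβ, rfl⟩ | ⟨s, hs, hsq, rfl⟩
  · exact ⟨holomorphicOn_toda, nondegenerate_toda hU hne, integrableModulo_toda⟩
  · exact ⟨holomorphicOn_volterra α β, nondegenerate_volterra hU hne hαβ,
      integrableModulo_volterra α β⟩
  · exact ⟨holomorphicOn_sqrtToda hs, nondegenerate_sqrtToda hU hne hs hsq,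
      integrableModulo_sqrtToda hU hs hsq⟩

end TodaEquation

/-! ### The identity theorem in two variables -/

section IdentityTheorem

variable {U : Set (ℂ × ℂ)} {F G : ℂ × ℂ → ℂ}

theorem AnalyticOnNhd.eq_zero_of_open (hF : AnalyticOnNhd ℂ F U) (hU : IsPreconnected U)
    {V : Set (ℂ × ℂ)} (hV : IsOpen V) (hVU : V ⊆ U) (hne : V.Nonempty) (h : ∀ P ∈ V, F P = 0) :
    ∀ P ∈ U, F P = 0 := by
  obtain ⟨P, hP⟩ := hne
  exact fun Q hQ => hF.eqOn_zero_of_preconnected_of_eventuallyEq_zero hU (hVU hP)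
    (by filter_upwards [hV.mem_nhds hP] with R hR using h R hR) hQ

theorem AnalyticOnNhd.isOpen_ne_zero (hF : AnalyticOnNhd ℂ F U) (hU : IsOpen U) :
    IsOpen {P | P ∈ U ∧ F P ≠ 0} :=
  hF.continuousOn.isOpen_inter_preimage hU isOpen_compl_singleton

/-- Holomorphic functions on a connected open set have no zero divisors; this produces the global
alternatives of the classification. -/
theorem AnalyticOnNhd.eq_zero_of_mul_eq_zero (hF : AnalyticOnNhd ℂ F U)
    (hG : AnalyticOnNhd ℂ G U) (hUo : IsOpen U) (hU : IsPreconnected U)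
    (h : ∀ P ∈ U, F P * G P = 0) : (∀ P ∈ U, F P = 0) ∨ ∀ P ∈ U, G P = 0 := by
  by_cases h0 : ∀ P ∈ U, F P = 0
  · exact Or.inl h0
  · push Not at h0
    obtain ⟨P, hP, hP0⟩ := h0
    exact Or.inr <| hG.eq_zero_of_open hU (hF.isOpen_ne_zero hUo) (fun _ h => h.1) ⟨P, hP, hP0⟩
      fun Q hQ => (mul_eq_zero.1 (h Q hQ.1)).resolve_left hQ.2

theorem eq_const_of_partial_eq_zero (hF : AnalyticOnNhd ℂ F U) (hUo : IsOpen U)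
    (hU : IsPreconnected U) (h1 : ∀ P ∈ U, partialU F P = 0) (h2 : ∀ P ∈ U, partialW F P = 0) :
    ∃ c, ∀ P ∈ U, F P = c := by
  refine hUo.exists_is_const_of_fderiv_eq_zero hU hF.differentiableOn fun P hP => ?_
  ext
  · simpa [partialU] using h1 P hP
  · simpa [partialW] using h2 P hP

end IdentityTheorem

/-! ### Vanishing of coefficients of polynomials -/

section Polynomials

theorem Polynomial.eq_zero_of_eval_eq_zero_of_ne {P N : Polynomial ℂ} (hN : N ≠ 0)
    (h : ∀ x, N.eval x ≠ 0 → P.eval x = 0) : P = 0 := by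
  have h1 : P * N = 0 := Polynomial.funext fun x => by
    by_cases hx : N.eval x = 0
    · simp [hx]
    · simp [h x hx]
  exact (mul_eq_zero.1 h1).resolve_right hN

/-- The polynomial with given coefficients. -/
def polyOf (n : ℕ) (c : ℕ → ℂ) : Polynomial ℂ :=
  ∑ i ∈ Finset.range n, Polynomial.C (c i) * Polynomial.X ^ i

theorem polyOf_eval (n : ℕ) (c : ℕ → ℂ) (x : ℂ) :
    (polyOf n c).eval x = ∑ i ∈ Finset.range n, c i * x ^ i := by
  simp [polyOf, Polynomial.eval_finsetSum]

theorem polyOf_coeff {n : ℕ} (c : ℕ → ℂ) {i : ℕ} (hi : i < n) : (polyOf n c).coeff i = c i := by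
  simp [polyOf, Polynomial.coeff_C_mul, Polynomial.coeff_X_pow, hi]

/-- A polynomial that vanishes wherever a non-zero polynomial does not has zero coefficients. -/
theorem coeff_eq_zero_of_forall {n k : ℕ} {c d : ℕ → ℂ} (hd : ∃ i < k, d i ≠ 0)
    (h : ∀ x, ∑ i ∈ Finset.range k, d i * x ^ i ≠ 0 → ∑ i ∈ Finset.range n, c i * x ^ i = 0)
    {i : ℕ} (hi : i < n) : c i = 0 := by
  obtain ⟨j, hj, hdj⟩ := hd
  have h1 : polyOf n c = 0 := Polynomial.eq_zero_of_eval_eq_zero_of_ne (N := polyOf k d)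
    (fun h0 => hdj (by rw [← polyOf_coeff d hj, h0, Polynomial.coeff_zero]))
    fun x hx => by rw [polyOf_eval] at hx ⊢; exact h x hx
  rw [← polyOf_coeff c hi, h1, Polynomial.coeff_zero]

/-- Interpolation at ±1, ±2. The variable will be the curvature of the curve, for which 0 is
excluded. -/
theorem cubic_coeff_eq_zero {a₀ a₁ a₂ a₃ : ℂ}
    (h : ∀ x : ℂ, x ≠ 0 → a₀ + a₁ * x + a₂ * x ^ 2 + a₃ * x ^ 3 = 0) :
    a₀ = 0 ∧ a₁ = 0 ∧ a₂ = 0 ∧ a₃ = 0 := by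
  have h1 := h 1 (by norm_num)
  have h2 := h (-1) (by norm_num)
  have h3 := h 2 (by norm_num)
  have h4 := h (-2) (by norm_num)
  refine ⟨?_, ?_, ?_, ?_⟩
  · linear_combination (2 / 3) * h1 + (2 / 3) * h2 - (1 / 6) * h3 - (1 / 6) * h4
  · linear_combination (2 / 3) * h1 - (2 / 3) * h2 - (1 / 12) * h3 + (1 / 12) * h4
  · linear_combination -(1 / 6) * h1 - (1 / 6) * h2 + (1 / 6) * h3 + (1 / 6) * h4
  · linear_combination -(1 / 6) * h1 + (1 / 6) * h2 + (1 / 12) * h3 - (1 / 12) * h4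

end Polynomials

/-! ### First-order corrections along curves of constant curvature -/

namespace TodaEquation

open JetAlg

variable {E : TodaEquation} {U : Set (ℂ × ℂ)} {D : Opens ℂ}

/-- Through every point in general position there is a curve with given slope and curvature. -/
theorem exists_quadratic_curve (hE : E.HolomorphicOn U) (hU : IsOpen U) {P : ℂ × ℂ} (hP : P ∈ U)
    (μ c : ℂ) (hn : E.nonlinearity μ P ≠ 0) :
    ∃ (D : Opens ℂ) (C : PhaseCurve U D), P.1 ∈ D ∧ C.w P.1 = P.2 ∧ deriv C.w P.1 = μ ∧
      HasD C.mu (algebraMap ℂ _ c) ∧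
      ∀ R ∈ D, E.nonlinearity (deriv C.w R) (R, C.w R) ≠ 0 := by
  let w : ℂ → ℂ := fun R => P.2 + μ * (R - P.1) + c / 2 * (R - P.1) ^ 2
  have hw : ∀ R, HasDerivAt w (μ + c * (R - P.1)) R := fun R => by
    have h1 : HasDerivAt (fun R => R - P.1) 1 R := (hasDerivAt_id R).sub_const _
    refine HasDerivAt.congr_deriv (f := w)
      (((h1.const_mul μ).const_add P.2).add ((h1.pow 2).const_mul (c / 2))) ?_
    norm_num
    ring
  have hdw : deriv w = fun R => μ + c * (R - P.1) := funext fun R => (hw R).deriv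
  have hwa : ∀ R, AnalyticAt ℂ w R := fun R =>
    (analyticAt_const.fun_add (analyticAt_const.fun_mul (analyticAt_id.fun_sub analyticAt_const))).fun_add
      (analyticAt_const.fun_mul ((analyticAt_id.fun_sub analyticAt_const).fun_pow 2))
  have hwP : w P.1 = P.2 := by simp [w]
  have hcurve : ContinuousAt (fun R => (R, w R)) P.1 :=
    continuousAt_id.prodMk (hwa P.1).continuousAt
  have hmem : ∀ᶠ R in 𝓝 P.1, (R, w R) ∈ U := hcurve.eventually (hU.mem_nhds (by simpa [hwP]))
  have hcont : ∀ {F : ℂ × ℂ → ℂ}, AnalyticOnNhd ℂ F U → ContinuousAt (fun R => F (R, w R)) P.1 :=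
    fun hF => ContinuousAt.comp (f := fun R => (R, w R))
      (by simpa [hwP] using (hF P hP).continuousAt) hcurve
  have hμ : ContinuousAt (fun R => deriv w R) P.1 := by rw [hdw]; fun_prop
  have hψ := analyticOnNhd_psi hE
  have hη := analyticOnNhd_eta hE
  -- The nonlinearity along the curve is continuous, so the curve stays in general position on a
  -- neighbourhood of the point.
  have hnc : ContinuousAt (fun R => partialU E.phi (R, w R) + (partialW E.phi (R, w R) +
      partialU E.psi (R, w R)) * deriv w R + (partialW E.psi (R, w R) + partialU E.eta (R, w R)) *
      deriv w R ^ 2 + partialW E.eta (R, w R) * deriv w R ^ 3) P.1 :=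
    (((hcont hE.1.partialU).add (((hcont hE.1.partialW).add (hcont hψ.partialU)).mul hμ)).add
      (((hcont hψ.partialW).add (hcont hη.partialU)).mul (hμ.pow 2))).add
      ((hcont hη.partialW).mul (hμ.pow 3))
  have hn0 := hnc.eventually_ne (y := 0) (by
    have := nonlinearity_eq hE μ hP
    simp only [hwP, hdw, sub_self, mul_zero, add_zero]
    rwa [← this])
  obtain ⟨D, hD, hDo, hPD⟩ := mem_nhds_iff.1 (hmem.and hn0)
  refine ⟨⟨D, hDo⟩, ⟨w, fun R _ => hwa R, fun R hR => (hD hR).1⟩, hPD, hwP, ?_, ?_, ?_⟩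
  · simp [hdw]
  · refine (hasD_base _).congr rfl (JetAlg.ext' fun j => ?_)
    simp only [base_apply, JetAlg.algebraMap_apply]
    rw [hdw]
    have : HasDerivAt (fun R => μ + c * (R - P.1)) c (j.1 0) := by
      simpa using (((hasDerivAt_id (j.1 0)).sub_const P.1).const_mul c).const_add μ
    exact this.deriv
  · intro R hR
    rw [nonlinearity_eq hE _ (hD hR).1]
    exact (hD hR).2

/-- The coefficients of a deformation modulo `ε ^ 3`. -/
theorem InheritsOnePhase.exists_coeffs (hE : E.HolomorphicOn U) (C : PhaseCurve U D)
    (h : E.InheritsOnePhase 2 D C.w) :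
    ∃ (W A B : ℕ → JetAlg D) (ω ω₁ ω₂ a₁ a₂ b₁ b₂ c₁ c₂ c₃ d₁ d₂ d₃ : JetAlg D),
      E.FormalReduction hE C 2 W A B ∧ W 0 = C.W ∧ A 0 = C.mu * X 1 ∧ B 0 = E.lam hE C * X 1 ∧
      (IsBase ω ∧ W 1 = ω * X 1) ∧
      (IsBase a₁ ∧ IsBase a₂ ∧ A 1 = a₁ * X 2 + a₂ * X 1 ^ 2) ∧
      (IsBase b₁ ∧ IsBase b₂ ∧ B 1 = b₁ * X 2 + b₂ * X 1 ^ 2) ∧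
      (IsBase ω₁ ∧ IsBase ω₂ ∧ W 2 = ω₁ * X 2 + ω₂ * X 1 ^ 2) ∧
      (IsBase c₁ ∧ IsBase c₂ ∧ IsBase c₃ ∧ A 2 = c₁ * X 3 + c₂ * (X 1 * X 2) + c₃ * X 1 ^ 3) ∧
      (IsBase d₁ ∧ IsBase d₂ ∧ IsBase d₃ ∧ B 2 = d₁ * X 3 + d₂ * (X 1 * X 2) + d₃ * X 1 ^ 3) := by
  obtain ⟨ω, α, β, hω, hα, hβ, hf⟩ := (inheritsOnePhase_iff hE C 2).1 h
  refine ⟨_, _, _, _, _, _, _, _, _, _, _, _, _, _, _, _, hf, rfl, rfl, rfl,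
    ⟨isBase_base _, dpoly_one _ (hω 1)⟩,
    ⟨isBase_base _, isBase_base _, dpoly_two _ (hα 1)⟩,
    ⟨isBase_base _, isBase_base _, dpoly_two _ (hβ 1)⟩,
    ⟨isBase_base _, isBase_base _, dpoly_two _ (hω 2)⟩,
    ⟨isBase_base _, isBase_base _, isBase_base _, dpoly_three _ (hα 2)⟩,
    ⟨isBase_base _, isBase_base _, isBase_base _, dpoly_three _ (hβ 2)⟩⟩

end TodaEquation

namespace JetAlg

variable {D : Opens ℂ}

theorem algebraMap_mul_cancel {c : ℂ} (hc : c ≠ 0) {x y : JetAlg D}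
    (h : algebraMap ℂ (JetAlg D) c * x = algebraMap ℂ _ c * y) : x = y := by
  have h1 : algebraMap ℂ (JetAlg D) c⁻¹ * algebraMap ℂ _ c = 1 := by
    rw [← map_mul, inv_mul_cancel₀ hc, map_one]
  linear_combination algebraMap ℂ (JetAlg D) c⁻¹ * h + (y - x) * h1

end JetAlg

namespace TodaEquation

open JetAlg

variable {E : TodaEquation} {U : Set (ℂ × ℂ)} {D : Opens ℂ}

/-- The derivative of the characteristic speed along a curve. -/
def lam' (hE : E.HolomorphicOn U) (C : PhaseCurve U D) (m₁ : JetAlg D) : JetAlg D :=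
  C.lift hE.1.partialU + C.lift hE.1.partialW * C.mu +
  (C.lift (analyticOnNhd_psi hE).partialU + C.lift (analyticOnNhd_psi hE).partialW * C.mu) * C.mu +
  (C.lift (analyticOnNhd_eta hE).partialU + C.lift (analyticOnNhd_eta hE).partialW * C.mu) *
    C.mu ^ 2 + (C.lift (analyticOnNhd_psi hE) +
    2 * (C.lift (analyticOnNhd_eta hE) * C.mu)) * m₁

theorem hasD_lam (hE : E.HolomorphicOn U) (C : PhaseCurve U D) {m₁ : JetAlg D}
    (hm : HasD C.mu m₁) : HasD (E.lam hE C) (lam' hE C m₁) := by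
  have h1 : C.lift hE.1 + C.lift (analyticOnNhd_psi hE) * C.mu +
      C.lift (analyticOnNhd_eta hE) * C.mu ^ 2 = E.lam hE C := by
    refine JetAlg.ext' fun j => ?_
    simp [lam, psi, eta]
  refine (((hasD_lift C hE.1).add ((hasD_lift C (analyticOnNhd_psi hE)).mul hm)).add
    ((hasD_lift C (analyticOnNhd_eta hE)).mul (hm.pow 2))).congr h1 ?_
  refine JetAlg.ext' fun j => ?_
  simp [lam']
  ring

/-- The speed varies with the point at fixed slope, which is the nonlinearity, and with the slope at
fixed point, which brings in the curvature. -/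
theorem lam'_apply (hE : E.HolomorphicOn U) (C : PhaseCurve U D) (m₁ : JetAlg D) (j : JetPt D) :
    lam' hE C m₁ j = E.nonlinearity (C.mu j) (j.1 0, C.w (j.1 0)) +
      (E.psi (j.1 0, C.w (j.1 0)) + 2 * E.eta (j.1 0, C.w (j.1 0)) * C.mu j) * m₁ j := by
  rw [nonlinearity_eq hE _ (C.mem _ j.2)]
  simp [lam']
  ring

/-- The first-order corrections along a curve of constant non-zero curvature. -/
theorem FormalReduction.first_order {hE : E.HolomorphicOn U} {C : PhaseCurve U D}
    {W A B : ℕ → JetAlg D} (hf : E.FormalReduction hE C 2 W A B) {c : ℂ} (hc : c ≠ 0)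
    (hm : HasD C.mu (algebraMap ℂ _ c)) {ω a₁ a₂ b₁ b₂ : JetAlg D}
    (hW0 : W 0 = C.W) (hA0 : A 0 = C.mu * X 1) (hB0 : B 0 = E.lam hE C * X 1)
    (iω : IsBase ω) (hW1 : W 1 = ω * X 1)
    (ia₁ : IsBase a₁) (ia₂ : IsBase a₂) (hA1 : A 1 = a₁ * X 2 + a₂ * X 1 ^ 2)
    (ib₁ : IsBase b₁) (ib₂ : IsBase b₂) (hB1 : B 1 = b₁ * X 2 + b₂ * X 1 ^ 2) :
    ω = a₁ + algebraMap ℂ _ (1 / 2) * C.mu ^ 2 ∧ HasD a₁ a₂ ∧ HasD b₁ b₂ ∧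
      algebraMap ℂ _ c * b₁ = a₁ * lam' hE C (algebraMap ℂ _ c) := by
  have imu : IsBase C.mu := isBase_base _
  have hl := hasD_lam hE C hm
  have il : IsBase (E.lam hE C) := fun j j' h => by simp only [lam_apply, h]
  have il₁ := hl.isBase il
  obtain ⟨l₂, hl₁, il₂⟩ := il₁.exists_hasD
  obtain ⟨ω', hω, iω'⟩ := iω.exists_hasD
  obtain ⟨a₁', ha₁, ia₁'⟩ := ia₁.exists_hasD
  obtain ⟨a₂', ha₂, -⟩ := ia₂.exists_hasD
  obtain ⟨b₁', hb₁, -⟩ := ib₁.exists_hasD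
  obtain ⟨b₂', hb₂, -⟩ := ib₂.exists_hasD
  have icst := fun c => isBase_algebraMap (D := D) c
  have hcst := fun c => hasD_algebraMap (D := D) c
  -- The order ε of w_x = Δ_y⁺ u. The R_xx part gives ω, and comparing its derivative with the R_x²
  -- part gives a₂ = a₁'.
  have e1 : (ω - a₁ - algebraMap ℂ _ (1 / 2) * C.mu ^ 2) * X 2 +
      (ω' - a₂ - algebraMap ℂ _ c * C.mu) * X 1 ^ 2 = 0 := by
    have := hf.wx 1 (by norm_num)
    rw [deltaCoeff_one _ _ _ (by norm_num), hA0, hA1, hW1] at this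
    simp only [if_true, one_ne_zero, if_false, map_zero, Derivation.leibniz,
      smul_eq_mul, hω.Dx, hm.evol, evol_X, hm.Dx, Dx_X,
      Function.iterate_succ_apply', Function.iterate_zero, id] at this
    refine JetAlg.ext' fun j => ?_
    have := congrArg (fun F : JetAlg D => F j) this
    simp [-PhaseCurve.mu_apply] at this ⊢
    linear_combination this
  obtain ⟨r1, r2⟩ := eq_zero_of_deg_two ((iω.sub ia₁).sub ((icst _).mul (imu.pow 2)))
    ((iω'.sub ia₂).sub ((icst _).mul imu)) e1
  have hω1 : ω = a₁ + algebraMap ℂ _ (1 / 2) * C.mu ^ 2 := by linear_combination r1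
  have hω' := (ha₁.add ((hcst (1 / 2)).mul (hm.pow 2))).congr hω1.symm rfl
  have hau := hω.unique hω'
  have ha : HasD a₁ a₂ := ha₁.congr rfl <| JetAlg.ext' fun j => by
    have h1 := congrArg (fun F : JetAlg D => F j) hau
    have h2 := congrArg (fun F : JetAlg D => F j) r2
    simp [-PhaseCurve.mu_apply] at h1 h2
    linear_combination h2 - h1
  have e2 := hf.compat 1 (by norm_num)
  rw [conv_one, conv_one, hA0, hB0, hA1, hB1] at e2
  have e3 := compat_first hm (hcst c) hl hl₁ ha₁ ha₂ hb₁ hb₂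
  have e4 : (0 : JetAlg D) * X 3 + (2 * (b₁ * algebraMap ℂ _ c -
      a₁ * lam' hE C (algebraMap ℂ _ c))) * (X 1 * X 2) + (b₁ * 0 + b₂ * algebraMap ℂ _ c - a₁ * l₂ -
      a₂ * lam' hE C (algebraMap ℂ _ c)) * X 1 ^ 3 = 0 := by
    linear_combination -e3 - e2
  have itwo : IsBase (2 : JetAlg D) := fun _ _ _ => by simp
  obtain ⟨-, r3, r4⟩ := eq_zero_of_deg_three isBase_zero
    (itwo.mul ((ib₁.mul (icst c)).sub (ia₁.mul il₁)))
    ((((ib₁.mul isBase_zero).add (ib₂.mul (icst c))).sub (ia₁.mul il₂)).sub (ia₂.mul il₁)) e4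
  have r5 : algebraMap ℂ _ c * b₁ = a₁ * lam' hE C (algebraMap ℂ _ c) := JetAlg.ext' fun j => by
    have h1 := congrArg (fun F : JetAlg D => F j) r3
    simp [-mul_eq_zero] at h1 ⊢
    linear_combination h1 / 2
  -- Differentiating c b₁ = a₁λ' and comparing with the R_x³ part of the commutator gives c b₁' = c
  -- b₂.
  refine ⟨hω1, ha, hb₁.congr rfl (algebraMap_mul_cancel hc ?_), r5⟩
  have h1 := (((hcst c).mul hb₁).congr r5 rfl).unique (ha.mul hl₁)
  linear_combination h1 - r4

/-- The first-order corrections to the speed in terms of those to the slope. -/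
theorem FormalReduction.ut_first {hE : E.HolomorphicOn U} {C : PhaseCurve U D}
    {W A B : ℕ → JetAlg D} (hf : E.FormalReduction hE C 2 W A B) {c : ℂ}
    (hm : HasD C.mu (algebraMap ℂ _ c)) {ω ω' a₁ a₂ b₁ b₂ : JetAlg D}
    (hA0 : A 0 = C.mu * X 1) (iω : IsBase ω) (hω₁ : HasD ω ω') (hW1 : W 1 = ω * X 1)
    (ia₁ : IsBase a₁) (ia₂ : IsBase a₂) (hA1 : A 1 = a₁ * X 2 + a₂ * X 1 ^ 2)
    (ib₁ : IsBase b₁) (ib₂ : IsBase b₂) (hB1 : B 1 = b₁ * X 2 + b₂ * X 1 ^ 2) :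
    b₁ = C.lift hE.2.1 * (C.lift hE.2.2.1.partialW * (ω * C.mu) +
      (C.lift hE.2.2.1.partialU + C.mu * C.lift hE.2.2.1.partialW) *
        (a₁ + algebraMap ℂ _ (1 / 2) * C.mu ^ 2)) +
    C.lift hE.2.2.2.1 * (C.lift hE.2.2.2.2.partialW * (ω * C.mu) +
      (C.lift hE.2.2.2.2.partialU + C.mu * C.lift hE.2.2.2.2.partialW) *
        (a₁ - algebraMap ℂ _ (1 / 2) * C.mu ^ 2)) ∧
    b₂ = C.lift hE.1.partialW * ω +
    C.lift hE.2.1.partialW * (ω * (C.mu * (C.lift hE.2.2.1.partialU +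
      C.mu * C.lift hE.2.2.1.partialW))) +
    C.lift hE.2.1 * ((C.lift hE.2.2.1.partialW.partialU +
        C.mu * C.lift hE.2.2.1.partialW.partialW) * (C.mu * ω) +
      C.lift hE.2.2.1.partialW * (C.mu * ω' + algebraMap ℂ _ c * ω) +
      a₂ * (C.lift hE.2.2.1.partialU + C.mu * C.lift hE.2.2.1.partialW) +
      algebraMap ℂ _ (1 / 2) * (C.mu ^ 2 * (C.lift hE.2.2.1.partialU.partialU +
        2 * (C.mu * C.lift hE.2.2.1.partialW.partialU) +
        C.mu ^ 2 * C.lift hE.2.2.1.partialW.partialW +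
        algebraMap ℂ _ c * C.lift hE.2.2.1.partialW) + 2 * (algebraMap ℂ _ c * (C.mu *
        (C.lift hE.2.2.1.partialU + C.mu * C.lift hE.2.2.1.partialW))))) +
    C.lift hE.2.2.2.1.partialW * (ω * (C.mu * (C.lift hE.2.2.2.2.partialU +
      C.mu * C.lift hE.2.2.2.2.partialW))) +
    C.lift hE.2.2.2.1 * ((C.lift hE.2.2.2.2.partialW.partialU +
        C.mu * C.lift hE.2.2.2.2.partialW.partialW) * (C.mu * ω) +
      C.lift hE.2.2.2.2.partialW * (C.mu * ω' + algebraMap ℂ _ c * ω) +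
      a₂ * (C.lift hE.2.2.2.2.partialU + C.mu * C.lift hE.2.2.2.2.partialW) -
      algebraMap ℂ _ (1 / 2) * (C.mu ^ 2 * (C.lift hE.2.2.2.2.partialU.partialU +
        2 * (C.mu * C.lift hE.2.2.2.2.partialW.partialU) +
        C.mu ^ 2 * C.lift hE.2.2.2.2.partialW.partialW +
        algebraMap ℂ _ c * C.lift hE.2.2.2.2.partialW) + 2 * (algebraMap ℂ _ c * (C.mu *
        (C.lift hE.2.2.2.2.partialU + C.mu * C.lift hE.2.2.2.2.partialW))))) := by
  have iω' := hω₁.isBase iω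
  have hg := hasD_lift C hE.2.2.1
  have hgU := hasD_lift C hE.2.2.1.partialU
  have hgW := hasD_lift C hE.2.2.1.partialW
  have hq := hasD_lift C hE.2.2.2.2
  have hqU := hasD_lift C hE.2.2.2.2.partialU
  have hqW := hasD_lift C hE.2.2.2.2.partialW
  obtain ⟨β₁, hβ₁⟩ : ∃ β, β = C.lift hE.2.1 * (C.lift hE.2.2.1.partialW * (ω * C.mu) +
      (C.lift hE.2.2.1.partialU + C.mu * C.lift hE.2.2.1.partialW) *
        (a₁ + algebraMap ℂ _ (1 / 2) * C.mu ^ 2)) +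
    C.lift hE.2.2.2.1 * (C.lift hE.2.2.2.2.partialW * (ω * C.mu) +
      (C.lift hE.2.2.2.2.partialU + C.mu * C.lift hE.2.2.2.2.partialW) *
        (a₁ - algebraMap ℂ _ (1 / 2) * C.mu ^ 2)) := ⟨_, rfl⟩
  obtain ⟨β₂, hβ₂⟩ : ∃ β, β = C.lift hE.1.partialW * ω +
    C.lift hE.2.1.partialW * (ω * (C.mu * (C.lift hE.2.2.1.partialU +
      C.mu * C.lift hE.2.2.1.partialW))) +
    C.lift hE.2.1 * ((C.lift hE.2.2.1.partialW.partialU +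
        C.mu * C.lift hE.2.2.1.partialW.partialW) * (C.mu * ω) +
      C.lift hE.2.2.1.partialW * (C.mu * ω' + algebraMap ℂ _ c * ω) +
      a₂ * (C.lift hE.2.2.1.partialU + C.mu * C.lift hE.2.2.1.partialW) +
      algebraMap ℂ _ (1 / 2) * (C.mu ^ 2 * (C.lift hE.2.2.1.partialU.partialU +
        2 * (C.mu * C.lift hE.2.2.1.partialW.partialU) +
        C.mu ^ 2 * C.lift hE.2.2.1.partialW.partialW +
        algebraMap ℂ _ c * C.lift hE.2.2.1.partialW) + 2 * (algebraMap ℂ _ c * (C.mu *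
        (C.lift hE.2.2.1.partialU + C.mu * C.lift hE.2.2.1.partialW))))) +
    C.lift hE.2.2.2.1.partialW * (ω * (C.mu * (C.lift hE.2.2.2.2.partialU +
      C.mu * C.lift hE.2.2.2.2.partialW))) +
    C.lift hE.2.2.2.1 * ((C.lift hE.2.2.2.2.partialW.partialU +
        C.mu * C.lift hE.2.2.2.2.partialW.partialW) * (C.mu * ω) +
      C.lift hE.2.2.2.2.partialW * (C.mu * ω' + algebraMap ℂ _ c * ω) +
      a₂ * (C.lift hE.2.2.2.2.partialU + C.mu * C.lift hE.2.2.2.2.partialW) -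
      algebraMap ℂ _ (1 / 2) * (C.mu ^ 2 * (C.lift hE.2.2.2.2.partialU.partialU +
        2 * (C.mu * C.lift hE.2.2.2.2.partialW.partialU) +
        C.mu ^ 2 * C.lift hE.2.2.2.2.partialW.partialW +
        algebraMap ℂ _ c * C.lift hE.2.2.2.2.partialW) + 2 * (algebraMap ℂ _ c * (C.mu *
        (C.lift hE.2.2.2.2.partialU + C.mu * C.lift hE.2.2.2.2.partialW))))) := ⟨_, rfl⟩
  have hut : B 1 = β₁ * X 2 + β₂ * X 1 ^ 2 := by
    rw [hf.ut 1 (by norm_num), rhsCoeff, conv_one, conv_one]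
    simp only [deltaCoeff_zero, deltaCoeff_one _ _ _ (show 1 ≤ 2 by norm_num),
      compCoeff_zero C _ _ (Or.inl rfl), compCoeff_one C _ _ (Or.inl rfl), hW1, hA0, hA1]
    simp only [Derivation.leibniz, smul_eq_mul, map_add, hg.evol, hgW.evol, hgU.evol, hq.evol,
      hqU.evol, hqW.evol, hω₁.evol, hm.evol, evol_X, Function.iterate_succ_apply',
      Function.iterate_zero, id, Dx_X, hm.Dx]
    refine JetAlg.ext' fun j => ?_
    simp [-PhaseCurve.mu_apply, hβ₁, hβ₂, partialW_partialU (hE.2.2.1 _ (C.mem _ j.2)),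
      partialW_partialU (hE.2.2.2.2 _ (C.mem _ j.2))]
    ring
  have iβ₁ : IsBase β₁ := fun j j' h => by simp [hβ₁, h, iω j j' h, ia₁ j j' h]
  have iβ₂ : IsBase β₂ := fun j j' h => by
    simp [hβ₂, h, iω j j' h, ia₂ j j' h, iω' j j' h]
  obtain ⟨s1, s2⟩ := eq_zero_of_deg_two (ib₁.sub iβ₁) (ib₂.sub iβ₂)
    (by linear_combination hut - hB1)
  exact ⟨(sub_eq_zero.1 s1).trans hβ₁, (sub_eq_zero.1 s2).trans hβ₂⟩

/-- The consequences at a point of integrability at first order in `ε`. -/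
theorem IntegrableModulo.first_order (hE : E.HolomorphicOn U) (hU : IsOpen U)
    (hint : E.IntegrableModulo U 2) {P : ℂ × ℂ} (hP : P ∈ U) {μ c : ℂ}
    (hn : E.nonlinearity μ P ≠ 0) (hc : c ≠ 0) :
    ∃ v : ℂ, v * E.nonlinearity μ P = c * (μ ^ 2 / 2 * (E.f P * partialU E.g P -
        E.p P * partialU E.q P + 2 * (E.f P * partialW E.g P) * μ)) ∧
      v * (partialW E.phi P - partialU E.psi P - 2 * partialU E.eta P * μ -
        partialW E.eta P * μ ^ 2 - E.eta P * c) + μ ^ 2 * (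
        (partialW E.phi P - (partialU E.f P * partialU E.g P - partialU E.p P * partialU E.q P)) / 2
        + (3 / 2 * E.f P * partialU (partialW E.g) P - E.p P * partialU (partialW E.q) P / 2 +
          partialW E.f P * partialU E.g P / 2 + partialW E.p P * partialU E.q P / 2 -
          (partialW E.f P * partialU E.g P + E.f P * partialU (partialW E.g) P -
            partialW E.p P * partialU E.q P - E.p P * partialU (partialW E.q) P) / 2 -
          (partialU E.f P * partialW E.g P + E.f P * partialU (partialW E.g) P)) * μ +
        (partialW E.p P * partialW E.q P - partialW E.f P * partialW E.g P) / 2 * μ ^ 2) = 0 := by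
  obtain ⟨D, C, hPD, hwP, hμ, hm, hnD⟩ := exists_quadratic_curve hE hU hP μ c hn
  obtain ⟨W, A, B, ω, ω₁, ω₂, a₁, a₂, b₁, b₂, c₁, c₂, c₃, d₁, d₂, d₃, hf, hW0, hA0, hB0, ⟨iω, hW1⟩,
    ⟨ia₁, ia₂, hA1⟩, ⟨ib₁, ib₂, hB1⟩, -⟩ := InheritsOnePhase.exists_coeffs hE C
      (hint D C.w ⟨D.isOpen, C.analytic, C.mem⟩ hnD)
  obtain ⟨hω, ha, hb, hbl⟩ := hf.first_order hc hm hW0 hA0 hB0 iω hW1 ia₁ ia₂ hA1 ib₁ ib₂ hB1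
  have hcst := fun c => hasD_algebraMap (D := D) c
  have imu : IsBase C.mu := isBase_base _
  obtain ⟨ω', hω₁, iω'⟩ := iω.exists_hasD
  have hau := hω₁.unique ((ha.add ((hcst (1 / 2)).mul (hm.pow 2))).congr hω.symm rfl)
  have hgU := hasD_lift C hE.2.2.1.partialU
  have hgW := hasD_lift C hE.2.2.1.partialW
  have hqU := hasD_lift C hE.2.2.2.2.partialU
  have hqW := hasD_lift C hE.2.2.2.2.partialW
  have hff := hasD_lift C hE.2.1
  have hp := hasD_lift C hE.2.2.2.1
  obtain ⟨s1, s2⟩ := hf.ut_first hm hA0 iω hω₁ hW1 ia₁ ia₂ hA1 ib₁ ib₂ hB1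
  have hβ' := ((hff.mul ((hgW.mul (hω₁.mul hm)).add ((hgU.add (hm.mul hgW)).mul
    (ha.add ((hcst (1 / 2)).mul (hm.pow 2)))))).add (hp.mul ((hqW.mul (hω₁.mul hm)).add
    ((hqU.add (hm.mul hqW)).mul (ha.sub ((hcst (1 / 2)).mul (hm.pow 2)))))))
  have s3 := (hb.congr s1 rfl).unique hβ'
  let j : JetPt D := pt hPD 0 0 0
  have hj : (j.1 0, C.w (j.1 0)) = P := by
    change (P.1, C.w P.1) = P
    rw [hwP]
  have hμj : C.mu j = μ := hμ
  have t1 := congrArg (fun F : JetAlg D => F j) hbl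
  have t2 := congrArg (fun F : JetAlg D => F j) s1
  have t3 := congrArg (fun F : JetAlg D => F j) s2
  have t4 := congrArg (fun F : JetAlg D => F j) s3
  have t5 := congrArg (fun F : JetAlg D => F j) hω
  have t6 := congrArg (fun F : JetAlg D => F j) hau
  have x1 := partialU_psi hE hP
  have x2 := partialU_eta hE hP
  have x3 := partialW_eta hE hP
  have x4 := partialW_partialU (hE.2.2.1 P hP)
  have x5 := partialW_partialU (hE.2.2.2.2 P hP)
  simp only [mul_apply, JetAlg.algebraMap_apply, lam'_apply, hj, hμj] at t1
  simp only [mul_apply, add_apply, sub_apply, zero_apply, pow_apply, natCast_apply,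
    ofNat_apply, JetAlg.algebraMap_apply, hj, hμj, PhaseCurve.lift_apply] at t2 t3 t4 t5 t6
  refine ⟨a₁ j, ?_, ?_⟩
  -- Two formulas for c b₁: commutation gives a₁λ', and u_t gives c times an expression linear in
  -- a₁. The curvature part of a₁λ' cancels, leaving the nonlinearity times a₁.
  · rw [t5] at t2
    simp only [psi, eta] at t1
    linear_combination -t1 + c * t2
  -- Two formulas for b₂: the R_x² part of u_t, and the derivative of b₁.
  · rw [x1, x2, x3, eta]
    simp only [x4, x5, t5, t6] at t3 t4
    norm_num at t3 t4
    linear_combination t4 - t3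

end TodaEquation

/-! ### Necessary conditions at first order -/

namespace TodaEquation

variable {E : TodaEquation} {U : Set (ℂ × ℂ)}

/-- The coefficients of the nonlinearity as a polynomial in the slope. -/
def nonlinearityCoeff (E : TodaEquation) (P : ℂ × ℂ) : ℕ → ℂ
  | 0 => partialU E.phi P
  | 1 => partialW E.phi P + partialU E.psi P
  | 2 => partialW E.psi P + partialU E.eta P
  | 3 => partialW E.eta P
  | _ => 0

theorem nonlinearity_eq_sum (hE : E.HolomorphicOn U) (μ : ℂ) {P : ℂ × ℂ} (hP : P ∈ U) :
    E.nonlinearity μ P = ∑ i ∈ Finset.range 4, E.nonlinearityCoeff P i * μ ^ i := by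
  rw [nonlinearity_eq hE μ hP]
  simp [Finset.sum_range_succ, nonlinearityCoeff]

/-- Neither η nor some coefficient of the nonlinearity vanishes identically; as U is connected,
neither does their product. At the resulting points all but finitely many slopes are in general
position. -/
theorem exists_generic_set (hE : E.HolomorphicOn U) (hU : IsOpen U) (hc : IsPreconnected U)
    (hn : E.Nondegenerate U) :
    ∃ V, IsOpen V ∧ V.Nonempty ∧ V ⊆ U ∧
      ∀ P ∈ V, E.eta P ≠ 0 ∧ ∃ i < 4, E.nonlinearityCoeff P i ≠ 0 := by
  have hη := analyticOnNhd_eta hE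
  have hψ := analyticOnNhd_psi hE
  have key : ∀ F : ℂ × ℂ → ℂ, AnalyticOnNhd ℂ F U → (∃ P ∈ U, F P ≠ 0) →
      ∃ V, IsOpen V ∧ V.Nonempty ∧ V ⊆ U ∧ ∀ P ∈ V, E.eta P ≠ 0 ∧ F P ≠ 0 := by
    intro F hF hF0
    refine ⟨{P | P ∈ U ∧ E.eta P ≠ 0} ∩ {P | P ∈ U ∧ F P ≠ 0},
      (hη.isOpen_ne_zero hU).inter (hF.isOpen_ne_zero hU), ?_, fun P hP => hP.1.1,
      fun P hP => ⟨hP.1.2, hP.2.2⟩⟩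
    by_contra hne
    have hz : ∀ P ∈ U, E.eta P * F P = 0 := fun P hP => by
      by_contra h0
      exact hne ⟨P, ⟨hP, left_ne_zero_of_mul h0⟩, hP, right_ne_zero_of_mul h0⟩
    obtain ⟨P, hP, hP0⟩ := hn.1
    obtain ⟨Q, hQ, hQ0⟩ := hF0
    rcases hη.eq_zero_of_mul_eq_zero hF hU hc hz with h | h
    · exact hP0 (h P hP)
    · exact hQ0 (h Q hQ)
  have h2 : ∃ i < 4, ∃ P ∈ U, E.nonlinearityCoeff P i ≠ 0 := by
    by_contra h
    push Not at h
    exact hn.2 fun P hP => ⟨h 3 (by norm_num) P hP, h 2 (by norm_num) P hP,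
      h 1 (by norm_num) P hP, h 0 (by norm_num) P hP⟩
  obtain ⟨i, hi, hi0⟩ := h2
  have han : AnalyticOnNhd ℂ (fun P => E.nonlinearityCoeff P i) U := by
    interval_cases i
    · exact hE.1.partialU
    · exact hE.1.partialW.add hψ.partialU
    · exact hψ.partialW.add hη.partialU
    · exact hη.partialW
  obtain ⟨V, hV, hne, hVU, h⟩ := key _ han hi0
  exact ⟨V, hV, hne, hVU, fun P hP => ⟨(h P hP).1, i, hi, (h P hP).2⟩⟩

/-- The conditions on the equation from integrability at first order in `ε`. -/
structure FirstOrderConditions (E : TodaEquation) (U : Set (ℂ × ℂ)) : Prop where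
  f_gW : ∀ P ∈ U, E.f P * partialW E.g P = 0
  f_gU : ∀ P ∈ U, E.f P * partialU E.g P = E.p P * partialU E.q P
  pW : ∀ P ∈ U, partialW E.p P = 0
  phiW : ∀ P ∈ U, partialW E.phi P =
    E.p P * partialU (partialU E.q) P - E.f P * partialU (partialU E.g) P
  f_or_gW : (∀ P ∈ U, E.f P = 0) ∨ ∀ P ∈ U, partialW E.g P = 0

/-- For fixed slope the correction a₁ is c·s with s independent of the curvature c. The second
relation of `first_order` is then polynomial in c with c²-coefficient -sη, so s = 0. The numerator
of s and the c-independent term thus vanish for generic μ, hence as polynomials in μ. -/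
theorem IntegrableModulo.relations_at (hE : E.HolomorphicOn U) (hU : IsOpen U)
    (hint : E.IntegrableModulo U 2) {P : ℂ × ℂ} (hP : P ∈ U) (hη : E.eta P ≠ 0)
    (hn : ∃ i < 4, E.nonlinearityCoeff P i ≠ 0) :
    E.f P * partialW E.g P = 0 ∧ E.f P * partialU E.g P = E.p P * partialU E.q P ∧
    partialW E.phi P = partialU E.f P * partialU E.g P - partialU E.p P * partialU E.q P ∧
    partialW E.p P * partialW E.q P = partialW E.f P * partialW E.g P := by
  have key : ∀ μ : ℂ, E.nonlinearity μ P ≠ 0 →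
      μ ^ 2 * (E.f P * partialU E.g P - E.p P * partialU E.q P +
        2 * (E.f P * partialW E.g P) * μ) = 0 ∧
      μ ^ 2 * ((partialW E.phi P -
        (partialU E.f P * partialU E.g P - partialU E.p P * partialU E.q P)) / 2
        + (3 / 2 * E.f P * partialU (partialW E.g) P - E.p P * partialU (partialW E.q) P / 2 +
          partialW E.f P * partialU E.g P / 2 + partialW E.p P * partialU E.q P / 2 -
          (partialW E.f P * partialU E.g P + E.f P * partialU (partialW E.g) P -
            partialW E.p P * partialU E.q P - E.p P * partialU (partialW E.q) P) / 2 -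
          (partialU E.f P * partialW E.g P + E.f P * partialU (partialW E.g) P)) * μ +
        (partialW E.p P * partialW E.q P - partialW E.f P * partialW E.g P) / 2 * μ ^ 2) = 0 := by
    intro μ hμ
    obtain ⟨s, hs⟩ : ∃ s, s * E.nonlinearity μ P = μ ^ 2 / 2 * (E.f P * partialU E.g P -
        E.p P * partialU E.q P + 2 * (E.f P * partialW E.g P) * μ) :=
      ⟨_, div_mul_cancel₀ _ hμ⟩
    have h1 := cubic_coeff_eq_zero (a₃ := 0) (a₂ := -(s * E.eta P))
      (a₁ := s * (partialW E.phi P - partialU E.psi P - 2 * partialU E.eta P * μ -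
        partialW E.eta P * μ ^ 2)) (a₀ := μ ^ 2 * ((partialW E.phi P -
        (partialU E.f P * partialU E.g P - partialU E.p P * partialU E.q P)) / 2
        + (3 / 2 * E.f P * partialU (partialW E.g) P - E.p P * partialU (partialW E.q) P / 2 +
          partialW E.f P * partialU E.g P / 2 + partialW E.p P * partialU E.q P / 2 -
          (partialW E.f P * partialU E.g P + E.f P * partialU (partialW E.g) P -
            partialW E.p P * partialU E.q P - E.p P * partialU (partialW E.q) P) / 2 -
          (partialU E.f P * partialW E.g P + E.f P * partialU (partialW E.g) P)) * μ +
        (partialW E.p P * partialW E.q P - partialW E.f P * partialW E.g P) / 2 * μ ^ 2)) (fun c hc => by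
        obtain ⟨v, hv1, hv2⟩ := hint.first_order hE hU hP hμ hc
        have hv : v = c * s := mul_right_cancel₀ hμ (by linear_combination hv1 - c * hs)
        rw [hv] at hv2
        refine Eq.trans ?_ hv2
        ring)
    have hs0 : s = 0 := by simpa [hη] using h1.2.2.1
    refine ⟨?_, h1.1⟩
    rw [hs0, zero_mul] at hs
    linear_combination -2 * hs
  have hsum : ∀ x, ∑ i ∈ Finset.range 4, E.nonlinearityCoeff P i * x ^ i ≠ 0 →
      E.nonlinearity x P ≠ 0 := fun x hx => by rwa [nonlinearity_eq_sum hE x hP]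
  -- Coefficients by powers of μ: this list is twice the numerator of s, and `c2f` is the
  -- c-independent term of the second relation.
  let c1f : ℕ → ℂ := fun i => match i with
      | 2 => E.f P * partialU E.g P - E.p P * partialU E.q P
      | 3 => 2 * (E.f P * partialW E.g P)
      | _ => 0
  have c1 : ∀ i < 4, c1f i = 0 := fun i hi => coeff_eq_zero_of_forall hn (n := 4) (fun x hx => by
    simp only [Finset.sum_range_succ, Finset.sum_range_zero, c1f]
    linear_combination (key x (hsum x hx)).1) hi
  let c2f : ℕ → ℂ := fun i => match i with
      | 2 => (partialW E.phi P -
        (partialU E.f P * partialU E.g P - partialU E.p P * partialU E.q P)) / 2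
      | 3 => 3 / 2 * E.f P * partialU (partialW E.g) P - E.p P * partialU (partialW E.q) P / 2 +
          partialW E.f P * partialU E.g P / 2 + partialW E.p P * partialU E.q P / 2 -
          (partialW E.f P * partialU E.g P + E.f P * partialU (partialW E.g) P -
            partialW E.p P * partialU E.q P - E.p P * partialU (partialW E.q) P) / 2 -
          (partialU E.f P * partialW E.g P + E.f P * partialU (partialW E.g) P)
      | 4 => (partialW E.p P * partialW E.q P - partialW E.f P * partialW E.g P) / 2
      | _ => 0
  have c2 : ∀ i < 5, c2f i = 0 := fun i hi => coeff_eq_zero_of_forall hn (n := 5) (fun x hx => by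
    simp only [Finset.sum_range_succ, Finset.sum_range_zero, c2f]
    linear_combination (key x (hsum x hx)).2) hi
  have d1 := c1 3 (by norm_num)
  have d2 := c1 2 (by norm_num)
  have d3 := c2 2 (by norm_num)
  have d4 := c2 4 (by norm_num)
  simp only [c1f, c2f] at d1 d2 d3 d4
  exact ⟨by linear_combination d1 / 2, by linear_combination d2, by linear_combination 2 * d3,
    by linear_combination 2 * d4⟩

/-- The pointwise relations extend from the generic set to U by the identity theorem, and products
that vanish identically split into alternatives. -/
theorem IntegrableModulo.firstOrderConditions (hE : E.HolomorphicOn U) (hU : IsOpen U)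
    (hc : IsPreconnected U) (hn : E.Nondegenerate U) (hint : E.IntegrableModulo U 2) :
    E.FirstOrderConditions U := by
  obtain ⟨V, hV, hne, hVU, hgen⟩ := exists_generic_set hE hU hc hn
  have hE' := hE
  obtain ⟨hphi, hf, hg, hp, hq⟩ := hE'
  have hat : ∀ P ∈ V, _ := fun P hP =>
    hint.relations_at hE hU (hVU hP) (hgen P hP).1 (hgen P hP).2
  have h1 : ∀ P ∈ U, E.f P * partialW E.g P = 0 :=
    (hf.mul hg.partialW).eq_zero_of_open hc hV hVU hne fun P hP => (hat P hP).1
  have h2 : ∀ P ∈ U, E.f P * partialU E.g P - E.p P * partialU E.q P = 0 :=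
    ((hf.mul hg.partialU).sub (hp.mul hq.partialU)).eq_zero_of_open hc hV hVU hne
      fun P hP => sub_eq_zero.2 (hat P hP).2.1
  have h3 : ∀ P ∈ U, partialW E.phi P -
      (partialU E.f P * partialU E.g P - partialU E.p P * partialU E.q P) = 0 :=
    (hphi.partialW.sub ((hf.partialU.mul hg.partialU).sub
      (hp.partialU.mul hq.partialU))).eq_zero_of_open hc hV hVU hne
      fun P hP => sub_eq_zero.2 (hat P hP).2.2.1
  have h4 : ∀ P ∈ U, partialW E.p P * partialW E.q P - partialW E.f P * partialW E.g P = 0 :=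
    ((hp.partialW.mul hq.partialW).sub (hf.partialW.mul hg.partialW)).eq_zero_of_open hc hV hVU hne
      fun P hP => sub_eq_zero.2 (hat P hP).2.2.2
  have h5 := hf.eq_zero_of_mul_eq_zero hg.partialW hU hc h1
  have h6 : ∀ P ∈ U, partialW E.f P * partialW E.g P = 0 := fun P hP => by
    rcases h5 with h | h
    · rw [partialW_congr (G := fun _ => 0) (by
        filter_upwards [hU.mem_nhds hP] with Q hQ using h Q hQ), partialW_const, zero_mul]
    · rw [h P hP, mul_zero]
  have h7 : ∀ P ∈ U, partialW E.p P * partialW E.q P = 0 := fun P hP => by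
    linear_combination h4 P hP + h6 P hP
  refine ⟨h1, fun P hP => sub_eq_zero.1 (h2 P hP), ?_, fun P hP => ?_, h5⟩
  -- If q_w ≡ 0, then η = f g_w + p q_w would vanish identically.
  · refine (hp.partialW.eq_zero_of_mul_eq_zero hq.partialW hU hc h7).resolve_right fun h => ?_
    obtain ⟨P, hP, hP0⟩ := hn.1
    exact hP0 (by rw [eta, h1 P hP, h P hP]; ring)
  -- The u-derivative of f g_u = p q_u converts f_u g_u - p_u q_u into p q_uu - f g_uu.
  · have h8 : partialU (fun Q => E.f Q * partialU E.g Q) P =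
        partialU (fun Q => E.p Q * partialU E.q Q) P :=
      partialU_congr (by filter_upwards [hU.mem_nhds hP] with Q hQ using sub_eq_zero.1 (h2 Q hQ))
    rw [partialU_mul (hf P hP) (hg.partialU P hP), partialU_mul (hp P hP) (hq.partialU P hP)] at h8
    linear_combination h3 P hP + h8

end TodaEquation

/-! ### Mixed partial derivatives -/

/-- The mixed partial derivative `∂_u^i ∂_w^k F`. -/
def mixed (F : ℂ × ℂ → ℂ) (i k : ℕ) : ℂ × ℂ → ℂ := partialU^[i] (partialW^[k] F)

section Mixed

variable {U : Set (ℂ × ℂ)} {D : Opens ℂ} {F : ℂ × ℂ → ℂ}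

theorem AnalyticOnNhd.partialU_iterate (hF : AnalyticOnNhd ℂ F U) (i : ℕ) :
    AnalyticOnNhd ℂ (_root_.partialU^[i] F) U := by
  induction i with
  | zero => exact hF
  | succ i ih => rw [Function.iterate_succ_apply']; exact ih.partialU

theorem AnalyticOnNhd.mixed (hF : AnalyticOnNhd ℂ F U) (i k : ℕ) :
    AnalyticOnNhd ℂ (mixed F i k) U := (hF.partialW_iterate k).partialU_iterate i

theorem partialU_mixed (F : ℂ × ℂ → ℂ) (i k : ℕ) : partialU (mixed F i k) = mixed F (i + 1) k :=
  (Function.iterate_succ_apply' _ _ _).symm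

theorem partialW_mixed_aux (i : ℕ) : ∀ {F : ℂ × ℂ → ℂ} {P : ℂ × ℂ}, AnalyticAt ℂ F P →
    partialW (partialU^[i] F) P = partialU^[i] (partialW F) P := by
  induction i with
  | zero => exact fun _ => rfl
  | succ i ih =>
    intro F P hF
    obtain ⟨V, hV, hVo, hPV⟩ := mem_nhds_iff.1 hF.eventually_analyticAt
    have hVa : AnalyticOnNhd ℂ F V := fun Q hQ => hV hQ
    rw [Function.iterate_succ_apply', Function.iterate_succ_apply',
      partialW_partialU (hVa.partialU_iterate i P hPV)]
    exact partialU_congr (by filter_upwards [hVo.mem_nhds hPV] with Q hQ using ih (hVa Q hQ))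

theorem partialW_mixed (hF : AnalyticOnNhd ℂ F U) (i k : ℕ) {P : ℂ × ℂ} (hP : P ∈ U) :
    partialW (mixed F i k) P = mixed F i (k + 1) P := by
  rw [mixed, partialW_mixed_aux i (hF.partialW_iterate k P hP), mixed, Function.iterate_succ_apply']

/-- The mixed partial derivatives along a curve. -/
def PhaseCurve.mixed (C : PhaseCurve U D) (hF : AnalyticOnNhd ℂ F U) (i k : ℕ) : JetAlg D :=
  C.lift (hF.mixed i k)

theorem PhaseCurve.mixed_apply (C : PhaseCurve U D) (hF : AnalyticOnNhd ℂ F U) (i k : ℕ)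
    (j : JetPt D) : C.mixed hF i k j = _root_.mixed F i k (j.1 0, C.w (j.1 0)) := rfl

theorem PhaseCurve.hasD_mixed (C : PhaseCurve U D) (hF : AnalyticOnNhd ℂ F U) (i k : ℕ) :
    JetAlg.HasD (C.mixed hF i k) (C.mixed hF (i + 1) k + C.mu * C.mixed hF i (k + 1)) :=
  (JetAlg.hasD_lift C (hF.mixed i k)).congr rfl <| JetAlg.ext' fun j => by
    simp only [JetAlg.add_apply, JetAlg.mul_apply, PhaseCurve.mixed_apply, PhaseCurve.lift_apply,
      partialU_mixed, partialW_mixed hF i k (C.mem _ j.2)]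

end Mixed

/-! ### Consequences of the first-order conditions for the corrections -/

namespace TodaEquation

open JetAlg

variable {E : TodaEquation} {U V : Set (ℂ × ℂ)} {D : Opens ℂ}

theorem HolomorphicOn.mono (hE : E.HolomorphicOn U) (hVU : V ⊆ U) : E.HolomorphicOn V :=
  ⟨hE.1.mono hVU, hE.2.1.mono hVU, hE.2.2.1.mono hVU, hE.2.2.2.1.mono hVU, hE.2.2.2.2.mono hVU⟩

theorem IntegrableModulo.mono {N : ℕ} (h : E.IntegrableModulo U N) (hVU : V ⊆ U) :
    E.IntegrableModulo V N :=
  fun D w hw hn => h D w ⟨hw.1, hw.2.1, fun R hR => hVU (hw.2.2 R hR)⟩ hn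

theorem FirstOrderConditions.mono (h : E.FirstOrderConditions U) (hVU : V ⊆ U) :
    E.FirstOrderConditions V :=
  ⟨fun P hP => h.f_gW P (hVU hP), fun P hP => h.f_gU P (hVU hP), fun P hP => h.pW P (hVU hP),
    fun P hP => h.phiW P (hVU hP), h.f_or_gW.imp (fun h P hP => h P (hVU hP))
      fun h P hP => h P (hVU hP)⟩

/-- The first-order corrections vanish when the first-order conditions hold. -/
theorem FormalReduction.first_order_zero {hE : E.HolomorphicOn U} {C : PhaseCurve U D}
    {W A B : ℕ → JetAlg D} (hf : E.FormalReduction hE C 2 W A B) (hF : E.FirstOrderConditions U)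
    {c : ℂ} (hc : c ≠ 0) (hm : HasD C.mu (algebraMap ℂ _ c)) {ω a₁ a₂ b₁ b₂ : JetAlg D}
    (hn : ∀ R ∈ D, E.nonlinearity (deriv C.w R) (R, C.w R) ≠ 0)
    (hW0 : W 0 = C.W) (hA0 : A 0 = C.mu * X 1) (hB0 : B 0 = E.lam hE C * X 1)
    (iω : IsBase ω) (hW1 : W 1 = ω * X 1)
    (ia₁ : IsBase a₁) (ia₂ : IsBase a₂) (hA1 : A 1 = a₁ * X 2 + a₂ * X 1 ^ 2)
    (ib₁ : IsBase b₁) (ib₂ : IsBase b₂) (hB1 : B 1 = b₁ * X 2 + b₂ * X 1 ^ 2) :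
    W 1 = algebraMap ℂ _ (1 / 2) * C.mu ^ 2 * X 1 ∧ A 1 = 0 ∧ B 1 = 0 := by
  obtain ⟨hω, ha, hb, hbl⟩ := hf.first_order hc hm hW0 hA0 hB0 iω hW1 ia₁ ia₂ hA1 ib₁ ib₂ hB1
  obtain ⟨ω', hω₁, iω'⟩ := iω.exists_hasD
  obtain ⟨s1, -⟩ := hf.ut_first hm hA0 iω hω₁ hW1 ia₁ ia₂ hA1 ib₁ ib₂ hB1
  -- Under the first-order conditions the source term in the equation for a₁ vanishes, so a₁ times
  -- the non-zero nonlinearity is zero.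
  have ha0 : a₁ = 0 := ext' fun j => by
    have hP := C.mem _ j.2
    have t1 := congrArg (fun F : JetAlg D => F j) hbl
    have t2 := congrArg (fun F : JetAlg D => F j) s1
    have t5 := congrArg (fun F : JetAlg D => F j) hω
    simp only [mul_apply, JetAlg.algebraMap_apply, lam'_apply] at t1
    simp only [mul_apply, add_apply, sub_apply, pow_apply, JetAlg.algebraMap_apply,
      PhaseCurve.lift_apply] at t2 t5
    rw [t5] at t2
    simp only [psi, eta] at t1
    refine (mul_eq_zero.1 ?_).resolve_right (hn _ j.2)
    rw [PhaseCurve.mu_apply] at *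
    linear_combination -t1 + c * t2 +
      (2 * c * (deriv C.w (j.1 0)) * (1 / 2 * (deriv C.w (j.1 0)) ^ 2)) * hF.f_gW _ hP +
      c * (1 / 2 * (deriv C.w (j.1 0)) ^ 2) * hF.f_gU _ hP
  have hb0 : b₁ = 0 := algebraMap_mul_cancel hc (by rw [hbl, ha0, zero_mul, mul_zero])
  have h0 : HasD (0 : JetAlg D) 0 := (hasD_algebraMap 0).congr (map_zero _) rfl
  rw [ha0] at ha
  rw [hb0] at hb
  refine ⟨?_, ?_, ?_⟩
  · rw [hW1, hω, ha0]; ring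
  · rw [hA1, ha0, ha.unique h0]; ring
  · rw [hB1, hb0, hb.unique h0]; ring

end TodaEquation

/-! ### The right-hand side at second order in terms of p, q and γ -/

namespace TodaEquation

open JetAlg

/-- The normalization of an equation subject to the first-order conditions in which `γ` stands for
`g_uu / g_u`. -/
structure SecondOrderSetting (E : TodaEquation) (V : Set (ℂ × ℂ)) (γ : ℂ × ℂ → ℂ) : Prop where
  holo : E.HolomorphicOn V
  isOpen : IsOpen V
  fst : E.FirstOrderConditions V
  an : AnalyticOnNhd ℂ γ V
  gammaW : ∀ P ∈ V, partialW γ P = 0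
  phiW : ∀ P ∈ V, partialW E.phi P = E.p P * (mixed E.q 2 0 P - γ P * mixed E.q 1 0 P)
  alt : (∀ P ∈ V, E.f P = 0 ∧ mixed E.q 1 0 P = 0) ∨
    ∀ P ∈ V, partialW E.g P = 0 ∧ partialU (partialU E.g) P = γ P * partialU E.g P

variable {E : TodaEquation} {V : Set (ℂ × ℂ)} {γ : ℂ × ℂ → ℂ} {D : Opens ℂ}

namespace SecondOrderSetting

theorem partialW_eq_zero (h : E.SecondOrderSetting V γ) {F : ℂ × ℂ → ℂ} (hF : ∀ P ∈ V, F P = 0) :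
    ∀ P ∈ V, partialW F P = 0 := fun P hP => by
  rw [partialW_congr (G := fun _ => 0) (by
    filter_upwards [h.isOpen.mem_nhds hP] with Q hQ using hF Q hQ), partialW_const]

theorem partialU_eq_zero (h : E.SecondOrderSetting V γ) {F : ℂ × ℂ → ℂ} (hF : ∀ P ∈ V, F P = 0) :
    ∀ P ∈ V, partialU F P = 0 := fun P hP => by
  rw [partialU_congr (G := fun _ => 0) (by
    filter_upwards [h.isOpen.mem_nhds hP] with Q hQ using hF Q hQ), partialU_const]

theorem partialW_congr_on (h : E.SecondOrderSetting V γ) {F G : ℂ × ℂ → ℂ}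
    (hF : ∀ P ∈ V, F P = G P) : ∀ P ∈ V, partialW F P = partialW G P := fun P hP =>
  partialW_congr (by filter_upwards [h.isOpen.mem_nhds hP] with Q hQ using hF Q hQ)

theorem partialU_congr_on (h : E.SecondOrderSetting V γ) {F G : ℂ × ℂ → ℂ}
    (hF : ∀ P ∈ V, F P = G P) : ∀ P ∈ V, partialU F P = partialU G P := fun P hP =>
  partialU_congr (by filter_upwards [h.isOpen.mem_nhds hP] with Q hQ using hF Q hQ)

theorem mixed_p_W (h : E.SecondOrderSetting V γ) (i : ℕ) :
    ∀ P ∈ V, mixed E.p i 1 P = 0 := by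
  induction i with
  | zero => exact h.fst.pW
  | succ i ih => rw [← partialU_mixed]; exact h.partialU_eq_zero ih

theorem hasD_p (h : E.SecondOrderSetting V γ) (C : PhaseCurve V D) (i : ℕ) :
    HasD (C.mixed h.holo.2.2.2.1 i 0) (C.mixed h.holo.2.2.2.1 (i + 1) 0) :=
  (C.hasD_mixed h.holo.2.2.2.1 i 0).congr rfl <| by
    rw [show C.mixed h.holo.2.2.2.1 i (0 + 1) = 0 from lift_eq_zero C _ (h.mixed_p_W i), mul_zero,
      add_zero]

theorem mixed_gamma_W (h : E.SecondOrderSetting V γ) (i : ℕ) :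
    ∀ P ∈ V, mixed γ i 1 P = 0 := by
  induction i with
  | zero => exact h.gammaW
  | succ i ih => rw [← partialU_mixed]; exact h.partialU_eq_zero ih

theorem hasD_gamma (h : E.SecondOrderSetting V γ) (C : PhaseCurve V D) (i : ℕ) :
    HasD (C.mixed h.an i 0) (C.mixed h.an (i + 1) 0) :=
  (C.hasD_mixed h.an i 0).congr rfl <| by
    rw [show C.mixed h.an i (0 + 1) = 0 from lift_eq_zero C _ (h.mixed_gamma_W i), mul_zero,
      add_zero]

/-- The contribution of `f Δ_y⁺ g` at second order. -/
theorem forward_coeff (h : E.SecondOrderSetting V γ) (C : PhaseCurve V D) {W A : ℕ → JetAlg D}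
    (hA : A 1 = 0) :
    conv (· * ·) (compCoeff C h.holo.2.1 2 W) (deltaCoeff 2 1 A (compCoeff C h.holo.2.2.1 2 W)) 2 =
      C.mixed h.holo.2.2.2.1 0 0 * (C.mixed h.holo.2.2.2.2 1 0 * (A 2 + algebraMap ℂ _ (1 / 6) *
        (evol (A 0) (evol (A 0) (A 0)) + 3 * (C.mixed h.an 0 0 * A 0 * evol (A 0) (A 0)) +
        (C.mixed h.an 1 0 + C.mixed h.an 0 0 ^ 2) * A 0 ^ 3)) +
      algebraMap ℂ _ (1 / 2) * (C.mixed h.holo.2.2.2.2 1 1 * W 1 * (evol (A 0) (A 0) +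
        C.mixed h.an 0 0 * A 0 ^ 2)) +
      (C.mixed h.holo.2.2.2.2 1 1 * W 2 +
        algebraMap ℂ _ (1 / 2) * (C.mixed h.holo.2.2.2.2 1 2 * W 1 ^ 2)) * A 0) := by
  have hE := h.holo
  have h2 : (2 : ℕ) = 2 ∨ (2 : ℕ) = 3 := Or.inl rfl
  rw [conv_two, compCoeff_zero _ _ _ h2, compCoeff_one _ _ _ h2, compCoeff_two _ _ _ h2]
  -- If f ≡ 0 and q_u ≡ 0, both sides vanish. Otherwise g depends on u only.
  rcases h.alt with h0 | h0
  · have f0 : ∀ P ∈ V, E.f P = 0 := fun P hP => (h0 P hP).1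
    have f1 := h.partialW_eq_zero f0
    have f2 := h.partialW_eq_zero f1
    have q0 : ∀ P ∈ V, mixed E.q 1 0 P = 0 := fun P hP => (h0 P hP).2
    have q1 : ∀ P ∈ V, mixed E.q 1 1 P = 0 := fun P hP =>
      (partialW_mixed hE.2.2.2.2 1 0 hP).symm.trans (h.partialW_eq_zero q0 P hP)
    have q2 : ∀ P ∈ V, mixed E.q 1 2 P = 0 := fun P hP =>
      (partialW_mixed hE.2.2.2.2 1 1 hP).symm.trans (h.partialW_eq_zero q1 P hP)
    rw [show C.mixed hE.2.2.2.2 1 0 = 0 from lift_eq_zero C _ q0,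
      show C.mixed hE.2.2.2.2 1 1 = 0 from lift_eq_zero C _ q1,
      show C.mixed hE.2.2.2.2 1 2 = 0 from lift_eq_zero C _ q2,
      lift_eq_zero C _ f0, lift_eq_zero C _ f1, lift_eq_zero C _ f2]
    ring
  · have g0 : ∀ P ∈ V, partialW E.g P = 0 := fun P hP => (h0 P hP).1
    have g1 := h.partialW_eq_zero g0
    have gu : ∀ P ∈ V, partialW (partialU E.g) P = 0 := fun P hP => by
      rw [partialW_partialU (hE.2.2.1 P hP)]; exact h.partialU_eq_zero g0 P hP
    have k0 : ∀ P ∈ V, E.f P * partialU E.g P = E.p P * mixed E.q 1 0 P := h.fst.f_gU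
    -- As p and g_u do not depend on w, differentiating f g_u = p q_u in w replaces f_w g_u by p
    -- q_uw, and then f_ww g_u by p q_uww; f and g disappear except through γ.
    have k1 : ∀ P ∈ V, partialW E.f P * partialU E.g P = E.p P * mixed E.q 1 1 P := fun P hP => by
      have := h.partialW_congr_on k0 P hP
      rw [partialW_mul (hE.2.1 P hP) (hE.2.2.1.partialU P hP),
        partialW_mul (hE.2.2.2.1 P hP) (hE.2.2.2.2.mixed 1 0 P hP), partialW_mixed hE.2.2.2.2 1 0 hP,
        gu P hP, h.fst.pW P hP] at this
      linear_combination this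
    have k2 : ∀ P ∈ V, partialW (partialW E.f) P * partialU E.g P = E.p P * mixed E.q 1 2 P :=
      fun P hP => by
      have := h.partialW_congr_on k1 P hP
      rw [partialW_mul (hE.2.1.partialW P hP) (hE.2.2.1.partialU P hP),
        partialW_mul (hE.2.2.2.1 P hP) (hE.2.2.2.2.mixed 1 1 P hP), partialW_mixed hE.2.2.2.2 1 1 hP,
        gu P hP, h.fst.pW P hP] at this
      linear_combination this
    have hg : HasD (C.lift hE.2.2.1) (C.lift hE.2.2.1.partialU) :=
      (hasD_lift C hE.2.2.1).congr rfl (by rw [lift_eq_zero C _ g0]; ring)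
    have hgU : HasD (C.lift hE.2.2.1.partialU) (C.mixed h.an 0 0 * C.lift hE.2.2.1.partialU) :=
      (hasD_lift C hE.2.2.1.partialU).congr rfl <| by
        rw [lift_eq_zero C _ gu]
        refine JetAlg.ext' fun j => ?_
        simp only [JetAlg.mul_apply, mul_zero, add_zero, PhaseCurve.lift_apply,
          PhaseCurve.mixed_apply]
        exact (h0 _ (C.mem _ j.2)).2
    have hγ := h.hasD_gamma C 0
    simp only [deltaCoeff_zero, deltaCoeff_one _ _ _ (show 1 ≤ 2 by norm_num),
      deltaCoeff_two _ _ _ le_rfl, compCoeff_zero _ _ _ h2, compCoeff_one _ _ _ h2,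
      compCoeff_two _ _ _ h2, lift_eq_zero C _ g0, lift_eq_zero C _ g1, hA, zero_mul, mul_zero,
      add_zero, map_zero, Derivation.leibniz, smul_eq_mul, map_add, hg.evol, hgU.evol, hγ.evol,
      evol_zero, zero_add]
    have e0 : C.lift hE.2.1 * C.lift hE.2.2.1.partialU =
        C.mixed hE.2.2.2.1 0 0 * C.mixed hE.2.2.2.2 1 0 :=
      JetAlg.ext' fun j => k0 _ (C.mem _ j.2)
    have e1 : C.lift hE.2.1.partialW * C.lift hE.2.2.1.partialU =
        C.mixed hE.2.2.2.1 0 0 * C.mixed hE.2.2.2.2 1 1 :=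
      JetAlg.ext' fun j => k1 _ (C.mem _ j.2)
    have e2 : C.lift hE.2.1.partialW.partialW * C.lift hE.2.2.1.partialU =
        C.mixed hE.2.2.2.1 0 0 * C.mixed hE.2.2.2.2 1 2 :=
      JetAlg.ext' fun j => k2 _ (C.mem _ j.2)
    rw [one_pow]
    linear_combination (A 2 + algebraMap ℂ _ (1 / 6) *
        (evol (A 0) (evol (A 0) (A 0)) + 3 * (C.mixed h.an 0 0 * A 0 * evol (A 0) (A 0)) +
        (C.mixed h.an 1 0 + C.mixed h.an 0 0 ^ 2) * A 0 ^ 3)) * e0 +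
      (algebraMap ℂ _ (1 / 2) * W 1 * (evol (A 0) (A 0) + C.mixed h.an 0 0 * A 0 ^ 2) +
        W 2 * A 0) * e1 + algebraMap ℂ _ (1 / 2) * W 1 ^ 2 * A 0 * e2

end SecondOrderSetting

end TodaEquation

theorem partialW_sub {F G : ℂ × ℂ → ℂ} {P : ℂ × ℂ} (hF : AnalyticAt ℂ F P)
    (hG : AnalyticAt ℂ G P) :
    partialW (fun Q => F Q - G Q) P = partialW F P - partialW G P := by
  simp [partialW, fderiv_fun_sub hF.differentiableAt hG.differentiableAt]

theorem partialU_sub {F G : ℂ × ℂ → ℂ} {P : ℂ × ℂ} (hF : AnalyticAt ℂ F P)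
    (hG : AnalyticAt ℂ G P) :
    partialU (fun Q => F Q - G Q) P = partialU F P - partialU G P := by
  simp [partialU, fderiv_fun_sub hF.differentiableAt hG.differentiableAt]

namespace TodaEquation

open JetAlg

variable {E : TodaEquation} {V : Set (ℂ × ℂ)} {γ : ℂ × ℂ → ℂ} {D : Opens ℂ}

namespace SecondOrderSetting

/-- The coefficient of `R_xxx` in the second-order correction to the speed. -/
def speedCoeff₁ (h : E.SecondOrderSetting V γ) (C : PhaseCurve V D) (o₁ c₁ : JetAlg D) : JetAlg D :=
  C.mixed h.holo.2.2.2.1 0 0 * ((o₁ * C.mu + c₁ * C.mu) * C.mixed h.holo.2.2.2.2 0 1 +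
    2 * c₁ * C.mixed h.holo.2.2.2.2 1 0 -
    algebraMap ℂ _ (1 / 12) * (C.mu ^ 4 * C.mixed h.holo.2.2.2.2 0 1) +
    algebraMap ℂ _ (1 / 3) * (C.mu ^ 3 * C.mixed h.holo.2.2.2.2 1 0))

/-- The coefficient of `R_x R_xx` in the second-order correction to the speed. -/
def speedCoeff₂ (h : E.SecondOrderSetting V γ) (C : PhaseCurve V D) (m₁ o₁ o₁' o₂ c₂ : JetAlg D) :
    JetAlg D :=
  C.mixed h.holo.2.2.2.1 0 0 * (
    (2 * o₂ * C.mu + o₁' * C.mu + 3 * (o₁ * m₁) + c₂ * C.mu - C.mu ^ 3 * m₁) *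
      C.mixed h.holo.2.2.2.2 0 1 +
    (2 * c₂ + 3 * (C.mu ^ 2 * m₁)) * C.mixed h.holo.2.2.2.2 1 0 +
    (2 * (o₁ * C.mu) + algebraMap ℂ _ (1 / 2) * C.mu ^ 4) * C.mixed h.holo.2.2.2.2 1 1 +
    o₁ * C.mu ^ 2 * C.mixed h.holo.2.2.2.2 0 2 +
    algebraMap ℂ _ (1 / 2) * C.mu ^ 3 * (C.mixed h.holo.2.2.2.2 2 0 +
      C.mixed h.an 0 0 * C.mixed h.holo.2.2.2.2 1 0) +
    o₁ * (C.mixed h.holo.2.2.2.2 2 0 - C.mixed h.an 0 0 * C.mixed h.holo.2.2.2.2 1 0))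

/-- The coefficient of `R_x³` in the second-order correction to the speed. -/
def speedCoeff₃ (h : E.SecondOrderSetting V γ) (C : PhaseCurve V D) (m₁ o₂ o₂' c₃ : JetAlg D) :
    JetAlg D :=
  C.mixed h.holo.2.2.2.1 0 0 * (
    (2 * (o₂ * m₁) + o₂' * C.mu + c₃ * C.mu - C.mu ^ 2 * m₁ ^ 2) * C.mixed h.holo.2.2.2.2 0 1 +
    (2 * (o₂ * C.mu) + C.mu ^ 3 * m₁) * C.mixed h.holo.2.2.2.2 1 1 +
    o₂ * C.mu ^ 2 * C.mixed h.holo.2.2.2.2 0 2 +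
    algebraMap ℂ _ (1 / 4) * (C.mu ^ 5 * C.mixed h.holo.2.2.2.2 1 2) +
    algebraMap ℂ _ (1 / 24) * (C.mu ^ 6 * C.mixed h.holo.2.2.2.2 0 3) +
    (2 * c₃ + 2 * (C.mu * m₁ ^ 2)) * C.mixed h.holo.2.2.2.2 1 0 +
    algebraMap ℂ _ (1 / 8) * (C.mu ^ 4 * (3 * C.mixed h.holo.2.2.2.2 2 1 +
      C.mixed h.an 0 0 * C.mixed h.holo.2.2.2.2 1 1)) +
    C.mu ^ 2 * m₁ * (C.mixed h.holo.2.2.2.2 2 0 +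
      C.mixed h.an 0 0 * C.mixed h.holo.2.2.2.2 1 0) +
    algebraMap ℂ _ (1 / 6) * (C.mu ^ 3 * (C.mixed h.holo.2.2.2.2 3 0 +
      (C.mixed h.an 1 0 + C.mixed h.an 0 0 ^ 2) * C.mixed h.holo.2.2.2.2 1 0)) +
    o₂ * (C.mixed h.holo.2.2.2.2 2 0 - C.mixed h.an 0 0 * C.mixed h.holo.2.2.2.2 1 0))

/-- The formula for φ_w and its w-derivative remove φ as well, so the ε² term of u_t involves only
p, q and γ. The slope has constant first derivative here. -/
theorem rhsCoeff_two (h : E.SecondOrderSetting V γ) (C : PhaseCurve V D) {W A : ℕ → JetAlg D}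
    {m₁ o₁ o₁' o₂ o₂' c₁ c₂ c₃ : JetAlg D} (hm : HasD C.mu m₁) (hm₁ : HasD m₁ 0) (ho₁ : HasD o₁ o₁')
    (ho₂ : HasD o₂ o₂') (hA0 : A 0 = C.mu * X 1)
    (hW1 : W 1 = algebraMap ℂ _ (1 / 2) * C.mu ^ 2 * X 1) (hA1 : A 1 = 0)
    (hW2 : W 2 = o₁ * X 2 + o₂ * X 1 ^ 2)
    (hA2 : A 2 = c₁ * X 3 + c₂ * (X 1 * X 2) + c₃ * X 1 ^ 3) :
    rhsCoeff h.holo C 2 W A 2 = h.speedCoeff₁ C o₁ c₁ * X 3 +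
      h.speedCoeff₂ C m₁ o₁ o₁' o₂ c₂ * (X 1 * X 2) + h.speedCoeff₃ C m₁ o₂ o₂' c₃ * X 1 ^ 3 := by
  have hE := h.holo
  have h2 : (2 : ℕ) = 2 ∨ (2 : ℕ) = 3 := Or.inl rfl
  have f1 : C.lift hE.1.partialW = C.mixed hE.2.2.2.1 0 0 * (C.mixed hE.2.2.2.2 2 0 -
      C.mixed h.an 0 0 * C.mixed hE.2.2.2.2 1 0) := JetAlg.ext' fun j => h.phiW _ (C.mem _ j.2)
  have f2 : C.lift hE.1.partialW.partialW = C.mixed hE.2.2.2.1 0 0 * (C.mixed hE.2.2.2.2 2 1 -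
      C.mixed h.an 0 0 * C.mixed hE.2.2.2.2 1 1) := JetAlg.ext' fun j => by
    have hP := C.mem _ j.2
    have := h.partialW_congr_on h.phiW _ hP
    have a0 := h.an _ hP
    have a1 := hE.2.2.2.2.mixed 1 0 _ hP
    rw [partialW_mul (hE.2.2.2.1 _ hP) ((hE.2.2.2.2.mixed 2 0 _ hP).fun_sub (a0.fun_mul a1)),
      partialW_sub (hE.2.2.2.2.mixed 2 0 _ hP) (a0.fun_mul a1), partialW_mul a0 a1,
      partialW_mixed hE.2.2.2.2 2 0 hP, partialW_mixed hE.2.2.2.2 1 0 hP, h.gammaW _ hP,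
      h.fst.pW _ hP] at this
    simp only [JetAlg.mul_apply, JetAlg.sub_apply, PhaseCurve.lift_apply, PhaseCurve.mixed_apply]
    rw [this]
    simp [mixed]
  have p1 : C.lift hE.2.2.2.1.partialW = 0 := lift_eq_zero C _ h.fst.pW
  have p2 : C.lift hE.2.2.2.1.partialW.partialW = 0 :=
    lift_eq_zero C _ (h.partialW_eq_zero h.fst.pW)
  have q0 := C.hasD_mixed hE.2.2.2.2 0 0
  have q1 := C.hasD_mixed hE.2.2.2.2 0 1
  have q2 := C.hasD_mixed hE.2.2.2.2 0 2
  have r1 := C.hasD_mixed hE.2.2.2.2 1 0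
  have r2 := C.hasD_mixed hE.2.2.2.2 1 1
  have r3 := C.hasD_mixed hE.2.2.2.2 2 0
  simp only [zero_add, Nat.reduceAdd] at q0 q1 q2 r1 r2 r3
  rw [rhsCoeff, h.forward_coeff C hA1, conv_two]
  simp only [deltaCoeff_zero, deltaCoeff_one _ _ _ (show 1 ≤ 2 by norm_num),
    deltaCoeff_two _ _ _ le_rfl, compCoeff_zero _ _ _ h2, compCoeff_one _ _ _ h2,
    compCoeff_two _ _ _ h2, hA1, p1, p2, f1, f2, zero_mul, mul_zero, add_zero, evol_zero,
    show C.lift hE.2.2.2.2 = C.mixed hE.2.2.2.2 0 0 from rfl,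
    show C.lift hE.2.2.2.1 = C.mixed hE.2.2.2.1 0 0 from rfl,
    show C.lift hE.2.2.2.2.partialW = C.mixed hE.2.2.2.2 0 1 from rfl,
    show C.lift hE.2.2.2.2.partialW.partialW = C.mixed hE.2.2.2.2 0 2 from rfl, hW1, hW2, hA2, hA0]
  simp only [Derivation.leibniz, Derivation.leibniz_pow, Derivation.map_algebraMap, smul_eq_mul,
    nsmul_eq_mul, map_add, q0.evol, q1.evol, q2.evol, r1.evol, r2.evol, r3.evol, hm.evol, hm₁.evol, Derivation.map_natCast,
    ho₁.evol, ho₂.evol, evol_X, Function.iterate_succ_apply',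
    Function.iterate_zero, id, Dx_X, hm.Dx, hm₁.Dx]
  refine JetAlg.ext' fun j => ?_
  simp [-PhaseCurve.mu_apply, speedCoeff₁, speedCoeff₂, speedCoeff₃]
  ring

end SecondOrderSetting

end TodaEquation

/-! ### The form of commuting second-order corrections -/

namespace TodaEquation

open JetAlg

variable {E : TodaEquation} {V : Set (ℂ × ℂ)} {D : Opens ℂ}

/-- The second-order corrections along a curve of constant non-zero curvature, expressed through
two functions `z` and `y`. -/
theorem FormalReduction.second_order {hE : E.HolomorphicOn V} {C : PhaseCurve V D}
    {W A B : ℕ → JetAlg D} (hf : E.FormalReduction hE C 2 W A B) {c : ℂ} (hc : c ≠ 0)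
    (hm : HasD C.mu (algebraMap ℂ _ c)) {l₁ l₂ l₃ o₁ o₂ c₁ c₂ c₃ d₁ d₂ d₃ : JetAlg D}
    (hl : HasD (E.lam hE C) l₁) (hl₁ : HasD l₁ l₂) (hl₂ : HasD l₂ l₃)
    (hA0 : A 0 = C.mu * X 1) (hB0 : B 0 = E.lam hE C * X 1)
    (hA1 : A 1 = 0) (hB1 : B 1 = 0)
    (io₁ : IsBase o₁) (io₂ : IsBase o₂) (hW2 : W 2 = o₁ * X 2 + o₂ * X 1 ^ 2)
    (ic₁ : IsBase c₁) (ic₂ : IsBase c₂) (ic₃ : IsBase c₃)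
    (hA2 : A 2 = c₁ * X 3 + c₂ * (X 1 * X 2) + c₃ * X 1 ^ 3)
    (id₁ : IsBase d₁) (id₂ : IsBase d₂) (id₃ : IsBase d₃)
    (hB2 : B 2 = d₁ * X 3 + d₂ * (X 1 * X 2) + d₃ * X 1 ^ 3) :
    ∃ z z₁ z₂ y y₁ : JetAlg D, HasD z z₁ ∧ HasD z₁ z₂ ∧ HasD y y₁ ∧
      c₁ = algebraMap ℂ _ c * z ∧ c₂ = algebraMap ℂ _ c * y ∧
      o₁ = algebraMap ℂ _ c * z + algebraMap ℂ _ (1 / 6) * C.mu ^ 3 ∧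
      o₂ = algebraMap ℂ _ (c / 2) * (y - z₁ + C.mu ^ 2) ∧
      c₃ = algebraMap ℂ _ (c / 2) * (y₁ - z₂) ∧
      d₁ = l₁ * z ∧ d₂ = l₁ * y + 2 * (l₂ * z) ∧
      d₃ = algebraMap ℂ _ (1 / 2) * (l₁ * (y₁ - z₂) + l₂ * y + l₃ * z) := by
  have imu : IsBase C.mu := isBase_base _
  have icst := fun c => isBase_algebraMap (D := D) c
  have hcst := fun c => hasD_algebraMap (D := D) c
  have il : IsBase (E.lam hE C) := fun j j' h => by simp only [lam_apply, h]
  have il₁ := hl.isBase il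
  have il₂ := hl₁.isBase il₁
  have il₃ := hl₂.isBase il₂
  have hcc : algebraMap ℂ (JetAlg D) c * algebraMap ℂ _ c⁻¹ = 1 := by
    rw [← map_mul, mul_inv_cancel₀ hc, map_one]
  -- Since μ' = c and μ'' = 0, the ratios are z = c₁/μ' and y = c₂/μ'.
  obtain ⟨z, hz⟩ : ∃ z, z = algebraMap ℂ _ c⁻¹ * c₁ := ⟨_, rfl⟩
  obtain ⟨y, hy⟩ : ∃ y, y = algebraMap ℂ _ c⁻¹ * c₂ := ⟨_, rfl⟩
  have iz : IsBase z := hz ▸ (icst _).mul ic₁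
  have iy : IsBase y := hy ▸ (icst _).mul ic₂
  have hcz : c₁ = algebraMap ℂ _ c * z := by rw [hz]; linear_combination -c₁ * hcc
  have hcy : c₂ = algebraMap ℂ _ c * y := by rw [hy]; linear_combination -c₂ * hcc
  obtain ⟨z₁, hz₁, iz₁⟩ := iz.exists_hasD
  obtain ⟨z₂, hz₂, iz₂⟩ := iz₁.exists_hasD
  obtain ⟨y₁, hy₁, iy₁⟩ := iy.exists_hasD
  obtain ⟨o₁', ho₁, io₁'⟩ := io₁.exists_hasD
  obtain ⟨o₂', ho₂, io₂'⟩ := io₂.exists_hasD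
  obtain ⟨c₃', hc₃, -⟩ := ic₃.exists_hasD
  obtain ⟨d₁', hd₁, -⟩ := id₁.exists_hasD
  obtain ⟨d₂', hd₂, -⟩ := id₂.exists_hasD
  obtain ⟨d₃', hd₃, -⟩ := id₃.exists_hasD
  -- The order ε² of w_x = Δ_y⁺ u: it determines o₁ and o₂, and then c₃ from the derivative of o₂.
  have e1 : (o₁ - c₁ - algebraMap ℂ _ (1 / 6) * C.mu ^ 3) * X 3 +
      (o₁' + 2 * o₂ - c₂ - algebraMap ℂ _ (3 / 2 * c) * C.mu ^ 2) * (X 1 * X 2) +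
      (o₂' - c₃ - algebraMap ℂ _ (c ^ 2) * C.mu) * X 1 ^ 3 = 0 := by
    have := hf.wx 2 le_rfl
    rw [deltaCoeff_two _ _ _ le_rfl, hA0, hA1, hW2, hA2] at this
    simp only [if_true, OfNat.ofNat_ne_zero, one_ne_zero, if_false, map_zero, map_add,
      Derivation.leibniz, Derivation.leibniz_pow, smul_eq_mul, nsmul_eq_mul, ho₁.Dx, ho₂.Dx,
      hm.evol, evol_X, hm.Dx, Dx_X, Derivation.map_algebraMap,
      Function.iterate_succ_apply', Function.iterate_zero, id] at this
    refine JetAlg.ext' fun j => ?_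
    have := congrArg (fun F : JetAlg D => F j) this
    simp [-PhaseCurve.mu_apply] at this ⊢
    linear_combination this
  have itwo : IsBase (2 : JetAlg D) := fun _ _ _ => by simp
  obtain ⟨r1, r2, r3⟩ := eq_zero_of_deg_three ((io₁.sub ic₁).sub ((icst _).mul (imu.pow 3)))
    (((io₁'.add (itwo.mul io₂)).sub ic₂).sub ((icst _).mul (imu.pow 2)))
    ((io₂'.sub ic₃).sub ((icst _).mul imu)) e1
  have k1 : o₁ = algebraMap ℂ _ c * z + algebraMap ℂ _ (1 / 6) * C.mu ^ 3 := by
    linear_combination r1 + hcz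
  have k2 := ho₁.unique ((((hcst c).mul hz₁).add ((hcst (1 / 6)).mul (hm.pow 3))).congr k1.symm rfl)
  have k3 : o₂ = algebraMap ℂ _ (c / 2) * (y - z₁ + C.mu ^ 2) := JetAlg.ext' fun j => by
    have h1 := congrArg (fun F : JetAlg D => F j) k2
    have h2 := congrArg (fun F : JetAlg D => F j) r2
    have h3 := congrArg (fun F : JetAlg D => F j) hcy
    simp [-PhaseCurve.mu_apply, -mul_eq_mul_left_iff] at h1 h2 h3 ⊢
    linear_combination h2 / 2 - h1 / 2 + h3 / 2
  have k4 := ho₂.unique (((hcst (c / 2)).mul ((hy₁.sub hz₂).add (hm.pow 2))).congr k3.symm rfl)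
  have k5 : c₃ = algebraMap ℂ _ (c / 2) * (y₁ - z₂) := JetAlg.ext' fun j => by
    have h1 := congrArg (fun F : JetAlg D => F j) k4
    have h2 := congrArg (fun F : JetAlg D => F j) r3
    simp [-PhaseCurve.mu_apply, -mul_eq_mul_left_iff] at h1 h2 ⊢
    linear_combination h1 - h2
  have e2 := hf.compat 2 le_rfl
  rw [conv_two, conv_two, hA0, hB0, hA1, hB1, hA2, hB2, map_zero] at e2
  have e3 := compat_second hm (hcst c) (hcst 0 |>.congr (map_zero _) rfl) hl hl₁ hl₂
    (((hcst c).mul hz₁).congr hcz.symm rfl) (((hcst c).mul hy₁).congr hcy.symm rfl) hc₃ hd₁ hd₂ hd₃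
  rw [hcz, hcy, k5] at e2 e3
  have ithree : IsBase (3 : JetAlg D) := fun _ _ _ => by simp
  -- The three coefficients of the commutator express d₁, d₂, d₃ through the same z and y, with λ in
  -- place of μ.
  obtain ⟨s1, s2, s3⟩ := eq_zero_of_deg_four
    (c₁ := 3 * (d₁ * algebraMap ℂ _ c - algebraMap ℂ _ c * z * l₁))
    (c₂ := 3 * (d₂ * algebraMap ℂ _ c - 2 * (algebraMap ℂ _ c * z) * l₂ -
      algebraMap ℂ _ c * y * l₁))
    (c₃ := 2 * d₃ * algebraMap ℂ _ c - algebraMap ℂ _ c * z * l₃ - algebraMap ℂ _ c * y * l₂ -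
      2 * (algebraMap ℂ _ (c / 2) * (y₁ - z₂)) * l₁)
    (ithree.mul ((id₁.mul (icst _)).sub (((icst _).mul iz).mul il₁)))
    (ithree.mul (((id₂.mul (icst _)).sub ((itwo.mul ((icst _).mul iz)).mul il₂)).sub
      (((icst _).mul iy).mul il₁)))
    (((((itwo.mul id₃).mul (icst _)).sub (((icst _).mul iz).mul il₃)).sub
      (((icst _).mul iy).mul il₂)).sub ((itwo.mul ((icst _).mul (iy₁.sub iz₂))).mul il₁))
    (by linear_combination -e3 - e2)
  refine ⟨z, z₁, z₂, y, y₁, hz₁, hz₂, hy₁, hcz, hcy, k1, k3, k5, ?_, ?_, ?_⟩ <;>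
    refine algebraMap_mul_cancel hc (JetAlg.ext' fun j => ?_)
  · have := congrArg (fun F : JetAlg D => F j) s1
    simp [-mul_eq_zero, -mul_eq_mul_left_iff] at this ⊢
    linear_combination this / 3
  · have := congrArg (fun F : JetAlg D => F j) s2
    simp [-mul_eq_zero, -mul_eq_mul_left_iff] at this ⊢
    linear_combination this / 3
  · have := congrArg (fun F : JetAlg D => F j) s3
    simp [-mul_eq_zero, -mul_eq_mul_left_iff] at this ⊢
    linear_combination this / 2

end TodaEquation

/-! ### Second-order relations along a curve of constant curvature -/

namespace TodaEquation

open JetAlg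

variable {E : TodaEquation} {V : Set (ℂ × ℂ)} {γ : ℂ × ℂ → ℂ} {D : Opens ℂ}

namespace SecondOrderSetting

theorem mixed_phi (h : E.SecondOrderSetting V γ) {P : ℂ × ℂ} (hP : P ∈ V) :
    mixed E.phi 1 1 P = mixed E.p 1 0 P * (mixed E.q 2 0 P - γ P * mixed E.q 1 0 P) +
      E.p P * (mixed E.q 3 0 P - (mixed γ 1 0 P * mixed E.q 1 0 P + γ P * mixed E.q 2 0 P)) := by
  have hE := h.holo
  have := h.partialU_congr_on h.phiW _ hP
  have a0 := h.an _ hP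
  have a1 := hE.2.2.2.2.mixed 1 0 _ hP
  rw [partialU_mul (hE.2.2.2.1 _ hP) ((hE.2.2.2.2.mixed 2 0 _ hP).fun_sub (a0.fun_mul a1)),
    partialU_sub (hE.2.2.2.2.mixed 2 0 _ hP) (a0.fun_mul a1), partialU_mul a0 a1,
    partialU_mixed, partialU_mixed] at this
  exact this

/-- The nonlinearity along a curve. -/
def slopeRate (h : E.SecondOrderSetting V γ) (C : PhaseCurve V D) : JetAlg D :=
  C.mixed h.holo.1 1 0 + (C.mixed h.holo.2.2.2.1 0 0 * (3 * C.mixed h.holo.2.2.2.2 2 0 -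
    C.mixed h.an 0 0 * C.mixed h.holo.2.2.2.2 1 0) +
    2 * (C.mixed h.holo.2.2.2.1 1 0 * C.mixed h.holo.2.2.2.2 1 0)) * C.mu +
  (3 * (C.mixed h.holo.2.2.2.1 0 0 * C.mixed h.holo.2.2.2.2 1 1) +
    C.mixed h.holo.2.2.2.1 1 0 * C.mixed h.holo.2.2.2.2 0 1) * C.mu ^ 2 +
  C.mixed h.holo.2.2.2.1 0 0 * C.mixed h.holo.2.2.2.2 0 2 * C.mu ^ 3

theorem hasD_lam (h : E.SecondOrderSetting V γ) (C : PhaseCurve V D) {m₁ : JetAlg D}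
    (hm : HasD C.mu m₁) : HasD (E.lam h.holo C) (h.slopeRate C +
      2 * m₁ * (C.mixed h.holo.2.2.2.1 0 0 * (C.mixed h.holo.2.2.2.2 1 0 +
        C.mixed h.holo.2.2.2.2 0 1 * C.mu))) := by
  have hE := h.holo
  have h1 : C.mixed hE.1 0 0 + C.mixed hE.2.2.2.1 0 0 * C.mixed hE.2.2.2.2 1 0 * C.mu +
      C.mixed hE.2.2.2.1 0 0 * C.mixed hE.2.2.2.2 1 0 * C.mu +
      C.mixed hE.2.2.2.1 0 0 * C.mixed hE.2.2.2.2 0 1 * C.mu ^ 2 = E.lam hE C := by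
    have e1 : C.lift hE.2.1 * C.lift hE.2.2.1.partialU =
        C.mixed hE.2.2.2.1 0 0 * C.mixed hE.2.2.2.2 1 0 :=
      JetAlg.ext' fun j => h.fst.f_gU _ (C.mem _ j.2)
    have e2 : C.lift hE.2.1 * C.lift hE.2.2.1.partialW = 0 :=
      JetAlg.ext' fun j => h.fst.f_gW _ (C.mem _ j.2)
    rw [lam, e1, e2, show C.lift hE.2.2.2.2.partialW = C.mixed hE.2.2.2.2 0 1 from rfl,
      show C.lift hE.2.2.2.2.partialU = C.mixed hE.2.2.2.2 1 0 from rfl,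
      show C.lift hE.2.2.2.1 = C.mixed hE.2.2.2.1 0 0 from rfl,
      show C.lift hE.1 = C.mixed hE.1 0 0 from rfl]
    ring
  have f1 : C.mixed hE.1 0 1 = C.mixed hE.2.2.2.1 0 0 * (C.mixed hE.2.2.2.2 2 0 -
      C.mixed h.an 0 0 * C.mixed hE.2.2.2.2 1 0) := JetAlg.ext' fun j => h.phiW _ (C.mem _ j.2)
  have hS := ((h.hasD_p C 0).mul (C.hasD_mixed hE.2.2.2.2 1 0)).mul hm
  refine ((((C.hasD_mixed hE.1 0 0).add hS).add hS).add
    (((h.hasD_p C 0).mul (C.hasD_mixed hE.2.2.2.2 0 1)).mul (hm.pow 2))).congr h1 ?_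
  simp only [zero_add, f1, slopeRate]
  refine JetAlg.ext' fun j => ?_
  simp [-PhaseCurve.mu_apply]
  ring

theorem slopeRate_apply (h : E.SecondOrderSetting V γ) (C : PhaseCurve V D) {c : ℂ}
    (hm : HasD C.mu (algebraMap ℂ _ c)) (j : JetPt D) :
    h.slopeRate C j = E.nonlinearity (C.mu j) (j.1 0, C.w (j.1 0)) := by
  have h1 := lam'_apply h.holo C (algebraMap ℂ _ c) j
  rw [← (h.hasD_lam C hm).unique (TodaEquation.hasD_lam h.holo C hm)] at h1
  have hP := C.mem _ j.2
  have e1 := h.fst.f_gU _ hP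
  have e2 := h.fst.f_gW _ hP
  simp only [JetAlg.add_apply, JetAlg.mul_apply, JetAlg.ofNat_apply, JetAlg.algebraMap_apply,
    PhaseCurve.mixed_apply, psi, eta, e1, e2,
    show mixed E.p 0 0 = E.p from rfl, show mixed E.q 1 0 = partialU E.q from rfl,
    show mixed E.q 0 1 = partialW E.q from rfl] at h1
  linear_combination h1

set_option maxHeartbeats 4000000 in
/-- The consequences at a point of integrability at second order in `ε`. -/
theorem second_order (h : E.SecondOrderSetting V γ) (hint : E.IntegrableModulo V 2)
    {P : ℂ × ℂ} (hP : P ∈ V) {μ c : ℂ} (hn : E.nonlinearity μ P ≠ 0) (hc : c ≠ 0)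
    {p p1 p2 q01 q02 q03 q10 q11 q12 q20 q21 q30 γ0 γ1 φ1 φ2 : ℂ}
    (hp : p = E.p P) (hp1 : p1 = mixed E.p 1 0 P) (hp2 : p2 = mixed E.p 2 0 P)
    (hq01 : q01 = mixed E.q 0 1 P) (hq02 : q02 = mixed E.q 0 2 P) (hq03 : q03 = mixed E.q 0 3 P)
    (hq10 : q10 = mixed E.q 1 0 P) (hq11 : q11 = mixed E.q 1 1 P) (hq12 : q12 = mixed E.q 1 2 P)
    (hq20 : q20 = mixed E.q 2 0 P) (hq21 : q21 = mixed E.q 2 1 P) (hq30 : q30 = mixed E.q 3 0 P)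
    (hγ0 : γ0 = γ P) (hγ1 : γ1 = mixed γ 1 0 P) (hφ1 : φ1 = mixed E.phi 1 0 P)
    (hφ2 : φ2 = mixed E.phi 2 0 P) :
    ∃ n nR nm z z' y : ℂ, n = E.nonlinearity μ P ∧
      n = φ1 + (p * (3 * q20 - γ0 * q10) + 2 * (p1 * q10)) * μ +
        (3 * (p * q11) + p1 * q01) * μ ^ 2 + p * q02 * μ ^ 3 ∧
      nm = (p * (3 * q20 - γ0 * q10) + 2 * (p1 * q10)) +
        2 * (3 * (p * q11) + p1 * q01) * μ + 3 * (p * q02) * μ ^ 2 ∧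
      nR = φ2 + (p1 * (4 * q20 - 2 * γ0 * q10) + p * (4 * q30 - 2 * γ1 * q10 - 2 * γ0 * q20) +
          2 * p2 * q10 + 2 * p1 * q20) * μ +
        (p * (6 * q21 - γ0 * q11) + 6 * (p1 * q11) + p2 * q01) * μ ^ 2 +
        (4 * (p * q12) + 2 * (p1 * q02)) * μ ^ 3 + p * q03 * μ ^ 4 ∧
      n * z = μ ^ 3 * (4 * (p * q10) + μ * (p * q01)) / 12 ∧
      n * z' + (nR + c * nm) * z = μ ^ 3 * (4 * (p1 * q10 + p * q20 + μ * (p * q11)) +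
        μ * (p1 * q01 + p * q11 + μ * (p * q02))) / 12 +
        c * (3 * μ ^ 2 * (4 * (p * q10)) + 4 * μ ^ 3 * (p * q01)) / 12 ∧
      n * y = -2 * nR * z - c * (9 * p * q20 + 8 * p1 * q10 - γ0 * p * q10 + 18 * μ * p * q11 +
          8 * μ * p1 * q01 + 9 * μ ^ 2 * p * q02) * z - c ^ 2 * (p * q01) * z +
        (2 / 3 * μ ^ 3 * p * q20 + 1 / 3 * γ0 * μ ^ 3 * p * q10 + 5 / 6 * μ ^ 4 * p * q11 +
          μ ^ 5 * p * q02 / 6) + c * (3 * μ ^ 2 * p * q10 + μ ^ 3 * p * q01) ∧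
      (μ ^ 3 / 6 * (p2 * q10 - γ0 * p * q20 - γ0 * p1 * q10 + γ0 ^ 2 * p * q10) +
        μ ^ 4 / 24 * (p2 * q01 - γ0 * p * q11)) +
      c * ((p * q20 + 2 * p1 * q10 + γ0 * p * q10 + 2 * μ * (p * q11 + p1 * q01) +
          μ ^ 2 * p * q02) * (z' - y / 2) +
        z * (1 / 2 * p * q30 + 3 / 2 * p1 * q20 + p2 * q10 + 1 / 2 * γ0 * (p * q20 + p1 * q10) +
          1 / 2 * γ1 * p * q10 + μ * (3 / 2 * p * q21 + 3 * p1 * q11 + p2 * q01 +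
          1 / 2 * γ0 * p * q11) + 3 / 2 * μ ^ 2 * (p * q12 + p1 * q02) + 1 / 2 * μ ^ 3 * p * q03) -
        (1 / 2 * μ ^ 2 * p1 * q10 + μ ^ 3 * (p * q11 + p1 * q01) / 6 + μ ^ 4 * p * q02 / 24)) +
      c ^ 2 * (-(1 / 2) * p * q01 * z' +
        z * (1 / 2 * (p * q11 + p1 * q01) + 1 / 2 * μ * p * q02)) = 0 := by
  have hE := h.holo
  obtain ⟨D, C, hPD, hwP, hμ, hm, hnD⟩ := exists_quadratic_curve hE h.isOpen hP μ c hn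
  obtain ⟨W, A, B, ω, o₁, o₂, a₁, a₂, b₁, b₂, c₁, c₂, c₃, d₁, d₂, d₃, hf, hW0, hA0, hB0, ⟨iω, hW1⟩,
    ⟨ia₁, ia₂, hA1⟩, ⟨ib₁, ib₂, hB1⟩, ⟨io₁, io₂, hW2⟩, ⟨ic₁, ic₂, ic₃, hA2⟩,
    ⟨id₁, id₂, id₃, hB2⟩⟩ := InheritsOnePhase.exists_coeffs hE C
      (hint D C.w ⟨D.isOpen, C.analytic, C.mem⟩ hnD)
  obtain ⟨hW1', hA1', hB1'⟩ := hf.first_order_zero h.fst hc hm hnD hW0 hA0 hB0 iω hW1 ia₁ ia₂ hA1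
    ib₁ ib₂ hB1
  have hcst := fun c => hasD_algebraMap (D := D) c
  have hl := h.hasD_lam C hm
  obtain ⟨l₁, hl₁⟩ : ∃ l, l = h.slopeRate C +
      2 * algebraMap ℂ _ c * (C.mixed h.holo.2.2.2.1 0 0 * (C.mixed h.holo.2.2.2.2 1 0 +
        C.mixed h.holo.2.2.2.2 0 1 * C.mu)) := ⟨_, rfl⟩
  rw [← hl₁] at hl
  have il : IsBase (E.lam hE C) := fun j j' h => by simp only [lam_apply, h]
  have il₁ := hl.isBase il
  obtain ⟨l₂, hl₂, il₂⟩ := il₁.exists_hasD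
  obtain ⟨l₃, hl₃, -⟩ := il₂.exists_hasD
  obtain ⟨z, z₁, z₂, y, y₁, hz, hz₁, hy, kc₁, kc₂, ko₁, ko₂, kc₃, kd₁, kd₂, kd₃⟩ :=
    hf.second_order hc hm hl hl₂ hl₃ hA0 hB0 hA1' hB1' io₁ io₂ hW2 ic₁ ic₂ ic₃ hA2 id₁ id₂ id₃ hB2
  obtain ⟨o₁', ho₁⟩ : ∃ o', HasD o₁ o' := ⟨_, io₁.exists_hasD.choose_spec.1⟩
  obtain ⟨o₂', ho₂⟩ : ∃ o', HasD o₂ o' := ⟨_, io₂.exists_hasD.choose_spec.1⟩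
  have k1 := ho₁.unique ((((hcst c).mul hz).add ((hcst (1 / 6)).mul (hm.pow 3))).congr ko₁.symm rfl)
  have k2 := ho₂.unique (((hcst (c / 2)).mul ((hy.sub hz₁).add (hm.pow 2))).congr ko₂.symm rfl)
  have hut := hf.ut 2 le_rfl
  rw [h.rhsCoeff_two C hm ((hcst c).congr rfl rfl) ho₁ ho₂ hA0 hW1' hA1' hW2 hA2, hB2] at hut
  have imu : IsBase C.mu := isBase_base _
  have iS₁ : IsBase (h.speedCoeff₁ C o₁ c₁) := fun j j' e => by
    simp [speedCoeff₁, PhaseCurve.mixed_apply, e, io₁ j j' e, ic₁ j j' e]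
  have iS₂ : IsBase (h.speedCoeff₂ C (algebraMap ℂ _ c) o₁ o₁' o₂ c₂) := fun j j' e => by
    simp [speedCoeff₂, PhaseCurve.mixed_apply, e, io₁ j j' e, ic₂ j j' e, io₂ j j' e,
      ho₁.isBase io₁ j j' e]
  have iS₃ : IsBase (h.speedCoeff₃ C (algebraMap ℂ _ c) o₂ o₂' c₃) := fun j j' e => by
    simp [speedCoeff₃, PhaseCurve.mixed_apply, e, ic₃ j j' e, io₂ j j' e, ho₂.isBase io₂ j j' e]
  obtain ⟨s1, s2, s3⟩ := eq_zero_of_deg_three (id₁.sub iS₁) (id₂.sub iS₂) (id₃.sub iS₃)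
    (by linear_combination hut)
  have p0 := h.hasD_p C 0
  have p1' := h.hasD_p C 1
  have t0 := h.hasD_gamma C 0
  have f0 := C.hasD_mixed hE.1 1 0
  have r01 := C.hasD_mixed hE.2.2.2.2 0 1
  have r02 := C.hasD_mixed hE.2.2.2.2 0 2
  have r10 := C.hasD_mixed hE.2.2.2.2 1 0
  have r11 := C.hasD_mixed hE.2.2.2.2 1 1
  have r20 := C.hasD_mixed hE.2.2.2.2 2 0
  simp only [zero_add, Nat.reduceAdd] at p0 p1' t0 f0 r01 r02 r10 r11 r20
  -- At a jet with R_x = 1 and R_xx = R_xxx = 0, applying D_x once or twice to a function of R gives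
  -- its first or second derivative.
  let j : JetPt D := pt hPD 1 0 0
  have hj0 : C.w (j.1 0) = P.2 := hwP
  have hj : (j.1 0, C.w (j.1 0)) = P := by rw [hj0]; rfl
  have hμj : C.mu j = μ := hμ
  have hj1 : j.1 1 = 1 := rfl
  have hj2 : j.1 2 = 0 := rfl
  have hsl : h.slopeRate C j = E.nonlinearity μ P := by rw [h.slopeRate_apply C hm, hj, hμj]
  have hφ := h.mixed_phi hP
  have el₁ := congrArg (fun F : JetAlg D => F j) hl₁
  have el₂ := congrArg (fun F : JetAlg D => Dx F j) hl₁
  rw [kd₁, kc₁, ko₁, sub_eq_zero] at s1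
  rw [kd₂, kc₂, ko₁, k1, ko₂, sub_eq_zero] at s2
  rw [kd₃, k2, ko₂, kc₃, sub_eq_zero] at s3
  unfold speedCoeff₁ at s1
  unfold speedCoeff₂ at s2
  unfold speedCoeff₃ at s3
  unfold slopeRate at el₁ el₂ hsl
  have e1 := congrArg (fun F : JetAlg D => F j) s1
  have e1' := congrArg (fun F : JetAlg D => Dx F j) s1
  have e1'' := congrArg (fun F : JetAlg D => Dx (Dx F) j) s1
  have e2 := congrArg (fun F : JetAlg D => F j) s2
  have e2' := congrArg (fun F : JetAlg D => Dx F j) s2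
  have e3 := congrArg (fun F : JetAlg D => F j) s3
  simp only [Derivation.leibniz, Derivation.leibniz_pow, Derivation.map_algebraMap, smul_eq_mul,
    nsmul_eq_mul, map_add, map_sub, map_zero, p0.Dx, p1'.Dx, t0.Dx, f0.Dx, r01.Dx, r02.Dx, r10.Dx, r11.Dx,
    r20.Dx, hm.Dx, Derivation.map_natCast, Dx_X, hz.Dx, hz₁.Dx, hy.Dx, hl₂.Dx, hl₃.Dx,
    show Dx (2 : JetAlg D) = 0 from Derivation.map_natCast _ 2,
    show Dx (3 : JetAlg D) = 0 from Derivation.map_natCast _ 3] at el₂ e1' e1'' e2'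
  simp only [JetAlg.add_apply, JetAlg.sub_apply, JetAlg.mul_apply, JetAlg.pow_apply,
    JetAlg.natCast_apply, JetAlg.ofNat_apply, JetAlg.zero_apply, JetAlg.algebraMap_apply, X_apply,
    PhaseCurve.mixed_apply, hj, hj1, hj2, hμj, hφ, show mixed E.p 0 0 = E.p from rfl,
    show mixed γ 0 0 = γ from rfl, ← hp, ← hp1, ← hp2, ← hq01, ← hq02, ← hq03, ← hq10, ← hq11,
    ← hq12, ← hq20, ← hq21, ← hq30, ← hγ0, ← hγ1, ← hφ1, ← hφ2] at el₁ el₂ e1 e1' e1'' e2 e2' e3 hsl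
  clear s1 s2 s3 k1 k2 kc₁ kc₂ kc₃ kd₁ kd₂ kd₃ ko₁ ko₂ hut
  generalize l₁ j = L1, l₂ j = L2, l₃ j = L3, z j = Z0, z₁ j = Z1, z₂ j = Z2, y j = Y0,
    y₁ j = Y1 at *
  subst el₁
  refine ⟨_, _, _, Z0, Z1, Y0, hsl, rfl, rfl, rfl, ?_, ?_, ?_, ?_⟩
  · linear_combination e1
  · linear_combination (norm := skip) e1' - Z0 * el₂
    push_cast
    ring
  · linear_combination (norm := skip) e2 - 2 * Z0 * el₂
    push_cast
    ring
  -- The corrections to R_t satisfy d₃ = (d₂' - d₁'')/2, so this combination cancels the derivatives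
  -- of λ; y' and z'' cancel too. What remains is the obstruction to the ε² term of u_t being a
  -- total x-derivative.
  · linear_combination (norm := skip) e2' / 2 - e3 - e1'' / 2
    push_cast
    ring

end SecondOrderSetting

end TodaEquation

/-! ### Pointwise conditions from second order -/

namespace TodaEquation

variable {E : TodaEquation} {V : Set (ℂ × ℂ)} {γ : ℂ × ℂ → ℂ}

namespace SecondOrderSetting

/-- The conditions at a point from integrability at second order in `ε`. -/
theorem relations_at (h : E.SecondOrderSetting V γ) (hint : E.IntegrableModulo V 2)
    {P : ℂ × ℂ} (hP : P ∈ V) (hη : E.eta P ≠ 0) (hn : ∃ i < 4, E.nonlinearityCoeff P i ≠ 0)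
    {p p1 p2 q01 q02 q03 q10 q11 q12 q20 q21 q30 γ0 γ1 φ1 φ2 : ℂ}
    (hp : p = E.p P) (hp1 : p1 = mixed E.p 1 0 P) (hp2 : p2 = mixed E.p 2 0 P)
    (hq01 : q01 = mixed E.q 0 1 P) (hq02 : q02 = mixed E.q 0 2 P) (hq03 : q03 = mixed E.q 0 3 P)
    (hq10 : q10 = mixed E.q 1 0 P) (hq11 : q11 = mixed E.q 1 1 P) (hq12 : q12 = mixed E.q 1 2 P)
    (hq20 : q20 = mixed E.q 2 0 P) (hq21 : q21 = mixed E.q 2 1 P) (hq30 : q30 = mixed E.q 3 0 P)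
    (hγ0 : γ0 = γ P) (hγ1 : γ1 = mixed γ 1 0 P) (hφ1 : φ1 = mixed E.phi 1 0 P)
    (hφ2 : φ2 = mixed E.phi 2 0 P) :
    p ≠ 0 ∧ q01 ≠ 0 ∧ p2 * q10 = γ0 * (p * q20 + p1 * q10 - γ0 * p * q10) ∧
      p2 * q01 = γ0 * p * q11 ∧ q10 * φ1 = 0 ∧
      p * q01 * φ1 + p * q10 * (5 * p * q20 + 2 * p1 * q10 - 3 * γ0 * p * q10) = 0 ∧
      2 * q01 * q20 + q10 * q11 = γ0 * q01 * q10 ∧ q01 * q11 = q10 * q02 ∧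
      (q10 = 0 → q11 = 0 → q12 = 0 → q20 = 0 → q21 = 0 → q30 = 0 → γ0 = 0 → φ1 = 0 → φ2 = 0 →
        q01 * q03 = q02 ^ 2) := by
  have hη' : p * q01 ≠ 0 := by
    have := h.fst.f_gW P hP
    rw [eta, this, zero_add] at hη
    rwa [hp, hq01]
  have hp0 := left_ne_zero_of_mul hη'
  have hq0 := right_ne_zero_of_mul hη'
  -- Polynomials in the slope x: n is the nonlinearity, n z = Z, and `nm`, `nR`, `Zm`, `ZR` are the
  -- derivatives of n and Z in the slope at fixed point and along the curve at fixed slope.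
  obtain ⟨G, hG⟩ : ∃ G : ℂ → ℂ, ∀ x, G x = p * q20 + 2 * p1 * q10 + γ0 * p * q10 +
      2 * x * (p * q11 + p1 * q01) + x ^ 2 * p * q02 := ⟨_, fun _ => rfl⟩
  obtain ⟨Z, hZ⟩ : ∃ Z : ℂ → ℂ, ∀ x, Z x = x ^ 3 * (4 * (p * q10) + x * (p * q01)) / 12 :=
    ⟨_, fun _ => rfl⟩
  obtain ⟨Zm, hZm⟩ : ∃ Zm : ℂ → ℂ, ∀ x, Zm x =
      (3 * x ^ 2 * (4 * (p * q10)) + 4 * x ^ 3 * (p * q01)) / 12 := ⟨_, fun _ => rfl⟩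
  obtain ⟨ZR, hZR⟩ : ∃ ZR : ℂ → ℂ, ∀ x, ZR x = x ^ 3 * (4 * (p1 * q10 + p * q20 + x * (p * q11)) +
        x * (p1 * q01 + p * q11 + x * (p * q02))) / 12 := ⟨_, fun _ => rfl⟩
  obtain ⟨T, hT⟩ : ∃ T : ℂ → ℂ, ∀ x, T x = 9 * p * q20 + 8 * p1 * q10 - γ0 * p * q10 +
      18 * x * p * q11 + 8 * x * p1 * q01 + 9 * x ^ 2 * p * q02 := ⟨_, fun _ => rfl⟩
  obtain ⟨F1, hF1⟩ : ∃ F : ℂ → ℂ, ∀ x, F x = 3 * x ^ 2 * p * q10 + x ^ 3 * p * q01 :=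
    ⟨_, fun _ => rfl⟩
  obtain ⟨B2, hB2⟩ : ∃ F : ℂ → ℂ, ∀ x, F x = 1 / 2 * (p * q11 + p1 * q01) + 1 / 2 * x * p * q02 :=
    ⟨_, fun _ => rfl⟩
  obtain ⟨r0, hr0⟩ : ∃ F : ℂ → ℂ, ∀ x, F x =
      x ^ 3 / 6 * (p2 * q10 - γ0 * p * q20 - γ0 * p1 * q10 + γ0 ^ 2 * p * q10) +
        x ^ 4 / 24 * (p2 * q01 - γ0 * p * q11) := ⟨_, fun _ => rfl⟩
  obtain ⟨n, hnx⟩ : ∃ F : ℂ → ℂ, ∀ x, F x = φ1 + (p * (3 * q20 - γ0 * q10) + 2 * (p1 * q10)) * x +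
        (3 * (p * q11) + p1 * q01) * x ^ 2 + p * q02 * x ^ 3 := ⟨_, fun _ => rfl⟩
  obtain ⟨nm, hnm⟩ : ∃ F : ℂ → ℂ, ∀ x, F x = (p * (3 * q20 - γ0 * q10) + 2 * (p1 * q10)) +
        2 * (3 * (p * q11) + p1 * q01) * x + 3 * (p * q02) * x ^ 2 := ⟨_, fun _ => rfl⟩
  obtain ⟨nR, hnR⟩ : ∃ F : ℂ → ℂ, ∀ x, F x = φ2 + (p1 * (4 * q20 - 2 * γ0 * q10) +
          p * (4 * q30 - 2 * γ1 * q10 - 2 * γ0 * q20) +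
          2 * p2 * q10 + 2 * p1 * q20) * x +
        (p * (6 * q21 - γ0 * q11) + 6 * (p1 * q11) + p2 * q01) * x ^ 2 +
        (4 * (p * q12) + 2 * (p1 * q02)) * x ^ 3 + p * q03 * x ^ 4 := ⟨_, fun _ => rfl⟩
  have key : ∀ x, ∑ i ∈ Finset.range 4, E.nonlinearityCoeff P i * x ^ i ≠ 0 →
      n x ≠ 0 ∧ r0 x = 0 ∧ p * q01 * (G x * Z x - (n x * Zm x - nm x * Z x)) = 0 ∧
      G x * (n x * Zm x - nm x * Z x - (n x * F1 x - T x * Z x) / 2) -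
        p * q01 * (n x * ZR x - nR x * Z x) / 2 + n x * Z x * B2 x = 0 := by
    intro x hx
    have hnx' : E.nonlinearity x P ≠ 0 := by rwa [nonlinearity_eq_sum h.holo x hP]
    have hn0 : n x ≠ 0 := by
      obtain ⟨n', _, _, _, _, _, h1, h2, -⟩ := h.second_order hint hP hnx' one_ne_zero hp hp1 hp2
        hq01 hq02 hq03 hq10 hq11 hq12 hq20 hq21 hq30 hγ0 hγ1 hφ1 hφ2
      rw [hnx, ← h2, h1]
      exact hnx'
    -- After multiplication by n² and elimination of z, z', y, the obstruction is a cubic polynomial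
    -- in the curvature. The coefficients of c⁰, c² and c³ are the ones used.
    have hcub := cubic_coeff_eq_zero (a₀ := n x ^ 2 * r0 x)
      (a₁ := G x * (n x * ZR x - n x / 2 * (2 / 3 * x ^ 3 * p * q20 + 1 / 3 * γ0 * x ^ 3 * p * q10 +
        5 / 6 * x ^ 4 * p * q11 + x ^ 5 * p * q02 / 6)) + n x * Z x * (1 / 2 * p * q30 +
        3 / 2 * p1 * q20 + p2 * q10 + 1 / 2 * γ0 * (p * q20 + p1 * q10) +
          1 / 2 * γ1 * p * q10 + x * (3 / 2 * p * q21 + 3 * p1 * q11 + p2 * q01 +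
          1 / 2 * γ0 * p * q11) + 3 / 2 * x ^ 2 * (p * q12 + p1 * q02) + 1 / 2 * x ^ 3 * p * q03) -
        n x ^ 2 * (1 / 2 * x ^ 2 * p1 * q10 + x ^ 3 * (p * q11 + p1 * q01) / 6 +
          x ^ 4 * p * q02 / 24))
      (a₂ := G x * (n x * Zm x - nm x * Z x - (n x * F1 x - T x * Z x) / 2) -
        p * q01 * (n x * ZR x - nR x * Z x) / 2 + n x * Z x * B2 x)
      (a₃ := p * q01 * (G x * Z x - (n x * Zm x - nm x * Z x)) / 2) (fun c hc => by
        obtain ⟨n', nR', nm', z, z', y, h1, h2, h3, h4, h5, h6, h7, h8⟩ :=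
          h.second_order hint hP hnx' hc hp hp1 hp2
            hq01 hq02 hq03 hq10 hq11 hq12 hq20 hq21 hq30 hγ0 hγ1 hφ1 hφ2
        rw [← hnx] at h2
        rw [← hnm] at h3
        rw [← hnR] at h4
        subst h2 h3 h4
        rw [← hZ] at h5
        rw [← hG, ← hr0] at h8
        rw [← hT] at h7
        have e6 : n x ^ 2 * z' = n x * (ZR x + c * Zm x) - (nR x + c * nm x) * Z x := by
          rw [hZR, hZm, ← h5]
          linear_combination n x * h6
        have e7 : n x ^ 2 * y = -2 * nR x * Z x - c * T x * Z x - c ^ 2 * (p * q01) * Z x +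
            n x * (2 / 3 * x ^ 3 * p * q20 + 1 / 3 * γ0 * x ^ 3 * p * q10 +
              5 / 6 * x ^ 4 * p * q11 + x ^ 5 * p * q02 / 6) + n x * c * F1 x := by
          rw [hF1, ← h5]
          linear_combination n x * h7
        rw [hB2]
        linear_combination n x ^ 2 * h8 - (c * G x - c ^ 2 * (p * q01) / 2) * e6 +
          c * G x / 2 * e7 - n x * (c * (1 / 2 * p * q30 +
        3 / 2 * p1 * q20 + p2 * q10 + 1 / 2 * γ0 * (p * q20 + p1 * q10) +
          1 / 2 * γ1 * p * q10 + x * (3 / 2 * p * q21 + 3 * p1 * q11 + p2 * q01 +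
          1 / 2 * γ0 * p * q11) + 3 / 2 * x ^ 2 * (p * q12 + p1 * q02) + 1 / 2 * x ^ 3 * p * q03) +
          c ^ 2 * (1 / 2 * (p * q11 + p1 * q01) + 1 / 2 * x * p * q02)) * h5)
    refine ⟨hn0, (mul_eq_zero.1 hcub.1).resolve_left (pow_ne_zero _ hn0), ?_, hcub.2.2.1⟩
    linear_combination 2 * hcub.2.2.2
  let c0 : ℕ → ℂ := fun i => match i with
    | 3 => (p2 * q10 - γ0 * p * q20 - γ0 * p1 * q10 + γ0 ^ 2 * p * q10) / 6
    | 4 => (p2 * q01 - γ0 * p * q11) / 24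
    | _ => 0
  have a0 : ∀ i < 5, c0 i = 0 := fun i hi => coeff_eq_zero_of_forall hn (n := 5) (fun x hx => by
    simp only [Finset.sum_range_succ, Finset.sum_range_zero, c0]
    have := (key x hx).2.1
    rw [hr0] at this
    linear_combination this) hi
  -- The c³-coefficient says G Z = n² ∂_μ(Z/n); its expansion in powers of μ yields the relations
  -- for φ_u, q_uu, q_uw and q_ww.
  let c3 : ℕ → ℂ := fun i => match i with
    | 2 => 12 * (p * q10) * φ1
    | 3 => 4 * (p * q01) * φ1 + 4 * (p * q10) * (5 * p * q20 + 2 * p1 * q10 - 3 * γ0 * p * q10)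
    | 4 => 4 * p ^ 2 * (2 * q01 * q20 + q10 * q11 - γ0 * q01 * q10)
    | 5 => 4 * p ^ 2 * (q01 * q11 - q10 * q02)
    | _ => 0
  have a3 : ∀ i < 6, c3 i = 0 := fun i hi => coeff_eq_zero_of_forall hn (n := 6) (fun x hx => by
    simp only [Finset.sum_range_succ, Finset.sum_range_zero, c3]
    have := (mul_eq_zero.1 (key x hx).2.2.1).resolve_left hη'
    rw [hG, hZ, hZm, hnx, hnm] at this
    linear_combination -12 * this) hi
  have b3 := a0 3 (by norm_num)
  have b4 := a0 4 (by norm_num)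
  have d2 := a3 2 (by norm_num)
  have d3 := a3 3 (by norm_num)
  have d4 := a3 4 (by norm_num)
  have d5 := a3 5 (by norm_num)
  simp only [c0, c3] at b3 b4 d2 d3 d4 d5
  have hpp : (4 : ℂ) * p ^ 2 ≠ 0 := mul_ne_zero (by norm_num) (pow_ne_zero _ hp0)
  refine ⟨hp0, hq0, by linear_combination 6 * b3, by linear_combination 24 * b4, ?_,
    by linear_combination d3 / 4, sub_eq_zero.1 ((mul_eq_zero.1 d4).resolve_left hpp),
    sub_eq_zero.1 ((mul_eq_zero.1 d5).resolve_left hpp), ?_⟩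
  · refine (mul_eq_zero.1 (?_ : p * (q10 * φ1) = 0)).resolve_left hp0
    linear_combination d2 / 12
  · rintro rfl rfl rfl rfl rfl rfl rfl rfl rfl
    have hp2' : p2 = 0 := (mul_eq_zero.1 (by linear_combination 24 * b4 : p2 * q01 = 0)).resolve_right hq0
    -- When the u-derivatives of q and φ and γ vanish, only the eighth power of μ survives in the
    -- c²-coefficient.
    let c2 : ℕ → ℂ := fun i => match i with
      | 8 => p ^ 3 * q01 / 24 * (q01 * q03 - q02 ^ 2)
      | _ => 0
    have a2 : c2 8 = 0 := coeff_eq_zero_of_forall hn (n := 9) (fun x hx => by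
      simp only [Finset.sum_range_succ, Finset.sum_range_zero, c2]
      have := (key x hx).2.2.2
      rw [hG, hZ, hZm, hnx, hnm, hF1, hT, hZR, hnR, hB2, hp2'] at this
      linear_combination this) (by norm_num)
    simp only [c2] at a2
    refine sub_eq_zero.1 ((mul_eq_zero.1 a2).resolve_left ?_)
    exact div_ne_zero (mul_ne_zero (pow_ne_zero _ hp0) hq0) (by norm_num)

end SecondOrderSetting

end TodaEquation

/-! ### Proportional functions -/

section Proportional

variable {U : Set (ℂ × ℂ)} {F G : ℂ × ℂ → ℂ}

theorem partialU_congr_of_isOpen (hU : IsOpen U) (h : ∀ P ∈ U, F P = G P) :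
    ∀ P ∈ U, partialU F P = partialU G P := fun P hP =>
  partialU_congr (by filter_upwards [hU.mem_nhds hP] with Q hQ using h Q hQ)

theorem partialW_congr_of_isOpen (hU : IsOpen U) (h : ∀ P ∈ U, F P = G P) :
    ∀ P ∈ U, partialW F P = partialW G P := fun P hP =>
  partialW_congr (by filter_upwards [hU.mem_nhds hP] with Q hQ using h Q hQ)

/-- Functions with proportional gradients in the sense of a vanishing Wronskian are proportional. -/
theorem exists_eq_const_mul (hF : AnalyticOnNhd ℂ F U) (hG : AnalyticOnNhd ℂ G U) (hUo : IsOpen U)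
    (hU : IsPreconnected U) (h0 : ∃ P ∈ U, F P ≠ 0)
    (h1 : ∀ P ∈ U, F P * partialU G P = G P * partialU F P)
    (h2 : ∀ P ∈ U, F P * partialW G P = G P * partialW F P) :
    ∃ c, ∀ P ∈ U, G P = c * F P := by
  obtain ⟨P₀, hP₀, hF₀⟩ := h0
  obtain ⟨r, hr, hball⟩ := Metric.isOpen_iff.1 (hF.isOpen_ne_zero hUo) P₀ ⟨hP₀, hF₀⟩
  set B := Metric.ball P₀ r
  -- On a ball without zeros of F the quotient G/F has zero gradient; the identity theorem then
  -- carries G = cF to U.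
  have hB0 : ∀ P ∈ B, F P ≠ 0 := fun P hP => (hball hP).2
  have hBU : B ⊆ U := fun P hP => (hball hP).1
  have hK : AnalyticOnNhd ℂ (fun P => G P / F P) B := (hG.mono hBU).div (hF.mono hBU) hB0
  have hKF : ∀ P ∈ B, G P / F P * F P = G P := fun P hP => div_mul_cancel₀ _ (hB0 P hP)
  obtain ⟨c, hc⟩ := eq_const_of_partial_eq_zero hK Metric.isOpen_ball
    (convex_ball P₀ r).isPreconnected
    (fun P hP => by
      have := partialU_congr_of_isOpen Metric.isOpen_ball hKF P hP
      rw [partialU_mul (hK P hP) (hF P (hBU hP))] at this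
      have e := h1 P (hBU hP)
      have h0 := hB0 P hP
      rw [← this] at e
      refine (mul_eq_zero.1 (?_ : F P ^ 2 * _ = 0)).resolve_left (pow_ne_zero 2 h0)
      linear_combination e - partialU F P * hKF P hP)
    (fun P hP => by
      have := partialW_congr_of_isOpen Metric.isOpen_ball hKF P hP
      rw [partialW_mul (hK P hP) (hF P (hBU hP))] at this
      have e := h2 P (hBU hP)
      have h0 := hB0 P hP
      rw [← this] at e
      refine (mul_eq_zero.1 (?_ : F P ^ 2 * _ = 0)).resolve_left (pow_ne_zero 2 h0)
      linear_combination e - partialW F P * hKF P hP)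
  refine ⟨c, fun P hP => sub_eq_zero.1 <| (hG.sub (analyticOnNhd_const.mul hF)).eq_zero_of_open hU
    Metric.isOpen_ball hBU (Metric.nonempty_ball.2 hr) (fun Q hQ => ?_) P hP⟩
  change G Q - c * F Q = 0
  rw [← hKF Q hQ, ← hc Q hQ, sub_self]

end Proportional

/-! ### Relations when q depends on w only -/

namespace TodaEquation

variable {E : TodaEquation} {U : Set (ℂ × ℂ)}

/-- The conditions on an integrable equation for which `q` is a function of `w` only. -/
theorem IntegrableModulo.second_order_of_q_eq (hE : E.HolomorphicOn U) (hU : IsOpen U)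
    (hc : IsPreconnected U) (hn : E.Nondegenerate U) (hint : E.IntegrableModulo U 2)
    (hq : ∀ P ∈ U, partialU E.q P = 0) :
    (∀ P ∈ U, partialU E.phi P = 0) ∧ (∀ P ∈ U, partialW E.phi P = 0) ∧
      (∀ P ∈ U, mixed E.p 2 0 P = 0) ∧
      (∀ P ∈ U, mixed E.q 0 1 P * mixed E.q 0 3 P = mixed E.q 0 2 P ^ 2) ∧
      ((∀ P ∈ U, E.f P = 0) ∨ (∀ P ∈ U, partialU E.g P = 0) ∧ ∀ P ∈ U, partialW E.g P = 0) := by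
  have hF := hint.firstOrderConditions hE hU hc hn
  obtain ⟨V, hV, hne, hVU, hgen⟩ := exists_generic_set hE hU hc hn
  have zU : ∀ {F : ℂ × ℂ → ℂ}, (∀ P ∈ U, F P = 0) → ∀ P ∈ U, partialU F P = 0 := fun h P hP => by
    rw [partialU_congr_of_isOpen hU (G := fun _ => 0) h P hP, partialU_const]
  have zW : ∀ {F : ℂ × ℂ → ℂ}, (∀ P ∈ U, F P = 0) → ∀ P ∈ U, partialW F P = 0 := fun h P hP => by
    rw [partialW_congr_of_isOpen hU (G := fun _ => 0) h P hP, partialW_const]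
  have mU : ∀ {i k : ℕ}, (∀ P ∈ U, mixed E.q i k P = 0) → ∀ P ∈ U, mixed E.q (i + 1) k P = 0 :=
    fun {i k} h P hP => by rw [← partialU_mixed]; exact zU h P hP
  have mW : ∀ {i k : ℕ}, (∀ P ∈ U, mixed E.q i k P = 0) → ∀ P ∈ U, mixed E.q i (k + 1) P = 0 :=
    fun {i k} h P hP => by rw [← partialW_mixed hE.2.2.2.2 i k hP]; exact zW h P hP
  have q10 : ∀ P ∈ U, mixed E.q 1 0 P = 0 := hq
  have q11 := mW q10
  have q12 := mW q11
  have q20 := mU q10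
  have q21 := mU q11
  have q30 := mU q20
  have hfg : (∀ P ∈ U, E.f P = 0) ∨ (∀ P ∈ U, partialU E.g P = 0) ∧ ∀ P ∈ U, partialW E.g P = 0 := by
    rcases hF.f_or_gW with h | h
    · exact Or.inl h
    · refine (hE.2.1.eq_zero_of_mul_eq_zero hE.2.2.1.partialU hU hc fun P hP => ?_).imp id
        fun h' => ⟨h', h⟩
      rw [hF.f_gU P hP, hq P hP, mul_zero]
  have hφW : ∀ P ∈ U, partialW E.phi P = 0 := fun P hP => by
    rw [hF.phiW P hP, zU hq P hP]
    rcases hfg with h | ⟨h, -⟩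
    · rw [h P hP]; ring
    · rw [zU h P hP]; ring
  -- Here either f ≡ 0 or g has zero gradient, so g_uu / g_u plays no role and γ = 0 is admissible.
  have hs : E.SecondOrderSetting V (fun _ => 0) :=
    ⟨hE.mono hVU, hV, hF.mono hVU, analyticOnNhd_const, fun P _ => partialW_const 0,
      fun P hP => by rw [hφW P (hVU hP), q20 P (hVU hP), zero_mul, sub_zero, mul_zero],
      hfg.imp (fun h P hP => ⟨h P (hVU hP), q10 P (hVU hP)⟩) fun h P hP =>
        ⟨h.2 P (hVU hP), by rw [zU h.1 P (hVU hP), zero_mul]⟩⟩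
  have hr : ∀ P ∈ V, _ := fun P hP => hs.relations_at (hint.mono hVU) hP (hgen P hP).1
    (hgen P hP).2 rfl rfl rfl rfl rfl rfl rfl rfl rfl rfl rfl rfl rfl rfl rfl rfl
  have hφU : ∀ P ∈ U, partialU E.phi P = 0 :=
    hE.1.partialU.eq_zero_of_open hc hV hVU hne fun P hP => by
      obtain ⟨h1, h2, -, -, -, h3, -⟩ := hr P hP
      rw [q10 P (hVU hP)] at h3
      refine (mul_eq_zero.1 (?_ : E.p P * mixed E.q 0 1 P * partialU E.phi P = 0)).resolve_left
        (mul_ne_zero h1 h2)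
      linear_combination (norm := skip) h3
      simp only [mixed, Function.iterate_succ, Function.iterate_zero, Function.comp, id]
      ring
  refine ⟨hφU, hφW, (hE.2.2.2.1.mixed 2 0).eq_zero_of_open hc hV hVU hne fun P hP => ?_,
    fun P hP => ?_, hfg⟩
  · obtain ⟨h1, h2, -, h3, -⟩ := hr P hP
    exact (mul_eq_zero.1 (h3.trans (by ring))).resolve_right h2
  · refine sub_eq_zero.1 ((((hE.2.2.2.2.mixed 0 1).mul (hE.2.2.2.2.mixed 0 3)).sub
      ((hE.2.2.2.2.mixed 0 2).pow 2)).eq_zero_of_open hc hV hVU hne (fun Q hQ => ?_) P hP)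
    have hQ' := hVU hQ
    obtain ⟨-, -, -, -, -, -, -, -, h3⟩ := hr Q hQ
    exact sub_eq_zero.2 (h3 (q10 Q hQ') (q11 Q hQ') (q12 Q hQ') (q20 Q hQ') (q21 Q hQ') (q30 Q hQ')
      rfl (hφU Q hQ') (zU hφU Q hQ'))

end TodaEquation

/-! ### Relations when q depends on u -/

namespace TodaEquation

variable {E : TodaEquation} {U : Set (ℂ × ℂ)}

/-- The pointwise second-order relations near a point where `q` depends on `u`. -/
theorem IntegrableModulo.exists_second_order_relations (hE : E.HolomorphicOn U) (hU : IsOpen U)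
    (hc : IsPreconnected U) (hn : E.Nondegenerate U) (hint : E.IntegrableModulo U 2)
    (hq : ∃ P ∈ U, partialU E.q P ≠ 0) :
    ∃ (V : Set (ℂ × ℂ)) (γ : ℂ × ℂ → ℂ), IsOpen V ∧ IsPreconnected V ∧ V.Nonempty ∧ V ⊆ U ∧
      AnalyticOnNhd ℂ γ V ∧ (∀ P ∈ V, partialW γ P = 0) ∧ (∀ P ∈ U, partialW E.g P = 0) ∧
      ∀ P ∈ V, (∃ i < 4, E.nonlinearityCoeff P i ≠ 0) ∧
        partialU (partialU E.g) P = γ P * partialU E.g P ∧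
        partialW E.phi P = E.p P * (mixed E.q 2 0 P - γ P * mixed E.q 1 0 P) ∧
        E.p P ≠ 0 ∧ mixed E.q 0 1 P ≠ 0 ∧ mixed E.q 1 0 P ≠ 0 ∧
        mixed E.p 2 0 P * mixed E.q 1 0 P = γ P * (E.p P * mixed E.q 2 0 P +
          mixed E.p 1 0 P * mixed E.q 1 0 P - γ P * E.p P * mixed E.q 1 0 P) ∧
        mixed E.p 2 0 P * mixed E.q 0 1 P = γ P * E.p P * mixed E.q 1 1 P ∧
        partialU E.phi P = 0 ∧
        5 * E.p P * mixed E.q 2 0 P + 2 * mixed E.p 1 0 P * mixed E.q 1 0 P =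
          3 * γ P * E.p P * mixed E.q 1 0 P ∧
        2 * mixed E.q 0 1 P * mixed E.q 2 0 P + mixed E.q 1 0 P * mixed E.q 1 1 P =
          γ P * mixed E.q 0 1 P * mixed E.q 1 0 P ∧
        mixed E.q 0 1 P * mixed E.q 1 1 P = mixed E.q 1 0 P * mixed E.q 0 2 P := by
  have hF := hint.firstOrderConditions hE hU hc hn
  obtain ⟨V, hV, hne, hVU, hgen⟩ := exists_generic_set hE hU hc hn
  obtain ⟨P₀, hP₀, hq₀⟩ : ∃ P ∈ V, partialU E.q P ≠ 0 := by
    by_contra h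
    push Not at h
    obtain ⟨P, hP, hq⟩ := hq
    exact hq (hE.2.2.2.2.partialU.eq_zero_of_open hc hV hVU hne h P hP)
  obtain ⟨r, hr, hball⟩ := Metric.isOpen_iff.1
    ((hE.2.2.2.2.partialU.mono hVU).isOpen_ne_zero hV) P₀ ⟨hP₀, hq₀⟩
  set B := Metric.ball P₀ r
  have hBV : B ⊆ V := fun P hP => (hball hP).1
  have hBU : B ⊆ U := hBV.trans hVU
  have hp0 : ∀ P ∈ B, E.p P ≠ 0 := fun P hP h0 => (hgen P (hBV hP)).1 <| by
    rw [eta, hF.f_gW P (hBU hP), h0]; ring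
  have hfg : ∀ P ∈ B, E.f P * partialU E.g P ≠ 0 := fun P hP => by
    rw [hF.f_gU P (hBU hP)]
    exact mul_ne_zero (hp0 P hP) (hball hP).2
  have hP₀B : P₀ ∈ B := Metric.mem_ball_self hr
  -- On the ball p q_u = f g_u is non-zero, which excludes f ≡ 0 and allows division by g_u.
  have hgW : ∀ P ∈ U, partialW E.g P = 0 := hF.f_or_gW.resolve_left fun h =>
    left_ne_zero_of_mul (hfg P₀ hP₀B) (h P₀ (hBU hP₀B))
  have hgU0 : ∀ P ∈ B, partialU E.g P ≠ 0 := fun P hP => right_ne_zero_of_mul (hfg P hP)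
  have hg := hE.2.2.1.mono hBU
  have hγ : AnalyticOnNhd ℂ (fun P => partialU (partialU E.g) P / partialU E.g P) B :=
    hg.partialU.partialU.div hg.partialU hgU0
  have hγg : ∀ P ∈ B, partialU (partialU E.g) P / partialU E.g P * partialU E.g P =
    partialU (partialU E.g) P := fun P hP => div_mul_cancel₀ _ (hgU0 P hP)
  have zU : ∀ {F : ℂ × ℂ → ℂ}, (∀ P ∈ U, F P = 0) → ∀ P ∈ U, partialU F P = 0 := fun h P hP => by
    rw [partialU_congr_of_isOpen hU (G := fun _ => 0) h P hP, partialU_const]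
  have hg11 : ∀ P ∈ U, partialW (partialU E.g) P = 0 := fun P hP => by
    rw [partialW_partialU (hE.2.2.1 P hP)]; exact zU hgW P hP
  have hg21 : ∀ P ∈ U, partialW (partialU (partialU E.g)) P = 0 := fun P hP => by
    rw [partialW_partialU (hE.2.2.1.partialU P hP)]; exact zU hg11 P hP
  have hγW : ∀ P ∈ B, partialW (fun P => partialU (partialU E.g) P / partialU E.g P) P = 0 :=
    fun P hP => by
    have := partialW_congr_of_isOpen Metric.isOpen_ball hγg P hP
    rw [partialW_mul (hγ P hP) (hg.partialU P hP), hg21 P (hBU hP), hg11 P (hBU hP), mul_zero,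
      add_zero] at this
    exact (mul_eq_zero.1 this).resolve_right (hgU0 P hP)
  have hφW : ∀ P ∈ B, partialW E.phi P = E.p P * (mixed E.q 2 0 P -
      partialU (partialU E.g) P / partialU E.g P * mixed E.q 1 0 P) := fun P hP => by
    rw [hF.phiW P (hBU hP), show mixed E.q 2 0 = partialU (partialU E.q) from rfl,
      show mixed E.q 1 0 = partialU E.q from rfl]
    linear_combination -E.f P * (hγg P hP).symm -
      partialU (partialU E.g) P / partialU E.g P * hF.f_gU P (hBU hP)
  have hs : E.SecondOrderSetting B (fun P => partialU (partialU E.g) P / partialU E.g P) :=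
    ⟨hE.mono hBU, Metric.isOpen_ball, hF.mono hBU, hγ, hγW, hφW,
      Or.inr fun P hP => ⟨hgW P (hBU hP), (hγg P hP).symm⟩⟩
  refine ⟨B, _, Metric.isOpen_ball, (convex_ball P₀ r).isPreconnected, ⟨P₀, hP₀B⟩, hBU, hγ, hγW,
    hgW, fun P hP => ?_⟩
  have hq0 : mixed E.q 1 0 P ≠ 0 := (hball hP).2
  obtain ⟨h1, h2, h3, h4, h5, h6, h7, h8, -⟩ := hs.relations_at (hint.mono hBU) hP
    (hgen P (hBV hP)).1 (hgen P (hBV hP)).2 rfl rfl rfl rfl rfl rfl rfl rfl rfl rfl rfl rfl rfl rfl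
    rfl rfl
  have h9 : partialU E.phi P = 0 := (mul_eq_zero.1 h5).resolve_left hq0
  refine ⟨(hgen P (hBV hP)).2, (hγg P hP).symm, hφW P hP, h1, h2, hq0, h3, h4, h9, ?_, h7, h8⟩
  rw [show mixed E.phi 1 0 P = 0 from h9] at h6
  exact sub_eq_zero.1 ((mul_eq_zero.1 ((zero_add _).symm.trans
    ((by ring : _ = _).trans h6))).resolve_left (mul_ne_zero h1 hq0))

/-- The conditions on an integrable equation for which `q` depends on `u`. -/
theorem IntegrableModulo.second_order_of_q_ne (hE : E.HolomorphicOn U) (hU : IsOpen U)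
    (hc : IsPreconnected U) (hn : E.Nondegenerate U) (hint : E.IntegrableModulo U 2)
    (hq : ∃ P ∈ U, partialU E.q P ≠ 0) :
    ∃ κ ≠ 0, (∀ P ∈ U, partialU E.phi P = 0) ∧ (∀ P ∈ U, partialW E.phi P = 0) ∧
      (∀ P ∈ U, partialW E.g P = 0) ∧
      (∀ P ∈ U, E.p P * mixed E.p 2 0 P + mixed E.p 1 0 P ^ 2 = 0) ∧
      (∀ P ∈ U, mixed E.q 0 2 P = κ * mixed E.q 0 1 P) ∧
      (∀ P ∈ U, E.p P * mixed E.q 1 1 P = mixed E.p 1 0 P * mixed E.q 0 1 P) ∧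
      (∀ P ∈ U, κ * (E.p P * mixed E.q 1 0 P) = mixed E.p 1 0 P * mixed E.q 0 1 P) ∧
      ∀ P ∈ U, E.p P * partialU (partialU E.g) P + mixed E.p 1 0 P * partialU E.g P = 0 := by
  have hF := hint.firstOrderConditions hE hU hc hn
  obtain ⟨V, γ, hV, hVc, hne, hVU, hγ, hγW, hgW, hrel⟩ :=
    hint.exists_second_order_relations hE hU hc hn hq
  have hq' := hE.2.2.2.2
  have hp := hE.2.2.2.1
  have mU : ∀ (i k : ℕ) {P : ℂ × ℂ}, partialU (mixed E.q i k) P = mixed E.q (i + 1) k P :=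
    fun i k P => congrFun (partialU_mixed _ _ _) P
  have mW : ∀ (i k : ℕ) {P : ℂ × ℂ}, P ∈ V → partialW (mixed E.q i k) P = mixed E.q i (k + 1) P :=
    fun i k P hP => partialW_mixed hq' i k (hVU hP)
  have hm : ∀ (i k : ℕ) {P : ℂ × ℂ}, P ∈ V → AnalyticAt ℂ (mixed E.q i k) P :=
    fun i k P hP => hq'.mixed i k P (hVU hP)
  have x1 : ∀ P ∈ V, mixed E.q 0 1 P * mixed E.q 1 1 P = mixed E.q 1 0 P * mixed E.q 0 2 P :=
    fun P hP => (hrel P hP).2.2.2.2.2.2.2.2.2.2.2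
  have x2 : ∀ P ∈ V, mixed E.q 0 1 P * mixed E.q 2 0 P * 2 + mixed E.q 1 0 P * mixed E.q 1 1 P =
      γ P * (mixed E.q 0 1 P * mixed E.q 1 0 P) :=
    fun P hP => by linear_combination (hrel P hP).2.2.2.2.2.2.2.2.2.2.1
  have x3 : ∀ P ∈ V, mixed E.q 0 1 P * mixed E.q 1 2 P = mixed E.q 1 0 P * mixed E.q 0 3 P :=
    fun P hP => by
    have := partialW_congr_of_isOpen hV x1 P hP
    rw [partialW_mul (hm 0 1 hP) (hm 1 1 hP), partialW_mul (hm 1 0 hP) (hm 0 2 hP), mW 0 1 hP,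
      mW 1 1 hP, mW 1 0 hP, mW 0 2 hP] at this
    linear_combination this
  have x4 : ∀ P ∈ V, mixed E.q 1 1 P ^ 2 + mixed E.q 0 1 P * mixed E.q 2 1 P =
      mixed E.q 2 0 P * mixed E.q 0 2 P + mixed E.q 1 0 P * mixed E.q 1 2 P := fun P hP => by
    have := partialU_congr_of_isOpen hV x1 P hP
    rw [partialU_mul (hm 0 1 hP) (hm 1 1 hP), partialU_mul (hm 1 0 hP) (hm 0 2 hP), mU 0 1,
      mU 1 1, mU 1 0, mU 0 2] at this
    linear_combination this
  have x5 : ∀ P ∈ V, 2 * mixed E.q 0 2 P * mixed E.q 2 0 P + 2 * mixed E.q 0 1 P * mixed E.q 2 1 P +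
      mixed E.q 1 1 P ^ 2 + mixed E.q 1 0 P * mixed E.q 1 2 P =
      γ P * (mixed E.q 0 2 P * mixed E.q 1 0 P + mixed E.q 0 1 P * mixed E.q 1 1 P) :=
    fun P hP => by
    have := partialW_congr_of_isOpen hV x2 P hP
    rw [partialW_add (((hm 0 1 hP).fun_mul (hm 2 0 hP)).fun_mul analyticAt_const)
      ((hm 1 0 hP).fun_mul (hm 1 1 hP)), partialW_mul ((hm 0 1 hP).fun_mul (hm 2 0 hP))
      analyticAt_const, partialW_mul (hm 0 1 hP) (hm 2 0 hP), partialW_mul (hm 1 0 hP) (hm 1 1 hP),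
      partialW_mul (hγ P hP) ((hm 0 1 hP).fun_mul (hm 1 0 hP)),
      partialW_mul (hm 0 1 hP) (hm 1 0 hP), partialW_const, hγW P hP, mW 0 1 hP,
      mW 1 1 hP, mW 1 0 hP, mW 2 0 hP] at this
    linear_combination this
  -- Eliminating γ, q_uu and q_uuw from the two relations and their first derivatives leaves the
  -- vanishing of the w-Wronskian of q_w and q_ww; `x7` is the u-Wronskian.
  have x6 : ∀ P ∈ V, mixed E.q 0 1 P * mixed E.q 0 3 P = mixed E.q 0 2 P * mixed E.q 0 2 P :=
    fun P hP => by
    obtain ⟨-, -, -, -, h01, h10, -⟩ := hrel P hP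
    refine mul_left_cancel₀ (pow_ne_zero 2 h10) ?_
    have e1 := x1 P hP
    have e2 := x2 P hP
    have e3 := x3 P hP
    have e4 := x4 P hP
    have e5 := x5 P hP
    have e6 : mixed E.q 0 1 P * (mixed E.q 1 0 P * mixed E.q 1 2 P) =
        mixed E.q 0 1 P * mixed E.q 1 1 P ^ 2 := by
      linear_combination (1 / 3) * mixed E.q 0 1 P * e5 - (2 / 3) * mixed E.q 0 1 P * e4 -
        (2 / 3) * mixed E.q 0 2 P * e2 + (γ P * mixed E.q 0 1 P / 3 - 2 / 3 * mixed E.q 1 1 P) * e1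
    linear_combination -mixed E.q 1 0 P * mixed E.q 0 1 P * e3 + mixed E.q 0 1 P * e6 +
      (mixed E.q 0 1 P * mixed E.q 1 1 P + mixed E.q 1 0 P * mixed E.q 0 2 P) * e1
  have x7 : ∀ P ∈ V, mixed E.q 0 1 P * mixed E.q 1 2 P = mixed E.q 0 2 P * mixed E.q 1 1 P :=
    fun P hP => by
    obtain ⟨-, -, -, -, h01, h10, -⟩ := hrel P hP
    refine mul_left_cancel₀ (mul_ne_zero h10 h01) ?_
    linear_combination mixed E.q 0 1 P * mixed E.q 1 0 P * x3 P hP +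
      mixed E.q 1 0 P ^ 2 * x6 P hP - mixed E.q 1 0 P * mixed E.q 0 2 P * x1 P hP
  obtain ⟨κ, hκ⟩ := exists_eq_const_mul ((hq'.mixed 0 1).mono hVU) ((hq'.mixed 0 2).mono hVU) hV
    hVc (hne.imp fun P hP => ⟨hP, (hrel P hP).2.2.2.2.1⟩)
    (fun P hP => by rw [mU 0 2, mU 0 1]; exact x7 P hP)
    (fun P hP => by rw [mW 0 2 hP, mW 0 1 hP]; exact x6 P hP)
  have hκ' : ∀ P ∈ V, mixed E.q 1 1 P = κ * mixed E.q 1 0 P := fun P hP =>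
    mul_left_cancel₀ (hrel P hP).2.2.2.2.1 (by
      linear_combination x1 P hP + mixed E.q 1 0 P * hκ P hP)
  -- For κ = 0 one finds q_uw = q_ww = 0, then p_uu = 0, γ = 0, q_uu = 0 and p_u = 0, so every
  -- coefficient of the nonlinearity vanishes, against genericity.
  have hκ0 : κ ≠ 0 := by
    rintro rfl
    obtain ⟨P, hP⟩ := hne
    obtain ⟨⟨i, hi, hi0⟩, -, hφ, hp0, h01, h10, y1, y2, y3, y4, y5, -⟩ := hrel P hP
    have e1 := hκ P hP
    have e2 := hκ' P hP
    rw [zero_mul] at e1 e2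
    rw [e2] at y2 y5
    have hp2 : mixed E.p 2 0 P = 0 := (mul_eq_zero.1 (y2.trans (mul_zero _))).resolve_right h01
    have hq20 : 2 * mixed E.q 2 0 P = γ P * mixed E.q 1 0 P := mul_left_cancel₀ h01 (by
      linear_combination y5)
    have hp1 : 4 * mixed E.p 1 0 P = γ P * E.p P := mul_left_cancel₀ h10 (by
      linear_combination 2 * y4 - 5 * E.p P * hq20)
    have hγ0 : γ P = 0 := by
      have : γ P ^ 2 * (E.p P * mixed E.q 1 0 P) = 0 := by
        rw [hp2] at y1
        linear_combination 4 * y1 + 2 * γ P * E.p P * hq20 + γ P * mixed E.q 1 0 P * hp1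
      exact pow_eq_zero_iff two_ne_zero |>.1 ((mul_eq_zero.1 this).resolve_right
        (mul_ne_zero hp0 h10))
    rw [hγ0, zero_mul] at hq20 hp1
    have hq20' : mixed E.q 2 0 P = 0 := by linear_combination hq20 / 2
    have hp1' : mixed E.p 1 0 P = 0 := by linear_combination hp1 / 4
    have hψ : ∀ Q ∈ U, E.psi Q = 2 * (E.p Q * mixed E.q 1 0 Q) := fun Q hQ => by
      rw [psi, hF.f_gU Q hQ]; exact (two_mul _).symm
    have hη : ∀ Q ∈ U, E.eta Q = E.p Q * mixed E.q 0 1 Q := fun Q hQ => by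
      rw [eta, hF.f_gW Q hQ, zero_add]; rfl
    have hPU := hVU hP
    have a1 := hp P hPU
    refine hi0 ?_
    interval_cases i
    · exact y3
    · rw [nonlinearityCoeff, partialU_congr_of_isOpen hU hψ P hPU,
        partialU_mul analyticAt_const (a1.fun_mul (hm 1 0 hP)), partialU_mul a1 (hm 1 0 hP), mU 1 0,
        hφ, hq20', hγ0, show partialU E.p P = 0 from hp1', partialU_const]
      ring
    · rw [nonlinearityCoeff, partialW_congr_of_isOpen hU hψ P hPU,
        partialU_congr_of_isOpen hU hη P hPU,
        partialW_mul analyticAt_const (a1.fun_mul (hm 1 0 hP)), partialW_mul a1 (hm 1 0 hP),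
        partialU_mul a1 (hm 0 1 hP), mU 0 1, mW 1 0 hP, hF.pW P hPU, e2,
        show partialU E.p P = 0 from hp1', partialW_const]
      ring
    · rw [nonlinearityCoeff, partialW_congr_of_isOpen hU hη P hPU,
        partialW_mul a1 (hm 0 1 hP), mW 0 1 hP, hF.pW P hPU, e1]
      ring
  have y1 : ∀ P ∈ V, γ P * E.p P * mixed E.q 0 1 P =
      4 * mixed E.p 1 0 P * mixed E.q 0 1 P - 5 * κ * E.p P * mixed E.q 1 0 P := fun P hP => by
    obtain ⟨-, -, -, -, -, h10, -, -, -, y4, y5, -⟩ := hrel P hP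
    refine mul_left_cancel₀ h10 ?_
    have := hκ' P hP
    linear_combination 5 * E.p P * y5 - 2 * mixed E.q 0 1 P * y4 -
      5 * E.p P * mixed E.q 1 0 P * this
  have y2 : ∀ P ∈ V, γ P * (mixed E.p 1 0 P * mixed E.q 0 1 P - κ * E.p P * mixed E.q 1 0 P) = 0 :=
    fun P hP => by
    obtain ⟨-, -, -, hp0, h01, h10, z1, z2, -, y4, y5, -⟩ := hrel P hP
    refine mul_left_cancel₀ h10 ?_
    linear_combination mixed E.q 0 1 P * z1 - mixed E.q 1 0 P * z2 + γ P * E.p P / 2 * y5 -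
      γ P * mixed E.q 1 0 P / 2 * y1 P hP - 3 / 2 * γ P * E.p P * mixed E.q 1 0 P * hκ' P hP
  -- The product with γ vanishes, so one factor does. If γ ≡ 0, then 4 p_u q_w = 5κ p q_u; its
  -- u-derivative forces p_u = 0 and hence p q_u = 0, a contradiction.
  have y3 : ∀ P ∈ V, mixed E.p 1 0 P * mixed E.q 0 1 P - κ * E.p P * mixed E.q 1 0 P = 0 := by
    refine (hγ.eq_zero_of_mul_eq_zero ((((hp.mixed 1 0).mul (hq'.mixed 0 1)).sub
      ((analyticOnNhd_const.mul hp).mul (hq'.mixed 1 0))).mono hVU) hV hVc y2).resolve_left ?_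
    intro hγ0
    obtain ⟨P, hP⟩ := hne
    obtain ⟨-, -, -, hp0, h01, h10, -, z2, -, y4, -⟩ := hrel P hP
    have hPU := hVU hP
    have e1 : ∀ Q ∈ V, mixed E.p 1 0 Q * mixed E.q 0 1 Q * 4 =
        E.p Q * mixed E.q 1 0 Q * (5 * κ) := fun Q hQ => by
      have := y1 Q hQ
      rw [hγ0 Q hQ] at this
      linear_combination -this
    have e2 := partialU_congr_of_isOpen hV e1 P hP
    have a1 := hp.mixed 1 0 P hPU
    rw [partialU_mul (a1.fun_mul (hm 0 1 hP)) analyticAt_const, partialU_mul a1 (hm 0 1 hP),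
      partialU_mul ((hp P hPU).fun_mul (hm 1 0 hP)) analyticAt_const,
      partialU_mul (hp P hPU) (hm 1 0 hP), mU 0 1, mU 1 0, partialU_mixed, partialU_const,
      partialU_const, show partialU E.p P = mixed E.p 1 0 P from rfl] at e2
    rw [hγ0 P hP] at z2 y4
    have e3 : κ * mixed E.q 1 0 P * mixed E.p 1 0 P = 0 := by
      linear_combination e2 - 4 * z2 - 4 * mixed E.p 1 0 P * hκ' P hP + κ * y4
    have e4 : mixed E.p 1 0 P = 0 :=
      (mul_eq_zero.1 e3).resolve_left (mul_ne_zero hκ0 h10)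
    have e5 := e1 P hP
    rw [e4] at e5
    refine mul_ne_zero (mul_ne_zero hp0 h10) (mul_ne_zero (by norm_num : (5 : ℂ) ≠ 0) hκ0) ?_
    linear_combination -e5
  -- This links g to p: g_uu / g_u = -p_u / p, so p g_u is constant in u.
  have y4 : ∀ P ∈ V, γ P * E.p P = -mixed E.p 1 0 P := fun P hP =>
    mul_right_cancel₀ (hrel P hP).2.2.2.2.1 (by linear_combination y1 P hP + 5 * y3 P hP)
  have hext : ∀ {F : ℂ × ℂ → ℂ}, AnalyticOnNhd ℂ F U → (∀ P ∈ V, F P = 0) → ∀ P ∈ U, F P = 0 :=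
    fun hF h => hF.eq_zero_of_open hc hV hVU hne h
  refine ⟨κ, hκ0, hext hE.1.partialU fun P hP => (hrel P hP).2.2.2.2.2.2.2.2.1,
    hext hE.1.partialW fun P hP => ?_, hgW,
    hext ((hp.mul (hp.mixed 2 0)).add ((hp.mixed 1 0).pow 2)) fun P hP => ?_,
    fun P hP => sub_eq_zero.1 (hext ((hq'.mixed 0 2).sub (analyticOnNhd_const.mul (hq'.mixed 0 1)))
      (fun Q hQ => sub_eq_zero.2 (hκ Q hQ)) P hP),
    fun P hP => sub_eq_zero.1 (hext ((hp.mul (hq'.mixed 1 1)).sub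
      ((hp.mixed 1 0).mul (hq'.mixed 0 1))) (fun Q hQ => ?_) P hP),
    fun P hP => sub_eq_zero.1 (hext ((analyticOnNhd_const.mul (hp.mul (hq'.mixed 1 0))).sub
      ((hp.mixed 1 0).mul (hq'.mixed 0 1))) (fun Q hQ => ?_) P hP),
    hext ((hp.mul hE.2.2.1.partialU.partialU).add ((hp.mixed 1 0).mul hE.2.2.1.partialU))
      fun P hP => ?_⟩
  · obtain ⟨-, -, hφ, -, h01, -, -, -, -, -, y5, -⟩ := hrel P hP
    rw [hφ]
    refine mul_left_cancel₀ h01 ?_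
    linear_combination E.p P / 2 * y5 - E.p P * mixed E.q 1 0 P / 2 * hκ' P hP -
      mixed E.q 0 1 P * mixed E.q 1 0 P / 2 * y4 P hP + mixed E.q 1 0 P / 2 * y3 P hP
  · obtain ⟨-, -, -, -, h01, -, -, z2, -⟩ := hrel P hP
    refine mul_left_cancel₀ h01 ?_
    linear_combination E.p P * z2 + E.p P * γ P * E.p P * hκ' P hP +
      κ * E.p P * mixed E.q 1 0 P * y4 P hP + mixed E.p 1 0 P * y3 P hP
  · simp only [Pi.sub_apply]
    linear_combination E.p Q * hκ' Q hQ - y3 Q hQ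
  · simp only [Pi.sub_apply]
    linear_combination -y3 Q hQ
  · obtain ⟨-, hg, -⟩ := hrel P hP
    linear_combination E.p P * hg + partialU E.g P * y4 P hP

end TodaEquation

/-! ### Integration of the relations and reduction to the Toda and Volterra equations -/

theorem partialU_exp_mul_snd (κ : ℂ) : partialU (fun P => Complex.exp (κ * P.2)) = fun _ => 0 :=
  funext fun P => by
    rw [partialU_comp_snd (s := fun w => Complex.exp (κ * w))
      (((hasDerivAt_id P.2).const_mul κ).cexp)]

theorem partialW_exp_mul_snd (κ : ℂ) :
    partialW (fun P => Complex.exp (κ * P.2)) = fun P => κ * Complex.exp (κ * P.2) :=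
  funext fun P => by
    rw [partialW_comp_snd (s := fun w => Complex.exp (κ * w))
      (((hasDerivAt_id P.2).const_mul κ).cexp)]
    simp [mul_comm]

theorem analyticAt_exp_mul_snd (κ : ℂ) (P : ℂ × ℂ) :
    AnalyticAt ℂ (fun P : ℂ × ℂ => Complex.exp (κ * P.2)) P :=
  (analyticAt_const.fun_mul analyticAt_snd).cexp

namespace TodaEquation

variable {E : TodaEquation} {U : Set (ℂ × ℂ)}

/-- The equation is equivalent, by a substitution and a Galilean transformation, to a listed one. -/
def IsEquivalentToListed (E : TodaEquation) (U : Set (ℂ × ℂ)) : Prop :=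
  ∃ (a b c d : ℂ) (E' : TodaEquation), a ≠ 0 ∧
    E'.IsListed {P : ℂ × ℂ | (a * P.1 + b, a * P.2 + d) ∈ U} ∧
    E.TransformsTo E' {P : ℂ × ℂ | (a * P.1 + b, a * P.2 + d) ∈ U} a b c d

/-- An equation in which `f Δ_y⁺ g` is absent, `φ` is constant, `p` is affine in `u` and `q` is a
function of `w` whose second derivative is proportional to the first. -/
theorem isEquivalentToListed_of_q_eq (hE : E.HolomorphicOn U) (hU : IsOpen U)
    (hc : IsPreconnected U) (hn : E.Nondegenerate U) (hpW : ∀ P ∈ U, partialW E.p P = 0)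
    (hq : ∀ P ∈ U, partialU E.q P = 0) (hφU : ∀ P ∈ U, partialU E.phi P = 0)
    (hφW : ∀ P ∈ U, partialW E.phi P = 0) (hp2 : ∀ P ∈ U, mixed E.p 2 0 P = 0)
    (hqw : ∀ P ∈ U, mixed E.q 0 1 P * mixed E.q 0 3 P = mixed E.q 0 2 P ^ 2)
    (hfg : (∀ P ∈ U, E.f P = 0) ∨ (∀ P ∈ U, partialU E.g P = 0) ∧ ∀ P ∈ U, partialW E.g P = 0) :
    E.IsEquivalentToListed U := by
  obtain ⟨hφ, hf, hg, hp, hq'⟩ := id hE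
  have zU : ∀ {F : ℂ × ℂ → ℂ}, (∀ P ∈ U, F P = 0) → ∀ P ∈ U, partialU F P = 0 := fun h P hP => by
    rw [partialU_congr_of_isOpen hU (G := fun _ => 0) h P hP, partialU_const]
  have zW : ∀ {F : ℂ × ℂ → ℂ}, (∀ P ∈ U, F P = 0) → ∀ P ∈ U, partialW F P = 0 := fun h P hP => by
    rw [partialW_congr_of_isOpen hU (G := fun _ => 0) h P hP, partialW_const]
  have hfg0 : ∀ P ∈ U, ∀ Q ∈ U, E.f P * (E.g Q - E.g P) = 0 := by
    rcases hfg with h | ⟨h1, h2⟩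
    · intro P hP Q _
      rw [h P hP, zero_mul]
    · obtain ⟨k, hk⟩ := eq_const_of_partial_eq_zero hg hU hc h1 h2
      intro P hP Q hQ
      rw [hk P hP, hk Q hQ, sub_self, mul_zero]
  have hfgU : ∀ P ∈ U, E.f P * partialU E.g P = 0 := fun P hP => by
    rcases hfg with h | ⟨h, -⟩ <;> simp [h P hP]
  have hfgW : ∀ P ∈ U, E.f P * partialW E.g P = 0 := fun P hP => by
    rcases hfg with h | ⟨-, h⟩ <;> simp [h P hP]
  have hψ : ∀ P ∈ U, E.psi P = 0 := fun P hP => by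
    rw [psi, hfgU P hP, hq P hP, mul_zero, add_zero]
  have hη : ∀ P ∈ U, E.eta P = E.p P * partialW E.q P := fun P hP => by
    rw [eta, hfgW P hP, zero_add]
  obtain ⟨c, hφc⟩ := eq_const_of_partial_eq_zero hφ hU hc hφU hφW
  obtain ⟨α, hα⟩ := eq_const_of_partial_eq_zero hp.partialU hU hc hp2 fun P hP => by
    rw [partialW_partialU (hp P hP)]; exact zU hpW P hP
  have haff : ∀ P : ℂ × ℂ, AnalyticAt ℂ (fun P : ℂ × ℂ => α * P.1 + 0) P := fun P =>
    (analyticAt_const.fun_mul analyticAt_fst).fun_add analyticAt_const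
  obtain ⟨β, hβ⟩ := eq_const_of_partial_eq_zero (F := fun P => E.p P - (α * P.1 + 0))
    (fun P hP => (hp P hP).fun_sub (haff P)) hU hc
    (fun P hP => by rw [partialU_sub (hp P hP) (haff P), hα P hP, partialU_affine, sub_self])
    (fun P hP => by rw [partialW_sub (hp P hP) (haff P), hpW P hP, partialW_affine, sub_self])
  have hpe : ∀ P ∈ U, E.p P = α * P.1 + β := fun P hP => by linear_combination hβ P hP
  obtain ⟨P₀, hP₀, hη₀⟩ := hn.1
  have hq₀ : partialW E.q P₀ ≠ 0 := right_ne_zero_of_mul (hη P₀ hP₀ ▸ hη₀)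
  have hp₀ : E.p P₀ ≠ 0 := left_ne_zero_of_mul (hη P₀ hP₀ ▸ hη₀)
  have h11 : ∀ P ∈ U, mixed E.q 1 1 P = 0 := fun P hP => by
    rw [← partialW_mixed hq' 1 0 hP]; exact zW hq P hP
  have h12 : ∀ P ∈ U, mixed E.q 1 2 P = 0 := fun P hP => by
    rw [← partialW_mixed hq' 1 1 hP]; exact zW h11 P hP
  obtain ⟨κ, hκ⟩ := exists_eq_const_mul (hq'.mixed 0 1) (hq'.mixed 0 2) hU hc ⟨P₀, hP₀, hq₀⟩
    (fun P hP => by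
      rw [partialU_mixed, partialU_mixed, zero_add, h11 P hP, h12 P hP, mul_zero, mul_zero])
    (fun P hP => by
      rw [partialW_mixed hq' 0 2 hP, partialW_mixed hq' 0 1 hP, hqw P hP, sq])
  by_cases hκ0 : κ = 0
  · obtain ⟨C, hC⟩ := eq_const_of_partial_eq_zero hq'.partialW hU hc h11 fun P hP =>
      (hκ P hP).trans (by rw [hκ0, zero_mul])
    have hC0 : C ≠ 0 := hC P₀ hP₀ ▸ hq₀
    have hlin : ∀ P : ℂ × ℂ, AnalyticAt ℂ (fun P : ℂ × ℂ => C * P.2) P := fun P =>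
      analyticAt_const.fun_mul analyticAt_snd
    obtain ⟨k, hk⟩ := eq_const_of_partial_eq_zero (F := fun P => E.q P - C * P.2)
      (fun P hP => (hq' P hP).fun_sub (hlin P)) hU hc
      (fun P hP => by
        rw [partialU_sub (hq' P hP) (hlin P), partialU_mul analyticAt_const analyticAt_snd,
          hq P hP, partialU_const, partialU_snd]; ring)
      (fun P hP => by
        rw [partialW_sub (hq' P hP) (hlin P), partialW_mul analyticAt_const analyticAt_snd,
          hC P hP, partialW_const, partialW_snd]; ring)
    have hqe : ∀ P ∈ U, E.q P = C * P.2 + k := fun P hP => by linear_combination hk P hP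
    -- With p constant and q linear in w, the dispersionless limit would be totally linearly
    -- degenerate.
    have hα0 : α ≠ 0 := by
      rintro rfl
      have hηc : ∀ P ∈ U, E.eta P = β * C := fun P hP => by
        rw [hη P hP, hC P hP, hpe P hP]; ring
      refine hn.2 fun P hP => ⟨?_, ?_, ?_, hφU P hP⟩
      · rw [partialW_congr_of_isOpen hU hηc P hP, partialW_const]
      · rw [partialU_congr_of_isOpen hU hηc P hP, partialU_const, zW hψ P hP, add_zero]
      · rw [zU hψ P hP, hφW P hP, add_zero]
    -- The shift b removes β, so p becomes u'/C and q becomes w'/α up to a constant; their product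
    -- carries the factor a = 1/(αC). The constant value of φ is the Galilean velocity.
    refine ⟨1 / (α * C), -β / α, c, 0, toda, one_div_ne_zero (mul_ne_zero hα0 hC0), Or.inl rfl, ?_⟩
    intro ε hε P hP Q hQ R hR ux
    simp only [rhs, toda, hφc _ hP, hpe _ hP, hqe _ hP, hqe _ hR]
    rw [← mul_div_assoc, hfg0 _ hP _ hQ]
    field_simp
    ring
  · obtain ⟨C, hC⟩ := exists_eq_const_mul (F := fun P => Complex.exp (κ * P.2))
      (fun P _ => analyticAt_exp_mul_snd κ P) hq'.partialW hU hc ⟨P₀, hP₀, Complex.exp_ne_zero _⟩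
      (fun P hP => by
        rw [partialU_exp_mul_snd, show partialU (partialW E.q) P = 0 from h11 P hP]; ring)
      (fun P hP => by
        rw [partialW_exp_mul_snd, show partialW (partialW E.q) P = _ from hκ P hP,
          show mixed E.q 0 1 = partialW E.q from rfl]
        ring)
    have hC0 : C ≠ 0 := left_ne_zero_of_mul (hC P₀ hP₀ ▸ hq₀)
    obtain ⟨k, hk⟩ := eq_const_of_partial_eq_zero
      (F := fun P => E.q P - C / κ * Complex.exp (κ * P.2))
      (fun P hP => (hq' P hP).fun_sub (analyticAt_const.fun_mul (analyticAt_exp_mul_snd κ P))) hU hc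
      (fun P hP => by
        rw [partialU_sub (hq' P hP) (analyticAt_const.fun_mul (analyticAt_exp_mul_snd κ P)),
          partialU_mul analyticAt_const (analyticAt_exp_mul_snd κ P),
          hq P hP, partialU_const, partialU_exp_mul_snd]; ring)
      (fun P hP => by
        rw [partialW_sub (hq' P hP) (analyticAt_const.fun_mul (analyticAt_exp_mul_snd κ P)),
          partialW_mul analyticAt_const (analyticAt_exp_mul_snd κ P),
          hC P hP, partialW_const, partialW_exp_mul_snd]; field_simp; ring)
    have hqe : ∀ P ∈ U, E.q P = C / κ * Complex.exp (κ * P.2) + k := fun P hP => by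
      linear_combination hk P hP
    -- The choice a = 1/κ turns e^{κw} into e^{w'}; the factor C/κ of q and the division by a are
    -- absorbed into the two constants.
    refine ⟨1 / κ, 0, c, 0, volterra (C / κ * α) (C * β), one_div_ne_zero hκ0,
      Or.inr (Or.inl ⟨_, _, ?_, rfl⟩), ?_⟩
    · by_contra h
      push Not at h
      have h1 : α = 0 := (mul_eq_zero.1 h.1).resolve_left (div_ne_zero hC0 hκ0)
      have h2 : β = 0 := (mul_eq_zero.1 h.2).resolve_left hC0
      exact hp₀ (by rw [hpe P₀ hP₀, h1, h2]; ring)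
    · intro ε hε P hP Q hQ R hR ux
      simp only [rhs, volterra, hφc _ hP, hpe _ hP, hqe _ hP, hqe _ hR]
      rw [← mul_div_assoc, hfg0 _ hP _ hQ]
      have e : ∀ x : ℂ, κ * (1 / κ * x + 0) = x := fun x => by field_simp; ring
      rw [e, e]
      field_simp
      ring

end TodaEquation

/-! ### Reduction to the square-root equation -/

namespace TodaEquation

variable {E : TodaEquation} {U : Set (ℂ × ℂ)}

/-- The integrable equations in which `q` depends on `u`. -/
theorem isEquivalentToListed_of_q_ne (hE : E.HolomorphicOn U) (hU : IsOpen U)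
    (hc : IsPreconnected U) (hn : E.Nondegenerate U) (hF : E.FirstOrderConditions U)
    (hq : ∃ P ∈ U, partialU E.q P ≠ 0) {κ : ℂ} (hκ : κ ≠ 0)
    (hφU : ∀ P ∈ U, partialU E.phi P = 0) (hφW : ∀ P ∈ U, partialW E.phi P = 0)
    (hgW : ∀ P ∈ U, partialW E.g P = 0)
    (hp2 : ∀ P ∈ U, E.p P * mixed E.p 2 0 P + mixed E.p 1 0 P ^ 2 = 0)
    (h02 : ∀ P ∈ U, mixed E.q 0 2 P = κ * mixed E.q 0 1 P)
    (h11 : ∀ P ∈ U, E.p P * mixed E.q 1 1 P = mixed E.p 1 0 P * mixed E.q 0 1 P)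
    (h10 : ∀ P ∈ U, κ * (E.p P * mixed E.q 1 0 P) = mixed E.p 1 0 P * mixed E.q 0 1 P)
    (hg2 : ∀ P ∈ U, E.p P * partialU (partialU E.g) P + mixed E.p 1 0 P * partialU E.g P = 0) :
    E.IsEquivalentToListed U := by
  obtain ⟨hφ, hf, hg, hp, hq'⟩ := id hE
  have zU : ∀ {F : ℂ × ℂ → ℂ}, (∀ P ∈ U, F P = 0) → ∀ P ∈ U, partialU F P = 0 := fun h P hP => by
    rw [partialU_congr_of_isOpen hU (G := fun _ => 0) h P hP, partialU_const]
  have hp1 : partialU E.p = mixed E.p 1 0 := rfl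
  have hpW1 : ∀ P ∈ U, partialW (mixed E.p 1 0) P = 0 := fun P hP => by
    rw [← hp1, partialW_partialU (hp P hP)]; exact zU hF.pW P hP
  obtain ⟨c, hφc⟩ := eq_const_of_partial_eq_zero hφ hU hc hφU hφW
  obtain ⟨P₀, hP₀, hη₀⟩ := hn.1
  have hη : ∀ P ∈ U, E.eta P = E.p P * mixed E.q 0 1 P := fun P hP => by
    rw [eta, hF.f_gW P hP, zero_add]; rfl
  have hq₀ : mixed E.q 0 1 P₀ ≠ 0 := right_ne_zero_of_mul (hη P₀ hP₀ ▸ hη₀)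
  have hp₀ : E.p P₀ ≠ 0 := left_ne_zero_of_mul (hη P₀ hP₀ ▸ hη₀)
  obtain ⟨P₁, hP₁, hpq⟩ : ∃ P ∈ U, E.p P * mixed E.q 1 0 P ≠ 0 := by
    by_contra h
    push Not at h
    rcases hp.eq_zero_of_mul_eq_zero (hq'.mixed 1 0) hU hc h with h | h
    · exact hp₀ (h P₀ hP₀)
    · obtain ⟨P, hP, h'⟩ := hq
      exact h' (h P hP)
  -- The relation p p_uu + p_u² = 0 says that p p_u is constant, so p² = 2ku + l. If k vanished, p
  -- q_u would vanish at a point where it does not; hence p has no zeros on U.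
  obtain ⟨k, hk⟩ := eq_const_of_partial_eq_zero (F := fun P => E.p P * mixed E.p 1 0 P)
    (hp.mul (hp.mixed 1 0)) hU hc
    (fun P hP => by
      rw [partialU_mul (hp P hP) (hp.mixed 1 0 P hP), partialU_mixed, hp1]
      linear_combination hp2 P hP)
    (fun P hP => by
      rw [partialW_mul (hp P hP) (hp.mixed 1 0 P hP), hF.pW P hP, hpW1 P hP]; ring)
  have hk0 : k ≠ 0 := by
    rw [← hk P₁ hP₁]
    refine mul_ne_zero (left_ne_zero_of_mul hpq) fun h0 => hpq ?_
    have := h10 P₁ hP₁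
    rw [h0, zero_mul] at this
    exact (mul_eq_zero.1 this).resolve_left hκ
  have hp0 : ∀ P ∈ U, E.p P ≠ 0 := fun P hP => left_ne_zero_of_mul ((hk P hP).trans_ne hk0)
  have hlin : ∀ P : ℂ × ℂ, AnalyticAt ℂ (fun P : ℂ × ℂ => 2 * k * P.1) P := fun P =>
    analyticAt_const.fun_mul analyticAt_fst
  obtain ⟨l, hl⟩ := eq_const_of_partial_eq_zero (F := fun P => E.p P * E.p P - 2 * k * P.1)
    (fun P hP => ((hp P hP).fun_mul (hp P hP)).fun_sub (hlin P)) hU hc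
    (fun P hP => by
      rw [partialU_sub ((hp P hP).fun_mul (hp P hP)) (hlin P), partialU_mul (hp P hP) (hp P hP),
        partialU_mul analyticAt_const analyticAt_fst, partialU_const, partialU_fst, hp1]
      linear_combination 2 * hk P hP)
    (fun P hP => by
      rw [partialW_sub ((hp P hP).fun_mul (hp P hP)) (hlin P), partialW_mul (hp P hP) (hp P hP),
        partialW_mul analyticAt_const analyticAt_fst, partialW_const, partialW_fst, hF.pW P hP]
      ring)
  have he : AnalyticOnNhd ℂ (fun P : ℂ × ℂ => Complex.exp (κ * P.2)) U :=
    fun P _ => analyticAt_exp_mul_snd κ P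
  have hpe : AnalyticOnNhd ℂ (fun P => E.p P * Complex.exp (κ * P.2)) U := hp.mul he
  have hpeU : ∀ P ∈ U, partialU (fun P => E.p P * Complex.exp (κ * P.2)) P =
      mixed E.p 1 0 P * Complex.exp (κ * P.2) := fun P hP => by
    rw [partialU_mul (hp P hP) (he P hP), partialU_exp_mul_snd, hp1]; ring
  have hpeW : ∀ P ∈ U, partialW (fun P => E.p P * Complex.exp (κ * P.2)) P =
      E.p P * (κ * Complex.exp (κ * P.2)) := fun P hP => by
    rw [partialW_mul (hp P hP) (he P hP), partialW_exp_mul_snd, hF.pW P hP]; ring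
  -- Both q_w and p e^{κw} have w-logarithmic derivative κ and u-logarithmic derivative p_u / p.
  obtain ⟨C, hC⟩ := exists_eq_const_mul hpe (hq'.mixed 0 1) hU hc
    ⟨P₀, hP₀, mul_ne_zero hp₀ (Complex.exp_ne_zero _)⟩
    (fun P hP => by
      rw [hpeU P hP, partialU_mixed]
      linear_combination Complex.exp (κ * P.2) * h11 P hP)
    (fun P hP => by
      rw [hpeW P hP, partialW_mixed hq' 0 1 hP, h02 P hP]
      ring)
  have hC0 : C ≠ 0 := left_ne_zero_of_mul (hC P₀ hP₀ ▸ hq₀)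
  obtain ⟨D, hD⟩ := eq_const_of_partial_eq_zero
    (F := fun P => E.q P - C / κ * (E.p P * Complex.exp (κ * P.2)))
    (fun P hP => (hq' P hP).fun_sub (analyticAt_const.fun_mul (hpe P hP))) hU hc
    (fun P hP => by
      rw [partialU_sub (hq' P hP) (analyticAt_const.fun_mul (hpe P hP)),
        partialU_mul analyticAt_const (hpe P hP), partialU_const, hpeU P hP]
      refine mul_left_cancel₀ (mul_ne_zero hκ (hp0 P hP)) ?_
      have e1 : C / κ * κ = C := div_mul_cancel₀ _ hκ
      have e2 : partialU E.q P = mixed E.q 1 0 P := rfl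
      rw [e2]
      linear_combination h10 P hP + mixed E.p 1 0 P * hC P hP -
        E.p P * mixed E.p 1 0 P * Complex.exp (κ * P.2) * e1)
    (fun P hP => by
      rw [partialW_sub (hq' P hP) (analyticAt_const.fun_mul (hpe P hP)),
        partialW_mul analyticAt_const (hpe P hP), partialW_const, hpeW P hP]
      have e1 : C / κ * κ = C := div_mul_cancel₀ _ hκ
      have e2 : partialW E.q P = mixed E.q 0 1 P := rfl
      rw [e2]
      linear_combination hC P hP - E.p P * Complex.exp (κ * P.2) * e1)
  obtain ⟨G, hG⟩ := eq_const_of_partial_eq_zero (F := fun P => E.p P * partialU E.g P)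
    (hp.mul hg.partialU) hU hc
    (fun P hP => by
      rw [partialU_mul (hp P hP) (hg.partialU P hP), hp1]
      linear_combination hg2 P hP)
    (fun P hP => by
      rw [partialW_mul (hp P hP) (hg.partialU P hP), hF.pW P hP, partialW_partialU (hg P hP),
        zU hgW P hP]; ring)
  have hG0 : G ≠ 0 := by
    rw [← hG P₁ hP₁]
    refine mul_ne_zero (hp0 P₁ hP₁) fun h0 => hpq ?_
    have := hF.f_gU P₁ hP₁
    rw [h0, mul_zero] at this
    exact this.symm
  obtain ⟨D₂, hD₂⟩ := eq_const_of_partial_eq_zero (F := fun P => E.g P - G / k * E.p P)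
    (fun P hP => (hg P hP).fun_sub (analyticAt_const.fun_mul (hp P hP))) hU hc
    (fun P hP => by
      rw [partialU_sub (hg P hP) (analyticAt_const.fun_mul (hp P hP)),
        partialU_mul analyticAt_const (hp P hP), partialU_const, hp1]
      refine mul_left_cancel₀ (hp0 P hP) ?_
      have e1 : G / k * k = G := div_mul_cancel₀ _ hk0
      linear_combination hG P hP - G / k * hk P hP - e1)
    (fun P hP => by
      rw [partialW_sub (hg P hP) (analyticAt_const.fun_mul (hp P hP)),
        partialW_mul analyticAt_const (hp P hP), partialW_const, hgW P hP, hF.pW P hP]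
      ring)
  have hqe : ∀ P ∈ U, E.q P = C / κ * (E.p P * Complex.exp (κ * P.2)) + D := fun P hP => by
    linear_combination hD P hP
  have hge : ∀ P ∈ U, E.g P = G / k * E.p P + D₂ := fun P hP => by linear_combination hD₂ P hP
  have hfe : ∀ P ∈ U, E.f P = k * C / (κ * G) * (E.p P * Complex.exp (κ * P.2)) := fun P hP => by
    refine mul_left_cancel₀ (mul_ne_zero hκ hG0) ?_
    have e1 : κ * G * (k * C / (κ * G)) = k * C := mul_div_cancel₀ _ (mul_ne_zero hκ hG0)
    have e2 : partialU E.q P = mixed E.q 1 0 P := rfl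
    have e3 := hF.f_gU P hP
    rw [e2] at e3
    linear_combination -κ * E.f P * hG P hP + κ * E.p P * e3 + E.p P * h10 P hP +
      mixed E.q 0 1 P * hk P hP + k * hC P hP - E.p P * Complex.exp (κ * P.2) * e1
  -- After u = u'/κ - l/(2k) one has p² = (2k/κ) u', so p/σ with σ² = 2k/κ is a branch of √u'.
  obtain ⟨σ, hσ⟩ := IsAlgClosed.exists_pow_nat_eq (2 * k / κ) two_pos
  have hσ0 : σ ≠ 0 := by
    rintro rfl
    exact div_ne_zero (mul_ne_zero two_ne_zero hk0) hκ (by rw [← hσ]; ring)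
  -- The shift of w multiplies e^{w'} by κ/(2Ck), which makes the factors of both difference terms
  -- equal to a = 1/κ.
  obtain ⟨δ, hδ⟩ : ∃ δ, Complex.exp δ = κ / (2 * C * k) :=
    ⟨_, Complex.exp_log (div_ne_zero hκ (mul_ne_zero (mul_ne_zero two_ne_zero hC0) hk0))⟩
  let s : ℂ × ℂ → ℂ := fun P => E.p (1 / κ * P.1 + -l / (2 * k), 1 / κ * P.2 + δ / κ) / σ
  refine ⟨1 / κ, -l / (2 * k), c, δ / κ, sqrtToda s, one_div_ne_zero hκ,
    Or.inr (Or.inr ⟨s, fun P hP => ?_, fun P hP => ?_, rfl⟩), ?_⟩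
  · have h1 : AnalyticAt ℂ
        (fun P : ℂ × ℂ => (1 / κ * P.1 + -l / (2 * k), 1 / κ * P.2 + δ / κ)) P :=
      ((analyticAt_const.fun_mul analyticAt_fst).fun_add analyticAt_const).prod
        ((analyticAt_const.fun_mul analyticAt_snd).fun_add analyticAt_const)
    exact (AnalyticAt.comp (g := E.p)
      (f := fun P : ℂ × ℂ => (1 / κ * P.1 + -l / (2 * k), 1 / κ * P.2 + δ / κ))
      (hp _ hP) h1).fun_div analyticAt_const hσ0
  · have h1 := hl _ hP
    have h2 : s P ^ 2 * σ ^ 2 = E.p (1 / κ * P.1 + -l / (2 * k), 1 / κ * P.2 + δ / κ) ^ 2 := by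
      rw [← mul_pow, div_mul_cancel₀ _ hσ0]
    refine mul_right_cancel₀ (pow_ne_zero 2 hσ0) ?_
    rw [h2, hσ]
    have e1 : 2 * k * (-l / (2 * k)) = -l := mul_div_cancel₀ _ (mul_ne_zero two_ne_zero hk0)
    linear_combination h1 + e1
  · intro ε hε P hP Q hQ R hR ux
    have hs : ∀ P, E.p (1 / κ * P.1 + -l / (2 * k), 1 / κ * P.2 + δ / κ) = σ * s P := fun P =>
      (mul_div_cancel₀ _ hσ0).symm
    have e : ∀ x : ℂ, Complex.exp (κ * (1 / κ * x + δ / κ)) =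
        Complex.exp x * (κ / (2 * C * k)) := fun x => by
      rw [← hδ, ← Complex.exp_add]
      congr 1
      field_simp
    have hσ' : κ * σ ^ 2 = 2 * k := by rw [hσ]; field_simp
    simp only [rhs, sqrtToda, hφc _ hP, hfe _ hP, hge _ hP, hge _ hQ, hqe _ hP, hqe _ hR, hs, e]
    field_simp
    linear_combination G * (s P * Complex.exp P.2 * (s Q - s P) +
      s P * (s P * Complex.exp P.2 - s R * Complex.exp R.2)) * hσ'

/-- Every non-degenerate equation that is integrable modulo `ε ^ 3` is equivalent to a listed
one. -/
theorem IntegrableModulo.isEquivalentToListed (hE : E.HolomorphicOn U) (hU : IsOpen U)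
    (hc : IsPreconnected U) (hn : E.Nondegenerate U) (hint : E.IntegrableModulo U 2) :
    E.IsEquivalentToListed U := by
  have hF := hint.firstOrderConditions hE hU hc hn
  by_cases hq : ∀ P ∈ U, partialU E.q P = 0
  · obtain ⟨h1, h2, h3, h4, h5⟩ := hint.second_order_of_q_eq hE hU hc hn hq
    exact isEquivalentToListed_of_q_eq hE hU hc hn hF.pW hq h1 h2 h3 h4 h5
  · push Not at hq
    obtain ⟨κ, hκ, h1, h2, h3, h4, h5, h6, h7, h8⟩ := hint.second_order_of_q_ne hE hU hc hn hq
    exact isEquivalentToListed_of_q_ne hE hU hc hn hF hq hκ h1 h2 h3 h4 h5 h6 h7 h8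

end TodaEquation

end

theorem theorem4 :
    (∀ (U : Set (ℂ × ℂ)) (E : TodaEquation), IsOpen U → IsConnected U → E.HolomorphicOn U →
      E.Nondegenerate U → E.IntegrableModulo U 2 →
        ∃ (a b c d : ℂ) (E' : TodaEquation), a ≠ 0 ∧
          E'.IsListed {P : ℂ × ℂ | (a * P.1 + b, a * P.2 + d) ∈ U} ∧
          E.TransformsTo E' {P : ℂ × ℂ | (a * P.1 + b, a * P.2 + d) ∈ U} a b c d) ∧
    (∀ (U : Set (ℂ × ℂ)) (E : TodaEquation), IsOpen U → IsConnected U → E.IsListed U →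
      E.HolomorphicOn U ∧ E.Nondegenerate U ∧ E.IntegrableModulo U 3) := by
  refine ⟨fun U E hU hc hE hn hint => ?_, fun U E hU hc h => h.integrable hU hc.nonempty⟩
  exact hint.isEquivalentToListed hE hU hc.isPreconnected hn
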